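/- Let $n\ge 2$, let $a=(a_1,\dots,a_{n-1})\in\mathbb R^{n-1}$, and put $P(w)=\prod_{j=1}^{n-1}(w+a_j)$, so that $P'(w)=\sum_{k=1}^{n-1}\prod_{i\ne k}(w+a_i)$. For $(v,y)\in\mathbb R^2$ let $w(v,y)$ be the unique real solution $w\ge-\min_j a_j$ of $P(w)=v^2+y^2$. Let $S\subseteq\mathbb R^2$ be open, with coordinates $(x,y)$, and for functions $u,v:S\to\mathbb R$ let $$N=\Bigl\{z\in\mathbb C^n:\ |z_j|^2-|z_{n-1}|^2=a_j-a_{n-1}\ (1\le j\le n-2),\quad i^{\,n-3}z_1\cdots z_{n-1}=v(x,y)+iy,\quad z_n=x+iu(x,y)\ \text{ for some }(x,y)\in S\Bigr\}.$$ Let $U(1)^{n-2}$ act on $\mathbb C^n$ by $$(e^{i\theta_1},\dots,e^{i\theta_{n-2}})\cdot z=(e^{i\theta_1}z_1,\dots,e^{i\theta_{n-2}}z_{n-2},e^{-i(\theta_1+\dots+\theta_{n-2})}z_{n-1},z_n).$$ An $n$-dimensional real submanifold of $\mathbb C^n$ is special Lagrangian if, for a suitable orientation, it is calibrated by $\operatorname{Re}(dz_1\wedge\dots\wedge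 dz_n)$ with respect to the Euclidean metric. Consider the system $$u_x=v_y,\qquad v_x=-P'(w(v,y))\,u_y.\tag{$*$}$$ 1. Suppose that $\min_j a_j$ is attained by exactly one $a_j$, that $u,v\in C^1(S)$, and that $(*)$ holds on $S$. Then $N$ is a $U(1)^{n-2}$-invariant, smooth ($C^\infty$) embedded special Lagrangian submanifold of dimension $n$. Moreover, if $u,v$ are $C^1$ up to $\partial S$, in the sense that they extend to $C^1$ functions $\tilde u,\tilde v$ on an open set $U\supseteq\overline S$, then $N$ extends as a $C^1$ submanifold up to $\partial S$: the set $\tilde N$ defined as $N$ is, with $U,\tilde u,\tilde v$ in place of $S,u,v$, is an $n$-dimensional embedded $C^1$ submanifold of $\mathbb C^n$ on which $(x,y)$ is a submersion to $\mathbb R^2$, and the closure of $N$ in $\mathbb C^n$ is the part of $\tilde N$ with $(x,y)\in\overline S$. 2. Suppose that $\min_j a_j$ is attained by more than one $a_j$, that $u,v\in C^0(S)$, and that $u,v$ are differentiable and satisfy $(*)$ at every point of $S$ with $(v(x,y),y)\ne(0,0)$. Then $N$ is a $U(1)^{n-2}$-invariant special Lagrangian $n$-fold that is singular precisely at its points with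 $v=y=0$. That is, near each of its other points $N$ is a smooth ($C^\infty$) embedded special Lagrangian submanifold of dimension $n$; these points are dense in $N$; and near a point with $v=y=0$ the set $N$ is not an $n$-dimensional embedded $C^1$ submanifold of $\mathbb C^n$. -/

import Mathlib

open scoped ContDiff

namespace SLTorus

/-! ### The polynomial `P` and its distinguished root

Throughout, `n = k + 2`, so that `a = (a₁, …, a_{n-1})` is indexed by `Fin (k + 1)`, and the
torus `U(1)^{n-2}` by `Fin k`. -/

/-- `min (a₁, …, a_{n-1})`. -/
noncomputable def minParam {k : ℕ} (a : Fin (k + 1) → ℝ) : ℝ :=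
  Finset.univ.inf' Finset.univ_nonempty a

/-- The number of indices at which the minimum of the `a_j` is attained. -/
noncomputable def minMultiplicity {k : ℕ} (a : Fin (k + 1) → ℝ) : ℕ :=
  Nat.card {j : Fin (k + 1) // a j = minParam a}

/-- `P(w) = ∏_j (w + a_j)`. -/
noncomputable def P {k : ℕ} (a : Fin (k + 1) → ℝ) (w : ℝ) : ℝ := ∏ j, (w + a j)

/-- `P'(w) = ∑_j ∏_{i ≠ j} (w + a_i)`. -/
noncomputable def P' {k : ℕ} (a : Fin (k + 1) → ℝ) (w : ℝ) : ℝ :=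
  ∑ j, ∏ i ∈ Finset.univ.erase j, (w + a i)

/-- For every `s ≥ 0` the equation `P(w) = s` has exactly one solution `w ≥ - min a_j`. -/
theorem existsUnique_root {k : ℕ} (a : Fin (k + 1) → ℝ) {s : ℝ} (hs : 0 ≤ s) :
    ∃! w : ℝ, -minParam a ≤ w ∧ P a w = s := by
  have hmin : ∀ j, minParam a ≤ a j := fun j => Finset.inf'_le _ (Finset.mem_univ j)
  have hcont : Continuous (P a) := by unfold P; fun_prop
  have hmono : ∀ w₁ w₂ : ℝ, -minParam a ≤ w₁ → w₁ < w₂ → P a w₁ < P a w₂ := by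
    intro w₁ w₂ h₁ h₂
    by_cases hz : ∃ j, w₁ + a j = 0
    · obtain ⟨j, hj⟩ := hz
      have h0 : P a w₁ = 0 := Finset.prod_eq_zero (Finset.mem_univ j) hj
      rw [h0]
      exact Finset.prod_pos fun i _ => by linarith [hmin i]
    · push Not at hz
      have hpos : ∀ j, 0 < w₁ + a j := fun j =>
        lt_of_le_of_ne (by linarith [hmin j]) (Ne.symm (hz j))
      exact Finset.prod_lt_prod_of_nonempty (fun j _ => hpos j) (fun j _ => by linarith)
        Finset.univ_nonempty
  obtain ⟨j₀, -, hj₀⟩ := Finset.exists_mem_eq_inf' (Finset.univ_nonempty (α := Fin (k + 1))) a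
  have hlow : P a (-minParam a) = 0 := by
    refine Finset.prod_eq_zero (Finset.mem_univ j₀) ?_
    have : minParam a = a j₀ := hj₀
    rw [this]; ring
  have hhigh : s ≤ P a (-minParam a + (s + 1)) := by
    have h1 : ∀ j ∈ (Finset.univ : Finset (Fin (k + 1))),
        s + 1 ≤ -minParam a + (s + 1) + a j := fun j _ => by linarith [hmin j]
    have h2 : (s + 1) ^ (k + 1) ≤ P a (-minParam a + (s + 1)) := by
      have := Finset.prod_le_prod (s := (Finset.univ : Finset (Fin (k + 1))))
        (f := fun _ => s + 1) (fun _ _ => by linarith) h1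
      simpa [P] using this
    have h3 : s + 1 ≤ (s + 1) ^ (k + 1) := le_self_pow₀ (by linarith) (by omega)
    linarith
  obtain ⟨w, hw, hws⟩ := intermediate_value_Icc
    (show -minParam a ≤ -minParam a + (s + 1) by linarith) hcont.continuousOn
    (show s ∈ Set.Icc (P a (-minParam a)) (P a (-minParam a + (s + 1))) from
      ⟨by rw [hlow]; exact hs, hhigh⟩)
  refine ⟨w, ⟨hw.1, hws⟩, ?_⟩
  rintro w' ⟨h1, h2⟩
  rcases lt_trichotomy w' w with h | h | h
  · have := hmono _ _ h1 h; linarith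
  · exact h
  · have := hmono _ _ hw.1 h; linarith

/-- `w(v, y)`: the unique real solution of `P(w) = v² + y²` with `w ≥ - min a_j`. -/
noncomputable def root {k : ℕ} (a : Fin (k + 1) → ℝ) (v y : ℝ) : ℝ :=
  (existsUnique_root a (show 0 ≤ v ^ 2 + y ^ 2 by positivity)).choose

/-- The reduced equations `u_x = v_y`, `v_x = - P'(w(v, y)) u_y` at the point `q = (x, y)`. The
partial derivatives are read off the Fréchet derivative. -/
def SolvesAt {k : ℕ} (a : Fin (k + 1) → ℝ) (u v : ℝ × ℝ → ℝ) (q : ℝ × ℝ) : Prop :=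
  fderiv ℝ u q (1, 0) = fderiv ℝ v q (0, 1) ∧
  fderiv ℝ v q (1, 0) = -P' a (root a (v q) q.2) * fderiv ℝ u q (0, 1)

/-! ### Submanifolds and special Lagrangian submanifolds of `ℂⁿ` -/

/-- `ℂⁿ`, `n = k + 2`, with the Euclidean metric `g = ∑ |dz_j|²` as its real inner product. The
coordinates `z₁, …, z_{n-1}` are `z j.castSucc` for `j : Fin (k + 1)`, and `z_n` is
`z (Fin.last (k + 1))`. -/
abbrev Cn (k : ℕ) : Type := EuclideanSpace ℂ (Fin (k + 2))

/-- The holomorphic volume form `Ω = dz₁ ∧ ⋯ ∧ dz_n`. -/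
noncomputable def Omega {k : ℕ} (e : Fin (k + 2) → Cn k) : ℂ :=
  (Matrix.of fun i j => e j i).det

/-- A real subspace `T` of dimension `n` is a special Lagrangian plane if, for one of its two
orientations, `Re Ω` restricts to its volume form: `Re Ω (e₁, …, e_n) = 1` for some orthonormal
basis (hence for all orthonormal bases of the same orientation). -/
def IsSpecialLagrangianPlane {k : ℕ} (T : Submodule ℝ (Cn k)) : Prop :=
  ∃ e : OrthonormalBasis (Fin (k + 2)) ℝ T, (Omega fun i => (e i : Cn k)).re = 1

/-- `F` is a submersion of class `C^r` from the open set `V ⊆ ℂⁿ` to `ℝⁿ` with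
`M ∩ V = F⁻¹(0) ∩ V`. Then `M ∩ V` is an embedded `C^r` submanifold of real dimension `n`, whose
tangent space at `p` is the kernel of the derivative of `F` at `p`. -/
def IsDefiningMap {k : ℕ} (r : WithTop ℕ∞) (M V : Set (Cn k))
    (F : Cn k → EuclideanSpace ℝ (Fin (k + 2))) : Prop :=
  IsOpen V ∧ ContDiffOn ℝ r F V ∧ (∀ p ∈ V, Function.Surjective (fderiv ℝ F p)) ∧
    ∀ p ∈ V, p ∈ M ↔ F p = 0

/-- Near `p`, the set `M` is an embedded `C^r` submanifold of real dimension `n`. -/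
def IsSubmanifoldAt {k : ℕ} (r : WithTop ℕ∞) (M : Set (Cn k)) (p : Cn k) : Prop :=
  ∃ V F, p ∈ V ∧ IsDefiningMap r M V F

/-- Near `p`, the set `M` is an embedded `C^r` submanifold of real dimension `n`, all of whose
tangent spaces are special Lagrangian planes. (As `Re Ω` vanishes on none of these tangent
spaces, it orients the submanifold; with this orientation the submanifold is calibrated by
`Re Ω`.) -/
def IsSpecialLagrangianAt {k : ℕ} (r : WithTop ℕ∞) (M : Set (Cn k)) (p : Cn k) : Prop :=
  ∃ V F, p ∈ V ∧ IsDefiningMap r M V F ∧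
    ∀ q ∈ M ∩ V, IsSpecialLagrangianPlane (LinearMap.ker (fderiv ℝ F q).toLinearMap)

/-! ### The torus action and the set `N` -/

/-- The action of `t ∈ U(1)^{n-2}` on `ℂⁿ`:
`(t₁ z₁, …, t_{n-2} z_{n-2}, (t₁ ⋯ t_{n-2})⁻¹ z_{n-1}, z_n)`. -/
noncomputable def torusAct {k : ℕ} (t : Fin k → Circle) (z : Cn k) : Cn k :=
  WithLp.toLp 2 (Fin.snoc (α := fun _ => ℂ)
    (Fin.snoc (α := fun _ => ℂ) (fun j : Fin k => (t j : ℂ) * z j.castSucc.castSucc)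
      ((∏ j, (t j : ℂ))⁻¹ * z (Fin.last k).castSucc))
    (z (Fin.last (k + 1))))

/-- Invariance under `U(1)^{n-2}`. -/
def IsTorusInvariant {k : ℕ} (M : Set (Cn k)) : Prop :=
  ∀ t : Fin k → Circle, ∀ z ∈ M, torusAct t z ∈ M

/-- `i^{n-3} z₁ ⋯ z_{n-1}`. -/
noncomputable def prodCoord {k : ℕ} (z : Cn k) : ℂ :=
  Complex.I ^ ((k : ℤ) - 1) * ∏ j : Fin (k + 1), z j.castSucc

/-- The set `N ⊆ ℂⁿ` attached to functions `u, v` on a set `S` of points `q = (x, y)`. -/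
def N {k : ℕ} (a : Fin (k + 1) → ℝ) (S : Set (ℝ × ℝ)) (u v : ℝ × ℝ → ℝ) : Set (Cn k) :=
  {z | (∀ j : Fin k, ‖z j.castSucc.castSucc‖ ^ 2 - ‖z (Fin.last k).castSucc‖ ^ 2 =
          a j.castSucc - a (Fin.last k)) ∧
       ∃ q ∈ S, prodCoord z = (v q : ℂ) + (q.2 : ℂ) * Complex.I ∧
         z (Fin.last (k + 1)) = (q.1 : ℂ) + (u q : ℂ) * Complex.I}

/-- The point `(x, y) = (Re z_n, Im (i^{n-3} z₁ ⋯ z_{n-1}))`, i.e. the parameter `q ∈ S` of a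
point `z` of `N`. -/
noncomputable def base {k : ℕ} (z : Cn k) : ℝ × ℝ :=
  ((z (Fin.last (k + 1))).re, (prodCoord z).im)

/-- The points of `N` at which `v = y = 0`. -/
def degenerateLocus {k : ℕ} (a : Fin (k + 1) → ℝ) (S : Set (ℝ × ℝ)) (u v : ℝ × ℝ → ℝ) :
    Set (Cn k) :=
  {z | z ∈ N a S u v ∧ v (base z) = 0 ∧ (base z).2 = 0}

/-- Near `p`, the set `M` is an embedded `C¹` submanifold of real dimension `n`, on which
`(x, y)` is a submersion to `ℝ²` at `p`. -/
def IsC1FibredAt {k : ℕ} (M : Set (Cn k)) (p : Cn k) : Prop :=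
  ∃ V F, p ∈ V ∧ IsDefiningMap 1 M V F ∧
    ∀ c : ℝ × ℝ, ∃ ξ : Cn k, fderiv ℝ F p ξ = 0 ∧ fderiv ℝ (base (k := k)) p ξ = c

end SLTorus

/-!
# Special Lagrangian submanifolds with torus symmetry

The set `N` is the zero set of `definingMap`, which consists of the shifted moments
`|z_j|² - |z_{n-1}|² - a_j + a_{n-1}` of the torus action, of `Re Π - v` with `Π = i^{n-3} z₁ ⋯ z_{n-1}`,
and of `Im z_n - u`; the map `base = (Re z_n, Im Π)` projects it to the plane of `(x, y)`. On `N` the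
moduli are determined by the base point, `|z_j|² = w + a_j` with `w = w(v, y)` (`norm_sq_of_mem`), so
that `|dΠ|² = P'(w)`, and `P'(w) > 0` holds exactly where at most one of `z₁, …, z_{n-1}` vanishes. This
is the case everywhere if the minimum of the `a_j` is attained once, and outside `v = y = 0` otherwise.

*Smoothness.* Where `P'(w) > 0` the reduced equations form an elliptic quasilinear system,
`u_x = v_y`, `A(v, y)_x = - u_y` with `∂A/∂v = 1 / P'(w(v, y))`, and all its differentiable solutions are
smooth (`contDiffAt_of_quasilinear`, `contDiffAt_of_solvesAt`). Pointwise solutions are weak solutions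
(`IsWeakSol.of_fderiv`), by a divergence theorem that needs no continuity of the derivatives. Weak
solutions are treated by Campanato iteration: on each ball the coefficient is frozen, a linear change
of variables turns the frozen system into the Cauchy-Riemann equations with a perturbation, and an
orthogonal projection in `L²` replaces the solution by a weakly holomorphic function
(`exists_holomorphic_replacement`), which has an expansion by a quantitative form of Weyl's lemma
(`weakly_holomorphic_taylor`). Iterating with constants gives Hölder continuity
(`IsWeakSol.exists_holder`), and with affine functions uniform expansions of an order larger than `1`
(`IsWeakSol.exists_taylor`), which together mean class `C^{1,γ}` (`IsWeakSol.hasHolderTaylor`). The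
`x`-derivatives solve a linear system of the same kind, so that the regularity can be bootstrapped
(`IsWeakSol.linear_isHolderClass`).

*Geometry.* Where `P'(w) > 0` the map `definingMap` is a submersion (`isDefiningMap_definingMap`), and
the tangent space of `N` is spanned by the directions of the torus orbit and by the lifts `liftVec` of
the two coordinate vectors of the base along the normal vector `conj dΠ`. This frame is isotropic
because of `v_x = - P'(w) u_y`, and on it `Ω = 1 + u_x² + P'(w) u_y²` is real and positive
(`isSpecialLagrangianPlane_ker`). As `(Re z_n, Im Π)` is open on `N`, every point over the closure of
`S` is a limit of points of `N` (`closure_N`).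

*Degenerate points.* If two of the `a_j` are minimal, at least two coordinates vanish over `v = y = 0`.
Such a point `p` is a limit of regular points, which are written down explicitly
(`exists_tendsto_degenerate`). Suppose that `N` is a `C¹` submanifold at `p`, hence a graph over its
tangent space `K` (`exists_isTangentChart`). The symmetries of `N` that fix `p` act linearly in this chart.
Comparing the fixed points of the symmetry that changes two signs shows that the degenerate locus is
the set where a coordinate of `K` vanishes (`prodCoord_chart_eq_zero_iff`). A curve in it along the last
axis gives `v(x, 0) = 0` for all `x` near that of `p` (`eventually_v_eq_zero`), so that near `p` the
degenerate locus is the part of `N` with `y = 0`. But `y` takes both signs near `p`, while two points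
outside the degenerate locus can, after a rotation of one of them by a symmetry, be joined by a segment
of `K` on which that coordinate does not vanish (`not_isSubmanifoldAt`).
-/

namespace SLTorus
open MeasureTheory Metric Filter Topology Complex Convolution

/-! ### Weakly holomorphic functions -/

/-- The mean value inequality: the circle averages of a holomorphic function are integrated in polar
coordinates. -/
theorem norm_mul_volume_ball_le_integral {G : ℂ → ℂ} (hc : Continuous G) (hi : Integrable G)
    {z : ℂ} {s : ℝ} (hs : 0 < s) (hd : DifferentiableOn ℂ G (ball z s)) :
    ‖G z‖ * (Real.pi * s ^ 2) ≤ ∫ w, ‖G w‖ := by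
  have hmv : ∀ t ∈ Set.Ioo 0 s, ENNReal.ofReal (2 * Real.pi * ‖G z‖) ≤
      ∫⁻ θ in Set.Ioo (-Real.pi) Real.pi, ‖G (z + Complex.polarCoord.symm (t, θ))‖ₑ := by
    intro t ht
    have h1 : DiffContOnCl ℂ G (ball z |t|) := by
      refine ⟨hd.mono (ball_subset_ball ?_), hc.continuousOn⟩
      rw [abs_of_pos ht.1]; exact ht.2.le
    have h2 := h1.circleAverage
    rw [Real.circleAverage_def] at h2
    have hper : Function.Periodic (fun θ => G (circleMap z t θ)) (2 * Real.pi) := by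
      intro θ; simp [periodic_circleMap z t θ]
    have h3 := hper.intervalIntegral_add_eq 0 (-Real.pi)
    simp only [zero_add] at h3
    rw [h3, show -Real.pi + 2 * Real.pi = Real.pi by ring,
      intervalIntegral.integral_of_le (by linarith [Real.pi_pos]),
      integral_Ioc_eq_integral_Ioo] at h2
    have h4 : 2 * Real.pi * ‖G z‖ = ‖∫ θ in Set.Ioo (-Real.pi) Real.pi, G (circleMap z t θ)‖ := by
      rw [← h2, norm_smul, norm_inv, Real.norm_of_nonneg (by positivity)]
      field_simp
    rw [h4, ofReal_norm]
    refine (enorm_integral_le_lintegral_enorm _).trans (le_of_eq ?_)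
    refine lintegral_congr fun θ => ?_
    simp [Complex.polarCoord_symm_apply, circleMap, Complex.exp_mul_I]
  have hpol := Complex.lintegral_comp_polarCoord_symm (fun w => ‖G (z + w)‖ₑ)
  rw [lintegral_add_left_eq_self (fun w => ‖G w‖ₑ) z] at hpol
  have hcp : Continuous fun p : ℝ × ℝ => Complex.polarCoord.symm p := by
    simp_rw [Complex.polarCoord_symm_apply]; fun_prop
  have hlow : ENNReal.ofReal (‖G z‖ * (Real.pi * s ^ 2)) ≤ ∫⁻ w, ‖G w‖ₑ := by
    rw [← hpol]
    calc ENNReal.ofReal (‖G z‖ * (Real.pi * s ^ 2))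
        = ∫⁻ t in Set.Ioo 0 s, ENNReal.ofReal (t * (2 * Real.pi * ‖G z‖)) := by
          rw [← ofReal_integral_eq_lintegral_ofReal]
          · congr 1
            rw [integral_mul_const, ← integral_Ioc_eq_integral_Ioo,
              ← intervalIntegral.integral_of_le hs.le, integral_id]
            ring
          · exact ((continuous_id.mul continuous_const).integrableOn_Icc).mono_set
              Set.Ioo_subset_Icc_self
          · filter_upwards [ae_restrict_mem measurableSet_Ioo] with t ht
            have := ht.1
            simp only [Pi.zero_apply]
            positivity
      _ ≤ ∫⁻ t in Set.Ioo 0 s, ∫⁻ θ in Set.Ioo (-Real.pi) Real.pi,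
            ENNReal.ofReal t * ‖G (z + Complex.polarCoord.symm (t, θ))‖ₑ := by
          refine setLIntegral_mono' measurableSet_Ioo fun t ht => ?_
          rw [ENNReal.ofReal_mul ht.1.le, lintegral_const_mul]
          · gcongr; exact hmv t ht
          · exact (hc.comp (continuous_const.add (hcp.comp (by fun_prop)))).enorm.measurable
      _ = ∫⁻ p in Set.Ioo 0 s ×ˢ Set.Ioo (-Real.pi) Real.pi,
            ENNReal.ofReal p.1 * ‖G (z + Complex.polarCoord.symm p)‖ₑ := by
          rw [Measure.volume_eq_prod, setLIntegral_prod]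
          exact ((ENNReal.measurable_ofReal.comp measurable_fst).mul
            (hc.comp (continuous_const.add hcp)).enorm.measurable).aemeasurable
      _ ≤ _ := by
          refine lintegral_mono_set ?_
          rw [_root_.polarCoord_target]
          exact Set.prod_mono Set.Ioo_subset_Ioi_self subset_rfl
  rw [integral_norm_eq_lintegral_enorm hi.aestronglyMeasurable]
  exact (ENNReal.ofReal_le_iff_le_toReal hi.2.ne).1 hlow

/-- Cauchy estimates for the first two Taylor coefficients, from the Schwarz lemma applied to `dslope`
and then to its own `dslope`. -/
theorem norm_sub_affine_le {G : ℂ → ℂ} {r M : ℝ} (hr : 0 < r)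
    (hd : DifferentiableOn ℂ G (ball 0 r)) (hM : ∀ z ∈ ball (0 : ℂ) r, ‖G z‖ ≤ M) :
    ‖deriv G 0‖ ≤ 2 * M / r ∧ ∀ z ∈ ball (0 : ℂ) r,
      ‖G z - G 0 - deriv G 0 * z‖ ≤ 4 * M / r ^ 2 * ‖z‖ ^ 2 := by
  have h0 : (0 : ℂ) ∈ ball (0 : ℂ) r := mem_ball_self hr
  have h1 : ∀ z ∈ ball (0 : ℂ) r, ‖dslope G 0 z‖ ≤ 2 * M / r := fun z hz =>
    norm_dslope_le_div_of_mapsTo_ball hd (fun w hw => by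
      rw [mem_closedBall, dist_eq_norm]
      linarith [norm_sub_le (G w) (G 0), hM w hw, hM 0 h0]) hz
  have hd1 : DifferentiableOn ℂ (dslope G 0) (ball 0 r) :=
    (differentiableOn_dslope (isOpen_ball.mem_nhds h0)).2 hd
  have h2 : ∀ z ∈ ball (0 : ℂ) r, ‖dslope (dslope G 0) 0 z‖ ≤ 2 * (2 * M / r) / r := fun z hz =>
    norm_dslope_le_div_of_mapsTo_ball hd1 (fun w hw => by
      rw [mem_closedBall, dist_eq_norm]
      linarith [norm_sub_le (dslope G 0 w) (dslope G 0 0), h1 w hw, h1 0 h0]) hz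
  refine ⟨by simpa using h1 0 h0, fun z hz => ?_⟩
  have e1 := sub_smul_dslope G 0 z
  have e2 := sub_smul_dslope (dslope G 0) 0 z
  simp only [sub_zero, smul_eq_mul, dslope_same] at e1 e2
  have : G z - G 0 - deriv G 0 * z = z * (z * dslope (dslope G 0) 0 z) := by
    rw [e2, mul_sub, e1]; ring
  rw [this, norm_mul, norm_mul]
  calc ‖z‖ * (‖z‖ * ‖dslope (dslope G 0) 0 z‖) ≤ ‖z‖ * (‖z‖ * (2 * (2 * M / r) / r)) := by
        gcongr; exact h2 z hz
    _ = _ := by field_simp; ring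


/-- `η` is a test function on the open set `O`: smooth, with compact support contained in `O`. -/
structure IsTest {F : Type*} [NormedAddCommGroup F] [NormedSpace ℝ F] (O : Set ℂ) (η : ℂ → F) :
    Prop where
  contDiff : ContDiff ℝ ∞ η
  hasCompactSupport : HasCompactSupport η
  tsupport_subset : tsupport η ⊆ O

/-- The derivative of a mollification, with the derivative falling on the mollifier. -/
theorem fderiv_mollifier_apply {g : ℂ → ℂ} (hg : Integrable g) {ρ : ℂ → ℝ}
    (hρc : HasCompactSupport ρ) (hρ1 : ContDiff ℝ 1 ρ) (z v : ℂ) :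
    Integrable (fun t => g t * ((fderiv ℝ ρ (z - t) v : ℝ) : ℂ)) ∧
    fderiv ℝ (ρ ⋆[ContinuousLinearMap.lsmul ℝ ℝ, volume] g) z v =
      ∫ t, g t * ((fderiv ℝ ρ (z - t) v : ℝ) : ℂ) := by
  have hd := hρc.hasFDerivAt_convolution_left (ContinuousLinearMap.lsmul ℝ ℝ) hρ1
    hg.locallyIntegrable z
  set L := (ContinuousLinearMap.precompL ℂ (ContinuousLinearMap.lsmul ℝ ℝ : ℝ →L[ℝ] ℂ →L[ℝ] ℂ))
    with hL
  have hint : Integrable (fun t => L (fderiv ℝ ρ (z - t)) (g t)) := by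
    have h : ConvolutionExistsAt (fderiv ℝ ρ) g z L volume :=
      (hρc.fderiv ℝ).convolutionExists_left L (hρ1.continuous_fderiv one_ne_zero)
        hg.locallyIntegrable z
    exact h.integrable_swap
  have he : ∀ t, L (fderiv ℝ ρ (z - t)) (g t) v = g t * ((fderiv ℝ ρ (z - t) v : ℝ) : ℂ) := by
    intro t
    rw [hL, ContinuousLinearMap.precompL_apply]
    simp [mul_comm]
  refine ⟨?_, ?_⟩
  · refine (hint.apply_continuousLinearMap v).congr (Eventually.of_forall fun t => ?_)
    exact he t
  · rw [hd.fderiv, convolution_eq_swap, ContinuousLinearMap.integral_apply hint]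
    exact integral_congr_ae (Eventually.of_forall he)

/-- The mollifications of a weakly holomorphic function are holomorphic on a smaller disc, bounded in
`L¹` by the function, and converge to it almost everywhere. -/
theorem exists_mollification {g : ℂ → ℂ} (hg : Integrable g)
    (hw : ∀ η : ℂ → ℂ, IsTest (ball 0 1) η →
      ∫ z, g z * (fderiv ℝ η z 1 + I * fderiv ℝ η z I) = 0) :
    ∃ G : ℕ → ℂ → ℂ, (∀ n, Continuous (G n) ∧ Integrable (G n) ∧ ∫ z, ‖G n z‖ ≤ ∫ z, ‖g z‖) ∧
      (∀ n, DifferentiableOn ℂ (G n) (ball 0 (3 / 4))) ∧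
      ∀ᵐ z, Tendsto (fun n => G n z) atTop (𝓝 (g z)) := by
  let φ : ℕ → ContDiffBump (0 : ℂ) := fun n =>
    { rIn := 1 / (8 * ((n : ℝ) + 1)), rOut := 1 / (4 * ((n : ℝ) + 1)),
      rIn_pos := by positivity,
      rIn_lt_rOut := by
        apply one_div_lt_one_div_of_lt <;> nlinarith [(Nat.cast_nonneg n : (0 : ℝ) ≤ n)] }
  have hφ : ∀ n, (φ n).rOut ≤ 1 / 4 := fun n => by
    apply one_div_le_one_div_of_le <;> nlinarith [(Nat.cast_nonneg n : (0 : ℝ) ≤ n)]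
  have hlim : Tendsto (fun n => (φ n).rOut) atTop (𝓝 0) := by
    have := (tendsto_one_div_add_atTop_nhds_zero_nat (𝕜 := ℝ)).const_mul (1 / 4)
    rw [mul_zero] at this
    refine this.congr fun n => ?_
    change _ = 1 / (4 * ((n : ℝ) + 1))
    field_simp
  let ρ : ℕ → ℂ → ℝ := fun n => (φ n).normed volume
  have hρc : ∀ n, HasCompactSupport (ρ n) := fun n => (φ n).hasCompactSupport_normed
  have hρs : ∀ n, ContDiff ℝ ∞ (ρ n) := fun n => (φ n).contDiff_normed
  have hρi : ∀ n, Integrable (ρ n) := fun n => (φ n).integrable_normed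
  refine ⟨fun n => ρ n ⋆[ContinuousLinearMap.lsmul ℝ ℝ, volume] g, fun n => ⟨?_, ?_, ?_⟩,
    fun n => ?_, ?_⟩
  · exact ((hρc n).contDiff_convolution_left (n := (⊤ : ℕ∞)) _ (hρs n) hg.locallyIntegrable).continuous
  · exact (hρi n).integrable_convolution _ hg
  · have h1 := integral_convolution (μ := volume) (ν := volume) (ContinuousLinearMap.lsmul ℝ ℝ)
      (hρi n) hg.norm
    have h2 : ∫ z, ρ n z = 1 := (φ n).integral_normed
    rw [h2] at h1
    simp only [ContinuousLinearMap.lsmul_apply, smul_eq_mul, one_mul] at h1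
    rw [← h1]
    refine integral_mono ((hρi n).integrable_convolution _ hg).norm
      ((hρi n).integrable_convolution _ hg.norm) fun z => ?_
    refine (norm_integral_le_integral_norm _).trans (le_of_eq ?_)
    refine integral_congr_ae (Eventually.of_forall fun w => ?_)
    simp only [ContinuousLinearMap.lsmul_apply, smul_eq_mul, norm_smul]
    rw [Real.norm_of_nonneg ((φ n).nonneg_normed w)]
  · intro z hz
    refine DifferentiableAt.differentiableWithinAt ?_
    rw [differentiableAt_complex_iff_differentiableAt_real]
    have hd := (hρc n).hasFDerivAt_convolution_left (ContinuousLinearMap.lsmul ℝ ℝ)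
      ((hρs n).of_le (by norm_num)) hg.locallyIntegrable z
    refine ⟨hd.differentiableAt, ?_⟩
    have hρ1 : ContDiff ℝ 1 (ρ n) := (hρs n).of_le (by norm_num)
    have key := fun v => (fderiv_mollifier_apply hg (hρc n) hρ1 z v).2
    have hkint := fun v => (fderiv_mollifier_apply hg (hρc n) hρ1 z v).1
    rw [key, key, smul_eq_mul]
    -- The Cauchy-Riemann equation at `z` is the weak equation for the mollifier recentred at `z`.
    set η : ℂ → ℂ := fun t => ((ρ n (z - t) : ℝ) : ℂ) with hη
    have hηd : ∀ t v, fderiv ℝ η t v = -((fderiv ℝ (ρ n) (z - t) v : ℝ) : ℂ) := by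
      intro t v
      have h1 : HasFDerivAt (ρ n) (fderiv ℝ (ρ n) (z - t)) (z - t) :=
        (hρ1.differentiable one_ne_zero _).hasFDerivAt
      have h2 : HasFDerivAt (fun t : ℂ => z - t) (-ContinuousLinearMap.id ℝ ℂ) t :=
        (hasFDerivAt_id t).const_sub z
      have h3 := (ofRealCLM.hasFDerivAt (x := ρ n (z - t))).comp t (h1.comp t h2)
      have h4 : HasFDerivAt η _ t := h3
      rw [h4.fderiv]; simp
    have hsupp : tsupport η ⊆ closedBall z (1 / 4) := by
      refine closure_minimal (fun t ht => ?_) isClosed_closedBall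
      have h5 : z - t ∈ Function.support (ρ n) := by
        intro h6; exact ht (by simp [hη, h6])
      rw [(φ n).support_normed_eq, mem_ball_zero_iff] at h5
      rw [mem_closedBall, dist_eq_norm, norm_sub_rev]
      exact h5.le.trans (hφ n)
    have htest : IsTest (ball 0 1) η := by
      refine ⟨?_, ?_, ?_⟩
      · exact ofRealCLM.contDiff.comp ((hρs n).comp (contDiff_const.sub contDiff_id))
      · exact HasCompactSupport.of_support_subset_isCompact (isCompact_closedBall z (1 / 4))
          ((subset_tsupport _).trans hsupp)
      · refine hsupp.trans fun w hw => ?_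
        rw [mem_closedBall, dist_eq_norm] at hw
        rw [mem_ball_zero_iff] at hz ⊢
        have := norm_add_le (w - z) z
        rw [sub_add_cancel] at this
        linarith
    have h0 := hw η htest
    have h7 : ∫ t, (g t * ((fderiv ℝ (ρ n) (z - t) 1 : ℝ) : ℂ) +
        I * (g t * ((fderiv ℝ (ρ n) (z - t) I : ℝ) : ℂ))) = 0 := by
      rw [← neg_eq_zero, ← integral_neg, ← h0]
      refine integral_congr_ae (Eventually.of_forall fun t => ?_)
      simp only [hηd]; ring
    rw [integral_add (hkint 1) ((hkint I).const_mul I), integral_const_mul] at h7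
    linear_combination (-I) * h7 +
      (∫ t, g t * ((fderiv ℝ (ρ n) (z - t) I : ℝ) : ℂ)) * I_sq
  · refine ContDiffBump.ae_convolution_tendsto_right_of_locallyIntegrable (K := 2) hlim
      (Eventually.of_forall fun n => ?_) hg.locallyIntegrable
    change 1 / (4 * ((n : ℝ) + 1)) ≤ 2 * (1 / (8 * ((n : ℝ) + 1)))
    refine le_of_eq ?_
    field_simp; norm_num

/-- A quantitative form of Weyl's lemma: a weakly holomorphic function on the unit disc has a first-order
expansion at `0` with bounds in terms of its `L¹` norm. The expansions of the mollifications have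
bounded coefficients, so a subsequence of them converges. -/
theorem weakly_holomorphic_taylor {g : ℂ → ℂ} (hg : Integrable g)
    (hw : ∀ η : ℂ → ℂ, IsTest (ball 0 1) η →
      ∫ z, g z * (fderiv ℝ η z 1 + I * fderiv ℝ η z I) = 0) :
    ∃ c d : ℂ, ‖c‖ ≤ 100 * ∫ z, ‖g z‖ ∧ ‖d‖ ≤ 100 * ∫ z, ‖g z‖ ∧
      ∀ᵐ z, z ∈ ball (0 : ℂ) (1 / 2) → ‖g z - c - d * z‖ ≤ 400 * (∫ z, ‖g z‖) * ‖z‖ ^ 2 := by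
  obtain ⟨G, hG, hGd, hGt⟩ := exists_mollification hg hw
  set J := ∫ z, ‖g z‖ with hJ
  have hJ0 : 0 ≤ J := integral_nonneg fun _ => norm_nonneg _
  have hb : ∀ n, ∀ z ∈ ball (0 : ℂ) (1 / 2), ‖G n z‖ ≤ 16 * J := by
    intro n z hz
    have h1 := norm_mul_volume_ball_le_integral (hG n).1 (hG n).2.1 (z := z) (s := 1 / 4)
      (by norm_num) ((hGd n).mono fun w hw => by
        rw [mem_ball_zero_iff] at hz ⊢
        rw [mem_ball, dist_eq_norm] at hw
        have := norm_add_le (w - z) z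
        rw [sub_add_cancel] at this
        linarith)
    nlinarith [(hG n).2.2, Real.pi_gt_three, norm_nonneg (G n z)]
  have hT := fun n => norm_sub_affine_le (r := 1 / 2) (by norm_num)
    ((hGd n).mono (ball_subset_ball (by norm_num))) (hb n)
  have hK : IsCompact (closedBall (0 : ℂ) (100 * J) ×ˢ closedBall (0 : ℂ) (100 * J)) :=
    (isCompact_closedBall _ _).prod (isCompact_closedBall _ _)
  obtain ⟨⟨c, d⟩, hcd, ψ, hψ, hψt⟩ := hK.tendsto_subseq
    (x := fun n => (G n 0, deriv (G n) 0)) (fun n => by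
      refine ⟨?_, ?_⟩ <;> rw [mem_closedBall_zero_iff]
      · have := hb n 0 (by simp); simp only; linarith
      · have := (hT n).1; simp only; linarith)
  rw [Set.mem_prod, mem_closedBall_zero_iff, mem_closedBall_zero_iff] at hcd
  refine ⟨c, d, hcd.1, hcd.2, ?_⟩
  filter_upwards [hGt] with z hz hzb
  have h1 := (hz.comp hψ.tendsto_atTop).sub ((continuous_fst.tendsto _).comp hψt)
  have h2 := (h1.sub (((continuous_snd.tendsto _).comp hψt).mul_const z)).norm
  refine le_of_tendsto h2 (Eventually.of_forall fun n => ?_)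
  have := (hT (ψ n)).2 z hzb
  simp only [Function.comp_apply]
  refine this.trans ?_
  rw [show 4 * (16 * J) / (1 / 2) ^ 2 = 256 * J by ring]
  gcongr
  linarith

end SLTorus

namespace SLTorus
open MeasureTheory Metric Filter Topology Complex

/-! ### Test functions and holomorphic replacement in `L²` -/

namespace IsTest

variable {F : Type*} [NormedAddCommGroup F] [NormedSpace ℝ F] {O : Set ℂ} {η ζ : ℂ → F}

theorem differentiable (h : IsTest O η) : Differentiable ℝ η :=
  h.contDiff.differentiable (by simp)

theorem continuous (h : IsTest O η) : Continuous η := h.contDiff.continuous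

theorem integrable (h : IsTest O η) : Integrable η :=
  h.continuous.integrable_of_hasCompactSupport h.hasCompactSupport

theorem fderiv_apply (h : IsTest O η) (v : ℂ) : IsTest O fun z => fderiv ℝ η z v where
  contDiff := (h.contDiff.fderiv_right (m := ∞) (by simp)).clm_apply contDiff_const
  hasCompactSupport := h.hasCompactSupport.fderiv_apply ℝ v
  tsupport_subset := (tsupport_fderiv_apply_subset ℝ v).trans h.tsupport_subset

theorem clm_comp {F' : Type*} [NormedAddCommGroup F'] [NormedSpace ℝ F'] (h : IsTest O η)
    (A : F →L[ℝ] F') : IsTest O fun z => A (η z) where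
  contDiff := A.contDiff.comp h.contDiff
  hasCompactSupport := h.hasCompactSupport.comp_left (map_zero A)
  tsupport_subset := (tsupport_comp_subset (map_zero A) η).trans h.tsupport_subset

theorem add (h : IsTest O η) (h' : IsTest O ζ) : IsTest O fun z => η z + ζ z where
  contDiff := h.contDiff.add h'.contDiff
  hasCompactSupport := h.hasCompactSupport.add h'.hasCompactSupport
  tsupport_subset := (tsupport_add η ζ).trans (Set.union_subset h.tsupport_subset h'.tsupport_subset)

theorem mono (h : IsTest O η) {O' : Set ℂ} (hO : O ⊆ O') : IsTest O' η :=
  ⟨h.contDiff, h.hasCompactSupport, h.tsupport_subset.trans hO⟩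

theorem eq_zero (h : IsTest O η) {z : ℂ} (hz : z ∉ O) : η z = 0 :=
  image_eq_zero_of_notMem_tsupport fun h' => hz (h.tsupport_subset h')

theorem fderiv_clm_comp {F' : Type*} [NormedAddCommGroup F'] [NormedSpace ℝ F'] (h : IsTest O η)
    (A : F →L[ℝ] F') (z v : ℂ) : fderiv ℝ (fun z => A (η z)) z v = A (fderiv ℝ η z v) := by
  have := (A.hasFDerivAt.comp z (h.differentiable z).hasFDerivAt).fderiv
  rw [show (fun z => A (η z)) = A ∘ η from rfl, this]; rfl

theorem fderiv_comm (h : IsTest O η) (z v w : ℂ) :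
    fderiv ℝ (fun z => fderiv ℝ η z v) z w = fderiv ℝ (fun z => fderiv ℝ η z w) z v := by
  have hd : DifferentiableAt ℝ (fderiv ℝ η) z :=
    (h.contDiff.fderiv_right (m := ∞) (by simp)).differentiable (by simp) z
  have hs : IsSymmSndFDerivAt ℝ η z :=
    (h.contDiff.contDiffAt).isSymmSndFDerivAt
      (by simpa using (WithTop.coe_le_coe.2 le_top : ((2 : ℕ∞) : WithTop ℕ∞) ≤ ∞))
  have e : ∀ v w, fderiv ℝ (fun z => fderiv ℝ η z v) z w = fderiv ℝ (fderiv ℝ η) z w v := by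
    intro v w
    rw [fderiv_clm_apply hd (differentiableAt_const v)]
    simp
  rw [e, e, hs]

theorem integral_mul_fderiv {ζ : ℂ → ℂ} {f : ℂ → ℂ} (hf : ContDiff ℝ ∞ f) (h : IsTest O ζ)
    (v : ℂ) : ∫ z, f z * fderiv ℝ ζ z v = -∫ z, fderiv ℝ f z v * ζ z := by
  have hd : Differentiable ℝ f := hf.differentiable (by simp)
  refine integral_mul_fderiv_eq_neg_fderiv_mul_of_integrable ?_ ?_ ?_
    (fun z _ => hd z) (fun z _ => h.differentiable z)
  · exact (((hf.fderiv_right (m := ∞) (by simp)).clm_apply contDiff_const).continuous.mul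
      h.continuous).integrable_of_hasCompactSupport h.hasCompactSupport.mul_left
  · exact (hf.continuous.mul (h.fderiv_apply v).continuous).integrable_of_hasCompactSupport
      (h.fderiv_apply v).hasCompactSupport.mul_left
  · exact (hf.continuous.mul h.continuous).integrable_of_hasCompactSupport
      h.hasCompactSupport.mul_left

theorem integral_fderiv_mul_comm {η ζ : ℂ → ℂ} (h : IsTest O η) (h' : IsTest O ζ) (v w : ℂ) :
    ∫ z, fderiv ℝ η z v * fderiv ℝ ζ z w = ∫ z, fderiv ℝ η z w * fderiv ℝ ζ z v := by
  rw [integral_mul_fderiv (h.fderiv_apply v).contDiff h',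
    integral_mul_fderiv (h.fderiv_apply w).contDiff h']
  simp_rw [h.fderiv_comm _ v w]

end IsTest

/-- For a test function, `‖η_x‖_{L²} ≤ ‖η_x - i η_y‖_{L²}`: the mixed terms integrate to zero. -/
theorem integral_sq_fderiv_one_le {O : Set ℂ} {η : ℂ → ℂ} (h : IsTest O η) :
    ∫ z, ‖fderiv ℝ η z 1‖ ^ 2 ≤ ∫ z, ‖fderiv ℝ η z 1 - I * fderiv ℝ η z I‖ ^ 2 := by
  have hc : IsTest O fun z => conjCLE (η z) := h.clm_comp (conjCLE : ℂ →L[ℝ] ℂ)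
  have hcd : ∀ z v, fderiv ℝ (fun z => conjCLE (η z)) z v = (starRingEnd ℂ) (fderiv ℝ η z v) :=
    fun z v => h.fderiv_clm_comp (conjCLE : ℂ →L[ℝ] ℂ) z v
  have hi : ∀ v w, Integrable fun z => fderiv ℝ η z v * (starRingEnd ℂ) (fderiv ℝ η z w) := by
    intro v w
    exact ((h.fderiv_apply v).continuous.mul (continuous_conj.comp
      (h.fderiv_apply w).continuous)).integrable_of_hasCompactSupport
        (h.fderiv_apply v).hasCompactSupport.mul_right
  have key := h.integral_fderiv_mul_comm hc 1 I
  simp only [hcd] at key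
  have e1 : ∀ v, ∫ z, ‖fderiv ℝ η z v‖ ^ 2 =
      (∫ z, fderiv ℝ η z v * (starRingEnd ℂ) (fderiv ℝ η z v)).re := by
    intro v
    rw [← reCLM_apply, ← ContinuousLinearMap.integral_comp_comm _ (hi v v)]
    refine integral_congr_ae (Eventually.of_forall fun z => ?_)
    simp only [reCLM_apply, mul_conj, ofReal_re, normSq_eq_norm_sq]
  have i1 : Integrable fun z => fderiv ℝ η z 1 * (starRingEnd ℂ) (fderiv ℝ η z 1) +
      fderiv ℝ η z I * (starRingEnd ℂ) (fderiv ℝ η z I) := (hi 1 1).add (hi I I)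
  have i2 : Integrable fun z => I * (fderiv ℝ η z 1 * (starRingEnd ℂ) (fderiv ℝ η z I)) -
      I * (fderiv ℝ η z I * (starRingEnd ℂ) (fderiv ℝ η z 1)) :=
    ((hi 1 I).const_mul I).sub ((hi I 1).const_mul I)
  have i3 : Integrable fun z => fderiv ℝ η z 1 * (starRingEnd ℂ) (fderiv ℝ η z 1) +
      fderiv ℝ η z I * (starRingEnd ℂ) (fderiv ℝ η z I) +
      (I * (fderiv ℝ η z 1 * (starRingEnd ℂ) (fderiv ℝ η z I)) -
      I * (fderiv ℝ η z I * (starRingEnd ℂ) (fderiv ℝ η z 1))) := i1.add i2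
  have e2 : ∫ z, ‖fderiv ℝ η z 1 - I * fderiv ℝ η z I‖ ^ 2 =
      (∫ z, (fderiv ℝ η z 1 * (starRingEnd ℂ) (fderiv ℝ η z 1) +
        fderiv ℝ η z I * (starRingEnd ℂ) (fderiv ℝ η z I) +
        (I * (fderiv ℝ η z 1 * (starRingEnd ℂ) (fderiv ℝ η z I)) -
        I * (fderiv ℝ η z I * (starRingEnd ℂ) (fderiv ℝ η z 1))))).re := by
    rw [← reCLM_apply, ← ContinuousLinearMap.integral_comp_comm _ i3]
    refine integral_congr_ae (Eventually.of_forall fun z => ?_)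
    simp only [reCLM_apply]
    rw [← normSq_eq_norm_sq, ← ofReal_re (normSq _), ← mul_conj]
    congr 1
    simp only [map_sub, map_mul, conj_I]
    linear_combination (fderiv ℝ η z I * (starRingEnd ℂ) (fderiv ℝ η z I)) * -I_sq
  rw [e2, integral_add i1 i2,
    integral_add (hi 1 1) (hi I I), integral_sub ((hi 1 I).const_mul I) ((hi I 1).const_mul I),
    integral_const_mul, integral_const_mul, key, sub_self, add_zero, add_re, ← e1, ← e1]
  have : 0 ≤ ∫ z, ‖fderiv ℝ η z I‖ ^ 2 := integral_nonneg fun _ => by positivity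
  linarith

/-- The unit disc with Lebesgue measure. -/
noncomputable abbrev discMeasure : Measure ℂ := volume.restrict (ball 0 1)

instance : IsFiniteMeasure discMeasure :=
  ⟨by rw [Measure.restrict_apply_univ]; exact measure_ball_lt_top⟩

theorem lp_norm_sq_eq (f : Lp ℂ 2 discMeasure) : ‖f‖ ^ 2 = ∫ z in ball 0 1, ‖f z‖ ^ 2 := by
  have h := L2.inner_def (𝕜 := ℂ) f f
  rw [inner_self_eq_norm_sq_to_K] at h
  have h2 : ∀ z, inner ℂ (f z) (f z) = ((‖f z‖ ^ 2 : ℝ) : ℂ) := fun z => by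
    rw [inner_self_eq_norm_sq_to_K]; simp
  simp_rw [h2] at h
  rw [integral_complex_ofReal] at h
  have h3 := congrArg re h
  rw [ofReal_re] at h3
  rw [← h3]
  simp [← ofReal_pow]

theorem norm_toLp_sq {f : ℂ → ℂ} (hf : MemLp f 2 discMeasure) :
    ‖hf.toLp f‖ ^ 2 = ∫ z in ball 0 1, ‖f z‖ ^ 2 := by
  rw [lp_norm_sq_eq]
  refine integral_congr_ae ?_
  filter_upwards [hf.coeFn_toLp] with z hz
  rw [hz]

theorem inner_lp_eq {f : Lp ℂ 2 discMeasure} {φ g : ℂ → ℂ} {x : Lp ℂ 2 discMeasure}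
    (hf : f =ᵐ[discMeasure] g) (hx : x =ᵐ[discMeasure] φ) (hφ : ∀ z ∉ ball (0 : ℂ) 1, φ z = 0) :
    inner ℂ x f = ∫ z, g z * (starRingEnd ℂ) (φ z) := by
  rw [L2.inner_def, ← setIntegral_eq_integral_of_forall_compl_eq_zero (s := ball (0 : ℂ) 1)
    (f := fun z => g z * (starRingEnd ℂ) (φ z))]
  · refine integral_congr_ae ?_
    filter_upwards [hf, hx] with z h1 h2
    rw [h1, h2, RCLike.inner_apply]
  · intro z hz; simp [hφ z hz]

theorem IsTest.memLp_disc {O : Set ℂ} {η : ℂ → ℂ} (h : IsTest O η) : MemLp η 2 discMeasure :=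
  (h.continuous.memLp_of_hasCompactSupport h.hasCompactSupport).restrict _

theorem IsTest.del {O : Set ℂ} {η : ℂ → ℂ} (h : IsTest O η) :
    IsTest O fun z => fderiv ℝ η z 1 - I * fderiv ℝ η z I := by
  have := (h.fderiv_apply 1).add ((h.fderiv_apply I).clm_comp
    ((-I) • (1 : ℂ →L[ℝ] ℂ)))
  simpa [sub_eq_add_neg] using this

/-- The fields `η_x - i η_y` of test functions on the unit disc, as a subspace of `L²`. -/
noncomputable def delTests : Submodule ℂ (Lp ℂ 2 discMeasure) where
  carrier := {x | ∃ η : ℂ → ℂ, IsTest (ball 0 1) η ∧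
    x =ᵐ[discMeasure] fun z => fderiv ℝ η z 1 - I * fderiv ℝ η z I}
  add_mem' := by
    rintro x y ⟨η, hη, hx⟩ ⟨ζ, hζ, hy⟩
    refine ⟨_, hη.add hζ, ?_⟩
    filter_upwards [Lp.coeFn_add x y, hx, hy] with z h1 h2 h3
    rw [h1, Pi.add_apply, h2, h3, fderiv_fun_add (hη.differentiable z) (hζ.differentiable z)]
    simp only [add_apply]; ring
  zero_mem' := by
    refine ⟨fun _ => 0, ⟨contDiff_const, HasCompactSupport.zero, by simp [tsupport]⟩, ?_⟩
    filter_upwards [Lp.coeFn_zero ℂ 2 discMeasure] with z hz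
    simpa using hz
  smul_mem' := by
    rintro c x ⟨η, hη, hx⟩
    have ht := hη.clm_comp (c • (1 : ℂ →L[ℝ] ℂ))
    refine ⟨_, ht, ?_⟩
    filter_upwards [Lp.coeFn_smul c x, hx] with z h1 h2
    rw [h1, Pi.smul_apply, h2, hη.fderiv_clm_comp, hη.fderiv_clm_comp]
    simp only [smul_apply, one_apply_eq_self, smul_eq_mul]; ring

/-- Holomorphic replacement. If `h_x + i h_y = -i E_x` weakly on the unit disc, then `h = g + k` with `g`
weakly holomorphic and `‖k‖ ≤ ‖E‖`: take for `k` the orthogonal projection of `h` to the closure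
of `delTests`. -/
theorem exists_holomorphic_replacement {h E : ℂ → ℂ} (hh : MemLp h 2 discMeasure)
    (hE : MemLp E 2 discMeasure)
    (hw : ∀ η : ℂ → ℂ, IsTest (ball 0 1) η →
      ∫ z, h z * (fderiv ℝ η z 1 + I * fderiv ℝ η z I) = -I * ∫ z, E z * fderiv ℝ η z 1) :
    ∃ g k : Lp ℂ 2 discMeasure, hh.toLp h = g + k ∧ ‖g‖ ≤ ‖hh.toLp h‖ ∧ ‖k‖ ≤ ‖hE.toLp E‖ ∧
      ∀ η : ℂ → ℂ, IsTest (ball 0 1) η →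
        ∫ z, (ball (0 : ℂ) 1).indicator g z * (fderiv ℝ η z 1 + I * fderiv ℝ η z I) = 0 := by
  set K := delTests.topologicalClosure with hK
  have hKc : IsClosed (K : Set (Lp ℂ 2 discMeasure)) := delTests.isClosed_topologicalClosure
  have : CompleteSpace K := hKc.completeSpace_coe
  set f := hh.toLp h with hf
  -- The inner product of `L²` conjugates the test function, which turns `η_x - i η_y` into the operator
  -- of the weak equation.
  have conj_test : ∀ η : ℂ → ℂ, IsTest (ball 0 1) η →
      IsTest (ball 0 1) (fun z => (starRingEnd ℂ) (η z)) ∧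
      ∀ z v, fderiv ℝ (fun z => (starRingEnd ℂ) (η z)) z v = (starRingEnd ℂ) (fderiv ℝ η z v) :=
    fun η hη => ⟨hη.clm_comp (conjCLE : ℂ →L[ℝ] ℂ),
      fun z v => hη.fderiv_clm_comp (conjCLE : ℂ →L[ℝ] ℂ) z v⟩
  -- By the weak equation, pairing `f` with a field `η_x - i η_y` is pairing `E` with `η_x`.
  have hb0 : ∀ x ∈ (delTests : Set (Lp ℂ 2 discMeasure)), ‖inner ℂ x f‖ ≤ ‖x‖ * ‖hE.toLp E‖ := by
    rintro x ⟨η, hη, hx⟩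
    obtain ⟨hζ, hζd⟩ := conj_test η hη
    have e1 := inner_lp_eq hh.coeFn_toLp hx (fun z hz => hη.del.eq_zero hz)
    have hx1 := (hη.fderiv_apply 1).memLp_disc
    have e2 := inner_lp_eq hE.coeFn_toLp hx1.coeFn_toLp
      (fun z hz => (hη.fderiv_apply 1).eq_zero hz)
    have e3 : inner ℂ x f = -I * inner ℂ (hx1.toLp _) (hE.toLp E) := by
      rw [e1, e2]
      have := hw _ hζ
      simp only [hζd] at this
      rw [← this]
      refine integral_congr_ae (Eventually.of_forall fun z => ?_)
      simp only [map_sub, map_mul, conj_I]; ring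
    rw [e3, norm_mul, norm_neg, norm_I, one_mul]
    refine (norm_inner_le_norm _ _).trans ?_
    gcongr
    rw [← sq_le_sq₀ (norm_nonneg _) (norm_nonneg _), norm_toLp_sq, lp_norm_sq_eq]
    have e4 : ∫ z in ball (0 : ℂ) 1, ‖x z‖ ^ 2 =
        ∫ z, ‖fderiv ℝ η z 1 - I * fderiv ℝ η z I‖ ^ 2 := by
      rw [← setIntegral_eq_integral_of_forall_compl_eq_zero (s := ball (0 : ℂ) 1)
        (f := fun z => ‖fderiv ℝ η z 1 - I * fderiv ℝ η z I‖ ^ 2)]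
      · refine integral_congr_ae ?_
        filter_upwards [hx] with z hz
        rw [hz]
      · intro z hz
        rw [hη.del.eq_zero hz]; simp
    rw [e4, setIntegral_eq_integral_of_forall_compl_eq_zero]
    · exact integral_sq_fderiv_one_le hη
    · intro z hz
      rw [(hη.fderiv_apply 1).eq_zero hz]; simp
  have hb : ∀ x ∈ K, ‖inner ℂ x f‖ ≤ ‖x‖ * ‖hE.toLp E‖ := by
    intro x hx
    refine closure_minimal (t := {x | ‖inner ℂ x f‖ ≤ ‖x‖ * ‖hE.toLp E‖}) hb0
      (isClosed_le ?_ ?_) hx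
    · exact (continuous_id.inner continuous_const).norm
    · exact continuous_norm.mul continuous_const
  refine ⟨f - K.starProjection f, K.starProjection f, by abel, ?_, ?_, ?_⟩
  · have : f - K.starProjection f = Kᗮ.starProjection f := by
      rw [Submodule.starProjection_orthogonal']; rfl
    rw [this]
    exact Submodule.norm_starProjection_apply_le _ _
  · have hk := hb _ (Submodule.starProjection_apply_mem K f)
    have h0 := Submodule.starProjection_inner_eq_zero (K := K) f _
      (Submodule.starProjection_apply_mem K f)
    have h1 : inner ℂ (K.starProjection f) f =
        inner ℂ (K.starProjection f) (K.starProjection f) := by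
      rw [inner_sub_left, sub_eq_zero] at h0
      rw [← inner_conj_symm, h0, inner_conj_symm]
    rw [h1, inner_self_eq_norm_sq_to_K, norm_pow, RCLike.norm_ofReal, abs_norm, sq] at hk
    rcases (norm_nonneg (K.starProjection f)).eq_or_lt with h2 | h2
    · rw [← h2]; exact norm_nonneg _
    · exact le_of_mul_le_mul_left hk h2
  · intro η hη
    obtain ⟨hζ, hζd⟩ := conj_test η hη
    have hx := hζ.del.memLp_disc
    have hm : hx.toLp _ ∈ K := delTests.le_topologicalClosure ⟨_, hζ, hx.coeFn_toLp⟩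
    have h0 := Submodule.inner_right_of_mem_orthogonal hm
      (Submodule.sub_starProjection_mem_orthogonal (K := K) f)
    have e : (f - K.starProjection f : Lp ℂ 2 discMeasure) =ᵐ[discMeasure]
        (ball (0 : ℂ) 1).indicator (f - K.starProjection f : Lp ℂ 2 discMeasure) := by
      filter_upwards [ae_restrict_mem measurableSet_ball] with z hz
      rw [Set.indicator_of_mem hz]
    rw [inner_lp_eq e hx.coeFn_toLp (fun z hz => hζ.del.eq_zero hz)] at h0
    refine Eq.trans ?_ h0
    refine integral_congr_ae (Eventually.of_forall fun z => ?_)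
    simp only [hζd, map_sub, map_mul, conj_I, conj_conj]; ring

end SLTorus

namespace SLTorus
open MeasureTheory Metric Filter Topology Complex

/-! ### Decay for the perturbed Cauchy-Riemann equations -/

theorem measureReal_ball (z : ℂ) {r : ℝ} (hr : 0 ≤ r) : volume.real (ball z r) = Real.pi * r ^ 2 := by
  rw [Measure.real, Complex.volume_ball, ENNReal.toReal_mul, ENNReal.toReal_pow,
    ENNReal.toReal_ofReal hr, mul_comm]
  rfl

instance isFiniteMeasure_restrict_ball (z : ℂ) (r : ℝ) :
    IsFiniteMeasure ((volume : Measure ℂ).restrict (ball z r)) :=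
  ⟨by rw [Measure.restrict_apply_univ]; exact measure_ball_lt_top⟩

theorem _root_.ContinuousOn.integrableOn_ball {F : Type*} [NormedAddCommGroup F] {f : ℂ → F} {z : ℂ} {r : ℝ}
    (hf : ContinuousOn f (closedBall z r)) : IntegrableOn f (ball z r) :=
  (hf.integrableOn_compact (isCompact_closedBall z r)).mono_set ball_subset_closedBall

theorem _root_.ContinuousOn.memLp_discMeasure {f : ℂ → ℂ}
    (hf : ContinuousOn f (closedBall 0 1)) : MemLp f 2 discMeasure := by
  rw [memLp_two_iff_integrable_sq_norm]
  · exact (hf.norm.pow 2).integrableOn_ball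
  · exact (hf.mono ball_subset_closedBall).aestronglyMeasurable measurableSet_ball

/-- Cauchy-Schwarz on the unit disc. -/
theorem sq_integral_norm_le {f : ℂ → ℂ} (hf : MemLp f 2 discMeasure) :
    (∫ z in ball 0 1, ‖f z‖) ^ 2 ≤ Real.pi * ∫ z in ball 0 1, ‖f z‖ ^ 2 := by
  set J := ∫ z in ball (0 : ℂ) 1, ‖f z‖
  have hi : Integrable (fun z => ‖f z‖) discMeasure := (hf.integrable (by norm_num)).norm
  have hi2 : Integrable (fun z => ‖f z‖ ^ 2) discMeasure := hf.integrable_norm_pow (by norm_num)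
  have h : ∀ t : ℝ, 0 ≤ (∫ z in ball (0 : ℂ) 1, ‖f z‖ ^ 2) - 2 * t * J + t ^ 2 * Real.pi := by
    intro t
    have h1 : 0 ≤ ∫ z in ball (0 : ℂ) 1, (‖f z‖ ^ 2 - 2 * t * ‖f z‖ + t ^ 2) :=
      integral_nonneg fun z => by
        simp only [Pi.zero_apply]; nlinarith [sq_nonneg (‖f z‖ - t)]
    have i1 : Integrable (fun z => ‖f z‖ ^ 2 - 2 * t * ‖f z‖) discMeasure :=
      hi2.sub (hi.const_mul _)
    rw [integral_add i1 (integrable_const _), integral_sub hi2 (hi.const_mul _),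
      integral_const_mul, setIntegral_const, measureReal_ball _ zero_le_one] at h1
    simp only [smul_eq_mul] at h1
    linarith
  have h2 := h (J / Real.pi)
  have hp := Real.pi_pos
  have : (∫ z in ball (0 : ℂ) 1, ‖f z‖ ^ 2) - 2 * (J / Real.pi) * J + (J / Real.pi) ^ 2 * Real.pi =
      (∫ z in ball (0 : ℂ) 1, ‖f z‖ ^ 2) - J ^ 2 / Real.pi := by field_simp; ring
  rw [this, sub_nonneg, div_le_iff₀ hp] at h2
  linarith

theorem norm_sub_sub_sq_le (a b c : ℂ) : ‖a - b - c‖ ^ 2 ≤ 3 * (‖a‖ ^ 2 + ‖b‖ ^ 2 + ‖c‖ ^ 2) := by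
  have h : ‖a - b - c‖ ≤ ‖a‖ + ‖b‖ + ‖c‖ :=
    (norm_sub_le _ _).trans (by linarith [norm_sub_le a b])
  have : ‖a - b - c‖ ^ 2 ≤ (‖a‖ + ‖b‖ + ‖c‖) ^ 2 := by gcongr
  nlinarith [sq_nonneg (‖a‖ - ‖b‖), sq_nonneg (‖a‖ - ‖c‖), sq_nonneg (‖b‖ - ‖c‖)]

theorem norm_add_sq_le (a b : ℂ) : ‖a + b‖ ^ 2 ≤ 2 * ‖a‖ ^ 2 + 2 * ‖b‖ ^ 2 := by
  have : ‖a + b‖ ^ 2 ≤ (‖a‖ + ‖b‖) ^ 2 := by gcongr; exact norm_add_le a b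
  nlinarith [sq_nonneg (‖a‖ - ‖b‖)]

/-- If `h_x + i h_y = -i E_x` weakly on the unit disc, then near `0` the function `h` is close in
`L²` to a complex affine function. -/
theorem disc_decay {h E : ℂ → ℂ} (hh : ContinuousOn h (closedBall 0 1))
    (hE : ContinuousOn E (closedBall 0 1))
    (hw : ∀ η : ℂ → ℂ, IsTest (ball 0 1) η →
      ∫ z, h z * (fderiv ℝ η z 1 + I * fderiv ℝ η z I) = -I * ∫ z, E z * fderiv ℝ η z 1) :
    ∃ c d : ℂ, ‖c‖ ^ 2 ≤ 10 ^ 8 * ∫ z in ball 0 1, ‖h z‖ ^ 2 ∧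
      ‖d‖ ^ 2 ≤ 10 ^ 8 * ∫ z in ball 0 1, ‖h z‖ ^ 2 ∧
      ∀ θ : ℝ, 0 < θ → θ ≤ 1 → ∫ z in ball 0 θ, ‖h z - c - d * z‖ ^ 2 ≤
        10 ^ 8 * (θ ^ 6 * (∫ z in ball 0 1, ‖h z‖ ^ 2) + ∫ z in ball 0 1, ‖E z‖ ^ 2) := by
  have hh2 := hh.memLp_discMeasure
  have hE2 := hE.memLp_discMeasure
  obtain ⟨g, k, hgk, hgn, hkn, hgw⟩ := exists_holomorphic_replacement hh2 hE2 hw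
  have hgI : Integrable ((ball (0 : ℂ) 1).indicator g) :=
    (integrable_indicator_iff measurableSet_ball).2 ((Lp.memLp g).integrable (by norm_num))
  obtain ⟨c, d, hc, hd, hcd⟩ := weakly_holomorphic_taylor hgI hgw
  have hJe : ∫ z, ‖(ball (0 : ℂ) 1).indicator g z‖ = ∫ z in ball 0 1, ‖g z‖ := by
    rw [← integral_indicator measurableSet_ball]
    simp_rw [norm_indicator_eq_indicator_norm]
  rw [hJe] at hc hd hcd
  set J := ∫ z in ball (0 : ℂ) 1, ‖g z‖ with hJ
  set Nh := ∫ z in ball (0 : ℂ) 1, ‖h z‖ ^ 2 with hNh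
  set NE := ∫ z in ball (0 : ℂ) 1, ‖E z‖ ^ 2 with hNE
  have hJ0 : 0 ≤ J := integral_nonneg fun _ => norm_nonneg _
  have hNE0 : 0 ≤ NE := integral_nonneg fun _ => by positivity
  have hNh0 : 0 ≤ Nh := integral_nonneg fun _ => by positivity
  have hp := Real.pi_pos
  have hp4 := Real.pi_lt_d2
  have hJN : J ^ 2 ≤ 4 * Nh := by
    have h1 := sq_integral_norm_le (Lp.memLp g)
    rw [← lp_norm_sq_eq] at h1
    have h2 : ‖g‖ ^ 2 ≤ Nh := by
      rw [hNh, ← norm_toLp_sq hh2]; gcongr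
    refine h1.trans ?_
    gcongr
    linarith
  have hkN : ∫ z in ball 0 1, ‖k z‖ ^ 2 ≤ NE := by
    rw [← lp_norm_sq_eq, hNE, ← norm_toLp_sq hE2]; gcongr
  have hc2 : ‖c‖ ^ 2 ≤ 40000 * Nh := by
    have : ‖c‖ ^ 2 ≤ (100 * J) ^ 2 := by gcongr
    linarith
  have hd2 : ‖d‖ ^ 2 ≤ 40000 * Nh := by
    have : ‖d‖ ^ 2 ≤ (100 * J) ^ 2 := by gcongr
    linarith
  refine ⟨c, d, by linarith, by linarith, fun θ hθ hθ1 => ?_⟩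
  have hsub : ball (0 : ℂ) θ ⊆ ball 0 1 := ball_subset_ball hθ1
  have hhc : ContinuousOn (fun z => ‖h z - c - d * z‖ ^ 2) (closedBall 0 1) :=
    ((hh.sub continuousOn_const).sub (continuousOn_const.mul continuousOn_id)).norm.pow 2
  -- The expansion of the holomorphic part `g` holds on the disc of radius `1 / 2`; for `θ > 1 / 2` the
  -- bound is trivial, as `θ ^ 6 ≥ 1 / 64`.
  rcases le_or_gt θ (1 / 2) with hs | hs
  · have hki : IntegrableOn (fun z => ‖k z‖ ^ 2) (ball 0 1) :=
      (Lp.memLp k).integrable_norm_pow (by norm_num)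
    have h1 : ∫ z in ball (0 : ℂ) θ, ‖h z - c - d * z‖ ^ 2 ≤
        ∫ z in ball (0 : ℂ) θ, (2 * (400 * J * θ ^ 2) ^ 2 + 2 * ‖k z‖ ^ 2) := by
      refine integral_mono_ae (hhc.integrableOn_ball.mono_set hsub)
        ((integrable_const _).add ((hki.mono_set hsub).const_mul 2)) ?_
      filter_upwards [ae_restrict_mem measurableSet_ball, ae_restrict_of_ae hcd,
        ae_restrict_of_ae_restrict_of_subset hsub hh2.coeFn_toLp,
        ae_restrict_of_ae_restrict_of_subset hsub (Lp.coeFn_add g k)] with z hz h1 h2 h3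
      rw [hgk, h3, Pi.add_apply] at h2
      rw [Set.indicator_of_mem (hsub hz)] at h1
      rw [← h2, show g z + k z - c - d * z = (g z - c - d * z) + k z by ring]
      refine (norm_add_sq_le _ _).trans ?_
      have h4 := h1 (ball_subset_ball hs hz)
      rw [mem_ball_zero_iff] at hz
      gcongr
      exact h4.trans (by gcongr)
    rw [integral_add (integrable_const _) ((hki.mono_set hsub).const_mul 2), setIntegral_const,
      measureReal_ball _ hθ.le, integral_const_mul, smul_eq_mul] at h1
    have h2 : ∫ z in ball (0 : ℂ) θ, ‖k z‖ ^ 2 ≤ NE :=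
      (setIntegral_mono_set hki (Eventually.of_forall fun _ => by positivity)
        hsub.eventuallyLE).trans hkN
    have h3 : Real.pi * θ ^ 2 * (2 * (400 * J * θ ^ 2) ^ 2) ≤ 4 * θ ^ 2 * (2 * (160000 * (4 * Nh) * θ ^ 4)) := by
      rw [show (400 * J * θ ^ 2) ^ 2 = 160000 * J ^ 2 * θ ^ 4 by ring]
      gcongr; linarith
    have h4 : 0 ≤ θ ^ 6 * Nh := by positivity
    nlinarith
  · have h1 : ∫ z in ball (0 : ℂ) θ, ‖h z - c - d * z‖ ^ 2 ≤
        ∫ z in ball (0 : ℂ) 1, ‖h z - c - d * z‖ ^ 2 :=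
      setIntegral_mono_set hhc.integrableOn_ball (Eventually.of_forall fun _ => by positivity)
        hsub.eventuallyLE
    have hhi : IntegrableOn (fun z => ‖h z‖ ^ 2) (ball 0 1) := (hh.norm.pow 2).integrableOn_ball
    have h2 : ∫ z in ball (0 : ℂ) 1, ‖h z - c - d * z‖ ^ 2 ≤
        ∫ z in ball (0 : ℂ) 1, (3 * ‖h z‖ ^ 2 + 3 * (40000 * Nh + 40000 * Nh)) := by
      refine setIntegral_mono_on hhc.integrableOn_ball
        ((hhi.const_mul 3).add (integrable_const _)) measurableSet_ball fun z hz => ?_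
      refine (norm_sub_sub_sq_le _ _ _).trans ?_
      rw [mem_ball_zero_iff] at hz
      have h3 : ‖d * z‖ ^ 2 ≤ ‖d‖ ^ 2 := by
        rw [norm_mul, mul_pow]
        exact mul_le_of_le_one_right (by positivity) (pow_le_one₀ (norm_nonneg _) hz.le)
      linarith
    rw [integral_add (hhi.const_mul 3) (integrable_const _), setIntegral_const,
      measureReal_ball _ zero_le_one, integral_const_mul, smul_eq_mul] at h2
    have h3 : (1 / 64 : ℝ) ≤ θ ^ 6 := by
      have : (1 / 2 : ℝ) ^ 6 ≤ θ ^ 6 := by gcongr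
      linarith
    have h4 : 1 / 64 * Nh ≤ θ ^ 6 * Nh := by gcongr
    nlinarith

/-- `u, v, B` satisfy `u_x = v_y`, `B_x = - u_y` on `O` in the sense of distributions. -/
def IsWeakSol (O : Set ℂ) (u v B : ℂ → ℝ) : Prop :=
  ∀ η : ℂ → ℝ, IsTest O η →
    ∫ z, (u z * fderiv ℝ η z 1 - v z * fderiv ℝ η z I) = 0 ∧
    ∫ z, (B z * fderiv ℝ η z 1 + u z * fderiv ℝ η z I) = 0

theorem IsTest.integrable_mul {𝕜 : Type*} [RCLike 𝕜] {O : Set ℂ} {f ζ : ℂ → 𝕜}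
    (h : IsTest O ζ) (hO : IsOpen O)
    (hf : ContinuousOn f O) : Integrable fun z => f z * ζ z := by
  refine Continuous.integrable_of_hasCompactSupport ?_ h.hasCompactSupport.mul_left
  rw [continuous_iff_continuousAt]
  intro z
  by_cases hz : z ∈ O
  · exact (hf.continuousAt (hO.mem_nhds hz)).mul h.continuous.continuousAt
  · have h1 : ζ =ᶠ[𝓝 z] 0 :=
      notMem_tsupport_iff_eventuallyEq.1 fun h' => hz (h.tsupport_subset h')
    refine (continuousAt_const (y := (0 : 𝕜))).congr ?_
    filter_upwards [h1] with w hw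
    simp [hw]

/-- The complex form of the system with coefficient `1`: a weak solution of `u_x = v_y`,
`(v + E)_x = - u_y` gives `h = u + i v` with `h_x + i h_y = - i E_x` weakly. -/
theorem IsWeakSol.complex {O : Set ℂ} (hO : IsOpen O) {u v E : ℂ → ℝ} (hu : ContinuousOn u O)
    (hv : ContinuousOn v O) (hE : ContinuousOn E O) (h : IsWeakSol O u v fun z => v z + E z)
    (η : ℂ → ℂ) (hη : IsTest O η) :
    ∫ z, ((u z : ℂ) + I * v z) * (fderiv ℝ η z 1 + I * fderiv ℝ η z I) =
      -I * ∫ z, (E z : ℂ) * fderiv ℝ η z 1 := by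
  have hp := hη.clm_comp reCLM
  have hq := hη.clm_comp imCLM
  have hpd : ∀ z w, fderiv ℝ (fun z => reCLM (η z)) z w = (fderiv ℝ η z w).re := fun z w =>
    hη.fderiv_clm_comp reCLM z w
  have hqd : ∀ z w, fderiv ℝ (fun z => imCLM (η z)) z w = (fderiv ℝ η z w).im := fun z w =>
    hη.fderiv_clm_comp imCLM z w
  have key : ∀ ζ : ℂ → ℝ, IsTest O ζ →
      Integrable (fun z => (((u z * fderiv ℝ ζ z 1 - v z * fderiv ℝ ζ z I : ℝ) : ℂ) +
        I * ((((v z + E z) * fderiv ℝ ζ z 1 + u z * fderiv ℝ ζ z I : ℝ)) : ℂ))) ∧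
      ∫ z, (((u z * fderiv ℝ ζ z 1 - v z * fderiv ℝ ζ z I : ℝ) : ℂ) +
        I * ((((v z + E z) * fderiv ℝ ζ z 1 + u z * fderiv ℝ ζ z I : ℝ)) : ℂ)) = 0 := by
    intro ζ hζ
    have i1 : Integrable fun z => (u z * fderiv ℝ ζ z 1 - v z * fderiv ℝ ζ z I) :=
      ((hζ.fderiv_apply 1).integrable_mul hO hu).sub ((hζ.fderiv_apply I).integrable_mul hO hv)
    have i2 : Integrable fun z => ((v z + E z) * fderiv ℝ ζ z 1 + u z * fderiv ℝ ζ z I) :=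
      ((hζ.fderiv_apply 1).integrable_mul hO (hv.add hE)).add
        ((hζ.fderiv_apply I).integrable_mul hO hu)
    have j1 : Integrable (fun z => ((u z * fderiv ℝ ζ z 1 - v z * fderiv ℝ ζ z I : ℝ) : ℂ)) :=
      i1.ofReal
    have j2 : Integrable (fun z => I * ((((v z + E z) * fderiv ℝ ζ z 1 +
      u z * fderiv ℝ ζ z I : ℝ)) : ℂ)) := i2.ofReal.const_mul I
    refine ⟨j1.add j2, ?_⟩
    rw [integral_add j1 j2, integral_const_mul, integral_complex_ofReal, integral_complex_ofReal,
      (h ζ hζ).1, (h ζ hζ).2]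
    simp
  have kp := key _ hp
  have kq := key _ hq
  have hs : ∫ z, (((u z : ℂ) + I * v z) * (fderiv ℝ η z 1 + I * fderiv ℝ η z I) +
      I * ((E z : ℂ) * fderiv ℝ η z 1)) = 0 := by
    have e := integral_add kp.1 (kq.1.const_mul I)
    rw [integral_const_mul, kp.2, kq.2, mul_zero, add_zero] at e
    rw [← e]
    refine integral_congr_ae (Eventually.of_forall fun z => ?_)
    simp only [hpd, hqd]
    rw [← re_add_im (fderiv ℝ η z 1), ← re_add_im (fderiv ℝ η z I)]
    simp only [add_re, ofReal_re, mul_re, I_re, mul_zero, ofReal_im, I_im, mul_one, sub_self,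
      add_zero, add_im, mul_im, zero_add]
    push_cast
    linear_combination ((v z : ℂ) * (fderiv ℝ η z I).re + I * v z * (fderiv ℝ η z I).im) * I_sq
  have hi1 : Integrable fun z => ((u z : ℂ) + I * v z) *
      (fderiv ℝ η z 1 + I * fderiv ℝ η z I) := by
    have ht : IsTest O fun z => fderiv ℝ η z 1 + I * fderiv ℝ η z I := by
      have := (hη.fderiv_apply 1).add ((hη.fderiv_apply I).clm_comp (I • (1 : ℂ →L[ℝ] ℂ)))
      simpa using this
    exact ht.integrable_mul hO ((continuous_ofReal.comp_continuousOn hu).add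
      (continuousOn_const.mul (continuous_ofReal.comp_continuousOn hv)))
  have hi2 : Integrable fun z => (E z : ℂ) * fderiv ℝ η z 1 :=
    (hη.fderiv_apply 1).integrable_mul hO (continuous_ofReal.comp_continuousOn hE)
  rw [integral_add hi1 (hi2.const_mul I), integral_const_mul] at hs
  linear_combination hs

end SLTorus

namespace SLTorus
open MeasureTheory Metric Filter Topology Complex

/-! ### Decay for systems with constant coefficients -/

/-- The real-linear map `x + iy ↦ s x + i t y`. -/
noncomputable def scaleCLM (s t : ℝ) : ℂ →L[ℝ] ℂ :=
  s • (ofRealCLM.comp reCLM) + t • ((ContinuousLinearMap.mul ℝ ℂ I).comp (ofRealCLM.comp imCLM))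

theorem scaleCLM_apply (s t : ℝ) (z : ℂ) : scaleCLM s t z = (s * z.re : ℝ) + I * (t * z.im : ℝ) := by
  simp [scaleCLM]; ring

@[simp] theorem scaleCLM_re (s t : ℝ) (z : ℂ) : (scaleCLM s t z).re = s * z.re := by
  simp [scaleCLM_apply]

@[simp] theorem scaleCLM_im (s t : ℝ) (z : ℂ) : (scaleCLM s t z).im = t * z.im := by
  simp [scaleCLM_apply]

theorem scaleCLM_scaleCLM (s t s' t' : ℝ) (z : ℂ) :
    scaleCLM s t (scaleCLM s' t' z) = scaleCLM (s * s') (t * t') z := by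
  apply Complex.ext <;> simp [mul_assoc]

theorem scaleCLM_one_one (z : ℂ) : scaleCLM 1 1 z = z := by apply Complex.ext <;> simp

theorem norm_scaleCLM_apply_le {s t m : ℝ} (hm : 0 ≤ m) (hs : |s| ≤ m) (ht : |t| ≤ m) (z : ℂ) :
    ‖scaleCLM s t z‖ ≤ m * ‖z‖ := by
  rw [← sq_le_sq₀ (norm_nonneg _) (by positivity), mul_pow, ← normSq_eq_norm_sq,
    ← normSq_eq_norm_sq, normSq_apply, normSq_apply, scaleCLM_re, scaleCLM_im]
  have h1 : s ^ 2 ≤ m ^ 2 := sq_le_sq' (by linarith [neg_abs_le s]) ((le_abs_self s).trans hs)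
  have h2 : t ^ 2 ≤ m ^ 2 := sq_le_sq' (by linarith [neg_abs_le t]) ((le_abs_self t).trans ht)
  nlinarith [mul_le_mul_of_nonneg_right h1 (sq_nonneg z.re),
    mul_le_mul_of_nonneg_right h2 (sq_nonneg z.im)]

theorem det_scaleCLM (s t : ℝ) : (scaleCLM s t).det = s * t := by
  rw [ContinuousLinearMap.det, ← LinearMap.det_toMatrix basisOneI, Matrix.det_fin_two]
  simp [LinearMap.toMatrix_apply, scaleCLM_apply]

/-- The linear change of variables in an integral. -/
theorem setIntegral_image_scaleCLM {b ρ : ℝ} (hb : 0 < b) (hρ : 0 < ρ) (z₀ : ℂ) {s : Set ℂ}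
    (hs : MeasurableSet s) (g : ℂ → ℝ) :
    ∫ z in (fun ζ => z₀ + scaleCLM (ρ * b) ρ ζ) '' s, g z =
      ρ ^ 2 * b * ∫ ζ in s, g (z₀ + scaleCLM (ρ * b) ρ ζ) := by
  rw [integral_image_eq_integral_abs_det_fderiv_smul volume hs
    (f' := fun _ => scaleCLM (ρ * b) ρ)]
  · rw [← integral_const_mul, det_scaleCLM, abs_of_pos (by positivity)]
    simp only [smul_eq_mul]
    congr 1; ext ζ; ring
  · intro x _
    exact ((scaleCLM (ρ * b) ρ).hasFDerivAt.const_add z₀).hasFDerivWithinAt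
  · intro x _ y _ hxy
    have h := congrArg (scaleCLM (ρ * b)⁻¹ ρ⁻¹) (add_left_cancel hxy)
    rwa [scaleCLM_scaleCLM, scaleCLM_scaleCLM, inv_mul_cancel₀ (by positivity),
      inv_mul_cancel₀ hρ.ne', scaleCLM_one_one, scaleCLM_one_one] at h

/-- The linear change of variables as a homeomorphism, from the original to the new variable. -/
noncomputable def scaleHomeomorph {b ρ : ℝ} (hb : 0 < b) (hρ : 0 < ρ) (z₀ : ℂ) : ℂ ≃ₜ ℂ where
  toFun z := scaleCLM (ρ * b)⁻¹ ρ⁻¹ (z - z₀)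
  invFun ζ := z₀ + scaleCLM (ρ * b) ρ ζ
  left_inv z := by
    simp only
    rw [scaleCLM_scaleCLM, mul_inv_cancel₀ (by positivity), mul_inv_cancel₀ hρ.ne',
      scaleCLM_one_one]; ring
  right_inv ζ := by
    simp only
    rw [add_sub_cancel_left, scaleCLM_scaleCLM, inv_mul_cancel₀ (by positivity),
      inv_mul_cancel₀ hρ.ne', scaleCLM_one_one]
  continuous_toFun := by fun_prop
  continuous_invFun := by fun_prop

/-- A weak solution of the system with constant coefficient `b²` becomes a weak solution of the
perturbed Cauchy-Riemann system after the linear change of variables `scaleHomeomorph`. -/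
theorem IsWeakSol.rescale {O : Set ℂ} {b ρ : ℝ} (hb : 0 < b) (hρ : 0 < ρ) {z₀ : ℂ}
    {u v E : ℂ → ℝ} (h : IsWeakSol O u v fun z => b ^ 2 * v z + E z) {O' : Set ℂ}
    (hO : ∀ ζ ∈ O', z₀ + scaleCLM (ρ * b) ρ ζ ∈ O) :
    IsWeakSol O' (fun ζ => u (z₀ + scaleCLM (ρ * b) ρ ζ))
      (fun ζ => b * v (z₀ + scaleCLM (ρ * b) ρ ζ))
      (fun ζ => b * v (z₀ + scaleCLM (ρ * b) ρ ζ) + E (z₀ + scaleCLM (ρ * b) ρ ζ) / b) := by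
  intro η hη
  set e := scaleHomeomorph hb hρ z₀ with he
  have heT : ∀ ζ, e (z₀ + scaleCLM (ρ * b) ρ ζ) = ζ := fun ζ => e.apply_symm_apply ζ
  have hTe : ∀ z, z₀ + scaleCLM (ρ * b) ρ (e z) = z := fun z => e.symm_apply_apply z
  have hed : ∀ z, HasFDerivAt e (scaleCLM (ρ * b)⁻¹ ρ⁻¹) z := fun z =>
    (scaleCLM (ρ * b)⁻¹ ρ⁻¹).hasFDerivAt.comp z ((hasFDerivAt_id z).sub_const z₀)
  have ht : IsTest O (η ∘ e) := by
    refine ⟨hη.contDiff.comp ((scaleCLM (ρ * b)⁻¹ ρ⁻¹).contDiff.comp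
      (contDiff_id.sub contDiff_const)), hη.hasCompactSupport.comp_homeomorph e, ?_⟩
    rw [tsupport_comp_eq_preimage]
    intro z hz
    have := hO _ (hη.tsupport_subset hz)
    rwa [hTe] at this
  have hd : ∀ ζ w, fderiv ℝ (η ∘ e) (z₀ + scaleCLM (ρ * b) ρ ζ) w =
      fderiv ℝ η ζ (scaleCLM (ρ * b)⁻¹ ρ⁻¹ w) := by
    intro ζ w
    have h1 : HasFDerivAt η (fderiv ℝ η ζ) (e (z₀ + scaleCLM (ρ * b) ρ ζ)) := by
      rw [heT]; exact (hη.differentiable ζ).hasFDerivAt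
    rw [(h1.comp _ (hed _)).fderiv]; rfl
  have e1 : scaleCLM (ρ * b)⁻¹ ρ⁻¹ 1 = (ρ * b)⁻¹ • (1 : ℂ) := by
    apply Complex.ext <;> simp
  have e2 : scaleCLM (ρ * b)⁻¹ ρ⁻¹ I = ρ⁻¹ • I := by
    apply Complex.ext <;> simp
  have cv : ∀ g : ℂ → ℝ, ∫ z, g z = 0 → ∫ ζ, g (z₀ + scaleCLM (ρ * b) ρ ζ) = 0 := by
    intro g hg
    have h1 := setIntegral_image_scaleCLM hb hρ z₀ MeasurableSet.univ g
    have h2 : (fun ζ => z₀ + scaleCLM (ρ * b) ρ ζ) '' Set.univ = Set.univ := by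
      rw [Set.image_univ]; exact e.symm.surjective.range_eq
    rw [h2, setIntegral_univ, setIntegral_univ, hg] at h1
    exact (mul_eq_zero.1 h1.symm).resolve_left (by positivity)
  have k1 := cv _ (h _ ht).1
  have k2 := cv _ (h _ ht).2
  simp only [hd, e1, e2, map_smul, smul_eq_mul] at k1 k2
  refine ⟨?_, ?_⟩
  · rw [← mul_zero (ρ * b), ← k1, ← integral_const_mul]
    refine integral_congr_ae (Eventually.of_forall fun ζ => ?_)
    simp only
    field_simp
  · rw [← mul_zero ρ, ← k2, ← integral_const_mul]
    refine integral_congr_ae (Eventually.of_forall fun ζ => ?_)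
    simp only
    field_simp

/-- The complex function `u + i v`. -/
noncomputable def cpx (u v : ℂ → ℝ) (z : ℂ) : ℂ := u z + I * v z

theorem _root_.ContinuousOn.cpx {u v : ℂ → ℝ} {s : Set ℂ} (hu : ContinuousOn u s)
    (hv : ContinuousOn v s) : ContinuousOn (SLTorus.cpx u v) s :=
  (continuous_ofReal.comp_continuousOn hu).add
      (continuousOn_const.mul (continuous_ofReal.comp_continuousOn hv))

/-- The real-linear maps `L` that solve `u_x = v_y`, `a v_x = -u_y`. -/
def IsLinSol (a : ℝ) (L : ℂ →L[ℝ] ℂ) : Prop :=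
  (L 1).re = (L I).im ∧ a * (L 1).im = -(L I).re

set_option maxHeartbeats 1000000 in
/-- One step of the Campanato iteration: on a ball of radius `r`, a weak solution of
`u_x = v_y`, `(b² v + E)_x = - u_y` is approximated on smaller concentric balls by a real-affine
solution of the system without `E`. -/
theorem exists_affine_decay {m : ℝ} (hm : 1 ≤ m) : ∃ C : ℝ, 1 ≤ C ∧ ∀ b : ℝ, m⁻¹ ≤ b → b ≤ m →
    ∀ (z₀ : ℂ) (r : ℝ), 0 < r → ∀ u v E : ℂ → ℝ, ContinuousOn u (closedBall z₀ r) →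
    ContinuousOn v (closedBall z₀ r) → ContinuousOn E (closedBall z₀ r) →
    (IsWeakSol (ball z₀ r) u v fun z => b ^ 2 * v z + E z) →
    ∃ (c : ℂ) (L : ℂ →L[ℝ] ℂ), IsLinSol (b ^ 2) L ∧
      r ^ 2 * ‖c‖ ^ 2 ≤ C * ∫ z in ball z₀ r, ‖cpx u v z‖ ^ 2 ∧
      r ^ 4 * ‖L‖ ^ 2 ≤ C * ∫ z in ball z₀ r, ‖cpx u v z‖ ^ 2 ∧
      ∀ θ : ℝ, 0 < θ → θ ≤ 1 → ∫ z in ball z₀ (θ * r), ‖cpx u v z - c - L (z - z₀)‖ ^ 2 ≤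
        C * (θ ^ 6 * (∫ z in ball z₀ r, ‖cpx u v z‖ ^ 2) + ∫ z in ball z₀ r, E z ^ 2) := by
  have hm0 : 0 < m := by linarith
  -- The power of `m` collects the distortion of norms and areas by the change of variables `T`.
  refine ⟨10 ^ 10 * m ^ 23, ?_, ?_⟩
  · have : 1 ≤ m ^ 23 := one_le_pow₀ hm
    linarith
  intro b hb1 hb2 z₀ r hr u v E hu hv hE hw
  have hb : 0 < b := lt_of_lt_of_le (by positivity) hb1
  have hbm : b⁻¹ ≤ m := by
    rw [inv_le_comm₀ hb hm0]; exact hb1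
  -- In the variable `ζ` with `z = T ζ` the function `u + i b v` solves the perturbed Cauchy-Riemann
  -- equations on the unit disc; `M` recovers `u + i v` from it. The radius `ρ` is such that `T` maps the
  -- unit disc into the ball of radius `r`.
  set ρ := r / m with hρdef
  have hρ : 0 < ρ := by positivity
  set A := scaleCLM (ρ * b) ρ with hA
  set A' := scaleCLM (ρ * b)⁻¹ ρ⁻¹ with hA'
  set M := scaleCLM 1 b⁻¹ with hM
  set T : ℂ → ℂ := fun ζ => z₀ + A ζ with hT
  have hρm : ρ * m = r := by rw [hρdef]; field_simp
  have hAn : ∀ ζ, ‖A ζ‖ ≤ r * ‖ζ‖ := by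
    refine norm_scaleCLM_apply_le hr.le ?_ ?_
    · rw [abs_of_pos (by positivity), ← hρm]; gcongr
    · rw [abs_of_pos hρ, ← hρm]; nlinarith
  have hA'n : ∀ ζ, ‖A' ζ‖ ≤ m ^ 2 / r * ‖ζ‖ := by
    have hρi : ρ⁻¹ = m / r := by rw [hρdef, inv_div]
    refine norm_scaleCLM_apply_le (by positivity) ?_ ?_
    · rw [abs_of_pos (by positivity), mul_inv, hρi, sq, mul_div_right_comm]; gcongr
    · rw [abs_of_pos (by positivity), hρi]; gcongr; nlinarith
  have hMn : ∀ ζ, ‖M ζ‖ ≤ m * ‖ζ‖ :=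
    norm_scaleCLM_apply_le hm0.le (by simpa using hm) (by rwa [abs_of_pos (by positivity)])
  have hTA : ∀ z, T (A' (z - z₀)) = z := (scaleHomeomorph hb hρ z₀).symm_apply_apply
  have hA'T : ∀ ζ, A' (T ζ - z₀) = ζ := (scaleHomeomorph hb hρ z₀).apply_symm_apply
  have hTb : ∀ ζ ∈ ball (0 : ℂ) 1, T ζ ∈ ball z₀ r := by
    intro ζ hζ
    rw [mem_ball_zero_iff] at hζ
    rw [hT, mem_ball, dist_eq_norm, add_sub_cancel_left]
    exact (hAn ζ).trans_lt (by nlinarith)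
  have hTc : Set.MapsTo T (closedBall 0 1) (closedBall z₀ r) := by
    intro ζ hζ
    rw [mem_closedBall_zero_iff] at hζ
    rw [hT, mem_closedBall, dist_eq_norm, add_sub_cancel_left]
    exact (hAn ζ).trans (by nlinarith)
  have hTcont : ContinuousOn T (closedBall 0 1) := by fun_prop
  have hw' := hw.rescale hb hρ hTb
  have huT := hu.comp hTcont hTc
  have hvT := hv.comp hTcont hTc
  have hET := hE.comp hTcont hTc
  have hvT' : ContinuousOn (fun ζ => b * v (T ζ)) (closedBall 0 1) := continuousOn_const.mul hvT
  have hET' : ContinuousOn (fun ζ => E (T ζ) / b) (closedBall 0 1) := hET.div_const b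
  obtain ⟨c, d, hc, hd, hcd⟩ := disc_decay
    (h := cpx (fun ζ => u (T ζ)) (fun ζ => b * v (T ζ))) (E := fun ζ => ((E (T ζ) / b : ℝ) : ℂ))
    (ContinuousOn.cpx huT hvT') (continuous_ofReal.comp_continuousOn hET')
    (fun η hη => hw'.complex isOpen_ball (huT.mono ball_subset_closedBall)
      (hvT'.mono ball_subset_closedBall) (hET'.mono ball_subset_closedBall) η hη)
  set H := cpx (fun ζ => u (T ζ)) (fun ζ => b * v (T ζ)) with hH
  set D := ρ ^ 2 * b with hD
  have hD0 : 0 < D := by positivity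
  have hDr : r ^ 2 ≤ m ^ 3 * D := by
    have h1 : 1 ≤ m * b := by
      have := mul_le_mul_of_nonneg_left hb1 hm0.le
      rwa [mul_inv_cancel₀ hm0.ne'] at this
    rw [hD, ← hρm]
    have : 0 ≤ ρ ^ 2 * m ^ 2 := by positivity
    nlinarith
  have hTball : T '' ball 0 1 ⊆ ball z₀ r := by
    rintro _ ⟨ζ, hζ, rfl⟩; exact hTb ζ hζ
  set Nh := ∫ z in ball z₀ r, ‖cpx u v z‖ ^ 2 with hNh
  set NE := ∫ z in ball z₀ r, E z ^ 2 with hNE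
  have hNh0 : 0 ≤ Nh := integral_nonneg fun _ => by positivity
  have hNE0 : 0 ≤ NE := integral_nonneg fun _ => by positivity
  have hcv := fun (s : Set ℂ) (hs : MeasurableSet s) (g : ℂ → ℝ) =>
    setIntegral_image_scaleCLM hb hρ z₀ hs g
  have hhi : IntegrableOn (fun z => ‖cpx u v z‖ ^ 2) (ball z₀ r) :=
    ((ContinuousOn.cpx hu hv).norm.pow 2).integrableOn_ball
  have hEi : IntegrableOn (fun z => E z ^ 2) (ball z₀ r) := (hE.pow 2).integrableOn_ball
  have hHN : D * ∫ ζ in ball 0 1, ‖H ζ‖ ^ 2 ≤ m ^ 2 * Nh := by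
    have h1 := hcv _ (measurableSet_ball (x := (0 : ℂ)) (ε := 1))
      (fun z => ‖cpx u (fun z => b * v z) z‖ ^ 2)
    rw [hD, show (∫ ζ in ball 0 1, ‖H ζ‖ ^ 2) = _ from rfl]
    rw [hH]
    refine (le_of_eq h1.symm).trans ?_
    have hgi : IntegrableOn (fun z => ‖cpx u (fun z => b * v z) z‖ ^ 2) (ball z₀ r) :=
      ((ContinuousOn.cpx hu (continuousOn_const.mul hv)).norm.pow 2).integrableOn_ball
    refine (setIntegral_mono_set hgi (Eventually.of_forall fun _ => by positivity)
      hTball.eventuallyLE).trans ?_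
    rw [hNh, ← integral_const_mul]
    refine setIntegral_mono_on hgi (hhi.const_mul _) measurableSet_ball fun z _ => ?_
    rw [← mul_pow]
    gcongr
    have := norm_scaleCLM_apply_le hm0.le (s := 1) (t := b) (by simpa using hm)
      (by rwa [abs_of_pos hb]) (cpx u v z)
    refine le_trans (le_of_eq ?_) this
    congr 1
    apply Complex.ext <;> simp [cpx]
  have hEN : D * ∫ ζ in ball 0 1, ‖((E (T ζ) / b : ℝ) : ℂ)‖ ^ 2 ≤ m ^ 2 * NE := by
    have h1 := hcv _ (measurableSet_ball (x := (0 : ℂ)) (ε := 1)) (fun z => ‖((E z / b : ℝ) : ℂ)‖ ^ 2)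
    rw [hD]
    refine (le_of_eq h1.symm).trans ?_
    have hgi : IntegrableOn (fun z => ‖((E z / b : ℝ) : ℂ)‖ ^ 2) (ball z₀ r) :=
      ((continuous_ofReal.comp_continuousOn (hE.div_const b)).norm.pow 2).integrableOn_ball
    refine (setIntegral_mono_set hgi (Eventually.of_forall fun _ => by positivity)
      hTball.eventuallyLE).trans ?_
    rw [hNE, ← integral_const_mul]
    refine setIntegral_mono_on hgi (hEi.const_mul _) measurableSet_ball fun z _ => ?_
    rw [norm_real, Real.norm_eq_abs, sq_abs, div_pow, div_eq_mul_inv, ← inv_pow, mul_comm]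
    gcongr
  set K := (∫ ζ in ball 0 1, ‖H ζ‖ ^ 2) with hK
  have hK0 : 0 ≤ K := integral_nonneg fun _ => by positivity
  have hKN : r ^ 2 * K ≤ m ^ 5 * Nh := by
    calc r ^ 2 * K ≤ m ^ 3 * D * K := by gcongr
      _ = m ^ 3 * (D * K) := by ring
      _ ≤ m ^ 3 * (m ^ 2 * Nh) := by gcongr
      _ = _ := by ring
  set Lc : ℂ →L[ℝ] ℂ := M.comp ((ContinuousLinearMap.mul ℝ ℂ d).comp A') with hLc
  have hL : ∀ w, Lc w = M (d * A' w) := fun w => rfl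
  have hLn : ‖Lc‖ ≤ m * (‖d‖ * (m ^ 2 / r)) := by
    refine ContinuousLinearMap.opNorm_le_bound _ (by positivity) fun w => ?_
    rw [hL]
    refine (hMn _).trans ?_
    rw [norm_mul, mul_assoc, mul_assoc]
    gcongr
    exact hA'n w
  have hc2 : r ^ 2 * ‖M c‖ ^ 2 ≤ 10 ^ 8 * m ^ 7 * Nh := by
    calc r ^ 2 * ‖M c‖ ^ 2 ≤ r ^ 2 * (m * ‖c‖) ^ 2 := by gcongr; exact hMn c
      _ = r ^ 2 * m ^ 2 * ‖c‖ ^ 2 := by ring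
      _ ≤ r ^ 2 * m ^ 2 * (10 ^ 8 * K) := by gcongr
      _ = 10 ^ 8 * m ^ 2 * (r ^ 2 * K) := by ring
      _ ≤ 10 ^ 8 * m ^ 2 * (m ^ 5 * Nh) := by gcongr
      _ = _ := by ring
  have hL2 : r ^ 4 * ‖Lc‖ ^ 2 ≤ 10 ^ 8 * m ^ 11 * Nh := by
    calc r ^ 4 * ‖Lc‖ ^ 2 ≤ r ^ 4 * (m * (‖d‖ * (m ^ 2 / r))) ^ 2 := by gcongr
      _ = r ^ 2 * m ^ 6 * ‖d‖ ^ 2 := by field_simp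
      _ ≤ r ^ 2 * m ^ 6 * (10 ^ 8 * K) := by gcongr
      _ = 10 ^ 8 * m ^ 6 * (r ^ 2 * K) := by ring
      _ ≤ 10 ^ 8 * m ^ 6 * (m ^ 5 * Nh) := by gcongr
      _ = _ := by ring
  have hpow : ∀ {i j : ℕ}, i ≤ j → m ^ i ≤ m ^ j := fun hij => pow_le_pow_right₀ hm hij
  refine ⟨M c, Lc, ?_, ?_, ?_, fun θ hθ hθ1 => ?_⟩
  · have e1 : A' 1 = ((ρ * b)⁻¹ : ℝ) := by apply Complex.ext <;> simp [hA']
    have e2 : A' I = (ρ⁻¹ : ℝ) * I := by apply Complex.ext <;> simp [hA']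
    constructor
    · rw [hL, hL, e1, e2]; simp [hM]; field_simp
    · rw [hL, hL, e1, e2]; simp [hM]; field_simp
  · refine hc2.trans ?_
    gcongr ?_ * Nh
    have := hpow (show 7 ≤ 23 by norm_num)
    nlinarith [pow_pos hm0 7]
  · refine hL2.trans ?_
    gcongr ?_ * Nh
    have := hpow (show 11 ≤ 23 by norm_num)
    nlinarith [pow_pos hm0 11]
  have hgc : ContinuousOn (fun z => ‖cpx u v z - M c - Lc (z - z₀)‖ ^ 2) (closedBall z₀ r) :=
    (((ContinuousOn.cpx hu hv).sub continuousOn_const).sub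
      (Lc.continuous.comp_continuousOn (continuousOn_id.sub continuousOn_const))).norm.pow 2
  -- The preimage under `T` of the ball of radius `θ r` lies in the disc of radius `m² θ`. If this
  -- exceeds `1`, then `θ` is bounded below and the bound is trivial.
  rcases le_or_gt (m ^ 2 * θ) 1 with hs | hs
  · have hsub : ball z₀ (θ * r) ⊆ T '' ball 0 (m ^ 2 * θ) := by
      intro z hz
      refine ⟨A' (z - z₀), ?_, hTA z⟩
      rw [mem_ball, dist_eq_norm] at hz
      rw [mem_ball_zero_iff]
      refine (hA'n _).trans_lt ?_
      calc m ^ 2 / r * ‖z - z₀‖ < m ^ 2 / r * (θ * r) := by gcongr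
        _ = _ := by field_simp
    have hsub2 : T '' ball 0 (m ^ 2 * θ) ⊆ ball z₀ r := by
      refine (Set.image_mono (ball_subset_ball hs)).trans hTball
    have h1 : ∫ z in ball z₀ (θ * r), ‖cpx u v z - M c - Lc (z - z₀)‖ ^ 2 ≤
        ∫ z in T '' ball 0 (m ^ 2 * θ), ‖cpx u v z - M c - Lc (z - z₀)‖ ^ 2 :=
      setIntegral_mono_set (hgc.integrableOn_ball.mono_set hsub2)
        (Eventually.of_forall fun _ => by positivity) hsub.eventuallyLE
    rw [hT, hcv _ measurableSet_ball] at h1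
    have h2 : ∫ ζ in ball 0 (m ^ 2 * θ), ‖cpx u v (z₀ + A ζ) - M c - Lc (z₀ + A ζ - z₀)‖ ^ 2 ≤
        ∫ ζ in ball 0 (m ^ 2 * θ), m ^ 2 * ‖H ζ - c - d * ζ‖ ^ 2 := by
      have hHc : ContinuousOn (fun ζ => ‖H ζ - c - d * ζ‖ ^ 2) (closedBall 0 1) :=
        (((ContinuousOn.cpx huT hvT').sub continuousOn_const).sub
          (continuousOn_const.mul continuousOn_id)).norm.pow 2
      refine setIntegral_mono_on ((hgc.comp hTcont hTc).integrableOn_ball.mono_set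
        (ball_subset_ball hs)) ((hHc.integrableOn_ball.mono_set (ball_subset_ball hs)).const_mul _)
        measurableSet_ball fun ζ _ => ?_
      have e3 : cpx u v (z₀ + A ζ) - M c - Lc (z₀ + A ζ - z₀) = M (H ζ - c - d * ζ) := by
        rw [hL, hA'T ζ, map_sub, map_sub]
        congr 2
        apply Complex.ext <;> simp [hM, hH, cpx, hT]
        field_simp
      rw [e3, ← mul_pow]
      gcongr
      exact hMn _
    rw [integral_const_mul] at h2
    have h3 := hcd (m ^ 2 * θ) (by positivity) hs
    calc _ ≤ _ := h1
      _ ≤ D * (m ^ 2 * (10 ^ 8 * ((m ^ 2 * θ) ^ 6 * K +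
            ∫ ζ in ball 0 1, ‖((E (T ζ) / b : ℝ) : ℂ)‖ ^ 2))) := by
          refine mul_le_mul_of_nonneg_left (h2.trans ?_) hD0.le
          gcongr
      _ = 10 ^ 8 * m ^ 2 * (m ^ 12 * θ ^ 6 * (D * K) +
            D * ∫ ζ in ball 0 1, ‖((E (T ζ) / b : ℝ) : ℂ)‖ ^ 2) := by ring
      _ ≤ 10 ^ 8 * m ^ 2 * (m ^ 12 * θ ^ 6 * (m ^ 2 * Nh) + m ^ 12 * (m ^ 2 * NE)) := by
          refine mul_le_mul_of_nonneg_left (add_le_add (by gcongr) (hEN.trans ?_)) (by positivity)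
          exact le_mul_of_one_le_left (by positivity) (one_le_pow₀ hm)
      _ = 10 ^ 8 * m ^ 16 * (θ ^ 6 * Nh + NE) := by ring
      _ ≤ _ := by
          gcongr ?_ * _
          have := hpow (show 16 ≤ 23 by norm_num)
          nlinarith [pow_pos hm0 16]
  · have hsub : ball z₀ (θ * r) ⊆ ball z₀ r := ball_subset_ball (by nlinarith)
    have h1 : ∫ z in ball z₀ (θ * r), ‖cpx u v z - M c - Lc (z - z₀)‖ ^ 2 ≤
        ∫ z in ball z₀ r, ‖cpx u v z - M c - Lc (z - z₀)‖ ^ 2 :=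
      setIntegral_mono_set hgc.integrableOn_ball (Eventually.of_forall fun _ => by positivity)
        hsub.eventuallyLE
    have h2 : ∫ z in ball z₀ r, ‖cpx u v z - M c - Lc (z - z₀)‖ ^ 2 ≤
        ∫ z in ball z₀ r, (3 * ‖cpx u v z‖ ^ 2 + 3 * (‖M c‖ ^ 2 + ‖Lc‖ ^ 2 * r ^ 2)) := by
      refine setIntegral_mono_on hgc.integrableOn_ball
        ((hhi.const_mul 3).add (integrable_const _)) measurableSet_ball fun z hz => ?_
      refine (norm_sub_sub_sq_le _ _ _).trans ?_
      rw [mem_ball, dist_eq_norm] at hz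
      have h3 : ‖Lc (z - z₀)‖ ^ 2 ≤ ‖Lc‖ ^ 2 * r ^ 2 := by
        rw [← mul_pow]
        gcongr
        exact (Lc.le_opNorm _).trans (by gcongr)
      linarith
    rw [integral_add (hhi.const_mul 3) (integrable_const _), setIntegral_const,
      measureReal_ball _ hr.le, integral_const_mul, smul_eq_mul] at h2
    have hp := Real.pi_pos
    have hp4 := Real.pi_lt_d2
    have h3 : 1 ≤ m ^ 12 * θ ^ 6 := by
      have : 1 ≤ (m ^ 2 * θ) ^ 6 := one_le_pow₀ hs.le
      calc 1 ≤ _ := this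
        _ = _ := by ring
    have h4 : Real.pi * r ^ 2 * (3 * (‖M c‖ ^ 2 + ‖Lc‖ ^ 2 * r ^ 2)) =
        3 * Real.pi * (r ^ 2 * ‖M c‖ ^ 2 + r ^ 4 * ‖Lc‖ ^ 2) := by ring
    have h5 : r ^ 2 * ‖M c‖ ^ 2 + r ^ 4 * ‖Lc‖ ^ 2 ≤ 2 * 10 ^ 8 * m ^ 11 * Nh := by
      have : m ^ 7 * Nh ≤ m ^ 11 * Nh := by gcongr ?_ * Nh; exact hpow (by norm_num)
      linarith
    have h6 : 3 * Real.pi * (r ^ 2 * ‖M c‖ ^ 2 + r ^ 4 * ‖Lc‖ ^ 2) ≤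
        3 * 4 * (2 * 10 ^ 8 * m ^ 11 * Nh) := by
      gcongr; linarith
    have h7 : Nh ≤ m ^ 11 * Nh := le_mul_of_one_le_left hNh0 (one_le_pow₀ hm)
    have h8 : 0 ≤ m ^ 11 * Nh := by positivity
    calc _ ≤ 10 ^ 10 * (m ^ 11 * Nh) := by linarith
      _ ≤ 10 ^ 10 * (m ^ 11 * Nh) * (m ^ 12 * θ ^ 6) := le_mul_of_one_le_right (by positivity) h3
      _ = 10 ^ 10 * m ^ 23 * (θ ^ 6 * Nh) := by ring
      _ ≤ _ := by gcongr; linarith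

end SLTorus

namespace SLTorus
open MeasureTheory Metric Filter Topology Complex

/-! ### The Campanato lemma -/

/-- Dependent choice with a relation `Q` between consecutive terms. -/
theorem exists_seq_of_step {α : Type*} {P : ℕ → α → Prop} {Q : ℕ → α → α → Prop}
    (h0 : ∃ a, P 0 a) (hs : ∀ n a, P n a → ∃ b, P (n + 1) b ∧ Q n a b) :
    ∃ f : ℕ → α, ∀ n, P n (f n) ∧ Q n (f n) (f (n + 1)) := by
  choose! g hg using hs
  obtain ⟨a, ha⟩ := h0
  let f : ℕ → α := fun n => Nat.rec a (fun n x => g n x) n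
  have hf : ∀ n, P n (f n) := by
    intro n
    induction n with
    | zero => exact ha
    | succ n ih => exact (hg n _ ih).1
  exact ⟨f, fun n => ⟨hf n, (hg n _ (hf n)).2⟩⟩

/-- The value of an affine function at the centre of a ball is controlled by its `L²` norm on the ball:
by the parallelogram law the linear part only increases the norm. -/
theorem norm_sq_mul_le_integral {c : ℂ} {L : ℂ →L[ℝ] ℂ} {z : ℂ} {d : ℝ} (hd : 0 < d) :
    ‖c‖ ^ 2 * (Real.pi * d ^ 2) ≤ ∫ w in ball z d, ‖c + L (w - z)‖ ^ 2 := by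
  have hc : Continuous fun w => ‖c + L w‖ ^ 2 := by fun_prop
  have h1 : ∫ w in ball z d, ‖c + L (w - z)‖ ^ 2 = ∫ w in ball 0 d, ‖c + L w‖ ^ 2 := by
    rw [← integral_indicator measurableSet_ball, ← integral_indicator measurableSet_ball,
      ← integral_sub_right_eq_self (fun w => (ball (0 : ℂ) d).indicator (fun w => ‖c + L w‖ ^ 2) w) z]
    refine integral_congr_ae (Eventually.of_forall fun w => ?_)
    simp only [Set.indicator, mem_ball, dist_eq_norm, sub_zero]
  have h2 : ∫ w in ball 0 d, ‖c + L w‖ ^ 2 = ∫ w in ball 0 d, ‖c - L w‖ ^ 2 := by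
    rw [← integral_indicator measurableSet_ball, ← integral_indicator measurableSet_ball,
      ← integral_neg_eq_self]
    refine integral_congr_ae (Eventually.of_forall fun w => ?_)
    simp only [Set.indicator, mem_ball_zero_iff, norm_neg, map_neg, sub_eq_add_neg]
  have hi1 : IntegrableOn (fun w => ‖c + L w‖ ^ 2) (ball 0 d) := hc.continuousOn.integrableOn_ball
  have hi2 : IntegrableOn (fun w => ‖c - L w‖ ^ 2) (ball 0 d) :=
    (show Continuous fun w => ‖c - L w‖ ^ 2 by fun_prop).continuousOn.integrableOn_ball
  have h3 : 2 * (‖c‖ ^ 2 * (Real.pi * d ^ 2)) ≤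
      ∫ w in ball 0 d, (‖c + L w‖ ^ 2 + ‖c - L w‖ ^ 2) := by
    have : ∫ w in ball (0 : ℂ) d, 2 * ‖c‖ ^ 2 = 2 * (‖c‖ ^ 2 * (Real.pi * d ^ 2)) := by
      rw [setIntegral_const, measureReal_ball _ hd.le, smul_eq_mul]; ring
    rw [← this]
    refine setIntegral_mono_on (integrable_const _) (hi1.add hi2) measurableSet_ball fun w _ => ?_
    have := parallelogram_law_with_norm ℝ c (L w)
    nlinarith [sq_nonneg ‖L w‖]
  rw [integral_add hi1 hi2, ← h2] at h3
  rw [h1]; linarith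

theorem integral_norm_sub_sq_le {f g : ℂ → ℂ} {z : ℂ} {d : ℝ}
    (hf : ContinuousOn f (closedBall z d)) (hg : ContinuousOn g (closedBall z d)) :
    ∫ w in ball z d, ‖f w - g w‖ ^ 2 ≤
      2 * (∫ w in ball z d, ‖f w‖ ^ 2) + 2 * ∫ w in ball z d, ‖g w‖ ^ 2 := by
  have h1 : IntegrableOn (fun w => ‖f w‖ ^ 2) (ball z d) := (hf.norm.pow 2).integrableOn_ball
  have h2 : IntegrableOn (fun w => ‖g w‖ ^ 2) (ball z d) := (hg.norm.pow 2).integrableOn_ball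
  rw [← integral_const_mul, ← integral_const_mul, ← integral_add (h1.const_mul 2) (h2.const_mul 2)]
  refine setIntegral_mono_on ((hf.sub hg).norm.pow 2).integrableOn_ball
    ((h1.const_mul 2).add (h2.const_mul 2)) measurableSet_ball fun w _ => ?_
  have := norm_add_sq_le (f w) (-g w)
  rwa [norm_neg, ← sub_eq_add_neg] at this

/-- Comparison of the expansions at two centres: an `L²` approximation of order `s` at every point
is an approximation of order `s` in the supremum norm. -/
theorem norm_sub_le_of_integral_le {h : ℂ → ℂ} {L : ℂ → ℂ →L[ℝ] ℂ} {K s r₀ : ℝ} (hK : 0 ≤ K)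
    {z z' : ℂ}
    (hc : ContinuousOn h (closedBall z r₀)) (hs : 0 ≤ s)
    (h1 : ∀ ρ, 0 < ρ → ρ ≤ r₀ →
      ∫ w in ball z ρ, ‖h w - h z - L z (w - z)‖ ^ 2 ≤ K * (ρ * ρ ^ s) ^ 2)
    (h2 : ∀ ρ, 0 < ρ → ρ ≤ r₀ →
      ∫ w in ball z' ρ, ‖h w - h z' - L z' (w - z')‖ ^ 2 ≤ K * (ρ * ρ ^ s) ^ 2)
    (hzz : 2 * ‖z' - z‖ ≤ r₀) :
    ‖h z' - h z - L z (z' - z)‖ ≤ 2 * Real.sqrt K * 2 ^ (1 + s) * ‖z' - z‖ ^ s := by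
  set d := ‖z' - z‖ with hd
  rcases (norm_nonneg (z' - z)).eq_or_lt with h0 | h0
  · have : z' = z := by rw [← sub_eq_zero, ← norm_eq_zero]; exact h0.symm
    subst this
    simp only [sub_self, map_zero, norm_zero]
    positivity
  rw [← hd] at h0
  have hsub : ball z' d ⊆ ball z (2 * d) := by
    intro w hw
    rw [mem_ball, dist_eq_norm] at hw ⊢
    have := norm_add_le (w - z') (z' - z)
    rw [sub_add_sub_cancel] at this
    linarith
  have hcb : closedBall z' d ⊆ closedBall z r₀ := by
    intro w hw
    rw [mem_closedBall, dist_eq_norm] at hw ⊢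
    have := norm_add_le (w - z') (z' - z)
    rw [sub_add_sub_cancel] at this
    linarith
  have hf : ∀ x, ContinuousOn (fun w => h w - h x - L x (w - x)) (closedBall z r₀) := fun x =>
    (hc.sub continuousOn_const).sub
      ((L x).continuous.comp_continuousOn (continuousOn_id.sub continuousOn_const))
  -- The difference of the two expansions is an affine function whose value at `z'` is the quantity to
  -- be bounded; on the ball of radius `d` about `z'` both expansions are close to `h`.
  have k1 := norm_sq_mul_le_integral (c := h z' - h z - L z (z' - z)) (L := L z' - L z) (z := z') h0
  have k2 := integral_norm_sub_sq_le ((hf z).mono hcb) ((hf z').mono hcb)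
  have k3 : ∫ w in ball z' d, ‖h w - h z - L z (w - z)‖ ^ 2 ≤ K * (2 * d * (2 * d) ^ s) ^ 2 := by
    refine le_trans ?_ (h1 (2 * d) (by positivity) hzz)
    exact setIntegral_mono_set (((hf z).mono (closedBall_subset_closedBall hzz)).norm.pow 2).integrableOn_ball
      (Eventually.of_forall fun _ => by positivity) hsub.eventuallyLE
  have k4 := h2 d h0 (by linarith)
  have e : ∀ w, (h z' - h z - L z (z' - z)) + (L z' - L z) (w - z') =
      (h w - h z - L z (w - z)) - (h w - h z' - L z' (w - z')) := by
    intro w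
    rw [sub_apply, show w - z = (w - z') + (z' - z) by ring, map_add]; ring
  simp_rw [e] at k1
  have hp := Real.pi_gt_three
  have k5 : d * d ^ s ≤ 2 * d * (2 * d) ^ s := by
    gcongr <;> linarith
  have k6 : (d * d ^ s) ^ 2 ≤ (2 * d * (2 * d) ^ s) ^ 2 := by gcongr
  have k7 : K * (d * d ^ s) ^ 2 ≤ K * (2 * d * (2 * d) ^ s) ^ 2 := by gcongr
  have e2 : 2 * d * (2 * d) ^ s = 2 ^ (1 + s) * d ^ s * d := by
    rw [Real.mul_rpow (by norm_num) h0.le, Real.rpow_add (by norm_num), Real.rpow_one]; ring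
  rw [← sq_le_sq₀ (norm_nonneg _) (by positivity)]
  set X := ‖h z' - h z - L z (z' - z)‖ ^ 2
  have k8 : X * (3 * d ^ 2) ≤ 4 * K * (2 ^ (1 + s) * d ^ s) ^ 2 * d ^ 2 := by
    have : X * (3 * d ^ 2) ≤ X * (Real.pi * d ^ 2) := by gcongr
    rw [e2] at k3 k7
    have hX : X * (Real.pi * d ^ 2) ≤ 2 * (K * (2 ^ (1 + s) * d ^ s * d) ^ 2) +
        2 * (K * (2 ^ (1 + s) * d ^ s * d) ^ 2) := by linarith
    calc X * (3 * d ^ 2) ≤ _ := this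
      _ ≤ _ := hX
      _ = _ := by ring
  have k9 : X * 3 ≤ 4 * K * (2 ^ (1 + s) * d ^ s) ^ 2 := by
    have : 0 < d ^ 2 := by positivity
    nlinarith
  have k10 : (2 * Real.sqrt K * 2 ^ (1 + s) * d ^ s) ^ 2 = 4 * K * (2 ^ (1 + s) * d ^ s) ^ 2 := by
    rw [show (2 * Real.sqrt K * 2 ^ (1 + s) * d ^ s) ^ 2 =
      4 * (Real.sqrt K) ^ 2 * (2 ^ (1 + s) * d ^ s) ^ 2 by ring, Real.sq_sqrt hK]
  rw [k10]
  have : 0 ≤ X := by positivity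
  linarith

/-- Summation of the Campanato iteration at one centre. -/
theorem campanato_limit {h : ℂ → ℂ} {z : ℂ} {r₀ θ s K K₁ : ℝ} (hr : 0 < r₀) (hθ : 0 < θ) (hθ1 : θ < 1)
    (hs : 0 < s) (hK : 0 ≤ K) (hK1 : 0 ≤ K₁) (hc : ContinuousOn h (closedBall z r₀))
    {c : ℕ → ℂ} {L : ℕ → ℂ →L[ℝ] ℂ} {L' : ℂ →L[ℝ] ℂ}
    (h1 : ∀ j, ∫ w in ball z (θ ^ j * r₀), ‖h w - c j - L j (w - z)‖ ^ 2 ≤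
      K * (θ ^ j * r₀ * (θ ^ j * r₀) ^ s) ^ 2)
    (h2 : ∀ j, ‖c j - c (j + 1)‖ ≤ K₁ * (θ ^ j * r₀) ^ s)
    (h3 : ∀ j, ‖L j - L'‖ * (θ ^ j * r₀) ≤ K₁ * (θ ^ j * r₀) ^ s) :
    ∀ ρ, 0 < ρ → ρ ≤ r₀ → ∫ w in ball z ρ, ‖h w - h z - L' (w - z)‖ ^ 2 ≤
      (3 * K + 12 * (K₁ / (1 - θ ^ s)) ^ 2 + 12 * K₁ ^ 2) / (θ * θ ^ s) ^ 2 * (ρ * ρ ^ s) ^ 2 := by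
  have hτ0 : 0 < θ ^ s := by positivity
  have hτ1 : θ ^ s < 1 := Real.rpow_lt_one hθ.le hθ1 hs
  have hρpos : ∀ j : ℕ, 0 < θ ^ j * r₀ := fun j => by positivity
  have hρs : ∀ j : ℕ, (θ ^ j * r₀) ^ s = r₀ ^ s * (θ ^ s) ^ j := by
    intro j
    rw [Real.mul_rpow (by positivity) hr.le, mul_comm, ← Real.rpow_natCast, ← Real.rpow_natCast,
      ← Real.rpow_mul hθ.le, ← Real.rpow_mul hθ.le, mul_comm s]
  have hρr : ∀ j : ℕ, θ ^ j * r₀ ≤ r₀ := fun j =>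
    mul_le_of_le_one_left hr.le (pow_le_one₀ hθ.le hθ1.le)
  have hd : ∀ j, dist (c j) (c (j + 1)) ≤ K₁ * r₀ ^ s * (θ ^ s) ^ j := fun j => by
    rw [dist_eq_norm, mul_assoc, ← hρs]; exact h2 j
  obtain ⟨c', hc'⟩ := cauchySeq_tendsto_of_complete (cauchySeq_of_le_geometric _ _ hτ1 hd)
  have hcc : ∀ j, ‖c j - c'‖ ≤ K₁ / (1 - θ ^ s) * (θ ^ j * r₀) ^ s := fun j => by
    have := dist_le_of_le_geometric_of_tendsto _ _ hτ1 hd hc' j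
    rw [dist_eq_norm] at this
    refine this.trans (le_of_eq ?_)
    rw [hρs]; ring
  set A := K₁ / (1 - θ ^ s) with hA
  have hA0 : 0 ≤ A := div_nonneg hK1 (by linarith)
  have hp := Real.pi_pos
  have hp4 := Real.pi_lt_d2
  have hcont : ∀ (a : ℂ) (M : ℂ →L[ℝ] ℂ), ContinuousOn (fun w => h w - a - M (w - z)) (closedBall z r₀) :=
    fun a M => (hc.sub continuousOn_const).sub
      (M.continuous.comp_continuousOn (continuousOn_id.sub continuousOn_const))
  have hlim0 : Tendsto (fun j : ℕ => (θ ^ j * r₀) ^ s) atTop (𝓝 0) := by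
    simp_rw [hρs]
    simpa using (tendsto_pow_atTop_nhds_zero_of_lt_one hτ0.le hτ1).const_mul (r₀ ^ s)
  -- Replacing `L j` by its limit, and `c j` by any constant.
  have hbig : ∀ j (e : ℂ), ∫ w in ball z (θ ^ j * r₀), ‖h w - e - L' (w - z)‖ ^ 2 ≤
      (3 * K + 12 * K₁ ^ 2) * (θ ^ j * r₀ * (θ ^ j * r₀) ^ s) ^ 2 +
        12 * ‖e - c j‖ ^ 2 * (θ ^ j * r₀) ^ 2 := by
    intro j e
    set ρ := θ ^ j * r₀ with hρ
    have hi1 : IntegrableOn (fun w => ‖h w - c j - L j (w - z)‖ ^ 2) (ball z ρ) :=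
      (((hcont _ _).mono (closedBall_subset_closedBall (hρr j))).norm.pow 2).integrableOn_ball
    have hi2 : IntegrableOn (fun w => ‖h w - e - L' (w - z)‖ ^ 2) (ball z ρ) :=
      (((hcont _ _).mono (closedBall_subset_closedBall (hρr j))).norm.pow 2).integrableOn_ball
    have h4 : ∫ w in ball z ρ, ‖h w - e - L' (w - z)‖ ^ 2 ≤
        ∫ w in ball z ρ, (3 * ‖h w - c j - L j (w - z)‖ ^ 2 +
          3 * (‖e - c j‖ ^ 2 + (K₁ * ρ ^ s) ^ 2)) := by
      refine setIntegral_mono_on hi2 ((hi1.const_mul 3).add (integrable_const _))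
        measurableSet_ball fun w hw => ?_
      rw [mem_ball, dist_eq_norm] at hw
      have e1 : h w - e - L' (w - z) =
          (h w - c j - L j (w - z)) - (e - c j) - (L' - L j) (w - z) := by
        rw [sub_apply]; ring
      rw [e1]
      refine (norm_sub_sub_sq_le _ _ _).trans ?_
      have h5 : ‖(L' - L j) (w - z)‖ ≤ K₁ * ρ ^ s := by
        refine ((L' - L j).le_opNorm _).trans ?_
        rw [norm_sub_rev]
        exact le_trans (by gcongr) (h3 j)
      have h6 : ‖(L' - L j) (w - z)‖ ^ 2 ≤ (K₁ * ρ ^ s) ^ 2 := by gcongr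
      linarith
    rw [integral_add (hi1.const_mul 3) (integrable_const _), integral_const_mul, setIntegral_const,
      measureReal_ball _ (hρpos j).le, smul_eq_mul] at h4
    have h5 := h1 j
    have h6 : Real.pi * ρ ^ 2 * (3 * (‖e - c j‖ ^ 2 + (K₁ * ρ ^ s) ^ 2)) ≤
        4 * ρ ^ 2 * (3 * (‖e - c j‖ ^ 2 + (K₁ * ρ ^ s) ^ 2)) := by gcongr; linarith
    nlinarith
  -- The averages of `h` over the shrinking balls tend both to `c'` and, by continuity, to `h z`.
  have hch : h z = c' := by
    have hsmall : Tendsto (fun j => (6 * ((3 * K + 12 * K₁ ^ 2) * ((θ ^ j * r₀) ^ s) ^ 2 +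
        12 * ‖c' - c j‖ ^ 2))) atTop (𝓝 0) := by
      have l1 := (hlim0.pow 2).const_mul (3 * K + 12 * K₁ ^ 2)
      have l2 := ((tendsto_const_nhds (x := c')).sub hc').norm.pow 2 |>.const_mul 12
      have := (l1.add l2).const_mul 6
      simpa using this
    by_contra hne
    have hpos : 0 < ‖h z - c'‖ ^ 2 := by
      have := norm_pos_iff.2 (sub_ne_zero.2 hne); positivity
    have hcz : ContinuousAt (fun w => ‖h w - h z - L' (w - z)‖ ^ 2) z :=
      ((hcont (h z) L').continuousAt (closedBall_mem_nhds z hr)).norm.pow 2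
    have hcz2 : ∀ᶠ w in 𝓝 z, ‖h w - h z - L' (w - z)‖ ^ 2 < ‖h z - c'‖ ^ 2 / 12 := by
      refine hcz.eventually (gt_mem_nhds ?_)
      simp; positivity
    obtain ⟨δ, hδ, hδ2⟩ := Metric.eventually_nhds_iff_ball.1 hcz2
    have hρ0 : Tendsto (fun j : ℕ => θ ^ j * r₀) atTop (𝓝 0) := by
      simpa using (tendsto_pow_atTop_nhds_zero_of_lt_one hθ.le hθ1).mul_const r₀
    obtain ⟨j, hj1, hj2⟩ := ((hρ0.eventually (gt_mem_nhds hδ)).and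
      (hsmall.eventually (gt_mem_nhds (show 0 < ‖h z - c'‖ ^ 2 by positivity)))).exists
    set ρ := θ ^ j * r₀ with hρ
    have hρ0 := hρpos j
    have k1 := norm_sq_mul_le_integral (c := h z - c') (L := 0) (z := z) hρ0
    have e : ∀ w, (h z - c') + (0 : ℂ →L[ℝ] ℂ) (w - z) =
      (h w - c' - L' (w - z)) - (h w - h z - L' (w - z)) := by intro w; simp
    simp_rw [e] at k1
    have hsubc : closedBall z ρ ⊆ closedBall z r₀ := closedBall_subset_closedBall (hρr j)
    have k2 := integral_norm_sub_sq_le ((hcont c' L').mono hsubc) ((hcont (h z) L').mono hsubc)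
    have k3 := hbig j c'
    have k4 : ∫ w in ball z ρ, ‖h w - h z - L' (w - z)‖ ^ 2 ≤
        Real.pi * ρ ^ 2 * (‖h z - c'‖ ^ 2 / 12) := by
      have : ∫ w in ball z ρ, ‖h w - h z - L' (w - z)‖ ^ 2 ≤
          ∫ w in ball z ρ, ‖h z - c'‖ ^ 2 / 12 := by
        refine setIntegral_mono_on (((hcont _ _).mono hsubc).norm.pow 2).integrableOn_ball
          (integrable_const _) measurableSet_ball fun w hw => ?_
        exact (hδ2 w (ball_subset_ball hj1.le hw)).le
      rwa [setIntegral_const, measureReal_ball _ hρ0.le, smul_eq_mul] at this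
    have hp3 := Real.pi_gt_three
    have hρ2 : 0 < ρ ^ 2 := by positivity
    have k5 : ‖h z - c'‖ ^ 2 * (Real.pi * ρ ^ 2) ≤
        (2 * ((3 * K + 12 * K₁ ^ 2) * (ρ ^ s) ^ 2 + 12 * ‖c' - c j‖ ^ 2) +
          2 * Real.pi * (‖h z - c'‖ ^ 2 / 12)) * ρ ^ 2 := by nlinarith
    have k6 : ‖h z - c'‖ ^ 2 * Real.pi ≤
        2 * ((3 * K + 12 * K₁ ^ 2) * (ρ ^ s) ^ 2 + 12 * ‖c' - c j‖ ^ 2) +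
          2 * Real.pi * (‖h z - c'‖ ^ 2 / 12) := by
      refine le_of_mul_le_mul_right ?_ hρ2
      rwa [mul_assoc]
    nlinarith
  intro ρ hρ hρr0
  -- Between consecutive radii `θ ^ (j + 1) r₀ < ρ ≤ θ ^ j r₀` the bound changes by a constant factor.
  obtain ⟨j, hj1, hj2⟩ := exists_nat_pow_near_of_lt_one (x := ρ / r₀) (by positivity)
    ((div_le_one hr).2 hρr0) hθ hθ1
  rw [lt_div_iff₀ hr] at hj1
  rw [div_le_iff₀ hr] at hj2
  have k1 := hbig j (h z)
  have k2 : ‖h z - c j‖ ^ 2 ≤ (A * (θ ^ j * r₀) ^ s) ^ 2 := by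
    rw [hch, norm_sub_rev]; gcongr; exact hcc j
  have k3 : ∫ w in ball z ρ, ‖h w - h z - L' (w - z)‖ ^ 2 ≤
      ∫ w in ball z (θ ^ j * r₀), ‖h w - h z - L' (w - z)‖ ^ 2 :=
    setIntegral_mono_set (((hcont _ _).mono (closedBall_subset_closedBall (hρr j))).norm.pow 2).integrableOn_ball
      (Eventually.of_forall fun _ => by positivity) (ball_subset_ball hj2).eventuallyLE
  have k4 : θ ^ j * r₀ ≤ ρ / θ := by
    rw [le_div_iff₀ hθ]; rw [pow_succ] at hj1; linarith
  have k5 : θ ^ j * r₀ * (θ ^ j * r₀) ^ s ≤ (ρ * ρ ^ s) / (θ * θ ^ s) := by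
    calc θ ^ j * r₀ * (θ ^ j * r₀) ^ s ≤ ρ / θ * (ρ / θ) ^ s := by gcongr
      _ = _ := by rw [Real.div_rpow hρ.le hθ.le, div_mul_div_comm]
  calc _ ≤ _ := k3
    _ ≤ _ := k1
    _ ≤ (3 * K + 12 * K₁ ^ 2) * (θ ^ j * r₀ * (θ ^ j * r₀) ^ s) ^ 2 +
        12 * (A * (θ ^ j * r₀) ^ s) ^ 2 * (θ ^ j * r₀) ^ 2 := by gcongr
    _ = (3 * K + 12 * A ^ 2 + 12 * K₁ ^ 2) * (θ ^ j * r₀ * (θ ^ j * r₀) ^ s) ^ 2 := by ring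
    _ ≤ (3 * K + 12 * A ^ 2 + 12 * K₁ ^ 2) * ((ρ * ρ ^ s) / (θ * θ ^ s)) ^ 2 := by gcongr
    _ = _ := by rw [div_pow]; ring

end SLTorus

namespace SLTorus
open MeasureTheory Metric Filter Topology Complex

/-! ### Subtracting affine solutions -/

theorem IsTest.integral_affine_mul_fderiv {O : Set ℂ} {η : ℂ → ℝ} (h : IsTest O η) (κ : ℝ)
    (A : ℂ →L[ℝ] ℝ) (z₀ v : ℂ) :
    ∫ z, (κ + A (z - z₀)) * fderiv ℝ η z v = -(A v * ∫ z, η z) := by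
  have hd : ∀ z, HasFDerivAt (fun z => κ + A (z - z₀)) A z := fun z =>
    ((A.hasFDerivAt (x := z - z₀)).comp z ((hasFDerivAt_id z).sub_const z₀)).const_add κ
  have hc : Continuous fun z => κ + A (z - z₀) := by fun_prop
  rw [integral_mul_fderiv_eq_neg_fderiv_mul_of_integrable ?_ ?_ ?_
    (fun z _ => (hd z).differentiableAt) (fun z _ => h.differentiable z)]
  · simp_rw [(hd _).fderiv]
    rw [integral_const_mul]
  · simp_rw [(hd _).fderiv]
    exact h.integrable.const_mul _
  · exact (hc.mul (h.fderiv_apply v).continuous).integrable_of_hasCompactSupport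
      (h.fderiv_apply v).hasCompactSupport.mul_left
  · exact (hc.mul h.continuous).integrable_of_hasCompactSupport h.hasCompactSupport.mul_left

/-- An affine solution may be subtracted from a weak solution. -/
theorem IsWeakSol.sub_affine {O : Set ℂ} (hO : IsOpen O) {u v B : ℂ → ℝ} (h : IsWeakSol O u v B)
    (hu : ContinuousOn u O) (hv : ContinuousOn v O) (hB : ContinuousOn B O) (z₀ : ℂ) (κ₁ κ₂ κ₃ : ℝ)
    {A₁ A₂ A₃ : ℂ →L[ℝ] ℝ} (h12 : A₁ 1 = A₂ I) (h31 : A₃ 1 = -A₁ I) :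
    IsWeakSol O (fun z => u z - (κ₁ + A₁ (z - z₀))) (fun z => v z - (κ₂ + A₂ (z - z₀)))
      (fun z => B z - (κ₃ + A₃ (z - z₀))) := by
  intro η hη
  have i : ∀ (κ : ℝ) (A : ℂ →L[ℝ] ℝ) (w : ℂ), Integrable fun z => (κ + A (z - z₀)) * fderiv ℝ η z w :=
    fun κ A w => (hη.fderiv_apply w).integrable_mul hO (by fun_prop)
  have iu := fun w => (hη.fderiv_apply w).integrable_mul hO hu
  have iv := fun w => (hη.fderiv_apply w).integrable_mul hO hv
  have iB := fun w => (hη.fderiv_apply w).integrable_mul hO hB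
  have k := hη.integral_affine_mul_fderiv
  constructor
  · have e : ∀ z, (u z - (κ₁ + A₁ (z - z₀))) * fderiv ℝ η z 1 -
        (v z - (κ₂ + A₂ (z - z₀))) * fderiv ℝ η z I =
        (u z * fderiv ℝ η z 1 - v z * fderiv ℝ η z I) -
          ((κ₁ + A₁ (z - z₀)) * fderiv ℝ η z 1 - (κ₂ + A₂ (z - z₀)) * fderiv ℝ η z I) := by
      intro z; ring
    simp_rw [e]
    have j1 : Integrable fun z => u z * fderiv ℝ η z 1 - v z * fderiv ℝ η z I := (iu 1).sub (iv I)
    have j2 : Integrable fun z => (κ₁ + A₁ (z - z₀)) * fderiv ℝ η z 1 -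
        (κ₂ + A₂ (z - z₀)) * fderiv ℝ η z I := (i _ _ _).sub (i _ _ _)
    rw [integral_sub j1 j2, integral_sub (i _ _ _) (i _ _ _), (h η hη).1, k, k, h12]; ring
  · have e : ∀ z, (B z - (κ₃ + A₃ (z - z₀))) * fderiv ℝ η z 1 +
        (u z - (κ₁ + A₁ (z - z₀))) * fderiv ℝ η z I =
        (B z * fderiv ℝ η z 1 + u z * fderiv ℝ η z I) -
          ((κ₃ + A₃ (z - z₀)) * fderiv ℝ η z 1 + (κ₁ + A₁ (z - z₀)) * fderiv ℝ η z I) := by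
      intro z; ring
    simp_rw [e]
    have j1 : Integrable fun z => B z * fderiv ℝ η z 1 + u z * fderiv ℝ η z I := (iB 1).add (iu I)
    have j2 : Integrable fun z => (κ₃ + A₃ (z - z₀)) * fderiv ℝ η z 1 +
        (κ₁ + A₁ (z - z₀)) * fderiv ℝ η z I := (i _ _ _).add (i _ _ _)
    rw [integral_sub j1 j2, integral_add (i _ _ _) (i _ _ _), (h η hη).2, k, k, h31]; ring

theorem IsWeakSol.mono {O O' : Set ℂ} (h : O' ⊆ O) {u v B : ℂ → ℝ} (hw : IsWeakSol O u v B) :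
    IsWeakSol O' u v B := fun η hη => hw η (hη.mono h)

/-- One step of the Campanato iteration for `B = b² v + β (z - z₀) + κ + E`, starting from an affine
approximation. -/
theorem exists_affine_step {m : ℝ} (hm : 1 ≤ m) : ∃ C : ℝ, 1 ≤ C ∧ ∀ b : ℝ, m⁻¹ ≤ b → b ≤ m →
    ∀ (z₀ : ℂ) (r : ℝ), 0 < r → ∀ u v B : ℂ → ℝ, ContinuousOn u (closedBall z₀ r) →
    ContinuousOn v (closedBall z₀ r) → ContinuousOn B (closedBall z₀ r) →
    IsWeakSol (ball z₀ r) u v B → ∀ (κ : ℝ) (β : ℂ →L[ℝ] ℝ) (c : ℂ) (L : ℂ →L[ℝ] ℂ),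
    IsLinSol (b ^ 2) L → ∃ (c' : ℂ) (L' : ℂ →L[ℝ] ℂ), IsLinSol (b ^ 2) L' ∧
      r ^ 2 * ‖c - c'‖ ^ 2 ≤
        C * ∫ z in ball z₀ r, ‖cpx u v z + (β 1 * (z - z₀).im : ℝ) - c - L (z - z₀)‖ ^ 2 ∧
      r ^ 4 * ‖L - L'‖ ^ 2 ≤
        C * ∫ z in ball z₀ r, ‖cpx u v z + (β 1 * (z - z₀).im : ℝ) - c - L (z - z₀)‖ ^ 2 ∧
      ∀ θ : ℝ, 0 < θ → θ ≤ 1 →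
        ∫ z in ball z₀ (θ * r), ‖cpx u v z + (β 1 * (z - z₀).im : ℝ) - c' - L' (z - z₀)‖ ^ 2 ≤
        C * (θ ^ 6 *
          (∫ z in ball z₀ r, ‖cpx u v z + (β 1 * (z - z₀).im : ℝ) - c - L (z - z₀)‖ ^ 2) +
          ∫ z in ball z₀ r, (B z - κ - b ^ 2 * v z - β (z - z₀)) ^ 2) := by
  obtain ⟨C, hC, hstep⟩ := exists_affine_decay hm
  refine ⟨C, hC, fun b hb1 hb2 z₀ r hr u v B hu hv hB hw κ β c L hL => ?_⟩
  -- Besides the solution `c + L (z - z₀)` the affine solution `(- β₁ Im (z - z₀), 0)` with `B`-part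
  -- `β (z - z₀)` is subtracted; this absorbs the term `β`.
  set u' : ℂ → ℝ := fun z => u z - (c.re + (reCLM.comp L - β 1 • imCLM) (z - z₀)) with hu'
  set v' : ℂ → ℝ := fun z => v z - (c.im + (imCLM.comp L) (z - z₀)) with hv'
  have hw' := hw.sub_affine isOpen_ball (hu.mono ball_subset_closedBall)
    (hv.mono ball_subset_closedBall) (hB.mono ball_subset_closedBall) z₀ c.re c.im
    (κ + b ^ 2 * c.im) (A₁ := reCLM.comp L - β 1 • imCLM) (A₂ := imCLM.comp L)
    (A₃ := β + b ^ 2 • imCLM.comp L) (by simpa using hL.1) (by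
      have := hL.2
      simp; linarith)
  have hBe : (fun z => B z - (κ + b ^ 2 * c.im + (β + b ^ 2 • imCLM.comp L) (z - z₀))) =
      fun z => b ^ 2 * v' z + (B z - κ - b ^ 2 * v z - β (z - z₀)) := by
    funext z
    simp [hv']; ring
  rw [hBe] at hw'
  have hg : ∀ z, cpx u' v' z = cpx u v z + (β 1 * (z - z₀).im : ℝ) - c - L (z - z₀) := by
    intro z
    apply Complex.ext <;> simp [cpx, hu', hv'] <;> ring
  obtain ⟨c1, L1, h1, h2, h3, h4⟩ := hstep b hb1 hb2 z₀ r hr u' v' _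
    (hu.sub (by fun_prop)) (hv.sub (by fun_prop))
    (((hB.sub continuousOn_const).sub (continuousOn_const.mul hv)).sub (by fun_prop)) hw'
  refine ⟨c + c1, L + L1, ⟨?_, ?_⟩, ?_, ?_, fun θ hθ hθ1 => ?_⟩
  · simp [hL.1, h1.1]
  · have e1 := hL.2
    have e2 := h1.2
    simp; linarith
  · simp_rw [← hg]; simpa using h2
  · simp_rw [← hg]; simpa using h3
  · have := h4 θ hθ hθ1
    simp_rw [← hg]
    refine le_trans (le_of_eq ?_) this
    refine integral_congr_ae (Eventually.of_forall fun z => ?_)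
    simp only
    rw [hg, add_apply]
    congr 2; ring

/-- A ratio for the Campanato iteration that beats the constant `C`. -/
theorem exists_rpow_small {δ : ℝ} (hδ : 0 < δ) (C : ℝ) : ∃ θ : ℝ, 0 < θ ∧ θ < 1 ∧ C * θ ^ δ ≤ 1 := by
  have h1 : Tendsto (fun θ : ℝ => C * θ ^ δ) (𝓝[>] 0) (𝓝 0) := by
    have := ((Real.continuousAt_rpow_const 0 δ (Or.inr hδ.le)).tendsto.const_mul C)
    rw [Real.zero_rpow hδ.ne', mul_zero] at this
    exact this.mono_left nhdsWithin_le_nhds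
  obtain ⟨θ, hθ, hθ1, hθ0⟩ := ((h1.eventually (gt_mem_nhds one_pos)).and
    ((eventually_nhdsWithin_of_eventually_nhds (gt_mem_nhds one_pos)).and
      self_mem_nhdsWithin)).exists
  exact ⟨θ, hθ0, hθ1, hθ.le⟩

/-- A point of the ball where `‖h - c‖²` is at most its mean value. -/
theorem exists_norm_sub_sq_mul_le {h : ℂ → ℂ} {z₀ : ℂ} {r : ℝ} (hr : 0 < r)
    (hh : ContinuousOn h (closedBall z₀ r)) (c : ℂ) :
    ∃ z ∈ ball z₀ r, ‖h z - c‖ ^ 2 * (Real.pi * r ^ 2) ≤ ∫ w in ball z₀ r, ‖h w - c‖ ^ 2 := by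
  have hi : IntegrableOn (fun w => ‖h w - c‖ ^ 2) (ball z₀ r) :=
    ((hh.sub continuousOn_const).norm.pow 2).integrableOn_ball
  obtain ⟨z, hz, h1⟩ := exists_le_setAverage (μ := volume)
    (measure_ball_pos _ _ hr).ne' measure_ball_lt_top.ne hi
  refine ⟨z, hz, ?_⟩
  rw [setAverage_eq, measureReal_ball _ hr.le, smul_eq_mul, ← div_eq_inv_mul,
    le_div_iff₀ (by positivity)] at h1
  exact h1

end SLTorus

namespace SLTorus
open MeasureTheory Metric Filter Topology Complex

/-! ### Hölder continuity of weak solutions -/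

/-- One step of the Campanato iteration with constants, when `B - b² v` is a small Lipschitz function
of `v` up to a Lipschitz function of `z`. The hypothesis `hstep` is the conclusion of
`exists_affine_step` on the given ball. -/
theorem holder_step {C b ε C₁ β θ K : ℝ} (hC : 1 ≤ C) (hβ : β ≤ 1) (hθ : 0 < θ) (hθ1 : θ < 1)
    (hθC : 40 * C * θ ^ 4 ≤ (θ * θ ^ β) ^ 2) (hε : 48 * C * ε ^ 2 ≤ (θ * θ ^ β) ^ 2)
    (hε0 : 0 ≤ ε) (hC₁ : 0 ≤ C₁)
    (hK : 400 * C * C₁ ^ 2 ≤ (θ * θ ^ β) ^ 2 * K)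
    {z₀ : ℂ} {r : ℝ} (hr : 0 < r) (hr1 : r ≤ 1) {u v B : ℂ → ℝ}
    (hu : ContinuousOn u (closedBall z₀ r)) (hv : ContinuousOn v (closedBall z₀ r))
    (hB : ContinuousOn B (closedBall z₀ r))
    (hBv : ∀ z ∈ closedBall z₀ r, ∀ z' ∈ closedBall z₀ r,
      |B z' - B z - b ^ 2 * (v z' - v z)| ≤ ε * |v z' - v z| + C₁ * ‖z' - z‖)
    (hstep : ∀ (κ : ℝ) (β : ℂ →L[ℝ] ℝ) (c : ℂ) (L : ℂ →L[ℝ] ℂ),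
      IsLinSol (b ^ 2) L → ∃ (c' : ℂ) (L' : ℂ →L[ℝ] ℂ), IsLinSol (b ^ 2) L' ∧
      r ^ 2 * ‖c - c'‖ ^ 2 ≤
        C * ∫ z in ball z₀ r, ‖cpx u v z + (β 1 * (z - z₀).im : ℝ) - c - L (z - z₀)‖ ^ 2 ∧
      r ^ 4 * ‖L - L'‖ ^ 2 ≤
        C * ∫ z in ball z₀ r, ‖cpx u v z + (β 1 * (z - z₀).im : ℝ) - c - L (z - z₀)‖ ^ 2 ∧
      ∀ θ : ℝ, 0 < θ → θ ≤ 1 →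
        ∫ z in ball z₀ (θ * r), ‖cpx u v z + (β 1 * (z - z₀).im : ℝ) - c' - L' (z - z₀)‖ ^ 2 ≤
        C * (θ ^ 6 *
          (∫ z in ball z₀ r, ‖cpx u v z + (β 1 * (z - z₀).im : ℝ) - c - L (z - z₀)‖ ^ 2) +
          ∫ z in ball z₀ r, (B z - κ - b ^ 2 * v z - β (z - z₀)) ^ 2))
    {c : ℂ} (hc : ∫ z in ball z₀ r, ‖cpx u v z - c‖ ^ 2 ≤ K * (r * r ^ β) ^ 2) :
    ∃ c' : ℂ, ‖c - c'‖ ≤ Real.sqrt (C * K) * r ^ β ∧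
      ∫ z in ball z₀ (θ * r), ‖cpx u v z - c'‖ ^ 2 ≤ K * (θ * r * (θ * r) ^ β) ^ 2 := by
  have hh := ContinuousOn.cpx hu hv
  set h := cpx u v with hhdef
  -- The constant in `B` is read off at a point where the deviation from `c` is at most its mean.
  obtain ⟨z₁, hz₁, hX1⟩ := exists_norm_sub_sq_mul_le hr hh c
  obtain ⟨c', L', -, h1, h2, h3⟩ := hstep (B z₁ - b ^ 2 * v z₁) 0 c 0 (by simp [IsLinSol])
  simp only [_root_.zero_apply, zero_mul, ofReal_zero, add_zero, sub_zero, zero_sub, norm_neg] at h1 h2 h3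
  set X := ∫ z in ball z₀ r, ‖h z - c‖ ^ 2 with hX
  have hX0 : 0 ≤ X := integral_nonneg fun _ => by positivity
  have hp := Real.pi_pos
  have hp4 := Real.pi_lt_d2
  have hi : IntegrableOn (fun w => ‖h w - c‖ ^ 2) (ball z₀ r) :=
    ((hh.sub continuousOn_const).norm.pow 2).integrableOn_ball
  have hK0 : 0 ≤ K := by
    by_contra hneg
    push Not at hneg
    have : K * (r * r ^ β) ^ 2 < 0 := mul_neg_of_neg_of_pos hneg (by positivity)
    linarith
  have hNE : ∫ z in ball z₀ r, (B z - (B z₁ - b ^ 2 * v z₁) - b ^ 2 * v z) ^ 2 ≤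
      6 * ε ^ 2 * X + 12 * Real.pi * C₁ ^ 2 * r ^ 4 := by
    have e1 : ∫ z in ball z₀ r, (B z - (B z₁ - b ^ 2 * v z₁) - b ^ 2 * v z) ^ 2 ≤
        ∫ z in ball z₀ r, (3 * ε ^ 2 * ‖h z - c‖ ^ 2 +
          (3 * ε ^ 2 * ‖h z₁ - c‖ ^ 2 + 12 * C₁ ^ 2 * r ^ 2)) := by
      refine setIntegral_mono_on (((hB.sub continuousOn_const).sub
        (continuousOn_const.mul hv)).pow 2).integrableOn_ball
        ((hi.const_mul _).add (integrable_const _)) measurableSet_ball fun z hz => ?_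
      have e2 := hBv z₁ (ball_subset_closedBall hz₁) z (ball_subset_closedBall hz)
      have e3 : |v z - v z₁| ≤ ‖h z - c‖ + ‖h z₁ - c‖ := by
        have : v z - v z₁ = (h z - h z₁).im := by simp [hhdef, cpx]
        rw [this]
        refine (abs_im_le_norm _).trans ?_
        rw [show h z - h z₁ = (h z - c) - (h z₁ - c) by ring]
        exact norm_sub_le _ _
      have e4 : ‖z - z₁‖ ≤ 2 * r := by
        rw [mem_ball, dist_eq_norm] at hz hz₁
        rw [show z - z₁ = (z - z₀) - (z₁ - z₀) by ring]
        exact (norm_sub_le _ _).trans (by linarith)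
      have e5 : |B z - B z₁ - b ^ 2 * (v z - v z₁)| ≤
          ε * ‖h z - c‖ + ε * ‖h z₁ - c‖ + 2 * C₁ * r := by
        refine e2.trans ?_
        have := mul_le_mul_of_nonneg_left e3 hε0
        have := mul_le_mul_of_nonneg_left e4 hC₁
        linarith
      rw [show B z - (B z₁ - b ^ 2 * v z₁) - b ^ 2 * v z = B z - B z₁ - b ^ 2 * (v z - v z₁) by ring,
        ← sq_abs]
      refine (pow_le_pow_left₀ (abs_nonneg _) e5 2).trans ?_
      nlinarith [sq_nonneg (ε * ‖h z - c‖ - ε * ‖h z₁ - c‖), sq_nonneg (ε * ‖h z - c‖ - 2 * C₁ * r),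
        sq_nonneg (ε * ‖h z₁ - c‖ - 2 * C₁ * r)]
    rw [integral_add (hi.const_mul _) (integrable_const _), integral_const_mul, setIntegral_const,
      measureReal_ball _ hr.le, smul_eq_mul] at e1
    have e6 : 3 * ε ^ 2 * (‖h z₁ - c‖ ^ 2 * (Real.pi * r ^ 2)) ≤ 3 * ε ^ 2 * X := by gcongr
    linarith
  refine ⟨c', ?_, ?_⟩
  · rw [← sq_le_sq₀ (norm_nonneg _) (by positivity), mul_pow, Real.sq_sqrt (by positivity)]
    have : r ^ 2 * ‖c - c'‖ ^ 2 ≤ r ^ 2 * (C * K * (r ^ β) ^ 2) := by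
      calc _ ≤ _ := h1
        _ ≤ C * (K * (r * r ^ β) ^ 2) := by gcongr
        _ = _ := by ring
    exact le_of_mul_le_mul_left this (by positivity)
  have h4 := h3 θ hθ hθ1.le
  have hcl : closedBall z₀ (θ * r) ⊆ closedBall z₀ r := closedBall_subset_closedBall (by nlinarith)
  have h5 := integral_norm_sub_sq_le (f := fun z => h z - c' - L' (z - z₀))
    (g := fun z => -L' (z - z₀)) (z := z₀) (d := θ * r)
    (((hh.mono hcl).sub continuousOn_const).sub (by fun_prop)) (by fun_prop)
  simp only [sub_neg_eq_add, sub_add_cancel, norm_neg] at h5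
  have h6 : ∫ z in ball z₀ (θ * r), ‖L' (z - z₀)‖ ^ 2 ≤ Real.pi * θ ^ 4 * (C * X) := by
    have : ∫ z in ball z₀ (θ * r), ‖L' (z - z₀)‖ ^ 2 ≤
        ∫ z in ball z₀ (θ * r), ‖L'‖ ^ 2 * (θ * r) ^ 2 := by
      refine setIntegral_mono_on (ContinuousOn.integrableOn_ball (by fun_prop))
        (integrable_const _) measurableSet_ball fun z hz => ?_
      rw [mem_ball, dist_eq_norm] at hz
      rw [← mul_pow]
      gcongr
      exact (L'.le_opNorm _).trans (by gcongr)
    rw [setIntegral_const, measureReal_ball _ (by positivity), smul_eq_mul] at this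
    calc _ ≤ _ := this
      _ = Real.pi * θ ^ 4 * (r ^ 4 * ‖L'‖ ^ 2) := by ring
      _ ≤ _ := by gcongr
  set NE := ∫ z in ball z₀ r, (B z - (B z₁ - b ^ 2 * v z₁) - b ^ 2 * v z) ^ 2
  set τ := θ * θ ^ β with hτ
  set Y := K * (r * r ^ β) ^ 2 with hY
  have hr4 : r ^ 4 ≤ (r * r ^ β) ^ 2 := by
    have : r ≤ r ^ β := by
      nth_rewrite 1 [← Real.rpow_one r]
      exact Real.rpow_le_rpow_of_exponent_ge hr hr1 hβ
    calc r ^ 4 = (r * r) ^ 2 := by ring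
      _ ≤ _ := by gcongr
  have hθ6 : θ ^ 6 ≤ θ ^ 4 := pow_le_pow_of_le_one hθ.le hθ1.le (by norm_num)
  have hCX : 0 ≤ C * X := by positivity
  -- The new deviation is the sum of a decaying part, a part that is small with `ε`, and a part from the
  -- Lipschitz term; each is at most a quarter of the bound.
  have g1 : 2 * (C * (θ ^ 6 * X)) + 2 * (Real.pi * θ ^ 4 * (C * X)) ≤ 10 * C * θ ^ 4 * X := by
    have a1 : C * (θ ^ 6 * X) ≤ C * (θ ^ 4 * X) := by gcongr
    have a2 : Real.pi * θ ^ 4 * (C * X) ≤ 4 * θ ^ 4 * (C * X) := by gcongr; linarith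
    linarith
  have g2 : 10 * C * θ ^ 4 * X ≤ τ ^ 2 / 4 * Y := by
    calc 10 * C * θ ^ 4 * X ≤ 10 * C * θ ^ 4 * Y := by gcongr
      _ ≤ τ ^ 2 / 4 * Y := by gcongr; linarith
  have g3 : 12 * C * ε ^ 2 * X ≤ τ ^ 2 / 4 * Y := by
    calc 12 * C * ε ^ 2 * X ≤ 12 * C * ε ^ 2 * Y := by gcongr
      _ ≤ τ ^ 2 / 4 * Y := by gcongr; linarith
  have g4 : 24 * Real.pi * C * C₁ ^ 2 * r ^ 4 ≤ τ ^ 2 / 4 * Y := by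
    calc 24 * Real.pi * C * C₁ ^ 2 * r ^ 4 ≤ 24 * 4 * C * C₁ ^ 2 * (r * r ^ β) ^ 2 := by
          gcongr; linarith
      _ = 400 * C * C₁ ^ 2 * (24 / 100) * (r * r ^ β) ^ 2 := by ring
      _ ≤ (τ ^ 2 * K) * (24 / 100) * (r * r ^ β) ^ 2 := by gcongr
      _ ≤ (τ ^ 2 * K) * (1 / 4) * (r * r ^ β) ^ 2 := by
          have : 0 ≤ (τ ^ 2 * K) * (r * r ^ β) ^ 2 := by positivity
          linarith
      _ = _ := by rw [hY]; ring
  have g5 : K * (θ * r * (θ * r) ^ β) ^ 2 = τ ^ 2 * Y := by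
    rw [hY, hτ, Real.mul_rpow hθ.le hr.le]; ring
  have g6 : C * NE ≤ C * (6 * ε ^ 2 * X + 12 * Real.pi * C₁ ^ 2 * r ^ 4) := by gcongr
  have g7 : 0 ≤ τ ^ 2 / 4 * Y := by positivity
  rw [g5]
  linarith

/-- Hölder continuity of weak solutions: if `B - b² v` is a Lipschitz function of `(z, v)` with a small
constant in `v`, then `u` and `v` are Hölder continuous with any given exponent `β < 1`. -/
theorem IsWeakSol.exists_holder {m β : ℝ} (hm : 1 ≤ m) (hβ0 : 0 < β) (hβ : β < 1) :
    ∃ ε > 0, ∀ b : ℝ, m⁻¹ ≤ b → b ≤ m → ∀ (p : ℂ) (R : ℝ), 0 < R → ∀ u v B : ℂ → ℝ,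
      ContinuousOn u (closedBall p R) → ContinuousOn v (closedBall p R) →
      ContinuousOn B (closedBall p R) → IsWeakSol (ball p R) u v B → ∀ C₁ : ℝ, 0 ≤ C₁ →
      (∀ z ∈ closedBall p R, ∀ z' ∈ closedBall p R,
        |B z' - B z - b ^ 2 * (v z' - v z)| ≤ ε * |v z' - v z| + C₁ * ‖z' - z‖) →
      ∃ K r, 0 ≤ K ∧ 0 < r ∧ ∀ z ∈ ball p r, ∀ z' ∈ ball p r,
        ‖cpx u v z' - cpx u v z‖ ≤ K * ‖z' - z‖ ^ β := by
  obtain ⟨C, hC, hstep⟩ := exists_affine_step hm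
  obtain ⟨θ, hθ, hθ1, hθC⟩ := exists_rpow_small (show 0 < 1 - β by linarith) (40 * C)
  set τ := θ * θ ^ β with hτ
  have hτ0 : 0 < τ := by positivity
  refine ⟨τ / (7 * C), by positivity, fun b hb1 hb2 p R hR u v B hu hv hB hw C₁ hC₁ hBv => ?_⟩
  set r₀ := min (R / 2) 1 with hr₀
  have hr0 : 0 < r₀ := by positivity
  have hh := ContinuousOn.cpx hu hv
  obtain ⟨M, hM⟩ := (isCompact_closedBall p R).exists_bound_of_continuousOn hh
  set K := 400 * C * C₁ ^ 2 / τ ^ 2 + 4 * r₀ ^ 2 * M ^ 2 / (r₀ * r₀ ^ β) ^ 2 with hK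
  have hK0 : 0 ≤ K := by positivity
  have hsub : ∀ z ∈ ball p (r₀ / 4), closedBall z r₀ ⊆ closedBall p R := by
    intro z hz w hw
    rw [mem_ball] at hz
    rw [mem_closedBall] at hw ⊢
    have := dist_triangle w z p
    have := min_le_left (R / 2) 1
    linarith
  have key : ∀ z ∈ ball p (r₀ / 4), ∀ ρ, 0 < ρ → ρ ≤ r₀ →
      ∫ w in ball z ρ, ‖cpx u v w - cpx u v z - (0 : ℂ →L[ℝ] ℂ) (w - z)‖ ^ 2 ≤
      (3 * K + 12 * (Real.sqrt (C * K) / (1 - θ ^ β)) ^ 2 + 12 * Real.sqrt (C * K) ^ 2) /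
        (θ * θ ^ β) ^ 2 * (ρ * ρ ^ β) ^ 2 := by
    intro z hz
    have hs := hsub z hz
    obtain ⟨f, hf⟩ := exists_seq_of_step
      (P := fun j (c : ℂ) => ∫ w in ball z (θ ^ j * r₀), ‖cpx u v w - c‖ ^ 2 ≤
        K * (θ ^ j * r₀ * (θ ^ j * r₀) ^ β) ^ 2)
      (Q := fun j c c' => ‖c - c'‖ ≤ Real.sqrt (C * K) * (θ ^ j * r₀) ^ β) (by
        refine ⟨0, ?_⟩
        simp only [pow_zero, one_mul, sub_zero]
        have : ∫ w in ball z r₀, ‖cpx u v w‖ ^ 2 ≤ ∫ w in ball z r₀, M ^ 2 := by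
          refine setIntegral_mono_on ((hh.mono hs).norm.pow 2).integrableOn_ball
            (integrable_const _) measurableSet_ball fun w hw => ?_
          gcongr
          exact hM w (hs (ball_subset_closedBall hw))
        rw [setIntegral_const, measureReal_ball _ hr0.le, smul_eq_mul] at this
        have hp4 := Real.pi_lt_d2
        calc _ ≤ _ := this
          _ ≤ 4 * r₀ ^ 2 * M ^ 2 := by gcongr; linarith
          _ = 4 * r₀ ^ 2 * M ^ 2 / (r₀ * r₀ ^ β) ^ 2 * (r₀ * r₀ ^ β) ^ 2 := by
              rw [div_mul_cancel₀]; positivity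
          _ ≤ _ := by
              gcongr
              rw [hK]
              exact le_add_of_nonneg_left (by positivity)) (by
        intro j c hc
        have hj : θ ^ j * r₀ ≤ r₀ := mul_le_of_le_one_left hr0.le (pow_le_one₀ hθ.le hθ1.le)
        have hs' : closedBall z (θ ^ j * r₀) ⊆ closedBall p R :=
          (closedBall_subset_closedBall hj).trans hs
        have hsb : ball z (θ ^ j * r₀) ⊆ ball p R := by
          rw [← interior_closedBall z (by positivity), ← interior_closedBall p hR.ne']
          exact interior_mono hs'
        have g1 : 40 * C * θ ^ 4 ≤ (θ * θ ^ β) ^ 2 := by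
          have : θ = θ ^ β * θ ^ (1 - β) := by
            rw [← Real.rpow_add hθ]; simp
          have h3 : θ ^ (1 - β) ≤ 1 := Real.rpow_le_one hθ.le hθ1.le (by linarith)
          have h4 : 0 < θ ^ (1 - β) := by positivity
          calc 40 * C * θ ^ 4 = 40 * C * θ ^ 2 * (θ ^ β * θ ^ (1 - β)) ^ 2 := by rw [← this]; ring
            _ = (θ * θ ^ β) ^ 2 * ((40 * C * θ ^ (1 - β)) * θ ^ (1 - β)) := by ring
            _ ≤ (θ * θ ^ β) ^ 2 * 1 := by
                gcongr
                exact mul_le_one₀ hθC h4.le h3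
            _ = _ := mul_one _
        have g2 : 48 * C * (τ / (7 * C)) ^ 2 ≤ (θ * θ ^ β) ^ 2 := by
          rw [← hτ, div_pow, mul_div_assoc', div_le_iff₀ (by positivity)]
          have : 48 * C ≤ (7 * C) ^ 2 := by nlinarith
          nlinarith [sq_nonneg τ]
        have g3 : 400 * C * C₁ ^ 2 ≤ (θ * θ ^ β) ^ 2 * K := by
          rw [← hτ, hK, mul_add, mul_div_cancel₀ _ (by positivity)]
          exact le_add_of_nonneg_right (by positivity)
        obtain ⟨c', h1, h2⟩ := holder_step hC hβ.le hθ hθ1 g1 g2 (by positivity) hC₁ g3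
          (by positivity) (hj.trans (min_le_right _ _)) (hu.mono hs') (hv.mono hs') (hB.mono hs')
          (fun z hz z' hz' => hBv z (hs' hz) z' (hs' hz'))
          (hstep b hb1 hb2 z _ (by positivity) u v B (hu.mono hs') (hv.mono hs') (hB.mono hs')
            (hw.mono hsb)) hc
        refine ⟨c', ?_, h1⟩
        rw [pow_succ', mul_assoc]
        exact h2)
    exact campanato_limit hr0 hθ hθ1 hβ0 hK0 (Real.sqrt_nonneg _) (hh.mono hs)
      (c := f) (L := fun _ => 0) (L' := 0) (fun j => by simpa using (hf j).1) (fun j => (hf j).2)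
      (fun j => by simpa using by positivity)
  set K' := (3 * K + 12 * (Real.sqrt (C * K) / (1 - θ ^ β)) ^ 2 + 12 * Real.sqrt (C * K) ^ 2) /
        (θ * θ ^ β) ^ 2 with hK'
  have hK'0 : 0 ≤ K' := by positivity
  refine ⟨2 * Real.sqrt K' * 2 ^ (1 + β), r₀ / 4, by positivity, by positivity,
    fun z hz z' hz' => ?_⟩
  have := norm_sub_le_of_integral_le (L := fun _ => 0) hK'0 (hh.mono (hsub z hz)) hβ0.le
      (key z hz) (key z' hz') (by
    rw [mem_ball, dist_eq_norm] at hz hz'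
    have := norm_sub_le (z' - p) (z - p)
    rw [sub_sub_sub_cancel_right] at this
    linarith)
  simpa using this

end SLTorus

namespace SLTorus
open MeasureTheory Metric Filter Topology Complex

/-! ### First-order expansions of weak solutions -/

/-- One step of the Campanato iteration with affine functions. The hypothesis `hstep` is the conclusion
of `exists_affine_step` on the given ball. -/
theorem taylor_step {C b C₃ s θ K : ℝ} (hC : 1 ≤ C) (hθ : 0 < θ) (hθ1 : θ < 1) (hs : 0 ≤ s)
    (hθC : 2 * C * θ ^ 6 ≤ (θ * θ ^ s) ^ 2) (hC₃ : 0 ≤ C₃)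
    (hK : 8 * C * C₃ ^ 2 ≤ (θ * θ ^ s) ^ 2 * K)
    {z₀ : ℂ} {r : ℝ} (hr : 0 < r) {u v B : ℂ → ℝ} (hv : ContinuousOn v (closedBall z₀ r))
    (hB : ContinuousOn B (closedBall z₀ r)) {β : ℂ →L[ℝ] ℝ}
    (hBv : ∀ z ∈ closedBall z₀ r,
      |B z - B z₀ - b ^ 2 * (v z - v z₀) - β (z - z₀)| ≤ C₃ * ‖z - z₀‖ ^ s)
    (hstep : ∀ (κ : ℝ) (β : ℂ →L[ℝ] ℝ) (c : ℂ) (L : ℂ →L[ℝ] ℂ),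
      IsLinSol (b ^ 2) L → ∃ (c' : ℂ) (L' : ℂ →L[ℝ] ℂ), IsLinSol (b ^ 2) L' ∧
      r ^ 2 * ‖c - c'‖ ^ 2 ≤
        C * ∫ z in ball z₀ r, ‖cpx u v z + (β 1 * (z - z₀).im : ℝ) - c - L (z - z₀)‖ ^ 2 ∧
      r ^ 4 * ‖L - L'‖ ^ 2 ≤
        C * ∫ z in ball z₀ r, ‖cpx u v z + (β 1 * (z - z₀).im : ℝ) - c - L (z - z₀)‖ ^ 2 ∧
      ∀ θ : ℝ, 0 < θ → θ ≤ 1 →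
        ∫ z in ball z₀ (θ * r), ‖cpx u v z + (β 1 * (z - z₀).im : ℝ) - c' - L' (z - z₀)‖ ^ 2 ≤
        C * (θ ^ 6 *
          (∫ z in ball z₀ r, ‖cpx u v z + (β 1 * (z - z₀).im : ℝ) - c - L (z - z₀)‖ ^ 2) +
          ∫ z in ball z₀ r, (B z - κ - b ^ 2 * v z - β (z - z₀)) ^ 2))
    {c : ℂ} {L : ℂ →L[ℝ] ℂ} (hL : IsLinSol (b ^ 2) L)
    (hc : ∫ z in ball z₀ r, ‖cpx u v z + (β 1 * (z - z₀).im : ℝ) - c - L (z - z₀)‖ ^ 2 ≤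
      K * (r * r ^ s) ^ 2) :
    ∃ (c' : ℂ) (L' : ℂ →L[ℝ] ℂ), IsLinSol (b ^ 2) L' ∧ ‖c - c'‖ ≤ Real.sqrt (C * K) * r ^ s ∧
      ‖L - L'‖ * r ≤ Real.sqrt (C * K) * r ^ s ∧
      ∫ z in ball z₀ (θ * r), ‖cpx u v z + (β 1 * (z - z₀).im : ℝ) - c' - L' (z - z₀)‖ ^ 2 ≤
        K * (θ * r * (θ * r) ^ s) ^ 2 := by
  obtain ⟨c', L', hL', h1, h2, h3⟩ := hstep (B z₀ - b ^ 2 * v z₀) β c L hL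
  set X := ∫ z in ball z₀ r, ‖cpx u v z + (β 1 * (z - z₀).im : ℝ) - c - L (z - z₀)‖ ^ 2 with hX
  have hX0 : 0 ≤ X := integral_nonneg fun _ => by positivity
  have hp := Real.pi_pos
  have hp4 := Real.pi_lt_d2
  have hK0 : 0 ≤ K := by
    by_contra hneg
    push Not at hneg
    have : K * (r * r ^ s) ^ 2 < 0 := mul_neg_of_neg_of_pos hneg (by positivity)
    linarith
  have hNE : ∫ z in ball z₀ r, (B z - (B z₀ - b ^ 2 * v z₀) - b ^ 2 * v z - β (z - z₀)) ^ 2 ≤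
      4 * C₃ ^ 2 * (r * r ^ s) ^ 2 := by
    have e1 : ∫ z in ball z₀ r, (B z - (B z₀ - b ^ 2 * v z₀) - b ^ 2 * v z - β (z - z₀)) ^ 2 ≤
        ∫ z in ball z₀ r, (C₃ * r ^ s) ^ 2 := by
      refine setIntegral_mono_on ((((hB.sub continuousOn_const).sub
        (continuousOn_const.mul hv)).sub (by fun_prop)).pow 2).integrableOn_ball
        (integrable_const _) measurableSet_ball fun z hz => ?_
      have e2 := hBv z (ball_subset_closedBall hz)
      rw [mem_ball, dist_eq_norm] at hz
      rw [show B z - (B z₀ - b ^ 2 * v z₀) - b ^ 2 * v z - β (z - z₀) =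
        B z - B z₀ - b ^ 2 * (v z - v z₀) - β (z - z₀) by ring, ← sq_abs]
      exact pow_le_pow_left₀ (abs_nonneg _) (e2.trans (by gcongr)) 2
    rw [setIntegral_const, measureReal_ball _ hr.le, smul_eq_mul] at e1
    calc _ ≤ _ := e1
      _ ≤ 4 * r ^ 2 * (C₃ * r ^ s) ^ 2 := by gcongr; linarith
      _ = _ := by ring
  refine ⟨c', L', hL', ?_, ?_, ?_⟩
  · rw [← sq_le_sq₀ (norm_nonneg _) (by positivity), mul_pow, Real.sq_sqrt (by positivity)]
    have : r ^ 2 * ‖c - c'‖ ^ 2 ≤ r ^ 2 * (C * K * (r ^ s) ^ 2) := by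
      calc _ ≤ _ := h1
        _ ≤ C * (K * (r * r ^ s) ^ 2) := by gcongr
        _ = _ := by ring
    exact le_of_mul_le_mul_left this (by positivity)
  · rw [← sq_le_sq₀ (by positivity) (by positivity), mul_pow, mul_pow, Real.sq_sqrt (by positivity)]
    have : r ^ 2 * (‖L - L'‖ ^ 2 * r ^ 2) ≤ r ^ 2 * (C * K * (r ^ s) ^ 2) := by
      calc _ = r ^ 4 * ‖L - L'‖ ^ 2 := by ring
        _ ≤ _ := h2
        _ ≤ C * (K * (r * r ^ s) ^ 2) := by gcongr
        _ = _ := by ring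
    exact le_of_mul_le_mul_left this (by positivity)
  have h4 := h3 θ hθ hθ1.le
  set NE := ∫ z in ball z₀ r, (B z - (B z₀ - b ^ 2 * v z₀) - b ^ 2 * v z - β (z - z₀)) ^ 2
  set τ := θ * θ ^ s with hτ
  set Y := K * (r * r ^ s) ^ 2 with hY
  have g2 : C * θ ^ 6 * X ≤ τ ^ 2 / 2 * Y := by
    calc C * θ ^ 6 * X ≤ C * θ ^ 6 * Y := by gcongr
      _ ≤ τ ^ 2 / 2 * Y := by gcongr; linarith
  have g3 : C * NE ≤ τ ^ 2 / 2 * Y := by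
    calc C * NE ≤ C * (4 * C₃ ^ 2 * (r * r ^ s) ^ 2) := by gcongr
      _ = 8 * C * C₃ ^ 2 * (1 / 2 * (r * r ^ s) ^ 2) := by ring
      _ ≤ τ ^ 2 * K * (1 / 2 * (r * r ^ s) ^ 2) := by gcongr
      _ = _ := by rw [hY]; ring
  have g5 : K * (θ * r * (θ * r) ^ s) ^ 2 = τ ^ 2 * Y := by
    rw [hY, hτ, Real.mul_rpow hθ.le hr.le]; ring
  rw [g5]
  linarith

theorem IsLinSol.isClosed (a : ℝ) : IsClosed {L : ℂ →L[ℝ] ℂ | IsLinSol a L} := by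
  refine IsClosed.inter (isClosed_eq ?_ ?_) (isClosed_eq ?_ ?_) <;> fun_prop

/-- The real-linear map `z ↦ t Im z`. Subtracting it turns affine approximations of
`cpx u v + β₁ Im (z - z₀)` into affine approximations of `cpx u v`. -/
noncomputable def imCorrection (t : ℝ) : ℂ →L[ℝ] ℂ := t • ofRealCLM.comp imCLM

theorem imCorrection_apply (t : ℝ) (z : ℂ) : imCorrection t z = (t * z.im : ℝ) := by
  simp [imCorrection]

theorem norm_imCorrection_le (t : ℝ) : ‖imCorrection t‖ ≤ |t| := by
  refine ContinuousLinearMap.opNorm_le_bound _ (abs_nonneg _) fun z => ?_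
  rw [imCorrection_apply, norm_real, norm_mul, Real.norm_eq_abs, Real.norm_eq_abs]
  gcongr
  exact abs_im_le_norm z

set_option maxHeartbeats 400000 in
/-- Weak solutions have expansions of order `s ∈ (1, 2)` if `B` is, up to an error of this order, the
function `b² v + β` with `b` and `β` frozen at the centre; the linear terms solve the linearized
system. -/
theorem IsWeakSol.exists_taylor {m s : ℝ} (hm : 1 ≤ m) (hs1 : 1 < s) (hs2 : s < 2) {p : ℂ} {R : ℝ}
    (hR : 0 < R) {u v B : ℂ → ℝ} (hu : ContinuousOn u (closedBall p R))
    (hv : ContinuousOn v (closedBall p R)) (hB : ContinuousOn B (closedBall p R))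
    (hw : IsWeakSol (ball p R) u v B) {b : ℂ → ℝ} {β : ℂ → ℂ →L[ℝ] ℝ} {C₃ D : ℝ} (hC₃ : 0 ≤ C₃)
    (hb : ∀ z ∈ ball p R, m⁻¹ ≤ b z ∧ b z ≤ m) (hβ : ∀ z ∈ ball p R, ‖β z‖ ≤ D)
    (hBv : ∀ z ∈ ball p R, ∀ z' ∈ closedBall p R,
      |B z' - B z - b z ^ 2 * (v z' - v z) - β z (z' - z)| ≤ C₃ * ‖z' - z‖ ^ s) :
    ∃ (K r : ℝ) (L : ℂ → ℂ →L[ℝ] ℂ), 0 < r ∧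
      (∀ z ∈ ball p r, ‖L z‖ ≤ K ∧ (L z 1).re = (L z I).im ∧
        b z ^ 2 * (L z 1).im + β z 1 = -(L z I).re) ∧
      ∀ z ∈ ball p r, ∀ z' ∈ ball p r, ‖cpx u v z' - cpx u v z - L z (z' - z)‖ ≤ K * ‖z' - z‖ ^ s := by
  obtain ⟨C, hC, hstep⟩ := exists_affine_step hm
  obtain ⟨θ, hθ, hθ1, hθC⟩ := exists_rpow_small (show 0 < 2 - s by linarith) (2 * C)
  set τ := θ * θ ^ s with hτ
  have hτ0 : 0 < τ := by positivity
  set r₀ := min (R / 2) 1 with hr₀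
  have hr0 : 0 < r₀ := by positivity
  have hr01 : r₀ ≤ 1 := min_le_right _ _
  have hD : 0 ≤ D := (norm_nonneg _).trans (hβ p (mem_ball_self hR))
  have hh := ContinuousOn.cpx hu hv
  obtain ⟨M, hM⟩ := (isCompact_closedBall p R).exists_bound_of_continuousOn hh
  have hM0 : 0 ≤ M := (norm_nonneg _).trans (hM p (mem_closedBall_self hR.le))
  set K := 8 * C * C₃ ^ 2 / τ ^ 2 + 4 * r₀ ^ 2 * (M + D) ^ 2 / (r₀ * r₀ ^ s) ^ 2 with hK
  have hK0 : 0 ≤ K := by positivity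
  have hsub : ∀ z ∈ ball p (r₀ / 4), closedBall z r₀ ⊆ closedBall p R := by
    intro z hz w hw
    rw [mem_ball] at hz
    rw [mem_closedBall] at hw ⊢
    have := dist_triangle w z p
    have := min_le_left (R / 2) 1
    linarith
  have hsubb : ball p (r₀ / 4) ⊆ ball p R := ball_subset_ball (by
    have := min_le_left (R / 2) 1
    linarith)
  set K₁ := Real.sqrt (C * K) / (1 - θ ^ (s - 1)) with hK₁
  have hσ0 : 0 < θ ^ (s - 1) := by positivity
  have hσ1 : θ ^ (s - 1) < 1 := Real.rpow_lt_one hθ.le hθ1 (by linarith)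
  have hKK₁ : Real.sqrt (C * K) ≤ K₁ := by
    rw [hK₁, le_div_iff₀ (by linarith)]
    have := Real.sqrt_nonneg (C * K)
    nlinarith
  have hK₁0 : 0 ≤ K₁ := (Real.sqrt_nonneg _).trans hKK₁
  set K' := (3 * K + 12 * (K₁ / (1 - θ ^ s)) ^ 2 + 12 * K₁ ^ 2) / (θ * θ ^ s) ^ 2 with hK'
  have hK'0 : 0 ≤ K' := by positivity
  have key : ∀ z ∈ ball p (r₀ / 4), ∃ L : ℂ →L[ℝ] ℂ,
      (‖L‖ ≤ K₁ * r₀ ^ s / r₀ + D ∧ (L 1).re = (L I).im ∧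
        b z ^ 2 * (L 1).im + β z 1 = -(L I).re) ∧
      ∀ ρ, 0 < ρ → ρ ≤ r₀ →
        ∫ w in ball z ρ, ‖cpx u v w - cpx u v z - L (w - z)‖ ^ 2 ≤ K' * (ρ * ρ ^ s) ^ 2 := by
    intro z hz
    have hcs := hsub z hz
    have hβ1 : |β z 1| ≤ D := by
      have := (β z).le_opNorm 1
      rw [norm_one, mul_one] at this
      exact this.trans (hβ z (hsubb hz))
    obtain ⟨f, hf⟩ := exists_seq_of_step
      (P := fun j (q : ℂ × (ℂ →L[ℝ] ℂ)) => (j = 0 → q.2 = 0) ∧ IsLinSol (b z ^ 2) q.2 ∧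
        ∫ w in ball z (θ ^ j * r₀),
          ‖cpx u v w + (β z 1 * (w - z).im : ℝ) - q.1 - q.2 (w - z)‖ ^ 2 ≤
        K * (θ ^ j * r₀ * (θ ^ j * r₀) ^ s) ^ 2)
      (Q := fun j q q' => ‖q.1 - q'.1‖ ≤ Real.sqrt (C * K) * (θ ^ j * r₀) ^ s ∧
        ‖q.2 - q'.2‖ * (θ ^ j * r₀) ≤ Real.sqrt (C * K) * (θ ^ j * r₀) ^ s) (by
        refine ⟨(0, 0), fun _ => rfl, by simp [IsLinSol], ?_⟩
        simp only [pow_zero, one_mul, sub_zero, _root_.zero_apply]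
        have : ∫ w in ball z r₀, ‖cpx u v w + (β z 1 * (w - z).im : ℝ)‖ ^ 2 ≤
            ∫ w in ball z r₀, (M + D) ^ 2 := by
          refine setIntegral_mono_on (((hh.mono hcs).add (by fun_prop)).norm.pow 2).integrableOn_ball
            (integrable_const _) measurableSet_ball fun w hw => ?_
          gcongr
          refine (norm_add_le _ _).trans (add_le_add (hM w (hcs (ball_subset_closedBall hw))) ?_)
          rw [norm_real, Real.norm_eq_abs, abs_mul]
          rw [mem_ball, dist_eq_norm] at hw
          have := abs_im_le_norm (w - z)
          calc _ ≤ D * 1 := by gcongr; linarith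
            _ = D := mul_one D
        rw [setIntegral_const, measureReal_ball _ hr0.le, smul_eq_mul] at this
        have hp4 := Real.pi_lt_d2
        calc _ ≤ _ := this
          _ ≤ 4 * r₀ ^ 2 * (M + D) ^ 2 := by gcongr; linarith
          _ = 4 * r₀ ^ 2 * (M + D) ^ 2 / (r₀ * r₀ ^ s) ^ 2 * (r₀ * r₀ ^ s) ^ 2 := by
              rw [div_mul_cancel₀]; positivity
          _ ≤ _ := by
              gcongr
              rw [hK]
              exact le_add_of_nonneg_left (by positivity)) (by
        rintro j ⟨c, L⟩ ⟨-, hL, hc⟩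
        have hj : θ ^ j * r₀ ≤ r₀ := mul_le_of_le_one_left hr0.le (pow_le_one₀ hθ.le hθ1.le)
        have hs' : closedBall z (θ ^ j * r₀) ⊆ closedBall p R :=
          (closedBall_subset_closedBall hj).trans hcs
        have hsb : ball z (θ ^ j * r₀) ⊆ ball p R := by
          rw [← interior_closedBall z (by positivity), ← interior_closedBall p hR.ne']
          exact interior_mono hs'
        have g1 : 2 * C * θ ^ 6 ≤ (θ * θ ^ s) ^ 2 := by
          have : θ ^ 2 = θ ^ s * θ ^ (2 - s) := by
            rw [← Real.rpow_add hθ, ← Real.rpow_natCast]; norm_num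
          have h3 : θ ^ (2 - s) ≤ 1 := Real.rpow_le_one hθ.le hθ1.le (by linarith)
          have h4 : 0 < θ ^ (2 - s) := by positivity
          calc 2 * C * θ ^ 6 = 2 * C * θ ^ 2 * (θ ^ s * θ ^ (2 - s)) ^ 2 := by rw [← this]; ring
            _ = (θ * θ ^ s) ^ 2 * ((2 * C * θ ^ (2 - s)) * θ ^ (2 - s)) := by ring
            _ ≤ (θ * θ ^ s) ^ 2 * 1 := by
                gcongr
                exact mul_le_one₀ hθC h4.le h3
            _ = _ := mul_one _
        have g3 : 8 * C * C₃ ^ 2 ≤ (θ * θ ^ s) ^ 2 * K := by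
          rw [← hτ, hK, mul_add, mul_div_cancel₀ _ (by positivity)]
          exact le_add_of_nonneg_right (by positivity)
        obtain ⟨c', L', hL', h1, h2, h3⟩ := taylor_step hC hθ hθ1 (by linarith) g1 hC₃ g3
          (by positivity) (hv.mono hs') (hB.mono hs') (β := β z)
          (fun z' hz' => hBv z (hsubb hz) z' (hs' hz'))
          (hstep (b z) (hb z (hsubb hz)).1 (hb z (hsubb hz)).2 z _ (by positivity) u v B
            (hu.mono hs') (hv.mono hs') (hB.mono hs') (hw.mono hsb)) hL hc
        refine ⟨(c', L'), ⟨by simp, hL', ?_⟩, h1, h2⟩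
        rw [pow_succ', mul_assoc]
        exact h3)
    have hρs : ∀ j : ℕ, (θ ^ j * r₀) ^ s = θ ^ j * r₀ * (r₀ ^ (s - 1) * (θ ^ (s - 1)) ^ j) := by
      intro j
      have hpos : 0 < θ ^ j * r₀ := by positivity
      have e1 : (θ ^ j * r₀) ^ s = (θ ^ j * r₀) * (θ ^ j * r₀) ^ (s - 1) := by
        rw [← Real.rpow_one_add' hpos.le (by linarith)]; congr 1; ring
      rw [e1, Real.mul_rpow (by positivity) hr0.le, mul_comm ((θ ^ j) ^ (s - 1)),
        ← Real.rpow_natCast, ← Real.rpow_natCast, ← Real.rpow_mul hθ.le, ← Real.rpow_mul hθ.le,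
        mul_comm (s - 1)]
    have hLd : ∀ j, dist (f j).2 (f (j + 1)).2 ≤
        Real.sqrt (C * K) * r₀ ^ (s - 1) * (θ ^ (s - 1)) ^ j := by
      intro j
      have h1 := (hf j).2.2
      have hpos : 0 < θ ^ j * r₀ := by positivity
      rw [hρs] at h1
      rw [dist_eq_norm]
      refine le_of_mul_le_mul_right (h1.trans (le_of_eq ?_)) hpos
      ring
    -- The increments of the linear parts decay like `θ ^ ((s - 1) j)`, and `s > 1`.
    obtain ⟨L', hL'⟩ := cauchySeq_tendsto_of_complete (cauchySeq_of_le_geometric _ _ hσ1 hLd)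
    have hLL : ∀ j, ‖(f j).2 - L'‖ * (θ ^ j * r₀) ≤ K₁ * (θ ^ j * r₀) ^ s := by
      intro j
      have h1 := dist_le_of_le_geometric_of_tendsto _ _ hσ1 hLd hL' j
      rw [dist_eq_norm] at h1
      rw [hρs, hK₁]
      calc _ ≤ Real.sqrt (C * K) * r₀ ^ (s - 1) * (θ ^ (s - 1)) ^ j / (1 - θ ^ (s - 1)) *
            (θ ^ j * r₀) := by gcongr
        _ = _ := by ring
    have hlin : IsLinSol (b z ^ 2) L' :=
      (IsLinSol.isClosed (b z ^ 2)).mem_of_tendsto hL' (Eventually.of_forall fun j => (hf j).1.2.1)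
    -- The shifted function `cpx u v + β₁ Im (w - z)` has the same value at `z`.
    have hcG : ContinuousOn (fun w => cpx u v w + (β z 1 * (w - z).im : ℝ)) (closedBall z r₀) :=
      (hh.mono hcs).add (by fun_prop)
    have hlim := campanato_limit hr0 hθ hθ1 (by linarith) hK0 hK₁0 hcG
      (c := fun j => (f j).1) (L := fun j => (f j).2) (L' := L') (fun j => (hf j).1.2.2)
      (fun j => (hf j).2.1.trans (by gcongr)) hLL
    refine ⟨L' - imCorrection (β z 1), ⟨?_, ?_, ?_⟩, fun ρ hρ hρr => ?_⟩
    · refine (norm_sub_le _ _).trans (add_le_add ?_ ((norm_imCorrection_le _).trans hβ1))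
      have := hLL 0
      rw [(hf 0).1.1 rfl, pow_zero, one_mul, zero_sub, norm_neg] at this
      rwa [le_div_iff₀ hr0]
    · simp [imCorrection_apply, hlin.1]
    · have := hlin.2
      simp [imCorrection_apply]
      linarith
    · refine le_trans (le_of_eq ?_) (hlim ρ hρ hρr)
      refine integral_congr_ae (Eventually.of_forall fun w => ?_)
      simp only [sub_apply, imCorrection_apply, sub_self, zero_im, mul_zero, ofReal_zero, add_zero]
      congr 2; ring
  choose! L hL using key
  refine ⟨max (K₁ * r₀ ^ s / r₀ + D) (2 * Real.sqrt K' * 2 ^ (1 + s)), r₀ / 4, L, by positivity,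
    fun z hz => ⟨(hL z hz).1.1.trans (le_max_left _ _), (hL z hz).1.2⟩, fun z hz z' hz' => ?_⟩
  have := norm_sub_le_of_integral_le (L := L) hK'0 (hh.mono (hsub z hz)) (by linarith)
      (hL z hz).2 (hL z' hz').2 (by
    rw [mem_ball, dist_eq_norm] at hz hz'
    have := norm_sub_le (z' - p) (z - p)
    rw [sub_sub_sub_cancel_right] at this
    linarith)
  refine this.trans ?_
  gcongr
  exact le_max_right _ _

end SLTorus

namespace SLTorus
open MeasureTheory Metric Filter Topology Complex

/-! ### Functions with uniform first-order expansions -/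

section HolderTaylor
variable {F G : Type} [NormedAddCommGroup F] [NormedSpace ℝ F] [NormedAddCommGroup G]
  [NormedSpace ℝ G] {f : ℂ → F} {g : ℂ → G} {p : ℂ}

/-- First-order Taylor expansions of `f` near `p`, uniform in both end points, with a remainder of
order `1 + γ` for some `γ > 0`. This is the class `C^{1,γ}` near `p`. -/
def HasHolderTaylor (f : ℂ → F) (p : ℂ) : Prop :=
  ∃ (γ K r : ℝ) (L : ℂ → ℂ →L[ℝ] F), 0 < γ ∧ γ ≤ 1 ∧ 0 < r ∧ 0 ≤ K ∧
    (∀ z ∈ ball p r, ‖L z‖ ≤ K) ∧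
    ∀ z ∈ ball p r, ∀ z' ∈ ball p r, ‖f z' - f z - L z (z' - z)‖ ≤ K * ‖z' - z‖ ^ (1 + γ)

/-- An expansion of order `1 + γ > 1` is a derivative. -/
theorem hasFDerivAt_of_taylor {γ K : ℝ} (hγ : 0 < γ) {L : ℂ →L[ℝ] F} {z : ℂ}
    (h : ∀ᶠ z' in 𝓝 z, ‖f z' - f z - L (z' - z)‖ ≤ K * ‖z' - z‖ ^ (1 + γ)) :
    HasFDerivAt f L z := by
  refine .of_isLittleO ?_
  have h1 : (fun z' => f z' - f z - L (z' - z)) =O[𝓝 z] fun z' => ‖z' - z‖ ^ (1 + γ) := by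
    refine Asymptotics.IsBigO.of_bound K ?_
    filter_upwards [h] with z' hz'
    rwa [Real.norm_of_nonneg (by positivity)]
  refine h1.trans_isLittleO ?_
  have h2 : Tendsto (fun z' : ℂ => ‖z' - z‖ ^ γ) (𝓝 z) (𝓝 0) := by
    have : Tendsto (fun z' : ℂ => ‖z' - z‖) (𝓝 z) (𝓝 0) := tendsto_norm_sub_self z
    have := this.rpow_const (Or.inr hγ.le)
    rwa [Real.zero_rpow hγ.ne'] at this
  have h3 := ((Asymptotics.isLittleO_one_iff ℝ).2 h2).mul_isBigO
    (Asymptotics.isBigO_refl (fun z' : ℂ => ‖z' - z‖) (𝓝 z))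
  refine Asymptotics.IsLittleO.of_norm_right ?_
  refine h3.congr (fun z' => ?_) (fun z' => one_mul _)
  rw [add_comm, Real.rpow_add_one' (norm_nonneg _) (by linarith)]

/-- Functions of class `C^{1,γ}` are Lipschitz near the point. -/
theorem HasHolderTaylor.exists_lipschitz (h : HasHolderTaylor f p) :
    ∃ K r : ℝ, 0 ≤ K ∧ 0 < r ∧ ∀ z ∈ ball p r, ∀ z' ∈ ball p r, ‖f z' - f z‖ ≤ K * ‖z' - z‖ := by
  obtain ⟨γ, K, r, L, hγ, hγ1, hr, hK, hL, h⟩ := h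
  refine ⟨2 * K, min r (1 / 2), by positivity, by positivity, fun z hz z' hz' => ?_⟩
  have hz1 := ball_subset_ball (min_le_left r (1 / 2)) hz
  have hz1' := ball_subset_ball (min_le_left r (1 / 2)) hz'
  have hd : ‖z' - z‖ ≤ 1 := by
    have h1 := ball_subset_ball (min_le_right r (1 / 2)) hz
    have h2 := ball_subset_ball (min_le_right r (1 / 2)) hz'
    rw [mem_ball] at h1 h2
    rw [← dist_eq_norm]
    linarith [dist_triangle_right z' z p]
  have h1 := h z hz1 z' hz1'
  have h2 : ‖z' - z‖ ^ (1 + γ) ≤ ‖z' - z‖ := by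
    calc _ ≤ ‖z' - z‖ ^ (1 : ℝ) :=
          Real.rpow_le_rpow_of_exponent_ge' (norm_nonneg _) hd zero_le_one (by linarith)
      _ = _ := Real.rpow_one _
  calc ‖f z' - f z‖ = ‖(f z' - f z - L z (z' - z)) + L z (z' - z)‖ := by rw [sub_add_cancel]
    _ ≤ K * ‖z' - z‖ + K * ‖z' - z‖ := by
        refine (norm_add_le _ _).trans (add_le_add (h1.trans (by gcongr)) ?_)
        exact ((L z).le_opNorm _).trans (by gcongr; exact hL z hz1)
    _ = _ := by ring

theorem HasHolderTaylor.continuousAt (h : HasHolderTaylor f p) : ContinuousAt f p := by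
  obtain ⟨γ, K, r, L, hγ, hγ1, hr, hK, hL, h⟩ := h
  refine (hasFDerivAt_of_taylor (L := L p) (K := K) hγ ?_).continuousAt
  filter_upwards [ball_mem_nhds p hr] with z' hz' using h p (mem_ball_self hr) z' hz'

theorem HasHolderTaylor.eventually (h : HasHolderTaylor f p) : ∀ᶠ z in 𝓝 p, HasHolderTaylor f z := by
  obtain ⟨γ, K, r, L, hγ, hγ1, hr, hK, hL, h⟩ := h
  filter_upwards [ball_mem_nhds p hr] with q hq
  obtain ⟨r', hr', hsub⟩ := Metric.isOpen_iff.1 isOpen_ball q hq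
  exact ⟨γ, K, r', L, hγ, hγ1, hr', hK, fun z hz => hL z (hsub hz),
    fun z hz z' hz' => h z (hsub hz) z' (hsub hz')⟩

theorem HasHolderTaylor.congr {f' : ℂ → F} (h : HasHolderTaylor f p) (hf : f =ᶠ[𝓝 p] f') :
    HasHolderTaylor f' p := by
  obtain ⟨γ, K, r, L, hγ, hγ1, hr, hK, hL, h⟩ := h
  obtain ⟨δ, hδ, hδ'⟩ := Metric.eventually_nhds_iff_ball.1 hf
  refine ⟨γ, K, min r δ, L, hγ, hγ1, by positivity, hK,
    fun z hz => hL z (ball_subset_ball (min_le_left _ _) hz), fun z hz z' hz' => ?_⟩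
  rw [← hδ' z (ball_subset_ball (min_le_right _ _) hz),
    ← hδ' z' (ball_subset_ball (min_le_right _ _) hz')]
  exact h z (ball_subset_ball (min_le_left _ _) hz) z' (ball_subset_ball (min_le_left _ _) hz')

/-- The radius may be shrunk and the exponent lowered. -/
theorem HasHolderTaylor.exists_le (h : HasHolderTaylor f p) : ∃ γ₀ r₀ : ℝ, 0 < γ₀ ∧ γ₀ ≤ 1 ∧ 0 < r₀ ∧
    ∃ K : ℝ, 0 ≤ K ∧ ∀ γ r, γ ≤ γ₀ → 0 < γ → r ≤ r₀ →
    (∀ z ∈ ball p r, ‖fderiv ℝ f z‖ ≤ K ∧ HasFDerivAt f (fderiv ℝ f z) z) ∧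
    ∀ z ∈ ball p r, ∀ z' ∈ ball p r,
      ‖f z' - f z - fderiv ℝ f z (z' - z)‖ ≤ K * ‖z' - z‖ ^ (1 + γ) := by
  obtain ⟨γ₀, K, r, L, hγ, hγ1, hr, hK, hL, h⟩ := h
  have hd : ∀ z ∈ ball p r, HasFDerivAt f (L z) z := fun z hz => by
    refine hasFDerivAt_of_taylor (K := K) hγ ?_
    filter_upwards [isOpen_ball.mem_nhds hz] with z' hz' using h z hz z' hz'
  refine ⟨γ₀, min r (1 / 2), hγ, hγ1, by positivity, K, hK, fun γ r' hγ' hγ0 hr' => ⟨?_, ?_⟩⟩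
  · intro z hz
    have hz1 := ball_subset_ball (hr'.trans (min_le_left r (1 / 2))) hz
    rw [(hd z hz1).fderiv]
    exact ⟨hL z hz1, hd z hz1⟩
  · intro z hz z' hz'
    have hz1 := ball_subset_ball (hr'.trans (min_le_left r (1 / 2))) hz
    have hz1' := ball_subset_ball (hr'.trans (min_le_left r (1 / 2))) hz'
    rw [(hd z hz1).fderiv]
    refine (h z hz1 z' hz1').trans ?_
    gcongr ?_ * ?_
    refine Real.rpow_le_rpow_of_exponent_ge' (norm_nonneg _) ?_ (by linarith) (by linarith)
    have h1 := ball_subset_ball (hr'.trans (min_le_right r (1 / 2))) hz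
    have h2 := ball_subset_ball (hr'.trans (min_le_right r (1 / 2))) hz'
    rw [mem_ball] at h1 h2
    rw [← dist_eq_norm]
    linarith [dist_triangle_right z' z p]

theorem HasHolderTaylor.eventually_differentiableAt (h : HasHolderTaylor f p) :
    ∀ᶠ z in 𝓝 p, DifferentiableAt ℝ f z := by
  obtain ⟨γ, r, hγ, -, hr, K, hK, h⟩ := h.exists_le
  filter_upwards [ball_mem_nhds p hr] with z hz
  exact ((h γ r le_rfl hγ le_rfl).1 z hz).2.differentiableAt

theorem HasHolderTaylor.continuousAt_fderiv (h : HasHolderTaylor f p) :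
    ContinuousAt (fderiv ℝ f) p := by
  obtain ⟨γ, r, hγ, -, hr, K, hK, h⟩ := h.exists_le
  obtain ⟨h1, h2⟩ := h γ r le_rfl hγ le_rfl
  -- compare the expansions at `p` and at `z` on the circle of radius `‖z - p‖` about `z`
  have key : ∀ z ∈ ball p (r / 2), ‖fderiv ℝ f z - fderiv ℝ f p‖ ≤ K * (2 + 2 ^ (1 + γ)) * ‖z - p‖ ^ γ := by
    intro z hz
    have hz' : z ∈ ball p r := ball_subset_ball (by linarith) hz
    rw [mem_ball, dist_eq_norm] at hz
    rcases (norm_nonneg (z - p)).eq_or_lt with h0 | h0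
    · have : z = p := by rw [← sub_eq_zero, ← norm_eq_zero]; exact h0.symm
      subst this
      simp only [sub_self, norm_zero]; positivity
    set d := ‖z - p‖ with hd
    refine ContinuousLinearMap.opNorm_le_of_unit_norm (by positivity) fun w hw => ?_
    have hdw : ‖(d : ℂ) * w‖ = d := by rw [norm_mul, hw, mul_one, norm_real, Real.norm_of_nonneg h0.le]
    have hzw : ‖z + d * w - p‖ ≤ 2 * d := by
      rw [show z + d * w - p = (z - p) + d * w by ring]
      exact (norm_add_le _ _).trans (by rw [hdw]; linarith)
    have hzw' : z + d * w ∈ ball p r := by rw [mem_ball, dist_eq_norm]; linarith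
    have a := h2 p (mem_ball_self hr) _ hzw'
    have b := h2 z hz' _ hzw'
    have c := h2 p (mem_ball_self hr) z hz'
    rw [add_sub_cancel_left, hdw] at b
    rw [← hd] at c
    have a' : K * ‖z + d * w - p‖ ^ (1 + γ) ≤ K * (2 * d) ^ (1 + γ) := by gcongr
    rw [Real.mul_rpow (by norm_num) h0.le] at a'
    have e1 : (fderiv ℝ f z - fderiv ℝ f p) ((d : ℂ) * w) = (f (z + d * w) - f p -
        fderiv ℝ f p (z + d * w - p)) - (f (z + d * w) - f z - fderiv ℝ f z (d * w)) -
        (f z - f p - fderiv ℝ f p (z - p)) := by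
      rw [sub_apply, show z + d * w - p = (z - p) + d * w by ring, map_add]; abel
    have e2 : ‖(fderiv ℝ f z - fderiv ℝ f p) ((d : ℂ) * w)‖ ≤ K * (2 + 2 ^ (1 + γ)) * d ^ (1 + γ) := by
      rw [e1]
      refine (norm_sub_le _ _).trans ((add_le_add_left (norm_sub_le _ _) _).trans ?_)
      linarith
    have e3 : (fderiv ℝ f z - fderiv ℝ f p) ((d : ℂ) * w) = d • (fderiv ℝ f z - fderiv ℝ f p) w := by
      rw [← real_smul, map_smul]
    rw [e3, norm_smul, Real.norm_of_nonneg h0.le,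
      Real.rpow_one_add' h0.le (by linarith)] at e2
    refine le_of_mul_le_mul_left (e2.trans (le_of_eq ?_)) h0
    ring
  refine tendsto_iff_norm_sub_tendsto_zero.2 ?_
  refine squeeze_zero' (Eventually.of_forall fun _ => norm_nonneg _)
    (mem_of_superset (ball_mem_nhds p (half_pos hr)) fun z hz => key z hz) ?_
  have : Tendsto (fun z' : ℂ => ‖z' - p‖) (𝓝 p) (𝓝 0) := tendsto_norm_sub_self p
  have := (this.rpow_const (Or.inr hγ.le)).const_mul (K * (2 + 2 ^ (1 + γ)))
  rwa [Real.zero_rpow hγ.ne', mul_zero] at this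

theorem HasHolderTaylor.prodMk (hf : HasHolderTaylor f p) (hg : HasHolderTaylor g p) :
    HasHolderTaylor (fun z => (f z, g z)) p := by
  obtain ⟨γ, r, hγ, hγ1, hr, K, hK, h⟩ := hf.exists_le
  obtain ⟨γ', r', hγ', -, hr', K', hK', h'⟩ := hg.exists_le
  obtain ⟨h1, h2⟩ := h (min γ γ') (min r r') (min_le_left _ _) (by positivity) (min_le_left _ _)
  obtain ⟨h1', h2'⟩ := h' (min γ γ') (min r r') (min_le_right _ _) (by positivity) (min_le_right _ _)
  refine ⟨min γ γ', max K K', min r r', fun z => (fderiv ℝ f z).prod (fderiv ℝ g z), by positivity,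
    (min_le_left _ _).trans hγ1, by positivity, by positivity, fun z hz => ?_, fun z hz z' hz' => ?_⟩
  · refine ContinuousLinearMap.opNorm_le_bound _ (by positivity) fun w => ?_
    rw [ContinuousLinearMap.prod_apply, Prod.norm_def]
    refine max_le ?_ ?_
    · exact ((fderiv ℝ f z).le_opNorm w).trans (by gcongr; exact (h1 z hz).1.trans (le_max_left _ _))
    · exact ((fderiv ℝ g z).le_opNorm w).trans (by gcongr; exact (h1' z hz).1.trans (le_max_right _ _))
  · rw [Prod.norm_def]
    refine max_le ?_ ?_
    · exact (h2 z hz z' hz').trans (by gcongr; exact le_max_left _ _)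
    · exact (h2' z hz z' hz').trans (by gcongr; exact le_max_right _ _)

/-- Quadratic Taylor remainders of a `C²` function, uniform in both end points. -/
theorem exists_quadratic_taylor {E : Type} [NormedAddCommGroup E] [NormedSpace ℝ E] {φ : E → G} {q : E}
    (h : ContDiffAt ℝ 2 φ q) : ∃ K r : ℝ, 0 ≤ K ∧ 0 < r ∧
      (∀ y ∈ ball q r, ‖fderiv ℝ φ y‖ ≤ K ∧ DifferentiableAt ℝ φ y ∧ ContinuousAt (fderiv ℝ φ) y) ∧
      ∀ y ∈ ball q r, ∀ y' ∈ ball q r, ‖φ y' - φ y - fderiv ℝ φ y (y' - y)‖ ≤ K * ‖y' - y‖ ^ 2 := by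
  have h1 : ContDiffAt ℝ 1 (fderiv ℝ φ) q := h.fderiv_right (by norm_num)
  obtain ⟨K, t, ht, hK⟩ := h1.exists_lipschitzOnWith
  have h2 : ∀ᶠ y in 𝓝 q, DifferentiableAt ℝ φ y ∧ ContinuousAt (fderiv ℝ φ) y := by
    filter_upwards [h.eventually (by simp)] with y hy
    exact ⟨hy.differentiableAt (by simp), (hy.fderiv_right (m := 1) (by norm_num)).continuousAt⟩
  have h3 : ∀ᶠ y in 𝓝 q, ‖fderiv ℝ φ y‖ < ‖fderiv ℝ φ q‖ + 1 :=
    h1.continuousAt.norm.eventually (gt_mem_nhds (by linarith))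
  obtain ⟨r, hr, hr'⟩ := Metric.eventually_nhds_iff_ball.1 ((h2.and h3).and ht)
  refine ⟨max K (‖fderiv ℝ φ q‖ + 1), r, by positivity, hr, fun y hy =>
    ⟨(hr' y hy).1.2.le.trans (le_max_right _ _), (hr' y hy).1.1⟩, fun y hy y' hy' => ?_⟩
  have h4 : ∀ x ∈ segment ℝ y y', ‖fderiv ℝ φ x - fderiv ℝ φ y‖ ≤ max (K : ℝ) (‖fderiv ℝ φ q‖ + 1) * ‖y' - y‖ := by
    intro x hx
    have hxb : x ∈ ball q r := (convex_ball q r).segment_subset hy hy' hx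
    have := hK.norm_sub_le (hr' x hxb).2 (hr' y hy).2
    refine this.trans ?_
    gcongr
    · exact le_max_left _ _
    · exact norm_sub_le_of_mem_segment hx
  have := (convex_segment y y').norm_image_sub_le_of_norm_hasFDerivWithin_le' (f := φ)
    (f' := fderiv ℝ φ) (φ := fderiv ℝ φ y) (fun x hx =>
      (hr' x ((convex_ball q r).segment_subset hy hy' hx)).1.1.1.hasFDerivAt.hasFDerivWithinAt)
    h4 (left_mem_segment ℝ y y') (right_mem_segment ℝ y y')
  rw [pow_two, ← mul_assoc]
  exact this

/-- The class `C^{1,γ}` is stable under composition with `C²` maps: the quadratic remainder of `φ` is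
absorbed by the Lipschitz bound for `f`. -/
theorem HasHolderTaylor.comp {φ : F → G} (hf : HasHolderTaylor f p) (hφ : ContDiffAt ℝ 2 φ (f p)) :
    HasHolderTaylor (fun z => φ (f z)) p := by
  obtain ⟨K', δ, hK', hδ, hφ1, hφ2⟩ := exists_quadratic_taylor hφ
  have hev : ∀ᶠ z in 𝓝 p, f z ∈ ball (f p) δ := hf.continuousAt (ball_mem_nhds _ hδ)
  obtain ⟨r₂, hr₂, hr₂'⟩ := Metric.eventually_nhds_iff_ball.1 hev
  obtain ⟨K₁, r₁, hK₁, hr₁, hlip⟩ := hf.exists_lipschitz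
  obtain ⟨γ, r, hγ, hγ1, hr, K, hK, h⟩ := hf.exists_le
  set ρ := min (min r (1 / 2)) (min r₁ r₂) with hρ
  have hρr : ρ ≤ r := (min_le_left _ _).trans (min_le_left _ _)
  have hρ1 : ρ ≤ 1 / 2 := (min_le_left _ _).trans (min_le_right _ _)
  have hρ2 : ρ ≤ r₁ := (min_le_right _ _).trans (min_le_left _ _)
  have hρ3 : ρ ≤ r₂ := (min_le_right _ _).trans (min_le_right _ _)
  obtain ⟨h1, h2⟩ := h γ ρ le_rfl hγ hρr
  refine ⟨γ, K' * K + K' * K₁ ^ 2, ρ, fun z => (fderiv ℝ φ (f z)).comp (fderiv ℝ f z), hγ, hγ1,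
    by positivity, by positivity, fun z hz => ?_, fun z hz z' hz' => ?_⟩
  · refine ((fderiv ℝ φ (f z)).opNorm_comp_le _).trans ?_
    have e1 := (hφ1 _ (hr₂' z (ball_subset_ball hρ3 hz))).1
    have e2 := (h1 z hz).1
    calc _ ≤ K' * K := by gcongr
      _ ≤ _ := le_add_of_nonneg_right (by positivity)
  · have hd : ‖z' - z‖ ≤ 1 := by
      have h1 := ball_subset_ball hρ1 hz
      have h2 := ball_subset_ball hρ1 hz'
      rw [mem_ball] at h1 h2
      rw [← dist_eq_norm]
      linarith [dist_triangle_right z' z p]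
    have e1 := hφ2 _ (hr₂' z (ball_subset_ball hρ3 hz)) _ (hr₂' z' (ball_subset_ball hρ3 hz'))
    have e2 := h2 z hz z' hz'
    have e3 := hlip z (ball_subset_ball hρ2 hz) z' (ball_subset_ball hρ2 hz')
    have e4 := (hφ1 _ (hr₂' z (ball_subset_ball hρ3 hz))).1
    have e5 : ‖z' - z‖ ^ 2 ≤ ‖z' - z‖ ^ (1 + γ) := by
      rw [← Real.rpow_natCast]
      exact Real.rpow_le_rpow_of_exponent_ge' (norm_nonneg _) hd (by linarith) (by push_cast; linarith)
    have e6 : φ (f z') - φ (f z) - (fderiv ℝ φ (f z)).comp (fderiv ℝ f z) (z' - z) =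
        (φ (f z') - φ (f z) - fderiv ℝ φ (f z) (f z' - f z)) +
          fderiv ℝ φ (f z) (f z' - f z - fderiv ℝ f z (z' - z)) := by
      rw [ContinuousLinearMap.comp_apply, map_sub (fderiv ℝ φ (f z)) (f z' - f z)]; abel
    rw [e6]
    refine (norm_add_le _ _).trans ?_
    have e7 : ‖fderiv ℝ φ (f z) (f z' - f z - fderiv ℝ f z (z' - z))‖ ≤
        K' * (K * ‖z' - z‖ ^ (1 + γ)) :=
      ((fderiv ℝ φ (f z)).le_opNorm _).trans (by gcongr)
    have e8 : ‖φ (f z') - φ (f z) - fderiv ℝ φ (f z) (f z' - f z)‖ ≤ K' * (K₁ ^ 2 * ‖z' - z‖ ^ (1 + γ)) := by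
      refine e1.trans ?_
      gcongr
      calc ‖f z' - f z‖ ^ 2 ≤ (K₁ * ‖z' - z‖) ^ 2 := by gcongr
        _ = K₁ ^ 2 * ‖z' - z‖ ^ 2 := by ring
        _ ≤ _ := by gcongr
    linarith

end HolderTaylor

end SLTorus

namespace SLTorus
open MeasureTheory Metric Filter Topology Complex

/-! ### Weak solutions are of class `C^{1,γ}` -/

/-- Regularity of weak solutions near `p`, where `B` has expansions in `(z, v)` with the derivatives `α`
in `v` and `β` in `z`, and `α p > 0`. Hölder continuity of `v` with an exponent close to `1` improves
the remainder of these expansions to an order larger than `1` in `z` alone. -/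
theorem IsWeakSol.hasHolderTaylor {p : ℂ} {R : ℝ} (hR : 0 < R) {u v B : ℂ → ℝ}
    (hu : ContinuousOn u (ball p R)) (hv : ContinuousOn v (ball p R))
    (hB : ContinuousOn B (ball p R)) (hw : IsWeakSol (ball p R) u v B)
    {α : ℂ → ℝ} {β : ℂ → ℂ →L[ℝ] ℝ} {γ C : ℝ} (hγ : 0 < γ) (hγ1 : γ ≤ 1) (hC : 0 ≤ C)
    (hα : ContinuousAt α p) (hα0 : 0 < α p) (hβ : ∀ z ∈ ball p R, ‖β z‖ ≤ C)
    (hBv : ∀ z ∈ ball p R, ∀ z' ∈ ball p R,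
      |B z' - B z - α z * (v z' - v z) - β z (z' - z)| ≤
        C * (‖z' - z‖ + |v z' - v z|) ^ (1 + γ)) :
    HasHolderTaylor (cpx u v) p ∧ ∀ᶠ z in 𝓝 p,
      (fderiv ℝ (cpx u v) z 1).re = (fderiv ℝ (cpx u v) z I).im ∧
      α z * (fderiv ℝ (cpx u v) z 1).im + β z 1 = -(fderiv ℝ (cpx u v) z I).re := by
  set b₀ := Real.sqrt (α p) with hb₀
  have hb0 : 0 < b₀ := Real.sqrt_pos.2 hα0
  set m := max (max (2 * b₀) (2 / b₀)) 1 with hm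
  have hm1 : 1 ≤ m := le_max_right _ _
  have hm2 : 2 * b₀ ≤ m := (le_max_left _ _).trans (le_max_left _ _)
  have hm3 : m⁻¹ ≤ b₀ / 2 := by
    have : 2 / b₀ ≤ m := (le_max_right _ _).trans (le_max_left _ _)
    calc m⁻¹ ≤ (2 / b₀)⁻¹ := by gcongr
      _ = _ := inv_div _ _
  -- The Hölder exponent `s` of `v` is chosen such that `s (1 + γ) = 1 + γ / 2 > 1`.
  set s := (1 + γ / 2) / (1 + γ) with hs
  have hs0 : 0 < s := by positivity
  have hs1 : s < 1 := by rw [hs, div_lt_one (by linarith)]; linarith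
  have hsγ : s * (1 + γ) = 1 + γ / 2 := by rw [hs]; field_simp
  obtain ⟨ε, hε, hol⟩ := IsWeakSol.exists_holder hm1 hs0 hs1
  -- a neighbourhood where `α` is nearly constant and `v` oscillates little
  have hsm : ∀ᶠ t : ℝ in 𝓝[>] 0, C * (3 * t) ^ γ ≤ ε / 2 ∧ t ≤ 1 / 2 := by
    have h1 : Tendsto (fun t : ℝ => C * (3 * t) ^ γ) (𝓝 0) (𝓝 0) := by
      have : Tendsto (fun t : ℝ => 3 * t) (𝓝 0) (𝓝 0) := by
        simpa using (continuous_const_mul (3 : ℝ)).tendsto 0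
      have := (this.rpow_const (Or.inr hγ.le)).const_mul C
      rwa [Real.zero_rpow hγ.ne', mul_zero] at this
    exact eventually_nhdsWithin_of_eventually_nhds ((h1.eventually (ge_mem_nhds (half_pos hε))).and
      (ge_mem_nhds (by norm_num)))
  obtain ⟨t, ⟨ht, ht1⟩, ht0⟩ := (hsm.and self_mem_nhdsWithin).exists
  have ht0 : 0 < t := ht0
  have hvp : ContinuousAt v p := hv.continuousAt (ball_mem_nhds p hR)
  have hev : ∀ᶠ z in 𝓝 p, |v z - v p| < t / 2 ∧ |α z - α p| < ε / 2 ∧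
      |Real.sqrt (α z) - b₀| < b₀ / 2 ∧ 0 < α z := by
    have h1 : ∀ᶠ z in 𝓝 p, |v z - v p| < t / 2 := by
      simpa [Real.dist_eq] using Metric.tendsto_nhds.1 hvp (t / 2) (by positivity)
    have h2 : ∀ᶠ z in 𝓝 p, |α z - α p| < ε / 2 := by
      simpa [Real.dist_eq] using Metric.tendsto_nhds.1 hα (ε / 2) (by positivity)
    have h3 : ∀ᶠ z in 𝓝 p, |Real.sqrt (α z) - b₀| < b₀ / 2 := by
      simpa [Real.dist_eq] using Metric.tendsto_nhds.1 hα.sqrt (b₀ / 2) (by positivity)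
    exact h1.and (h2.and (h3.and (hα.eventually (lt_mem_nhds hα0))))
  obtain ⟨r₁, hr₁, hr₁'⟩ := Metric.eventually_nhds_iff_ball.1 hev
  set r := min (min (R / 2) (r₁ / 2)) (t / 2) with hr
  have hr0 : 0 < r := by positivity
  have hrR : closedBall p r ⊆ ball p R := closedBall_subset_ball (by
    have : r ≤ R / 2 := (min_le_left _ _).trans (min_le_left _ _)
    linarith)
  have hrr : closedBall p r ⊆ ball p r₁ := closedBall_subset_ball (by
    have : r ≤ r₁ / 2 := (min_le_left _ _).trans (min_le_right _ _)
    linarith)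
  have hdist : ∀ z ∈ closedBall p r, ∀ z' ∈ closedBall p r, ‖z' - z‖ ≤ t := by
    intro z hz z' hz'
    rw [mem_closedBall] at hz hz'
    rw [← dist_eq_norm]
    have : r ≤ t / 2 := min_le_right _ _
    linarith [dist_triangle_right z' z p]
  have hvd : ∀ z ∈ closedBall p r, ∀ z' ∈ closedBall p r, |v z' - v z| ≤ t := by
    intro z hz z' hz'
    have h1 := (hr₁' z (hrr hz)).1
    have h2 := (hr₁' z' (hrr hz')).1
    rw [abs_lt] at h1 h2
    rw [abs_le]
    constructor <;> linarith
  have hw' := hw.mono (ball_subset_closedBall.trans hrR)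
  have hbb : m⁻¹ ≤ b₀ ∧ b₀ ≤ m := ⟨by linarith, by linarith⟩
  obtain ⟨K, r₂, hK, hr₂, hKh⟩ := hol b₀ hbb.1 hbb.2 p r hr0 u v B (hu.mono hrR) (hv.mono hrR)
    (hB.mono hrR) hw' (C + ε / 2) (by positivity) (by
      intro z hz z' hz'
      have h1 := hBv z (hrR hz) z' (hrR hz')
      set X := ‖z' - z‖
      set Y := |v z' - v z|
      have hX : 0 ≤ X := norm_nonneg _
      have hY : 0 ≤ Y := abs_nonneg _
      have hXt : X ≤ t := hdist z hz z' hz'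
      have hYt : Y ≤ t := hvd z hz z' hz'
      have h2 : C * (X + Y) ^ (1 + γ) ≤ ε / 2 * (X + Y) := by
        rw [Real.rpow_one_add' (by positivity) (by linarith)]
        have : C * (X + Y) ^ γ ≤ ε / 2 := le_trans (by gcongr; linarith) ht
        calc C * ((X + Y) * (X + Y) ^ γ) = (C * (X + Y) ^ γ) * (X + Y) := by ring
          _ ≤ _ := by gcongr
      have h3 : |(α z - α p) * (v z' - v z)| ≤ ε / 2 * Y := by
        rw [abs_mul]
        gcongr
        exact (hr₁' z (hrr hz)).2.1.le
      have h4 : |β z (z' - z)| ≤ C * X :=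
        ((β z).le_opNorm _).trans (by gcongr; exact hβ z (hrR hz))
      rw [Real.sq_sqrt hα0.le]
      have e : B z' - B z - α p * (v z' - v z) =
        (B z' - B z - α z * (v z' - v z) - β z (z' - z)) + (α z - α p) * (v z' - v z) +
          β z (z' - z) := by ring
      rw [e]
      refine (abs_add_three _ _ _).trans ?_
      linarith)
  -- with the Hölder bound for `v`, the remainder is of order larger than `1`
  set ρ := min r (r₂ / 2) with hρ
  have hρ0 : 0 < ρ := by positivity
  have hρr : closedBall p ρ ⊆ closedBall p r := closedBall_subset_closedBall (min_le_left _ _)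
  have hρ2 : closedBall p ρ ⊆ ball p r₂ := closedBall_subset_ball (by
    have : ρ ≤ r₂ / 2 := min_le_right _ _
    linarith)
  obtain ⟨K', r', L, hr', hL, hKL⟩ := (hw'.mono (ball_subset_ball (min_le_left r (r₂ / 2)))).exists_taylor
    (s := 1 + γ / 2) hm1 (by linarith)
    (by linarith) hρ0 (hu.mono (hρr.trans hrR)) (hv.mono (hρr.trans hrR)) (hB.mono (hρr.trans hrR))
    (b := fun z => Real.sqrt (α z)) (β := β) (C₃ := C * (1 + K) ^ (1 + γ)) (D := C) (by positivity)
    (fun z hz => by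
      have := (hr₁' z (hrr (hρr (ball_subset_closedBall hz)))).2.2.1
      rw [abs_lt] at this
      constructor <;> linarith)
    (fun z hz => hβ z (hrR (hρr (ball_subset_closedBall hz))))
    (fun z hz z' hz' => by
      have hz1 := ball_subset_closedBall hz
      rw [Real.sq_sqrt (hr₁' z (hrr (hρr hz1))).2.2.2.le]
      refine (hBv z (hrR (hρr hz1)) z' (hrR (hρr hz'))).trans ?_
      rw [mul_assoc]
      gcongr
      have h1 : |v z' - v z| ≤ K * ‖z' - z‖ ^ s := by
        have : v z' - v z = (cpx u v z' - cpx u v z).im := by simp [cpx]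
        rw [this]
        exact (abs_im_le_norm _).trans (hKh z (hρ2 hz1) z' (hρ2 hz'))
      have h2 : ‖z' - z‖ ≤ ‖z' - z‖ ^ s := by
        nth_rewrite 1 [← Real.rpow_one ‖z' - z‖]
        exact Real.rpow_le_rpow_of_exponent_ge' (norm_nonneg _)
          ((hdist z (hρr hz1) z' (hρr hz')).trans (by linarith)) hs0.le hs1.le
      calc (‖z' - z‖ + |v z' - v z|) ^ (1 + γ) ≤ ((1 + K) * ‖z' - z‖ ^ s) ^ (1 + γ) := by
            gcongr; linarith
        _ = _ := by
            rw [Real.mul_rpow (by positivity) (by positivity), ← Real.rpow_mul (norm_nonneg _), hsγ])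
  have hK'0 : 0 ≤ K' := (norm_nonneg _).trans (hL p (mem_ball_self hr')).1
  have hLd : ∀ z ∈ ball p r', HasFDerivAt (cpx u v) (L z) z := fun z hz => by
    refine hasFDerivAt_of_taylor (γ := γ / 2) (K := K') (by positivity) ?_
    filter_upwards [isOpen_ball.mem_nhds hz] with z' hz' using hKL z hz z' hz'
  refine ⟨⟨γ / 2, K', r', L, by positivity, by linarith, hr', hK'0, fun z hz => (hL z hz).1, hKL⟩, ?_⟩
  filter_upwards [ball_mem_nhds p hr', ball_mem_nhds p hr₁] with z hz hz1
  rw [(hLd z hz).fderiv]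
  have := (hL z hz).2
  rwa [Real.sq_sqrt (hr₁' z hz1).2.2.2.le] at this

end SLTorus

namespace SLTorus
open MeasureTheory Metric Filter Topology Complex

/-! ### The classes `C^{m+1,γ}` -/

/-- `f` is of class `C^{m+1,γ}` near `p` for some `γ > 0`. -/
def IsHolderClass : ℕ → ∀ {F : Type} [NormedAddCommGroup F] [NormedSpace ℝ F], (ℂ → F) → ℂ → Prop
  | 0, _, _, _, f, p => HasHolderTaylor f p
  | m + 1, _, _, _, f, p => (∀ᶠ z in 𝓝 p, DifferentiableAt ℝ f z) ∧ IsHolderClass m (fderiv ℝ f) p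

theorem IsHolderClass.congr {m : ℕ} : ∀ {F : Type} [NormedAddCommGroup F] [NormedSpace ℝ F]
    {f f' : ℂ → F} {p : ℂ}, IsHolderClass m f p → f =ᶠ[𝓝 p] f' → IsHolderClass m f' p := by
  induction m with
  | zero => intro F _ _ f f' p h hf; exact HasHolderTaylor.congr h hf
  | succ m ih =>
    intro F _ _ f f' p h hf
    refine ⟨?_, ih h.2 hf.fderiv⟩
    filter_upwards [h.1, hf.eventuallyEq_nhds] with z hz hz'
    exact hz.congr_of_eventuallyEq hz'.symm

/-- A function whose derivative is of class `C^{1,γ}` is so itself, with exponent `1`. -/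
theorem HasHolderTaylor.of_fderiv {F : Type} [NormedAddCommGroup F] [NormedSpace ℝ F] {f : ℂ → F}
    {p : ℂ} (hd : ∀ᶠ z in 𝓝 p, DifferentiableAt ℝ f z) (h : HasHolderTaylor (fderiv ℝ f) p) :
    HasHolderTaylor f p := by
  obtain ⟨K, r, hK, hr, hlip⟩ := h.exists_lipschitz
  obtain ⟨r', hr', hd'⟩ := Metric.eventually_nhds_iff_ball.1 hd
  set ρ := min (min r r') 1 with hρ
  have hρ0 : 0 < ρ := by positivity
  have h1 : ball p ρ ⊆ ball p r := ball_subset_ball ((min_le_left _ _).trans (min_le_left _ _))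
  have h2 : ball p ρ ⊆ ball p r' := ball_subset_ball ((min_le_left _ _).trans (min_le_right _ _))
  refine ⟨1, ‖fderiv ℝ f p‖ + K, ρ, fderiv ℝ f, one_pos, le_rfl, hρ0, by positivity,
    fun z hz => ?_, fun z hz z' hz' => ?_⟩
  · have := hlip p (mem_ball_self hr) z (h1 hz)
    have h3 : ‖z - p‖ ≤ 1 := by
      rw [← dist_eq_norm]
      exact (mem_ball.1 hz).le.trans (min_le_right _ _)
    calc ‖fderiv ℝ f z‖ = ‖fderiv ℝ f p + (fderiv ℝ f z - fderiv ℝ f p)‖ := by rw [add_sub_cancel]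
      _ ≤ ‖fderiv ℝ f p‖ + K * ‖z - p‖ := (norm_add_le _ _).trans (by gcongr)
      _ ≤ ‖fderiv ℝ f p‖ + K * 1 := by gcongr
      _ = _ := by rw [mul_one]
  · have h4 : ∀ x ∈ segment ℝ z z', ‖fderiv ℝ f x - fderiv ℝ f z‖ ≤ K * ‖z' - z‖ := by
      intro x hx
      have hxb := (convex_ball p ρ).segment_subset hz hz' hx
      refine (hlip z (h1 hz) x (h1 hxb)).trans ?_
      gcongr
      exact norm_sub_le_of_mem_segment hx
    have := (convex_segment z z').norm_image_sub_le_of_norm_hasFDerivWithin_le' (f := f)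
      (f' := fderiv ℝ f) (φ := fderiv ℝ f z) (fun x hx =>
        (hd' x (h2 ((convex_ball p ρ).segment_subset hz hz' hx))).hasFDerivAt.hasFDerivWithinAt)
      h4 (left_mem_segment ℝ z z') (right_mem_segment ℝ z z')
    refine this.trans ?_
    rw [show (1 : ℝ) + 1 = (2 : ℕ) by norm_num, Real.rpow_natCast, pow_two, ← mul_assoc]
    gcongr
    exact le_add_of_nonneg_left (norm_nonneg _)

theorem IsHolderClass.of_succ {m : ℕ} : ∀ {F : Type} [NormedAddCommGroup F] [NormedSpace ℝ F]
    {f : ℂ → F} {p : ℂ}, IsHolderClass (m + 1) f p → IsHolderClass m f p := by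
  induction m with
  | zero => intro F _ _ f p h; exact HasHolderTaylor.of_fderiv h.1 h.2
  | succ m ih => intro F _ _ f p h; exact ⟨h.1, ih h.2⟩

theorem IsHolderClass.hasHolderTaylor {m : ℕ} {F : Type} [NormedAddCommGroup F] [NormedSpace ℝ F]
    {f : ℂ → F} {p : ℂ} (h : IsHolderClass m f p) : HasHolderTaylor f p := by
  induction m with
  | zero => exact h
  | succ m ih => exact ih h.of_succ

theorem IsHolderClass.contDiffAt {m : ℕ} : ∀ {F : Type} [NormedAddCommGroup F] [NormedSpace ℝ F]
    {f : ℂ → F} {p : ℂ}, IsHolderClass m f p → ContDiffAt ℝ m f p := by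
  induction m with
  | zero =>
    intro F _ _ f p h
    refine contDiffAt_zero.2 ⟨{z | ContinuousAt f z}, ?_, fun z hz => ContinuousAt.continuousWithinAt hz⟩
    exact (HasHolderTaylor.eventually h).mono fun z hz => hz.continuousAt
  | succ m ih =>
    intro F _ _ f p h
    push_cast
    exact contDiffAt_succ_iff_hasFDerivAt.2 ⟨fderiv ℝ f, ⟨_, h.1, fun z hz => hz.hasFDerivAt⟩, ih h.2⟩

/-- Composition with a linear map; the induction for `IsHolderClass.comp` uses this case. -/
theorem IsHolderClass.clm_comp {m : ℕ} : ∀ {F G : Type} [NormedAddCommGroup F] [NormedSpace ℝ F]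
    [NormedAddCommGroup G] [NormedSpace ℝ G] {f : ℂ → F} {p : ℂ} (A : F →L[ℝ] G),
    IsHolderClass m f p → IsHolderClass m (fun z => A (f z)) p := by
  induction m with
  | zero => intro F G _ _ _ _ f p A h; exact HasHolderTaylor.comp h A.contDiff.contDiffAt
  | succ m ih =>
    intro F G _ _ _ _ f p A h
    refine ⟨h.1.mono fun z hz => A.differentiableAt.comp z hz, ?_⟩
    refine (ih (ContinuousLinearMap.compL ℝ ℂ F G A) h.2).congr ?_
    filter_upwards [h.1] with z hz
    exact (A.hasFDerivAt.comp z hz.hasFDerivAt).fderiv.symm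

theorem IsHolderClass.prodMk {m : ℕ} : ∀ {F G : Type} [NormedAddCommGroup F] [NormedSpace ℝ F]
    [NormedAddCommGroup G] [NormedSpace ℝ G] {f : ℂ → F} {g : ℂ → G} {p : ℂ},
    IsHolderClass m f p → IsHolderClass m g p → IsHolderClass m (fun z => (f z, g z)) p := by
  induction m with
  | zero => intro F G _ _ _ _ f g p h h'; exact HasHolderTaylor.prodMk h h'
  | succ m ih =>
    intro F G _ _ _ _ f g p h h'
    refine ⟨(h.1.and h'.1).mono fun z hz => hz.1.prodMk hz.2, ?_⟩
    refine ((ih h.2 h'.2).clm_comp ((ContinuousLinearMap.prodₗᵢ (𝕜 := ℝ) (E := ℂ) (F := F) (G := G)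
      ℝ).toContinuousLinearEquiv.toContinuousLinearMap)).congr ?_
    filter_upwards [h.1, h'.1] with z hz hz'
    exact (hz.hasFDerivAt.prodMk hz'.hasFDerivAt).fderiv.symm

/-- The derivative of `φ ∘ f` is a bilinear expression in `φ' ∘ f`, of the class by induction, and `f'`. -/
theorem IsHolderClass.comp {m : ℕ} : ∀ {F G : Type} [NormedAddCommGroup F] [NormedSpace ℝ F]
    [NormedAddCommGroup G] [NormedSpace ℝ G] {f : ℂ → F} {φ : F → G} {p : ℂ},
    IsHolderClass m f p → ContDiffAt ℝ ∞ φ (f p) → IsHolderClass m (fun z => φ (f z)) p := by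
  have h2 : (2 : WithTop ℕ∞) ≤ ∞ := by
    simpa using (WithTop.coe_le_coe.2 le_top : ((2 : ℕ∞) : WithTop ℕ∞) ≤ ∞)
  induction m with
  | zero => intro F G _ _ _ _ f φ p h hφ; exact HasHolderTaylor.comp h (hφ.of_le h2)
  | succ m ih =>
    intro F G _ _ _ _ f φ p h hφ
    have hc : ContinuousAt f p := h.hasHolderTaylor.continuousAt
    have hd : ∀ᶠ z in 𝓝 p, DifferentiableAt ℝ φ (f z) := by
      refine hc.eventually ?_
      filter_upwards [(hφ.of_le h2).eventually (by simp)] with y hy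
      exact hy.differentiableAt (by simp)
    refine ⟨(h.1.and hd).mono fun z hz => hz.2.comp z hz.1, ?_⟩
    have h3 : ContDiffAt ℝ ∞ (fderiv ℝ φ) (f p) := hφ.fderiv_right (by simp)
    have h4 := (ih h.of_succ h3).prodMk h.2
    have h5 : ContDiff ℝ ∞ fun q : (F →L[ℝ] G) × (ℂ →L[ℝ] F) => q.1.comp q.2 :=
      contDiff_fst.clm_comp contDiff_snd
    refine (ih h4 h5.contDiffAt).congr ?_
    filter_upwards [h.1, hd] with z hz hz'
    exact (hz'.hasFDerivAt.comp z hz.hasFDerivAt).fderiv.symm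

theorem IsHolderClass.mul {m : ℕ} {f g : ℂ → ℝ} {p : ℂ} (hf : IsHolderClass m f p)
    (hg : IsHolderClass m g p) : IsHolderClass m (fun z => f z * g z) p :=
  (hf.prodMk hg).comp (φ := fun q : ℝ × ℝ => q.1 * q.2) (contDiff_fst.mul contDiff_snd).contDiffAt

theorem IsHolderClass.add {m : ℕ} {F : Type} [NormedAddCommGroup F] [NormedSpace ℝ F] {f g : ℂ → F}
    {p : ℂ} (hf : IsHolderClass m f p) (hg : IsHolderClass m g p) :
    IsHolderClass m (fun z => f z + g z) p :=
  (hf.prodMk hg).comp (φ := fun q : F × F => q.1 + q.2) (contDiff_fst.add contDiff_snd).contDiffAt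

theorem IsHolderClass.neg {m : ℕ} {F : Type} [NormedAddCommGroup F] [NormedSpace ℝ F] {f : ℂ → F}
    {p : ℂ} (hf : IsHolderClass m f p) : IsHolderClass m (fun z => -f z) p :=
  hf.comp (φ := fun q : F => -q) contDiff_neg.contDiffAt

theorem IsHolderClass.fderiv_apply {m : ℕ} {F : Type} [NormedAddCommGroup F] [NormedSpace ℝ F]
    {f : ℂ → F} {p : ℂ} (hf : IsHolderClass (m + 1) f p) (w : ℂ) :
    IsHolderClass m (fun z => fderiv ℝ f z w) p :=
  hf.2.clm_comp (ContinuousLinearMap.apply ℝ F w)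

theorem clm_eq_partials (A : ℂ →L[ℝ] ℝ) : A = A 1 • reCLM + A I • imCLM := by
  ext z
  have : z = z.re • (1 : ℂ) + z.im • I := by apply Complex.ext <;> simp
  conv_lhs => rw [this, map_add, map_smul, map_smul]
  simp [mul_comm]

theorem IsHolderClass.of_partials {m : ℕ} {f : ℂ → ℝ} {p : ℂ}
    (hd : ∀ᶠ z in 𝓝 p, DifferentiableAt ℝ f z) (h1 : IsHolderClass m (fun z => fderiv ℝ f z 1) p)
    (hI : IsHolderClass m (fun z => fderiv ℝ f z I) p) : IsHolderClass (m + 1) f p := by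
  refine ⟨hd, ?_⟩
  have a := (h1.clm_comp ((ContinuousLinearMap.id ℝ ℝ).smulRight reCLM)).add
    (hI.clm_comp ((ContinuousLinearMap.id ℝ ℝ).smulRight imCLM))
  refine a.congr (Eventually.of_forall fun z => ?_)
  simp only [ContinuousLinearMap.smulRight_apply, ContinuousLinearMap.id_apply]
  exact (clm_eq_partials _).symm

/-- Integration by parts against a test function. -/
theorem IsTest.integral_mul_fderiv_of_contDiffOn {O : Set ℂ} (hO : IsOpen O) {ζ f : ℂ → ℝ}
    (hζ : IsTest O ζ) (hf : ContDiffOn ℝ 1 f O) (w : ℂ) :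
    Integrable (fun z => fderiv ℝ f z w * ζ z) ∧ Integrable (fun z => f z * fderiv ℝ ζ z w) ∧
      ∫ z, f z * fderiv ℝ ζ z w = -∫ z, fderiv ℝ f z w * ζ z := by
  have i1 := hζ.integrable_mul hO
    ((hf.continuousOn_fderiv_of_isOpen hO le_rfl).clm_apply (continuousOn_const (c := w)))
  have i2 := (hζ.fderiv_apply w).integrable_mul hO hf.continuousOn
  refine ⟨i1, i2, integral_mul_fderiv_eq_neg_fderiv_mul_of_integrable i1 i2
    (hζ.integrable_mul hO hf.continuousOn) (fun z hz => ?_) fun z _ => hζ.differentiable z⟩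
  exact (hf.differentiableOn one_ne_zero).differentiableAt (hO.mem_nhds (hζ.tsupport_subset hz))

/-- Second derivatives commute in the sense of distributions. -/
theorem IsTest.integral_fderiv_mul_fderiv_comm {O : Set ℂ} (hO : IsOpen O) {η f : ℂ → ℝ}
    (hη : IsTest O η) (hf : ContDiffOn ℝ 1 f O) (v w : ℂ) :
    ∫ z, (fderiv ℝ f z v * fderiv ℝ η z w - fderiv ℝ f z w * fderiv ℝ η z v) = 0 := by
  obtain ⟨i1, -, h1⟩ := (hη.fderiv_apply w).integral_mul_fderiv_of_contDiffOn hO hf v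
  obtain ⟨i2, -, h2⟩ := (hη.fderiv_apply v).integral_mul_fderiv_of_contDiffOn hO hf w
  simp_rw [hη.fderiv_comm _ w v] at h1
  rw [integral_sub i1 i2]
  linarith

/-- The `x`-derivatives of a weak solution form a weak solution. -/
theorem IsWeakSol.fderiv_one {O : Set ℂ} (hO : IsOpen O) {u v B : ℂ → ℝ} (h : IsWeakSol O u v B)
    (hu : ContDiffOn ℝ 1 u O) (hv : ContDiffOn ℝ 1 v O) (hB : ContDiffOn ℝ 1 B O) :
    IsWeakSol O (fun z => fderiv ℝ u z 1) (fun z => fderiv ℝ v z 1) (fun z => fderiv ℝ B z 1) := by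
  intro η hη
  have ibp := fun (f : ℂ → ℝ) (hf : ContDiffOn ℝ 1 f O) (w : ℂ) =>
    (hη.fderiv_apply w).integral_mul_fderiv_of_contDiffOn hO hf 1
  simp_rw [hη.fderiv_comm _ _ 1] at ibp
  obtain ⟨k1, k2⟩ := h _ (hη.fderiv_apply 1)
  have u1 := ibp u hu 1
  have uI := ibp u hu I
  have vI := ibp v hv I
  have B1 := ibp B hB 1
  rw [integral_sub u1.2.1 vI.2.1, u1.2.2, vI.2.2] at k1
  rw [integral_add B1.2.1 uI.2.1, B1.2.2, uI.2.2] at k2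
  constructor
  · rw [integral_sub u1.1 vI.1]; linarith
  · rw [integral_add B1.1 uI.1]; linarith

end SLTorus

namespace SLTorus
open MeasureTheory Metric Filter Topology Complex

/-! ### Regularity for linear systems -/

/-- The real and imaginary parts of a function of class `C^{1,γ}`, and their derivatives. -/
theorem hasHolderTaylor_of_cpx {u v : ℂ → ℝ} {p : ℂ} (h : HasHolderTaylor (cpx u v) p) :
    HasHolderTaylor u p ∧ HasHolderTaylor v p ∧ ∀ᶠ z in 𝓝 p, ∀ w,
      fderiv ℝ u z w = (fderiv ℝ (cpx u v) z w).re ∧ fderiv ℝ v z w = (fderiv ℝ (cpx u v) z w).im := by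
  have eu : u = fun z => reCLM (cpx u v z) := by funext z; simp [cpx]
  have ev : v = fun z => imCLM (cpx u v z) := by funext z; simp [cpx]
  refine ⟨?_, ?_, ?_⟩
  · rw [eu]; exact h.comp reCLM.contDiff.contDiffAt
  · rw [ev]; exact h.comp imCLM.contDiff.contDiffAt
  · filter_upwards [h.eventually_differentiableAt] with z hz w
    constructor
    · conv_lhs => rw [eu]
      rw [show (fun z => reCLM (cpx u v z)) = reCLM ∘ cpx u v from rfl,
        (reCLM.hasFDerivAt.comp z hz.hasFDerivAt).fderiv]; rfl
    · conv_lhs => rw [ev]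
      rw [show (fun z => imCLM (cpx u v z)) = imCLM ∘ cpx u v from rfl,
        (imCLM.hasFDerivAt.comp z hz.hasFDerivAt).fderiv]; rfl

/-- Regularity for the linear system `u_x = v_y`, `(g v + E)_x = - u_y`: the base case. -/
theorem IsWeakSol.linear_hasHolderTaylor {p : ℂ} {R : ℝ} (hR : 0 < R) {u v g E : ℂ → ℝ}
    (hu : ContinuousOn u (ball p R)) (hv : ContinuousOn v (ball p R))
    (hg : HasHolderTaylor g p) (hE : HasHolderTaylor E p) (hg0 : 0 < g p)
    (hw : IsWeakSol (ball p R) u v fun z => g z * v z + E z) :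
    HasHolderTaylor u p ∧ HasHolderTaylor v p ∧ ∀ᶠ z in 𝓝 p,
      fderiv ℝ u z 1 = fderiv ℝ v z I ∧
      g z * fderiv ℝ v z 1 + fderiv ℝ g z 1 * v z + fderiv ℝ E z 1 = -fderiv ℝ u z I := by
  obtain ⟨K₁, r₁, hK₁, hr₁, hlip⟩ := hg.exists_lipschitz
  obtain ⟨γ, r₂, hγ, hγ1, hr₂, K₂, hK₂, hg2⟩ := hg.exists_le
  obtain ⟨γ', r₃, hγ', -, hr₃, K₃, hK₃, hE2⟩ := hE.exists_le
  have hvp : ContinuousAt v p := hv.continuousAt (ball_mem_nhds p hR)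
  have hvb : ∀ᶠ z in 𝓝 p, |v z - v p| < 1 / 4 := by
    simpa [Real.dist_eq] using Metric.tendsto_nhds.1 hvp (1 / 4) (by positivity)
  obtain ⟨r₄, hr₄, hr₄'⟩ := Metric.eventually_nhds_iff_ball.1 hvb
  set ρ := min (min R (1 / 4)) (min (min r₁ r₂) (min r₃ r₄)) with hρ
  have hρ0 : 0 < ρ := by positivity
  have hρR : ball p ρ ⊆ ball p R := ball_subset_ball ((min_le_left _ _).trans (min_le_left _ _))
  have hρ5 : ρ ≤ 1 / 4 := (min_le_left _ _).trans (min_le_right _ _)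
  have hρ1 : ball p ρ ⊆ ball p r₁ :=
    ball_subset_ball ((min_le_right _ _).trans ((min_le_left _ _).trans (min_le_left _ _)))
  have hρ2 : ρ ≤ r₂ := (min_le_right _ _).trans ((min_le_left _ _).trans (min_le_right _ _))
  have hρ3 : ρ ≤ r₃ := (min_le_right _ _).trans ((min_le_right _ _).trans (min_le_left _ _))
  have hρ4 : ball p ρ ⊆ ball p r₄ :=
    ball_subset_ball ((min_le_right _ _).trans ((min_le_right _ _).trans (min_le_right _ _)))
  obtain ⟨a1, a2⟩ := hg2 (min γ γ') ρ (min_le_left _ _) (by positivity) hρ2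
  obtain ⟨b1, b2⟩ := hE2 (min γ γ') ρ (min_le_right _ _) (by positivity) hρ3
  set σ := min γ γ' with hσ
  have hσ0 : 0 < σ := by positivity
  have hσ1 : σ ≤ 1 := (min_le_left _ _).trans hγ1
  set M := |v p| + 1 with hM
  have hvM : ∀ z ∈ ball p ρ, |v z| ≤ M := by
    intro z hz
    have h1 := hr₄' z (hρ4 hz)
    have := abs_sub_abs_le_abs_sub (v z) (v p)
    linarith
  have hM0 : 0 ≤ M := by positivity
  have hgc : ContinuousOn g (ball p ρ) := fun z hz => (a1 z hz).2.continuousAt.continuousWithinAt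
  have hEc : ContinuousOn E (ball p ρ) := fun z hz => (b1 z hz).2.continuousAt.continuousWithinAt
  have hmain := (hw.mono hρR).hasHolderTaylor (α := g)
    (β := fun z => v z • fderiv ℝ g z + fderiv ℝ E z) (γ := σ) (C := M * K₂ + K₃ + K₁) hρ0
    (hu.mono hρR) (hv.mono hρR) ((hgc.mul (hv.mono hρR)).add hEc) hσ0 hσ1 (by positivity)
    hg.continuousAt hg0 (fun z hz => by
      refine (norm_add_le _ _).trans ?_
      rw [norm_smul, Real.norm_eq_abs]
      have h1 : |v z| * ‖fderiv ℝ g z‖ ≤ M * K₂ := by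
        gcongr
        · exact hvM z hz
        · exact (a1 z hz).1
      have h2 := (b1 z hz).1
      linarith) (fun z hz z' hz' => by
      have e1 := a2 z hz z' hz'
      have e2 := b2 z hz z' hz'
      have e3 := hlip z (hρ1 hz) z' (hρ1 hz')
      rw [Real.norm_eq_abs] at e1 e2 e3
      have e4 := hvM z hz
      set X := ‖z' - z‖
      set Y := |v z' - v z|
      have hX0 : 0 ≤ X := norm_nonneg _
      have hY0 : 0 ≤ Y := abs_nonneg _
      have hX1 : X ≤ 1 / 2 := by
        rw [mem_ball] at hz hz'
        have := dist_triangle_right z' z p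
        rw [dist_eq_norm] at this
        linarith
      have hY1 : Y ≤ 1 / 2 := by
        have h1 := hr₄' z (hρ4 hz)
        have h2 := hr₄' z' (hρ4 hz')
        rw [abs_lt] at h1 h2
        exact abs_le.2 ⟨by linarith, by linarith⟩
      have e5 : X ^ (1 + σ) ≤ (X + Y) ^ (1 + σ) := by gcongr; linarith
      have e6 : X * Y ≤ (X + Y) ^ (1 + σ) := by
        calc X * Y ≤ (X + Y) ^ 2 := by nlinarith
          _ = (X + Y) ^ ((2 : ℕ) : ℝ) := (Real.rpow_natCast _ _).symm
          _ ≤ (X + Y) ^ (1 + σ) := Real.rpow_le_rpow_of_exponent_ge' (by positivity) (by linarith)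
              (by linarith) (by push_cast; linarith)
      have e7 : g z' * v z' + E z' - (g z * v z + E z) - g z * (v z' - v z) -
          (v z • fderiv ℝ g z + fderiv ℝ E z) (z' - z) =
          v z * (g z' - g z - fderiv ℝ g z (z' - z)) + (E z' - E z - fderiv ℝ E z (z' - z)) +
            (g z' - g z) * (v z' - v z) := by
        simp only [add_apply, smul_apply, smul_eq_mul]; ring
      refine (le_of_eq (congrArg abs e7)).trans ?_
      refine (abs_add_three _ _ _).trans ?_
      rw [abs_mul, abs_mul]
      have f1 : |v z| * |g z' - g z - fderiv ℝ g z (z' - z)| ≤ M * (K₂ * (X + Y) ^ (1 + σ)) := by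
        gcongr
        exact e1.trans (by gcongr)
      have f2 : |E z' - E z - fderiv ℝ E z (z' - z)| ≤ K₃ * (X + Y) ^ (1 + σ) :=
        e2.trans (by gcongr)
      have f3 : |g z' - g z| * |v z' - v z| ≤ K₁ * (X + Y) ^ (1 + σ) := by
        calc _ ≤ (K₁ * X) * Y := by gcongr
          _ = K₁ * (X * Y) := by ring
          _ ≤ _ := by gcongr
      linarith)
  obtain ⟨h1, h2⟩ := hmain
  obtain ⟨hu', hv', hd⟩ := hasHolderTaylor_of_cpx h1
  refine ⟨hu', hv', ?_⟩
  filter_upwards [h2, hd] with z hz hz'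
  rw [(hz' 1).1, (hz' 1).2, (hz' I).1, (hz' I).2]
  refine ⟨hz.1, ?_⟩
  have := hz.2
  simp only [add_apply, smul_apply, smul_eq_mul] at this
  linarith

theorem HasHolderTaylor.exists_contDiffOn {f : ℂ → ℝ} {p : ℂ} (h : HasHolderTaylor f p) :
    ∀ᶠ r in 𝓝[>] (0 : ℝ), ContDiffOn ℝ 1 f (ball p r) := by
  have h1 : ∀ᶠ z in 𝓝 p, DifferentiableAt ℝ f z ∧ ContinuousAt (fderiv ℝ f) z := by
    filter_upwards [h.eventually_differentiableAt, h.eventually] with z hz hz'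
    exact ⟨hz, hz'.continuousAt_fderiv⟩
  obtain ⟨r, hr, hr'⟩ := Metric.eventually_nhds_iff_ball.1 h1
  filter_upwards [Ioo_mem_nhdsGT hr] with ρ hρ
  have hsub : ball p ρ ⊆ ball p r := ball_subset_ball hρ.2.le
  rw [show (1 : WithTop ℕ∞) = 0 + 1 from (zero_add 1).symm,
    contDiffOn_succ_iff_fderiv_of_isOpen isOpen_ball]
  exact ⟨fun z hz => (hr' z (hsub hz)).1.differentiableWithinAt, by simp,
    contDiffOn_zero.2 fun z hz => (hr' z (hsub hz)).2.continuousWithinAt⟩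

/-- Regularity for the linear system `u_x = v_y`, `(g v + E)_x = - u_y`: solutions are as regular as
the coefficients. -/
theorem IsWeakSol.linear_isHolderClass {m : ℕ} : ∀ {p : ℂ} {R : ℝ}, 0 < R → ∀ {u v g E : ℂ → ℝ},
    ContinuousOn u (ball p R) → ContinuousOn v (ball p R) → IsHolderClass m g p →
    IsHolderClass m E p → 0 < g p → (IsWeakSol (ball p R) u v fun z => g z * v z + E z) →
    IsHolderClass m u p ∧ IsHolderClass m v p := by
  induction m with
  | zero =>
    intro p R hR u v g E hu hv hg hE hg0 hw
    have := hw.linear_hasHolderTaylor hR hu hv hg hE hg0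
    exact ⟨this.1, this.2.1⟩
  | succ m ih =>
    intro p R hR u v g E hu hv hg hE hg0 hw
    obtain ⟨hu1, hv1, heq⟩ := hw.linear_hasHolderTaylor hR hu hv hg.hasHolderTaylor
      hE.hasHolderTaylor hg0
    obtain ⟨hum, hvm⟩ := ih hR hu hv hg.of_succ hE.of_succ hg0 hw
    obtain ⟨r, ⟨⟨⟨⟨cu, cv⟩, cg⟩, cE⟩, hrR⟩, hr0⟩ := (((((hu1.exists_contDiffOn.and
      hv1.exists_contDiffOn).and hg.hasHolderTaylor.exists_contDiffOn).and
      hE.hasHolderTaylor.exists_contDiffOn).and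
      (eventually_nhdsWithin_of_eventually_nhds (ge_mem_nhds hR))).and self_mem_nhdsWithin).exists
    have hr0 : 0 < r := hr0
    have hw' := (hw.mono (ball_subset_ball hrR)).fderiv_one isOpen_ball cu cv ((cg.mul cv).add cE)
    have cont : ∀ f : ℂ → ℝ, ContDiffOn ℝ 1 f (ball p r) →
        ContinuousOn (fun z => fderiv ℝ f z 1) (ball p r) := fun f hf =>
      (hf.continuousOn_fderiv_of_isOpen isOpen_ball le_rfl).clm_apply continuousOn_const
    have diff : ∀ f : ℂ → ℝ, ContDiffOn ℝ 1 f (ball p r) → ∀ z ∈ ball p r, DifferentiableAt ℝ f z :=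
      fun f hf z hz => (hf.differentiableOn one_ne_zero).differentiableAt (isOpen_ball.mem_nhds hz)
    have hE' : IsHolderClass m (fun z => fderiv ℝ g z 1 * v z + fderiv ℝ E z 1) p :=
      ((hg.fderiv_apply 1).mul hvm).add (hE.fderiv_apply 1)
    -- The `x`-derivatives solve a system of the same form, with `E` replaced by `g_x v + E_x`.
    have hw'' : IsWeakSol (ball p r) (fun z => fderiv ℝ u z 1) (fun z => fderiv ℝ v z 1)
        fun z => g z * fderiv ℝ v z 1 + (fderiv ℝ g z 1 * v z + fderiv ℝ E z 1) := by
      intro η hη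
      refine ⟨(hw' η hη).1, ?_⟩
      rw [← (hw' η hη).2]
      refine integral_congr_ae (Eventually.of_forall fun z => ?_)
      by_cases hz : z ∈ ball p r
      · simp only
        have hf := ((diff g cg z hz).hasFDerivAt.mul (diff v cv z hz).hasFDerivAt).add
          (diff E cE z hz).hasFDerivAt
        have : fderiv ℝ (fun z => g z * v z + E z) z 1 =
            g z * fderiv ℝ v z 1 + (fderiv ℝ g z 1 * v z + fderiv ℝ E z 1) := by
          rw [show (fun z => g z * v z + E z) = (g * v + E) from rfl, hf.fderiv]
          simp; ring
        rw [this]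
      · simp [(hη.fderiv_apply 1).eq_zero hz, (hη.fderiv_apply I).eq_zero hz]
    obtain ⟨hux, hvx⟩ := ih hr0 (cont u cu) (cont v cv) hg.of_succ hE' hg0 hw''
    -- The equations express the `y`-derivatives by the `x`-derivatives.
    refine ⟨IsHolderClass.of_partials hu1.eventually_differentiableAt hux ?_,
      IsHolderClass.of_partials hv1.eventually_differentiableAt hvx ?_⟩
    · have : IsHolderClass m (fun z => -(g z * fderiv ℝ v z 1 +
          (fderiv ℝ g z 1 * v z + fderiv ℝ E z 1))) p := ((hg.of_succ.mul hvx).add hE').neg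
      refine this.congr ?_
      filter_upwards [heq] with z hz
      linarith [hz.2]
    · refine hux.congr ?_
      filter_upwards [heq] with z hz using hz.1

end SLTorus

namespace SLTorus
open MeasureTheory Metric Filter Topology Complex

/-! ### From pointwise to weak solutions -/

/-- The divergence theorem for compactly supported differentiable vector fields in the plane, whose
divergence is only assumed to be integrable. -/
theorem integral_divergence_eq_zero {f g : ℂ → ℝ} (hf : Differentiable ℝ f) (hg : Differentiable ℝ g)
    (hfc : HasCompactSupport f) (hgc : HasCompactSupport g)
    (hi : Integrable fun z => fderiv ℝ f z 1 + fderiv ℝ g z I) :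
    ∫ z, (fderiv ℝ f z 1 + fderiv ℝ g z I) = 0 := by
  set e : (ℝ × ℝ) ≃L[ℝ] ℂ := equivRealProdCLM.symm
  have he1 : e (1, 0) = 1 := rfl
  have he2 : e (0, 1) = I := rfl
  have hmp : MeasurePreserving e := volume_preserving_equiv_real_prod.symm
  have hme : MeasurableEmbedding e := measurableEquivRealProd.symm.measurableEmbedding
  obtain ⟨R, hR⟩ := (hfc.isBounded.union hgc.isBounded).subset_ball 0
  set r := max R 1 with hr
  have hr1 : 1 ≤ r := le_max_right _ _
  have hzero : ∀ z : ℂ, r ≤ ‖z‖ → z ∉ tsupport f ∧ z ∉ tsupport g := by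
    intro z hz
    have : z ∉ ball (0 : ℂ) R := by
      rw [mem_ball_zero_iff, not_lt]; exact (le_max_left _ _).trans hz
    exact ⟨fun h => this (hR (Or.inl h)), fun h => this (hR (Or.inr h))⟩
  have hn : ∀ q : ℝ × ℝ, |q.1| ≤ ‖e q‖ ∧ |q.2| ≤ ‖e q‖ := fun q => ⟨abs_re_le_norm (e q),
    abs_im_le_norm (e q)⟩
  have hd1 : ∀ q, HasFDerivAt (f ∘ e) ((fderiv ℝ f (e q)).comp (e : ℝ × ℝ →L[ℝ] ℂ)) q :=
    fun q => (hf (e q)).hasFDerivAt.comp q e.hasFDerivAt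
  have hd2 : ∀ q, HasFDerivAt (g ∘ e) ((fderiv ℝ g (e q)).comp (e : ℝ × ℝ →L[ℝ] ℂ)) q :=
    fun q => (hg (e q)).hasFDerivAt.comp q e.hasFDerivAt
  have hint : Integrable fun q : ℝ × ℝ => fderiv ℝ f (e q) 1 + fderiv ℝ g (e q) I :=
    (hmp.integrable_comp_emb hme).2 hi
  have key := integral_divergence_prod_Icc_of_hasFDerivAt_of_le (f ∘ e) (g ∘ e)
    (fun q => (fderiv ℝ f (e q)).comp (e : ℝ × ℝ →L[ℝ] ℂ))
    (fun q => (fderiv ℝ g (e q)).comp (e : ℝ × ℝ →L[ℝ] ℂ)) (-r, -r) (r, r)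
    ⟨by simp; linarith, by simp; linarith⟩
    (hf.continuous.comp e.continuous).continuousOn (hg.continuous.comp e.continuous).continuousOn
    (fun q _ => hd1 q) (fun q _ => hd2 q) hint.integrableOn
  simp only [ContinuousLinearMap.comp_apply, ContinuousLinearEquiv.coe_coe, he1, he2,
    Function.comp_apply] at key
  have z1 : ∀ x : ℝ, g (e (x, r)) = 0 ∧ g (e (x, -r)) = 0 ∧ f (e (r, x)) = 0 ∧ f (e (-r, x)) = 0 := by
    intro x
    have a1 := (hn (x, r)).2
    have a2 := (hn (x, -r)).2
    have a3 := (hn (r, x)).1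
    have a4 := (hn (-r, x)).1
    simp only [abs_neg, abs_of_pos (show (0 : ℝ) < r by linarith)] at a1 a2 a3 a4
    exact ⟨image_eq_zero_of_notMem_tsupport (hzero _ a1).2,
      image_eq_zero_of_notMem_tsupport (hzero _ a2).2,
      image_eq_zero_of_notMem_tsupport (hzero _ a3).1,
      image_eq_zero_of_notMem_tsupport (hzero _ a4).1⟩
  simp only [(z1 _).1, (z1 _).2.1, (z1 _).2.2.1, (z1 _).2.2.2, intervalIntegral.integral_zero,
    sub_zero, add_zero] at key
  rw [setIntegral_eq_integral_of_forall_compl_eq_zero] at key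
  · rw [← key]
    exact (hmp.integral_comp hme fun z => fderiv ℝ f z 1 + fderiv ℝ g z I).symm
  · intro q hq
    have hq' : r ≤ ‖e q‖ := by
      by_contra hlt
      push Not at hlt
      have h1 := abs_le.1 ((hn q).1.trans hlt.le)
      have h2 := abs_le.1 ((hn q).2.trans hlt.le)
      exact hq ⟨⟨h1.1, h2.1⟩, ⟨h1.2, h2.2⟩⟩
    have h1 : fderiv ℝ f (e q) = 0 := by
      by_contra hne
      exact (hzero _ hq').1 (support_fderiv_subset ℝ hne)
    have h2 : fderiv ℝ g (e q) = 0 := by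
      by_contra hne
      exact (hzero _ hq').2 (support_fderiv_subset ℝ hne)
    simp [h1, h2]

/-- The product with a test function on `O` is differentiable everywhere, though `f` need only be
differentiable on `O`. -/
theorem IsTest.mul_hasFDerivAt {O : Set ℂ} {η : ℂ → ℝ} (hη : IsTest O η) {f : ℂ → ℝ}
    (hf : ∀ z ∈ O, DifferentiableAt ℝ f z) (z : ℂ) :
    HasFDerivAt (fun z => f z * η z) (f z • fderiv ℝ η z + η z • fderiv ℝ f z) z := by
  by_cases hz : z ∈ tsupport η
  · exact (hf z (hη.tsupport_subset hz)).hasFDerivAt.mul (hη.differentiable z).hasFDerivAt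
  · have h1 : η =ᶠ[𝓝 z] 0 := notMem_tsupport_iff_eventuallyEq.1 hz
    have h2 : fderiv ℝ η z = 0 := by rw [h1.fderiv_eq]; simp
    rw [h2, h1.eq_of_nhds]
    simp only [smul_zero, Pi.zero_apply, zero_smul, add_zero]
    refine (hasFDerivAt_const (0 : ℝ) z).congr_of_eventuallyEq ?_
    filter_upwards [h1] with w hw
    simp [hw]

/-- A pair of functions with `f_x + g_y = 0` pointwise satisfies this equation weakly; the partial
derivatives are not assumed to be continuous or integrable. -/
theorem IsTest.integral_eq_zero {O : Set ℂ} (hO : IsOpen O) {η : ℂ → ℝ} (hη : IsTest O η) {f g : ℂ → ℝ}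
    (hf : ∀ z ∈ O, DifferentiableAt ℝ f z) (hg : ∀ z ∈ O, DifferentiableAt ℝ g z)
    (h : ∀ z ∈ O, fderiv ℝ f z 1 + fderiv ℝ g z I = 0) :
    ∫ z, (f z * fderiv ℝ η z 1 + g z * fderiv ℝ η z I) = 0 := by
  have hdf := hη.mul_hasFDerivAt hf
  have hdg := hη.mul_hasFDerivAt hg
  have e : ∀ z, fderiv ℝ (fun z => f z * η z) z 1 + fderiv ℝ (fun z => g z * η z) z I =
      f z * fderiv ℝ η z 1 + g z * fderiv ℝ η z I := by
    intro z
    rw [(hdf z).fderiv, (hdg z).fderiv]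
    simp only [add_apply, smul_apply, smul_eq_mul]
    by_cases hz : z ∈ O
    · linear_combination η z * h z hz
    · rw [hη.eq_zero hz]; ring
  have hcf : ContinuousOn f O := fun z hz => (hf z hz).continuousAt.continuousWithinAt
  have hcg : ContinuousOn g O := fun z hz => (hg z hz).continuousAt.continuousWithinAt
  have := integral_divergence_eq_zero (fun z => (hdf z).differentiableAt)
    (fun z => (hdg z).differentiableAt) hη.hasCompactSupport.mul_left hη.hasCompactSupport.mul_left (by
      simp_rw [e]
      exact ((hη.fderiv_apply 1).integrable_mul hO hcf).add
        ((hη.fderiv_apply I).integrable_mul hO hcg))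
  simp_rw [e] at this
  exact this

/-- Pointwise solutions are weak solutions; the derivatives are not assumed to be continuous. -/
theorem IsWeakSol.of_fderiv {O : Set ℂ} (hO : IsOpen O) {u v B : ℂ → ℝ}
    (hu : ∀ z ∈ O, DifferentiableAt ℝ u z) (hv : ∀ z ∈ O, DifferentiableAt ℝ v z)
    (hB : ∀ z ∈ O, DifferentiableAt ℝ B z)
    (h1 : ∀ z ∈ O, fderiv ℝ u z 1 = fderiv ℝ v z I)
    (h2 : ∀ z ∈ O, fderiv ℝ B z 1 = -fderiv ℝ u z I) : IsWeakSol O u v B := by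
  intro η hη
  refine ⟨?_, hη.integral_eq_zero hO hB hu fun z hz => by rw [h2 z hz]; ring⟩
  have := hη.integral_eq_zero hO hu (g := fun z => -v z) (fun z hz => (hv z hz).neg) fun z hz => by
    rw [show (fun z => -v z) = -v from rfl, fderiv_neg, h1 z hz]; simp
  simpa [sub_eq_add_neg] using this

end SLTorus

namespace SLTorus
open MeasureTheory Metric Filter Topology Complex

/-! ### Regularity for quasilinear systems -/

/-- An antiderivative of `g` in the first variable, with quadratic Taylor remainders. -/
theorem exists_antiderivative {g : ℝ × ℝ → ℝ} {q₀ : ℝ × ℝ} (hg : ContDiffAt ℝ 2 g q₀) :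
    ∃ (A β : ℝ × ℝ → ℝ) (C δ : ℝ), 0 ≤ C ∧ 0 < δ ∧ ∀ q ∈ ball q₀ δ, |β q| ≤ C ∧
      ∀ q' ∈ ball q₀ δ, |A q' - A q - g q * (q'.1 - q.1) - β q * (q'.2 - q.2)| ≤
        C * (|q'.1 - q.1| + |q'.2 - q.2|) ^ 2 := by
  obtain ⟨K, r, hK, hr, h1, h2⟩ := exists_quadratic_taylor hg
  have hlip : ∀ a ∈ ball q₀ r, ∀ b ∈ ball q₀ r, |g b - g a| ≤ K * ‖b - a‖ := fun a ha b hb =>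
    (convex_ball q₀ r).norm_image_sub_le_of_norm_fderiv_le (𝕜 := ℝ) (fun x hx => (h1 x hx).2.1)
      (fun x hx => (h1 x hx).1) ha hb
  have hmem : ∀ q : ℝ × ℝ, q ∈ ball q₀ r ↔ |q.1 - q₀.1| < r ∧ |q.2 - q₀.2| < r := by
    intro q
    rw [mem_ball, Prod.dist_eq, max_lt_iff, Real.dist_eq, Real.dist_eq]
  have hseg : ∀ {s a b : ℝ}, s ∈ Set.uIcc a b → |a - q₀.1| < r → |b - q₀.1| < r → |s - q₀.1| < r := by
    intro s a b hs ha hb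
    rw [abs_lt] at *
    rcases Set.mem_uIcc.1 hs with h | h <;> constructor <;> linarith [h.1, h.2]
  have h00 : |q₀.1 - q₀.1| < r := by simpa using hr
  have hcg : ∀ {y a b : ℝ}, |y - q₀.2| < r → |a - q₀.1| < r → |b - q₀.1| < r →
      IntervalIntegrable (fun s => g (s, y)) volume a b := by
    intro y a b hy ha hb
    refine ContinuousOn.intervalIntegrable fun s hs => ?_
    have := (h1 (s, y) ((hmem _).2 ⟨hseg hs ha hb, hy⟩)).2.1.continuousAt
    exact (this.comp (f := fun s : ℝ => (s, y)) (by fun_prop)).continuousWithinAt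
  have hcd : ∀ {y a b : ℝ}, |y - q₀.2| < r → |a - q₀.1| < r → |b - q₀.1| < r →
      IntervalIntegrable (fun s => fderiv ℝ g (s, y) (0, 1)) volume a b := by
    intro y a b hy ha hb
    refine ContinuousOn.intervalIntegrable fun s hs => ?_
    have := (h1 (s, y) ((hmem _).2 ⟨hseg hs ha hb, hy⟩)).2.2
    exact ((this.comp (f := fun s : ℝ => (s, y)) (by fun_prop)).clm_apply
      continuousAt_const).continuousWithinAt
  have h01 : ‖((0 : ℝ), (1 : ℝ))‖ = 1 := by simp [Prod.norm_def]
  refine ⟨fun q => ∫ s in q₀.1..q.1, g (s, q.2), fun q => ∫ s in q₀.1..q.1, fderiv ℝ g (s, q.2) (0, 1),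
    K + K * r, r, by positivity, hr, fun q hq => ⟨?_, fun q' hq' => ?_⟩⟩
  · obtain ⟨hq1, hq2⟩ := (hmem q).1 hq
    have : ‖∫ s in q₀.1..q.1, fderiv ℝ g (s, q.2) (0, 1)‖ ≤ K * |q.1 - q₀.1| := by
      refine intervalIntegral.norm_integral_le_of_norm_le_const fun s hs => ?_
      have := (fderiv ℝ g (s, q.2)).le_opNorm (0, 1)
      rw [h01, mul_one] at this
      exact this.trans (h1 (s, q.2)
        ((hmem (s, q.2)).2 ⟨hseg (Set.uIoc_subset_uIcc hs) h00 hq1, hq2⟩)).1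
    refine this.trans ?_
    have : K * |q.1 - q₀.1| ≤ K * r := by gcongr
    linarith
  · obtain ⟨hq1, hq2⟩ := (hmem q).1 hq
    obtain ⟨hq1', hq2'⟩ := (hmem q').1 hq'
    simp only
    have e1 : ∫ s in q₀.1..q'.1, g (s, q'.2) =
        (∫ s in q₀.1..q.1, g (s, q'.2)) + ∫ s in q.1..q'.1, g (s, q'.2) :=
      (intervalIntegral.integral_add_adjacent_intervals (hcg hq2' h00 hq1) (hcg hq2' hq1 hq1')).symm
    have e2 : (∫ s in q.1..q'.1, (g (s, q'.2) - g q)) =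
        (∫ s in q.1..q'.1, g (s, q'.2)) - g q * (q'.1 - q.1) := by
      rw [intervalIntegral.integral_sub (hcg hq2' hq1 hq1') (by simp), intervalIntegral.integral_const,
        smul_eq_mul, mul_comm]
    have e3 : (∫ s in q₀.1..q.1, (g (s, q'.2) - g (s, q.2) -
        fderiv ℝ g (s, q.2) (0, 1) * (q'.2 - q.2))) =
        (∫ s in q₀.1..q.1, g (s, q'.2)) - (∫ s in q₀.1..q.1, g (s, q.2)) -
          (∫ s in q₀.1..q.1, fderiv ℝ g (s, q.2) (0, 1)) * (q'.2 - q.2) := by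
      rw [intervalIntegral.integral_sub ((hcg hq2' h00 hq1).sub (hcg hq2 h00 hq1))
        ((hcd hq2 h00 hq1).mul_const _), intervalIntegral.integral_sub (hcg hq2' h00 hq1)
        (hcg hq2 h00 hq1), intervalIntegral.integral_mul_const]
    have e4 : ‖∫ s in q.1..q'.1, (g (s, q'.2) - g q)‖ ≤
        K * (|q'.1 - q.1| + |q'.2 - q.2|) * |q'.1 - q.1| := by
      refine intervalIntegral.norm_integral_le_of_norm_le_const fun s hs => ?_
      have hs' := Set.uIoc_subset_uIcc hs
      refine (hlip q hq (s, q'.2) ((hmem _).2 ⟨hseg hs' hq1 hq1', hq2'⟩)).trans ?_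
      gcongr
      rw [Prod.norm_def]
      have := Set.abs_sub_left_of_mem_uIcc hs'
      exact max_le (this.trans (le_add_of_nonneg_right (abs_nonneg _)))
        (le_add_of_nonneg_left (abs_nonneg _))
    have e5 : ‖∫ s in q₀.1..q.1, (g (s, q'.2) - g (s, q.2) -
        fderiv ℝ g (s, q.2) (0, 1) * (q'.2 - q.2))‖ ≤ K * |q'.2 - q.2| ^ 2 * |q.1 - q₀.1| := by
      refine intervalIntegral.norm_integral_le_of_norm_le_const fun s hs => ?_
      have hs1 := hseg (Set.uIoc_subset_uIcc hs) h00 hq1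
      have := h2 (s, q.2) ((hmem _).2 ⟨hs1, hq2⟩) (s, q'.2) ((hmem _).2 ⟨hs1, hq2'⟩)
      have e6 : ((s, q'.2) : ℝ × ℝ) - (s, q.2) = (q'.2 - q.2) • ((0 : ℝ), (1 : ℝ)) := by
        ext <;> simp
      rw [e6, map_smul, norm_smul, h01, mul_one, smul_eq_mul, mul_comm (q'.2 - q.2)] at this
      exact this
    have e7 : ∀ a b c d e f : ℝ, (a + b) - c - d - e = (b - d) + (a - c - e) := by intros; ring
    rw [e1, e7 _ _ _ _ _ 0, ← e2, ← e3]
    refine (abs_add_le _ _).trans ((add_le_add e4 e5).trans ?_)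
    have hX := abs_nonneg (q'.1 - q.1)
    have hY := abs_nonneg (q'.2 - q.2)
    have f1 : K * |q'.2 - q.2| ^ 2 * |q.1 - q₀.1| ≤ K * (|q'.1 - q.1| + |q'.2 - q.2|) ^ 2 * r := by
      gcongr
      linarith
    have f2 : K * (|q'.1 - q.1| + |q'.2 - q.2|) * |q'.1 - q.1| ≤
        K * (|q'.1 - q.1| + |q'.2 - q.2|) * (|q'.1 - q.1| + |q'.2 - q.2|) := by
      gcongr; linarith
    nlinarith

/-- Differentiable solutions of `u_x = v_y`, `u_y = - g(v, y) v_x` with `g` smooth and positive are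
smooth; the derivatives are not assumed to be continuous. With an antiderivative `A` of `g` in the
first variable, `A(v, y)_x = - u_y` is the second equation in divergence form, which gives `C^{1,γ}`
regularity; then the linear system for the `x`-derivatives is bootstrapped. -/
theorem contDiffAt_of_quasilinear {u v : ℂ → ℝ} {p : ℂ} {g : ℝ × ℝ → ℝ}
    (hg : ContDiffAt ℝ ∞ g (v p, p.im)) (hg0 : 0 < g (v p, p.im))
    (hd : ∀ᶠ z in 𝓝 p, DifferentiableAt ℝ u z ∧ DifferentiableAt ℝ v z ∧
      fderiv ℝ u z 1 = fderiv ℝ v z I ∧ fderiv ℝ u z I = -(g (v z, z.im) * fderiv ℝ v z 1)) :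
    ContDiffAt ℝ ∞ u p ∧ ContDiffAt ℝ ∞ v p := by
  have h2 : (2 : WithTop ℕ∞) ≤ ∞ := by
    simpa using (WithTop.coe_le_coe.2 le_top : ((2 : ℕ∞) : WithTop ℕ∞) ≤ ∞)
  obtain ⟨A, β, C, δ, hC, hδ, hA⟩ := exists_antiderivative (hg.of_le h2)
  set q : ℂ → ℝ × ℝ := fun z => (v z, z.im) with hq
  have hqc : ContinuousAt q p := by
    have : ContinuousAt v p := hd.self_of_nhds.2.1.continuousAt
    exact this.prodMk continuous_im.continuousAt
  obtain ⟨R, hR, hR'⟩ := Metric.eventually_nhds_iff_ball.1 (hd.and (hqc (ball_mem_nhds _ hδ)))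
  have hu : ContinuousOn u (ball p R) := fun z hz => (hR' z hz).1.1.continuousAt.continuousWithinAt
  have hv : ContinuousOn v (ball p R) := fun z hz => (hR' z hz).1.2.1.continuousAt.continuousWithinAt
  have hAd : ∀ z ∈ ball p R, HasFDerivAt (fun z => A (q z))
      (g (q z) • fderiv ℝ v z + β (q z) • imCLM) z := by
    intro z hz
    have hqz := (hR' z hz).2
    have hA' : HasFDerivAt A (g (q z) • ContinuousLinearMap.fst ℝ ℝ ℝ +
        β (q z) • ContinuousLinearMap.snd ℝ ℝ ℝ) (q z) := by
      refine .of_isLittleO ?_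
      have h1 : (fun x => A x - A (q z) - (g (q z) • ContinuousLinearMap.fst ℝ ℝ ℝ +
          β (q z) • ContinuousLinearMap.snd ℝ ℝ ℝ) (x - q z)) =O[𝓝 (q z)]
          fun x => ‖x - q z‖ ^ 2 := by
        refine Asymptotics.IsBigO.of_bound (C * 4) ?_
        filter_upwards [isOpen_ball.mem_nhds hqz] with x hx
        have := (hA _ hqz).2 x hx
        rw [Real.norm_eq_abs, norm_pow, norm_norm]
        simp only [add_apply, smul_apply, ContinuousLinearMap.coe_fst', ContinuousLinearMap.coe_snd',
          smul_eq_mul, Prod.fst_sub, Prod.snd_sub]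
        rw [← sub_sub]
        refine this.trans ?_
        rw [mul_assoc, show (4 : ℝ) * ‖x - q z‖ ^ 2 = (‖x - q z‖ + ‖x - q z‖) ^ 2 by ring]
        gcongr
        · exact norm_fst_le (x - q z)
        · exact norm_snd_le (x - q z)
      refine h1.trans_isLittleO ?_
      have := Asymptotics.isLittleO_norm_pow_id (E' := ℝ × ℝ) (n := 2) (by norm_num)
      have h3 := this.comp_tendsto (k := fun x => x - q z) (l' := 𝓝 (q z))
        (by simpa using (continuous_sub_right (q z)).tendsto (q z))
      exact h3
    have hqd : HasFDerivAt q ((fderiv ℝ v z).prod imCLM) z :=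
      (hR' z hz).1.2.1.hasFDerivAt.prodMk imCLM.hasFDerivAt
    refine (hA'.comp z hqd).congr_fderiv ?_
    ext w
    simp
  have hw : IsWeakSol (ball p R) u v fun z => A (q z) := by
    refine IsWeakSol.of_fderiv isOpen_ball (fun z hz => (hR' z hz).1.1) (fun z hz => (hR' z hz).1.2.1)
      (fun z hz => (hAd z hz).differentiableAt) (fun z hz => (hR' z hz).1.2.2.1) fun z hz => ?_
    rw [(hAd z hz).fderiv, (hR' z hz).1.2.2.2]
    simp [hq]
  have hT := hw.hasHolderTaylor hR hu hv (fun z hz => (hAd z hz).continuousAt.continuousWithinAt)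
    (α := fun z => g (q z)) (β := fun z => β (q z) • imCLM) (γ := 1) (C := C) one_pos le_rfl hC
    (ContinuousAt.comp (f := q) (x := p) hg.continuousAt hqc) hg0 (fun z hz => by
      rw [norm_smul, Real.norm_eq_abs, imCLM_norm, mul_one]
      exact (hA _ (hR' z hz).2).1) (fun z hz z' hz' => by
      have := (hA _ (hR' z hz).2).2 _ (hR' z' hz').2
      simp only [smul_apply, imCLM_apply, smul_eq_mul, sub_im]
      refine this.trans ?_
      rw [show (1 : ℝ) + 1 = (2 : ℕ) by norm_num, Real.rpow_natCast]
      gcongr C * ?_ ^ 2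
      rw [add_comm]
      gcongr
      have := abs_im_le_norm (z' - z)
      simpa using this)
  obtain ⟨hu0, hv0, -⟩ := hasHolderTaylor_of_cpx hT.1
  have hclass : ∀ m, IsHolderClass m u p ∧ IsHolderClass m v p := by
    intro m
    induction m with
    | zero => exact ⟨hu0, hv0⟩
    | succ m ih =>
      have him : IsHolderClass m (fun z : ℂ => z.im) p := by
        have : ∀ m, IsHolderClass m (fun z : ℂ => z) p := by
          intro m
          induction m with
          | zero =>
            exact ⟨1, 1, 1, fun _ => ContinuousLinearMap.id ℝ ℂ, one_pos, le_rfl, one_pos, zero_le_one,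
              fun _ _ => ContinuousLinearMap.norm_id_le, fun z _ z' _ => by simp; positivity⟩
          | succ m ih =>
            refine ⟨Eventually.of_forall fun z => differentiableAt_id, ?_⟩
            exact (ih.comp (φ := fun _ => ContinuousLinearMap.id ℝ ℂ) contDiffAt_const).congr
              (Eventually.of_forall fun z => fderiv_id.symm)
        exact (this m).clm_comp imCLM
      have hgm : IsHolderClass m (fun z => g (q z)) p := (ih.2.prodMk him).comp hg
      have h0 : IsHolderClass m (fun _ : ℂ => (0 : ℝ)) p :=
        him.comp (φ := fun _ => (0 : ℝ)) contDiffAt_const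
      obtain ⟨r, ⟨⟨cu, cv⟩, hrR⟩, hr0⟩ := (((hu0.exists_contDiffOn.and hv0.exists_contDiffOn).and
        (eventually_nhdsWithin_of_eventually_nhds (ge_mem_nhds hR))).and self_mem_nhdsWithin).exists
      have hr0 : 0 < r := hr0
      have cont : ∀ f : ℂ → ℝ, ContDiffOn ℝ 1 f (ball p r) →
          ContinuousOn (fun z => fderiv ℝ f z 1) (ball p r) := fun f hf =>
        (hf.continuousOn_fderiv_of_isOpen isOpen_ball le_rfl).clm_apply continuousOn_const
      -- By commuting derivatives, `(u_x, v_x)` solves the linear system with coefficient `g(v, y)`.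
      have hw'' : IsWeakSol (ball p r) (fun z => fderiv ℝ u z 1) (fun z => fderiv ℝ v z 1)
          fun z => g (q z) * fderiv ℝ v z 1 + 0 := by
        intro η hη
        have hs := ball_subset_ball (x := p) hrR
        constructor
        · refine Eq.trans ?_ (hη.integral_fderiv_mul_fderiv_comm isOpen_ball cv I 1)
          refine integral_congr_ae (Eventually.of_forall fun z => ?_)
          by_cases hz : z ∈ ball p r
          · simp only
            rw [(hR' z (hs hz)).1.2.2.1]
          · simp [(hη.fderiv_apply 1).eq_zero hz, (hη.fderiv_apply I).eq_zero hz]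
        · refine Eq.trans ?_ (hη.integral_fderiv_mul_fderiv_comm isOpen_ball cu 1 I)
          refine integral_congr_ae (Eventually.of_forall fun z => ?_)
          by_cases hz : z ∈ ball p r
          · simp only
            rw [(hR' z (hs hz)).1.2.2.2]
            ring
          · simp [(hη.fderiv_apply 1).eq_zero hz, (hη.fderiv_apply I).eq_zero hz]
      obtain ⟨hux, hvx⟩ := hw''.linear_isHolderClass hr0 (cont u cu) (cont v cv) hgm h0 hg0
      refine ⟨IsHolderClass.of_partials hu0.eventually_differentiableAt hux ?_,
        IsHolderClass.of_partials hv0.eventually_differentiableAt hvx ?_⟩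
      · refine ((hgm.mul hvx).neg).congr ?_
        filter_upwards [hd] with z hz using hz.2.2.2.symm
      · refine hux.congr ?_
        filter_upwards [hd] with z hz using hz.2.2.1
  exact ⟨contDiffAt_infty.2 fun m => (hclass m).1.contDiffAt,
    contDiffAt_infty.2 fun m => (hclass m).2.contDiffAt⟩

end SLTorus

namespace SLTorus
open Metric Filter Topology

/-! ### The root `w(v, y)` and regularity for the reduced equations -/

section Root
variable {k : ℕ} (a : Fin (k + 1) → ℝ)

theorem neg_minParam_le_root (v y : ℝ) : -minParam a ≤ root a v y :=
  (existsUnique_root a (show 0 ≤ v ^ 2 + y ^ 2 by positivity)).choose_spec.1.1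

theorem P_root (v y : ℝ) : P a (root a v y) = v ^ 2 + y ^ 2 :=
  (existsUnique_root a (show 0 ≤ v ^ 2 + y ^ 2 by positivity)).choose_spec.1.2

theorem eq_root {v y w : ℝ} (h : -minParam a ≤ w) (hw : P a w = v ^ 2 + y ^ 2) : w = root a v y :=
  (existsUnique_root a (show 0 ≤ v ^ 2 + y ^ 2 by positivity)).choose_spec.2 w ⟨h, hw⟩

theorem minParam_le (j : Fin (k + 1)) : minParam a ≤ a j := Finset.inf'_le _ (Finset.mem_univ j)

theorem exists_eq_minParam : ∃ j, a j = minParam a := by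
  obtain ⟨j, -, hj⟩ := Finset.exists_mem_eq_inf' (Finset.univ_nonempty (α := Fin (k + 1))) a
  exact ⟨j, hj.symm⟩

theorem P_neg_minParam : P a (-minParam a) = 0 := by
  obtain ⟨j, hj⟩ := exists_eq_minParam a
  exact Finset.prod_eq_zero (Finset.mem_univ j) (by rw [hj]; ring)

theorem root_zero : root a 0 0 = -minParam a :=
  (eq_root a le_rfl (by rw [P_neg_minParam]; norm_num)).symm

theorem root_add_nonneg (v y : ℝ) (j : Fin (k + 1)) : 0 ≤ root a v y + a j := by
  have := neg_minParam_le_root a v y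
  have := minParam_le a j
  linarith

theorem contDiff_P : ContDiff ℝ ∞ (P a) := by
  unfold P
  fun_prop

theorem contDiff_P' : ContDiff ℝ ∞ (P' a) := by
  unfold P'
  fun_prop

theorem hasDerivAt_P (w : ℝ) : HasDerivAt (P a) (P' a w) w := by
  have := HasDerivAt.fun_finsetProd (u := Finset.univ) (f := fun (j : Fin (k + 1)) (w : ℝ) => w + a j)
    (f' := fun _ => 1) (x := w) fun j _ => (hasDerivAt_id w).add_const (a j)
  simp only [smul_eq_mul, mul_one] at this
  exact this

variable {a}

theorem P'_pos {w : ℝ} {j₀ : Fin (k + 1)} (h0 : 0 ≤ w + a j₀) (h : ∀ i ≠ j₀, 0 < w + a i) :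
    0 < P' a w := by
  have h1 : ∀ i, 0 ≤ w + a i := fun i => by
    by_cases hi : i = j₀
    · rwa [hi]
    · exact (h i hi).le
  refine Finset.sum_pos' (fun j _ => Finset.prod_nonneg fun i _ => h1 i) ⟨j₀, Finset.mem_univ _, ?_⟩
  exact Finset.prod_pos fun i hi => h i (Finset.ne_of_mem_erase hi)

theorem root_add_pos {v y : ℝ} (h : (v, y) ≠ (0, 0)) (j : Fin (k + 1)) : 0 < root a v y + a j := by
  refine (root_add_nonneg a v y j).lt_of_ne fun h0 => h ?_
  have : v ^ 2 + y ^ 2 = 0 := by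
    rw [← P_root a v y]
    exact Finset.prod_eq_zero (Finset.mem_univ j) h0.symm
  have hv : v = 0 := by nlinarith [sq_nonneg v, sq_nonneg y]
  have hy : y = 0 := by nlinarith [sq_nonneg v, sq_nonneg y]
  rw [hv, hy]

theorem P'_root_pos_of_ne {v y : ℝ} (h : (v, y) ≠ (0, 0)) : 0 < P' a (root a v y) :=
  P'_pos (j₀ := 0) (root_add_nonneg a v y 0) fun i _ => root_add_pos h i

theorem P'_root_pos_of_minMultiplicity (h : minMultiplicity a = 1) (v y : ℝ) :
    0 < P' a (root a v y) := by
  obtain ⟨⟨j₀, hj₀⟩, huniq⟩ := Nat.card_eq_one_iff_exists.1 h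
  refine P'_pos (j₀ := j₀) (root_add_nonneg a v y j₀) fun i hi => ?_
  have h1 : a i ≠ minParam a := fun h' => hi (by simpa using huniq ⟨i, h'⟩)
  have h2 := (minParam_le a i).lt_of_ne h1.symm
  have := neg_minParam_le_root a v y
  linarith

/-- The root depends smoothly on `(v, y)` where `P'` does not vanish. -/
theorem contDiffAt_root {v₀ y₀ : ℝ} (h : 0 < P' a (root a v₀ y₀)) :
    ContDiffAt ℝ ∞ (fun q : ℝ × ℝ => root a q.1 q.2) (v₀, y₀) := by
  set w₀ := root a v₀ y₀ with hw₀
  have hs : HasStrictDerivAt (P a) (P' a w₀) w₀ :=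
    (contDiff_P a).contDiffAt.hasStrictDerivAt' (hasDerivAt_P a w₀) (by simp)
  have hf : HasStrictFDerivAt (P a)
      (ContinuousLinearEquiv.unitsEquivAut ℝ (Units.mk0 _ h.ne') : ℝ →L[ℝ] ℝ) w₀ :=
    hs.hasStrictFDerivAt_equiv h.ne'
  set φ := hf.localInverse (P a) _ w₀ with hφ
  have hφs : ContDiffAt ℝ ∞ φ (P a w₀) :=
    (contDiff_P a).contDiffAt.to_localInverse hf.hasFDerivAt (by simp)
  have hφ0 : φ (P a w₀) = w₀ := hf.localInverse_apply_image
  have hφr : ∀ᶠ s in 𝓝 (P a w₀), P a (φ s) = s := hf.eventually_right_inverse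
  -- `P` is strictly increasing near `w₀`
  have hpos : ∀ᶠ w in 𝓝 w₀, 0 < P' a w :=
    (contDiff_P' a).continuous.continuousAt.eventually (lt_mem_nhds h)
  obtain ⟨δ, hδ, hδ'⟩ := Metric.eventually_nhds_iff_ball.1 hpos
  have hmono : StrictMonoOn (P a) (ball w₀ δ) := by
    refine strictMonoOn_of_deriv_pos (convex_ball w₀ δ) (contDiff_P a).continuous.continuousOn ?_
    intro x hx
    rw [(hasDerivAt_P a x).deriv]
    exact hδ' x (interior_subset hx)
  have hev : ∀ᶠ s in 𝓝 (P a w₀), 0 ≤ s → -minParam a ≤ φ s := by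
    have h1 : ∀ᶠ s in 𝓝 (P a w₀), φ s ∈ ball w₀ δ := by
      refine hφs.continuousAt ?_
      rw [hφ0]
      exact ball_mem_nhds _ hδ
    filter_upwards [h1, hφr] with s h1 h2 hs0
    by_contra hlt
    push Not at hlt
    have hw := neg_minParam_le_root a v₀ y₀
    have h3 : -minParam a ∈ ball w₀ δ := by
      rw [mem_ball, Real.dist_eq, abs_lt] at h1 ⊢
      constructor <;> linarith [h1.1, h1.2]
    have h4 := hmono h1 h3 hlt
    rw [P_neg_minParam, h2] at h4
    linarith
  have hq : ContDiff ℝ ∞ fun q : ℝ × ℝ => q.1 ^ 2 + q.2 ^ 2 := by fun_prop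
  have hP0 : P a w₀ = v₀ ^ 2 + y₀ ^ 2 := P_root a v₀ y₀
  have hcomp : ContDiffAt ℝ ∞ (fun q : ℝ × ℝ => φ (q.1 ^ 2 + q.2 ^ 2)) (v₀, y₀) := by
    rw [hP0] at hφs
    exact hφs.comp (v₀, y₀) hq.contDiffAt
  refine hcomp.congr_of_eventuallyEq ?_
  have ht : Tendsto (fun q : ℝ × ℝ => q.1 ^ 2 + q.2 ^ 2) (𝓝 (v₀, y₀)) (𝓝 (P a w₀)) := by
    rw [hP0]
    exact hq.continuous.tendsto (v₀, y₀)
  filter_upwards [ht.eventually hev, ht.eventually hφr] with q h1 h2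
  exact (eq_root a (h1 (by positivity)) h2).symm

open Complex in
/-- Regularity of solutions of the reduced equations: where `P'(w(v, y)) > 0` the system is
elliptic, and differentiable solutions are smooth. -/
theorem contDiffAt_of_solvesAt {u v : ℝ × ℝ → ℝ} {q : ℝ × ℝ} (h : 0 < P' a (root a (v q) q.2))
    (hd : ∀ᶠ q' in 𝓝 q, DifferentiableAt ℝ u q' ∧ DifferentiableAt ℝ v q' ∧ SolvesAt a u v q') :
    ContDiffAt ℝ ∞ u q ∧ ContDiffAt ℝ ∞ v q := by
  set e : ℂ ≃L[ℝ] ℝ × ℝ := equivRealProdCLM with he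
  have he1 : e 1 = (1, 0) := rfl
  have he2 : e I = (0, 1) := rfl
  set p := e.symm q with hp
  have hep : e p = q := e.apply_symm_apply q
  have hroot := contDiffAt_root h
  have hP'r : ContDiffAt ℝ ∞ (fun x : ℝ × ℝ => P' a (root a x.1 x.2)) (v q, q.2) :=
    (contDiff_P' a).contDiffAt.comp _ hroot
  have hvc : ContinuousAt v q := hd.self_of_nhds.2.1.continuousAt
  have hP'ev : ∀ᶠ q' in 𝓝 q, 0 < P' a (root a (v q') q'.2) := by
    have h1 : ContinuousAt (fun q' : ℝ × ℝ => (v q', q'.2)) q := hvc.prodMk continuousAt_snd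
    have h2 : ContinuousAt (fun q' : ℝ × ℝ => P' a (root a (v q') q'.2)) q :=
      ContinuousAt.comp (f := fun q' : ℝ × ℝ => (v q', q'.2)) hP'r.continuousAt h1
    exact h2.eventually (lt_mem_nhds h)
  have hpim : p.im = q.2 := by rw [← hep]; rfl
  have key := contDiffAt_of_quasilinear (u := u ∘ e) (v := v ∘ e) (p := p)
    (g := fun x => (P' a (root a x.1 x.2))⁻¹) (by
      rw [Function.comp_apply, hep, hpim]
      exact hP'r.inv h.ne') (by
      simp only [Function.comp_apply, hep, hpim]
      positivity) (by
      have ht : Tendsto e (𝓝 p) (𝓝 q) := by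
        rw [← hep]; exact e.continuous.tendsto p
      filter_upwards [ht.eventually hd, ht.eventually hP'ev] with z hz hz'
      have d1 := hz.1.hasFDerivAt.comp z e.hasFDerivAt
      have d2 := hz.2.1.hasFDerivAt.comp z e.hasFDerivAt
      refine ⟨d1.differentiableAt, d2.differentiableAt, ?_, ?_⟩
      · rw [d1.fderiv, d2.fderiv]
        simpa [he1, he2] using hz.2.2.1
      · rw [d1.fderiv, d2.fderiv]
        have h2 := hz.2.2.2
        have h3 : (e z).2 = z.im := rfl
        rw [h3] at h2 hz'
        simp only [ContinuousLinearMap.comp_apply, ContinuousLinearEquiv.coe_coe, he1, he2,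
          Function.comp_apply]
        rw [h2]
        field_simp)
  have hu : u = (u ∘ e) ∘ e.symm := by funext x; simp
  have hv : v = (v ∘ e) ∘ e.symm := by funext x; simp
  rw [hu, hv]
  exact ⟨key.1.comp q e.symm.contDiff.contDiffAt, key.2.comp q e.symm.contDiff.contDiffAt⟩

end Root

end SLTorus

namespace SLTorus
open Matrix

/-! ### Special Lagrangian planes -/

/-- The hermitian product `∑ conj(x_l) y_l`. -/
noncomputable def herm {k : ℕ} (x y : Cn k) : ℂ := ∑ l, (starRingEnd ℂ) (x l) * y l

theorem re_herm {k : ℕ} (x y : Cn k) : (herm x y).re = inner ℝ x y := by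
  rw [PiLp.inner_apply, herm, Complex.re_sum]
  refine Finset.sum_congr rfl fun l _ => ?_
  rw [Complex.inner, mul_comm]

/-- A real subspace `T` of dimension `n` with a basis that is isotropic for the symplectic form
`Im ⟨·,·⟩` and on which `Ω` is positive is a special Lagrangian plane: in an orthonormal basis of `T`,
which is then unitary, `Ω` is real and of modulus `1`, and its sign can be adjusted. -/
theorem isSpecialLagrangianPlane_of_basis {k : ℕ} {T : Submodule ℝ (Cn k)}
    (hT : Module.finrank ℝ T = k + 2) {b : Fin (k + 2) → Cn k} (hb : ∀ i, b i ∈ T)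
    (hiso : ∀ i j, (herm (b i) (b j)).im = 0) {t : ℝ} (ht : 0 < t) (hΩ : Omega b = t) :
    IsSpecialLagrangianPlane T := by
  set e : OrthonormalBasis (Fin (k + 2)) ℝ T := (stdOrthonormalBasis ℝ T).reindex (finCongr hT)
  set E : Matrix (Fin (k + 2)) (Fin (k + 2)) ℂ := .of fun i j => (e j : Cn k) i with hE
  set B : Matrix (Fin (k + 2)) (Fin (k + 2)) ℂ := .of fun i j => b j i with hB
  set R : Matrix (Fin (k + 2)) (Fin (k + 2)) ℝ := .of fun i j => e.repr ⟨b j, hb j⟩ i with hR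
  have hBE : B = E * R.map Complex.ofRealHom := by
    ext l j
    have h1 := e.sum_repr ⟨b j, hb j⟩
    have h2 := congrArg (fun x : T => (x : Cn k) l) h1
    simp only [Submodule.coe_sum, Submodule.coe_smul, WithLp.ofLp_sum, Finset.sum_apply,
      WithLp.ofLp_smul, Pi.smul_apply, Complex.real_smul] at h2
    rw [Matrix.mul_apply]
    simp only [hB, hE, hR, Matrix.of_apply, Matrix.map_apply, Complex.ofRealHom_eq_coe]
    rw [← h2]
    exact Finset.sum_congr rfl fun i _ => mul_comm _ _
  have hdet :  (t : ℂ) = E.det * ((R.det : ℝ) : ℂ) := by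
    rw [← hΩ, Omega, show (Matrix.of fun i j => b j i) = B from rfl, hBE, Matrix.det_mul]
    congr 1
    exact (RingHom.map_det Complex.ofRealHom R).symm
  have hR0 : R.det ≠ 0 := by
    intro h0
    rw [h0] at hdet
    simp at hdet
    exact ht.ne' (by exact_mod_cast hdet)
  have hEreal : E.det = ( (t / R.det : ℝ) : ℂ) := by
    have : ((R.det : ℝ) : ℂ) ≠ 0 := by exact_mod_cast hR0
    push_cast
    rw [eq_div_iff this, hdet]
  -- the Gram matrix of `e` for the hermitian product is real
  set Q := R⁻¹ with hQ
  have hRQ : R.map Complex.ofRealHom * Q.map Complex.ofRealHom = 1 := by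
    rw [← Matrix.map_mul, Matrix.mul_nonsing_inv _ (isUnit_iff_ne_zero.2 hR0)]
    simp
  have hEB : E = B * Q.map Complex.ofRealHom := by
    rw [hBE, Matrix.mul_assoc, hRQ, Matrix.mul_one]
  set G : Matrix (Fin (k + 2)) (Fin (k + 2)) ℝ := .of fun i j => (herm (b i) (b j)).re
  have hG : Bᴴ * B = G.map Complex.ofRealHom := by
    ext i j
    rw [Matrix.mul_apply]
    simp only [Matrix.conjTranspose_apply, hB, Matrix.of_apply, Matrix.map_apply]
    apply Complex.ext
    · simp [G, herm]
    · have := hiso i j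
      rw [herm] at this
      simpa using this
  have hQt : (Q.map Complex.ofRealHom)ᴴ = Qᵀ.map Complex.ofRealHom := by
    ext i j; simp
  have hEE : Eᴴ * E = (Qᵀ * G * Q).map Complex.ofRealHom := by
    rw [hEB, Matrix.conjTranspose_mul, hQt, Matrix.mul_assoc, ← Matrix.mul_assoc Bᴴ, hG,
      ← Matrix.map_mul, ← Matrix.map_mul, ← Matrix.mul_assoc]
  have hone : Eᴴ * E = 1 := by
    ext i j
    apply Complex.ext
    · have h1 : ((Eᴴ * E) i j).re = (herm (e i : Cn k) (e j : Cn k)).re := by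
        rw [Matrix.mul_apply]; rfl
      rw [h1, re_herm, ← Submodule.coe_inner, e.inner_eq_ite, Matrix.one_apply]
      split_ifs <;> simp
    · rw [hEE, Matrix.one_apply]
      split_ifs <;> simp
  have hsq :  (t / R.det) ^ 2 = 1 := by
    have h1 := congrArg Matrix.det hone
    rw [Matrix.det_mul, Matrix.det_conjTranspose, Matrix.det_one, hEreal] at h1
    have h2 : star ( (t / R.det : ℝ) : ℂ) = ((t / R.det : ℝ) : ℂ) := Complex.conj_ofReal _
    rw [h2, ← Complex.ofReal_mul] at h1
    have h3 :  (t / R.det) * (t / R.det) = 1 := by exact_mod_cast h1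
    rw [sq, h3]
  rcases mul_self_eq_one_iff.1 ((sq _).symm.trans hsq) with h | h
  · exact ⟨e, by rw [Omega]; change E.det.re = 1; rw [hEreal, h]; simp⟩
  · refine ⟨e.reindex (Equiv.swap 0 1), ?_⟩
    have h1 : (Omega fun i => ((e.reindex (Equiv.swap 0 1)) i : Cn k)) =
        (E.submatrix id (Equiv.swap (0 : Fin (k + 2)) 1)).det := by
      rw [Omega]
      congr 1
      ext i j
      simp [hE]
    rw [h1, Matrix.det_permute', Equiv.Perm.sign_swap (by simp), hEreal, h]
    simp

end SLTorus

namespace SLTorus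
open Filter Topology

/-! ### The defining map of `N` -/

section DefiningMap
variable {k : ℕ}

/-- The coordinate `z_l` as a real-linear map. -/
noncomputable def coord (l : Fin (k + 2)) : Cn k →L[ℝ] ℂ :=
  (EuclideanSpace.proj l : Cn k →L[ℂ] ℂ).restrictScalars ℝ

@[simp] theorem coord_apply (l : Fin (k + 2)) (z : Cn k) : coord l z = z l := rfl

/-- The partial derivative of `prodCoord` with respect to the coordinate `z_j`. -/
noncomputable def prodErase (z : Cn k) (j : Fin (k + 1)) : ℂ :=
  Complex.I ^ ((k : ℤ) - 1) * ∏ i ∈ Finset.univ.erase j, z i.castSucc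

theorem prodErase_mul (z : Cn k) (j : Fin (k + 1)) :
    prodErase z j * z j.castSucc = prodCoord z := by
  rw [prodErase, prodCoord, mul_assoc, Finset.prod_erase_mul _ _ (Finset.mem_univ j)]

theorem prodErase_ne_zero {z : Cn k} {j₀ : Fin (k + 1)} (h : ∀ i ≠ j₀, z i.castSucc ≠ 0) :
    prodErase z j₀ ≠ 0 :=
  mul_ne_zero (zpow_ne_zero _ Complex.I_ne_zero)
    (Finset.prod_ne_zero_iff.2 fun i hi => h i (Finset.ne_of_mem_erase hi))

/-- The derivative of `prodCoord`. -/
noncomputable def prodDeriv (z : Cn k) : Cn k →L[ℝ] ℂ := ∑ j, prodErase z j • coord j.castSucc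

theorem prodDeriv_apply (z ξ : Cn k) : prodDeriv z ξ = ∑ j, prodErase z j * ξ j.castSucc := by
  simp [prodDeriv]

theorem contDiff_prodCoord {r : WithTop ℕ∞} : ContDiff ℝ r (prodCoord (k := k)) := by
  unfold prodCoord
  exact contDiff_const.mul (contDiff_prod fun j _ => (coord j.castSucc).contDiff)

theorem hasFDerivAt_prodCoord (z : Cn k) : HasFDerivAt prodCoord (prodDeriv z) z := by
  have h := (HasFDerivAt.finsetProd (u := Finset.univ) (g := fun (j : Fin (k + 1)) (z : Cn k) =>
    z j.castSucc) (g' := fun j => coord j.castSucc) (x := z)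
    fun j _ => (coord j.castSucc).hasFDerivAt).const_mul (Complex.I ^ ((k : ℤ) - 1))
  refine h.congr_fderiv ?_
  ext ξ
  simp [prodDeriv_apply, prodErase, Finset.mul_sum, mul_assoc]

/-- The derivative of `base`. -/
noncomputable def baseDeriv (z : Cn k) : Cn k →L[ℝ] ℝ × ℝ :=
  (Complex.reCLM ∘L coord (Fin.last (k + 1))).prod (Complex.imCLM ∘L prodDeriv z)

theorem baseDeriv_apply (z ξ : Cn k) :
    baseDeriv z ξ = ((ξ (Fin.last (k + 1))).re, (prodDeriv z ξ).im) := rfl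

theorem contDiff_base {r : WithTop ℕ∞} : ContDiff ℝ r (base (k := k)) :=
  (Complex.reCLM.contDiff.comp (coord (Fin.last (k + 1))).contDiff).prodMk
    (Complex.imCLM.contDiff.comp contDiff_prodCoord)

theorem continuous_base : Continuous (base (k := k)) := (contDiff_base (r := 0)).continuous

theorem hasFDerivAt_base (z : Cn k) : HasFDerivAt base (baseDeriv z) z :=
  (Complex.reCLM.hasFDerivAt.comp z (coord (Fin.last (k + 1))).hasFDerivAt).prodMk
    (Complex.imCLM.hasFDerivAt.comp z (hasFDerivAt_prodCoord z))

/-- The moment map of the torus action, shifted so that it vanishes on `N`. -/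
noncomputable def moment (a : Fin (k + 1) → ℝ) (j : Fin k) (z : Cn k) : ℝ :=
  ‖z j.castSucc.castSucc‖ ^ 2 - ‖z (Fin.last k).castSucc‖ ^ 2 - (a j.castSucc - a (Fin.last k))

/-- `Re (conj w ξ)`: half the derivative of `|w|²` in the direction `ξ`. -/
noncomputable def momentDeriv (z : Cn k) (j : Fin k) : Cn k →L[ℝ] ℝ :=
  2 • ((innerSL ℝ (z j.castSucc.castSucc)) ∘L coord j.castSucc.castSucc) -
    2 • ((innerSL ℝ (z (Fin.last k).castSucc)) ∘L coord (Fin.last k).castSucc)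

theorem momentDeriv_apply (z ξ : Cn k) (j : Fin k) : momentDeriv z j ξ =
    2 * (inner ℝ (z j.castSucc.castSucc) (ξ j.castSucc.castSucc) -
      inner ℝ (z (Fin.last k).castSucc) (ξ (Fin.last k).castSucc)) := by
  simp [momentDeriv]
  ring

theorem contDiff_moment {r : WithTop ℕ∞} (a : Fin (k + 1) → ℝ) (j : Fin k) :
    ContDiff ℝ r (moment a j) :=
  ((((coord j.castSucc.castSucc).contDiff.norm_sq ℝ).sub
    ((coord (Fin.last k).castSucc).contDiff.norm_sq ℝ))).sub contDiff_const

theorem hasFDerivAt_moment (a : Fin (k + 1) → ℝ) (j : Fin k) (z : Cn k) :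
    HasFDerivAt (moment a j) (momentDeriv z j) z :=
  ((coord j.castSucc.castSucc).hasFDerivAt.norm_sq.sub
    (coord (Fin.last k).castSucc).hasFDerivAt.norm_sq).sub_const _

theorem mem_N_iff {a : Fin (k + 1) → ℝ} {S : Set (ℝ × ℝ)} {u v : ℝ × ℝ → ℝ} {z : Cn k} :
    z ∈ N a S u v ↔ base z ∈ S ∧ (∀ j, moment a j z = 0) ∧ (prodCoord z).re = v (base z) ∧
      (z (Fin.last (k + 1))).im = u (base z) := by
  constructor
  · rintro ⟨hm, q, hq, h1, h2⟩
    have hb : base z = q := by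
      apply Prod.ext
      · rw [base, h2]; simp
      · rw [base, h1]; simp
    rw [hb]
    refine ⟨hq, fun j => sub_eq_zero.2 (hm j), by rw [h1]; simp, by rw [h2]; simp⟩
  · rintro ⟨hS, hm, h1, h2⟩
    refine ⟨fun j => sub_eq_zero.1 (hm j), base z, hS, ?_, ?_⟩
    · rw [← h1]; exact (Complex.re_add_im _).symm
    · rw [← h2]; exact (Complex.re_add_im _).symm

theorem norm_prodCoord_sq (z : Cn k) : ‖prodCoord z‖ ^ 2 = ∏ j : Fin (k + 1), ‖z j.castSucc‖ ^ 2 := by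
  rw [prodCoord, norm_mul, norm_zpow, Complex.norm_I, one_zpow, one_mul, norm_prod,
    Finset.prod_pow]

/-- On the common zero set of the moments the moduli of the coordinates are determined by the value
of the product: `|z_j|² = w + a_j`. -/
theorem norm_sq_eq_of_moment {a : Fin (k + 1) → ℝ} {z : Cn k} (h : ∀ j, moment a j z = 0)
    (j : Fin (k + 1)) :
    ‖z j.castSucc‖ ^ 2 = root a (prodCoord z).re (prodCoord z).im + a j := by
  set s := ‖z (Fin.last k).castSucc‖ ^ 2 - a (Fin.last k) with hs
  have h1 : ∀ j : Fin (k + 1), ‖z j.castSucc‖ ^ 2 = s + a j := by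
    intro j
    refine Fin.lastCases ?_ (fun j => ?_) j
    · rw [hs]; ring
    · have := h j
      rw [moment] at this
      rw [hs]; linarith
  have h2 : s = root a (prodCoord z).re (prodCoord z).im := by
    refine eq_root a ?_ ?_
    · obtain ⟨j, hj⟩ := exists_eq_minParam a
      have := h1 j
      rw [← hj]
      nlinarith [sq_nonneg ‖z j.castSucc‖]
    · have h3 := norm_prodCoord_sq z
      rw [← Complex.normSq_eq_norm_sq, Complex.normSq_apply] at h3
      rw [P, sq, sq, h3]
      exact Finset.prod_congr rfl fun j _ => (h1 j).symm
  rw [h1, h2]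

theorem norm_sq_of_mem {a : Fin (k + 1) → ℝ} {S : Set (ℝ × ℝ)} {u v : ℝ × ℝ → ℝ} {z : Cn k}
    (hz : z ∈ N a S u v) (j : Fin (k + 1)) :
    ‖z j.castSucc‖ ^ 2 = root a (v (base z)) (base z).2 + a j := by
  obtain ⟨-, hm, h1, -⟩ := mem_N_iff.1 hz
  rw [norm_sq_eq_of_moment hm, h1]
  rfl

/-- At a point of `N` with `P'(w) > 0` at most one of `z₁, …, z_{n-1}` vanishes. -/
theorem exists_forall_ne_zero {a : Fin (k + 1) → ℝ} {S : Set (ℝ × ℝ)} {u v : ℝ × ℝ → ℝ} {z : Cn k}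
    (hz : z ∈ N a S u v) (hP : 0 < P' a (root a (v (base z)) (base z).2)) :
    ∃ j₀, ∀ i ≠ j₀, z (Fin.castSucc i) ≠ 0 := by
  obtain ⟨j₀, -, hj₀⟩ := Finset.exists_ne_zero_of_sum_ne_zero hP.ne'
  refine ⟨j₀, fun i hi h0 => ?_⟩
  have h1 := Finset.prod_ne_zero_iff.1 hj₀ i (by simp [hi])
  rw [← norm_sq_of_mem hz, h0] at h1
  simp at h1

/-- The map `(moments, Re prodCoord - v, Im z_n - u)` whose zero set is `N`. -/
noncomputable def definingMap (a : Fin (k + 1) → ℝ) (u v : ℝ × ℝ → ℝ) (z : Cn k) :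
    EuclideanSpace ℝ (Fin (k + 2)) :=
  WithLp.toLp 2 (Fin.snoc (α := fun _ => ℝ)
    (Fin.snoc (α := fun _ => ℝ) (fun j : Fin k => moment a j z) ((prodCoord z).re - v (base z)))
    ((z (Fin.last (k + 1))).im - u (base z)))

section Components
variable (a : Fin (k + 1) → ℝ) (u v : ℝ × ℝ → ℝ) (z : Cn k)

@[simp] theorem definingMap_moment (j : Fin k) :
    definingMap a u v z j.castSucc.castSucc = moment a j z := by simp [definingMap]

@[simp] theorem definingMap_prod :
    definingMap a u v z (Fin.last k).castSucc = (prodCoord z).re - v (base z) := by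
  simp [definingMap]

@[simp] theorem definingMap_last :
    definingMap a u v z (Fin.last (k + 1)) = (z (Fin.last (k + 1))).im - u (base z) := by
  simp [definingMap]

theorem forall_index {p : Fin (k + 2) → Prop} : (∀ i, p i) ↔
    (∀ j : Fin k, p j.castSucc.castSucc) ∧ p (Fin.last k).castSucc ∧ p (Fin.last (k + 1)) := by
  constructor
  · exact fun h => ⟨fun j => h _, h _, h _⟩
  · rintro ⟨h1, h2, h3⟩ i
    refine Fin.lastCases h3 (fun i => ?_) i
    exact Fin.lastCases h2 h1 i

theorem definingMap_eq_zero_iff : definingMap a u v z = 0 ↔ (∀ j, moment a j z = 0) ∧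
    (prodCoord z).re = v (base z) ∧ (z (Fin.last (k + 1))).im = u (base z) := by
  have : definingMap a u v z = 0 ↔ ∀ i, definingMap a u v z i = 0 :=
    ⟨fun h i => by rw [h]; rfl, fun h => by ext i; exact h i⟩
  rw [this, forall_index]
  simp [sub_eq_zero]

end Components

section Derivative
variable (a : Fin (k + 1) → ℝ) {u v : ℝ × ℝ → ℝ} {z : Cn k}

theorem contDiffAt_definingMap {r : WithTop ℕ∞} (hu : ContDiffAt ℝ r u (base z))
    (hv : ContDiffAt ℝ r v (base z)) : ContDiffAt ℝ r (definingMap a u v) z := by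
  rw [contDiffAt_euclidean, forall_index]
  simp only [definingMap_moment, definingMap_prod, definingMap_last]
  exact ⟨fun j => (contDiff_moment a j).contDiffAt,
    (Complex.reCLM.contDiff.comp contDiff_prodCoord).contDiffAt.sub
      (hv.comp z contDiff_base.contDiffAt),
    (Complex.imCLM.contDiff.comp (coord (Fin.last (k + 1))).contDiff).contDiffAt.sub
      (hu.comp z contDiff_base.contDiffAt)⟩

variable {a} in
theorem fderiv_component {F : Cn k → EuclideanSpace ℝ (Fin (k + 2))} (hF : DifferentiableAt ℝ F z)
    {i : Fin (k + 2)} {f' : Cn k →L[ℝ] ℝ} (h : HasFDerivAt (fun z => F z i) f' z) (ξ : Cn k) :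
    fderiv ℝ F z ξ i = f' ξ := by
  have h1 := (EuclideanSpace.proj i : EuclideanSpace ℝ (Fin (k + 2)) →L[ℝ] ℝ).hasFDerivAt.comp z
    hF.hasFDerivAt
  exact DFunLike.congr_fun (h1.unique h) ξ

variable (hu : DifferentiableAt ℝ u (base z)) (hv : DifferentiableAt ℝ v (base z))
include hu hv

theorem differentiableAt_definingMap : DifferentiableAt ℝ (definingMap a u v) z := by
  rw [differentiableAt_euclidean, forall_index]
  simp only [definingMap_moment, definingMap_prod, definingMap_last]
  exact ⟨fun j => (hasFDerivAt_moment a j z).differentiableAt,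
    (Complex.reCLM.hasFDerivAt.comp z (hasFDerivAt_prodCoord z)).differentiableAt.sub
      (hv.comp z (hasFDerivAt_base z).differentiableAt),
    (Complex.imCLM.differentiableAt.comp z (coord (Fin.last (k + 1))).differentiableAt).sub
      (hu.comp z (hasFDerivAt_base z).differentiableAt)⟩

theorem fderiv_definingMap_moment (ξ : Cn k) (j : Fin k) :
    fderiv ℝ (definingMap a u v) z ξ j.castSucc.castSucc =
      2 * (inner ℝ (z j.castSucc.castSucc) (ξ j.castSucc.castSucc) -
      inner ℝ (z (Fin.last k).castSucc) (ξ (Fin.last k).castSucc)) := by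
  rw [← momentDeriv_apply]
  refine fderiv_component (differentiableAt_definingMap a hu hv) ?_ ξ
  simp only [definingMap_moment]
  exact hasFDerivAt_moment a j z

theorem fderiv_definingMap_prod (ξ : Cn k) :
    fderiv ℝ (definingMap a u v) z ξ (Fin.last k).castSucc =
      (prodDeriv z ξ).re - fderiv ℝ v (base z) (baseDeriv z ξ) := by
  refine fderiv_component (f' := Complex.reCLM ∘L prodDeriv z - fderiv ℝ v (base z) ∘L baseDeriv z)
    (differentiableAt_definingMap a hu hv) ?_ ξ
  simp only [definingMap_prod]
  exact (Complex.reCLM.hasFDerivAt.comp z (hasFDerivAt_prodCoord z)).sub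
    (hv.hasFDerivAt.comp z (hasFDerivAt_base z))

theorem fderiv_definingMap_last (ξ : Cn k) :
    fderiv ℝ (definingMap a u v) z ξ (Fin.last (k + 1)) =
      (ξ (Fin.last (k + 1))).im - fderiv ℝ u (base z) (baseDeriv z ξ) := by
  refine fderiv_component (f' := Complex.imCLM ∘L coord (Fin.last (k + 1)) -
    fderiv ℝ u (base z) ∘L baseDeriv z) (differentiableAt_definingMap a hu hv) ?_ ξ
  simp only [definingMap_last]
  exact (Complex.imCLM.hasFDerivAt.comp z (coord (Fin.last (k + 1))).hasFDerivAt).sub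
    (hu.hasFDerivAt.comp z (hasFDerivAt_base z))

end Derivative

/-- Where at most one of `z₁, …, z_{n-1}` vanishes, the derivatives of `|z_j|²` (up to a common
constant) and of `prodCoord` can be prescribed independently. -/
theorem exists_prescribed_deriv {z : Cn k} {j₀ : Fin (k + 1)} (h : ∀ i ≠ j₀, z i.castSucc ≠ 0)
    (m : Fin (k + 1) → ℝ) (ζ : ℂ) : ∃ ξ : Fin (k + 1) → ℂ,
      (∃ l : ℝ, ∀ j, inner ℝ (z j.castSucc) (ξ j) = m j + l) ∧ ∑ j, prodErase z j * ξ j = ζ := by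
  set D := prodErase z j₀ with hD
  have hD0 : D ≠ 0 := prodErase_ne_zero h
  set n : Fin (k + 1) → ℝ := fun j => ‖z j.castSucc‖ ^ 2 with hn
  set A := n j₀ * ∑ j ∈ Finset.univ.erase j₀, (n j)⁻¹ with hA
  have hA0 : 0 ≤ A := mul_nonneg (sq_nonneg _) (Finset.sum_nonneg fun j _ => inv_nonneg.2 (sq_nonneg _))
  -- the constant is forced by the equation at the index `j₀`
  set l := (inner ℝ (z j₀.castSucc) (ζ / D) - m j₀ -
    n j₀ * ∑ j ∈ Finset.univ.erase j₀, m j * (n j)⁻¹) / (1 + A) with hl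
  set t : Fin (k + 1) → ℝ := fun j => (m j + l) * (n j)⁻¹ with ht
  set T := ∑ j ∈ Finset.univ.erase j₀, t j with hT
  have hTA : n j₀ * T = n j₀ * ∑ j ∈ Finset.univ.erase j₀, m j * (n j)⁻¹ + l * A := by
    simp only [hT, ht, add_mul, Finset.sum_add_distrib, mul_add, hA, ← Finset.mul_sum]
    ring
  have hlA : l * (1 + A) = inner ℝ (z j₀.castSucc) (ζ / D) - m j₀ -
      n j₀ * ∑ j ∈ Finset.univ.erase j₀, m j * (n j)⁻¹ := by
    rw [hl]; field_simp
  refine ⟨fun j => if j = j₀ then ζ / D - T * z j₀.castSucc else t j * z j.castSucc,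
    ⟨l, fun j => ?_⟩, ?_⟩
  · by_cases hj : j = j₀
    · subst hj
      simp only [if_true]
      rw [inner_sub_right, ← Complex.real_smul, inner_smul_right, real_inner_self_eq_norm_sq]
      have : T * ‖z j.castSucc‖ ^ 2 = n j * T := mul_comm _ _
      rw [this, hTA]
      linarith
    · simp only [if_neg hj]
      rw [← Complex.real_smul, inner_smul_right, real_inner_self_eq_norm_sq]
      have : ‖z j.castSucc‖ ^ 2 ≠ 0 := pow_ne_zero 2 (norm_ne_zero_iff.2 (h j hj))
      simp only [ht, hn]
      rw [mul_assoc, inv_mul_cancel₀ this, mul_one]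
  · rw [← Finset.add_sum_erase _ _ (Finset.mem_univ j₀)]
    have : ∀ j ∈ Finset.univ.erase j₀, prodErase z j *
        (if j = j₀ then ζ / D - T * z j₀.castSucc else t j * z j.castSucc) = prodCoord z * t j := by
      intro j hj
      rw [if_neg (Finset.ne_of_mem_erase hj), ← prodErase_mul z j]
      ring
    rw [Finset.sum_congr rfl this, ← Finset.mul_sum]
    simp only [if_true]
    rw [← prodErase_mul z j₀, ← hD, hT]
    push_cast
    field_simp
    ring

/-- The points over `S` at which at most one of `z₁, …, z_{n-1}` vanishes. -/
def regularSet (k : ℕ) (S : Set (ℝ × ℝ)) : Set (Cn k) :=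
  {z | base z ∈ S ∧ ∃ j₀, ∀ i ≠ j₀, z (Fin.castSucc i) ≠ 0}

theorem isOpen_regularSet {S : Set (ℝ × ℝ)} (hS : IsOpen S) : IsOpen (regularSet k S) := by
  have h1 : regularSet k S = base ⁻¹' S ∩ ⋃ j₀, ⋂ i, ⋂ (_ : i ≠ j₀), {z | z (Fin.castSucc i) ≠ 0} := by
    ext z; simp [regularSet]
  rw [h1]
  refine (hS.preimage continuous_base).inter (isOpen_iUnion fun j₀ => ?_)
  refine isOpen_iInter_of_finite fun i => isOpen_iInter_of_finite fun _ => ?_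
  exact isOpen_ne_fun (coord i.castSucc).continuous continuous_const

/-- `definingMap` is a submersion on the regular set. -/
theorem isDefiningMap_definingMap {a : Fin (k + 1) → ℝ} {S S' : Set (ℝ × ℝ)} {u v : ℝ × ℝ → ℝ}
    {r : WithTop ℕ∞} (hr : r ≠ 0) (hS' : IsOpen S') (hSS : S' ⊆ S) (hu : ContDiffOn ℝ r u S')
    (hv : ContDiffOn ℝ r v S') :
    IsDefiningMap r (N a S u v) (regularSet k S') (definingMap a u v) := by
  refine ⟨isOpen_regularSet hS', fun z hz => ?_, ?_, fun z hz => ?_⟩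
  · exact (contDiffAt_definingMap a (hu.contDiffAt (hS'.mem_nhds hz.1))
      (hv.contDiffAt (hS'.mem_nhds hz.1))).contDiffWithinAt
  · rintro z ⟨hz, j₀, hj₀⟩ c
    have hu' := (hu.contDiffAt (hS'.mem_nhds hz)).differentiableAt hr
    have hv' := (hv.contDiffAt (hS'.mem_nhds hz)).differentiableAt hr
    obtain ⟨ξ, ⟨l, hl⟩, hξ⟩ := exists_prescribed_deriv hj₀
      (Fin.snoc (α := fun _ => ℝ) (fun j => c j.castSucc.castSucc / 2) 0)
      ((c (Fin.last k).castSucc : ℝ) : ℂ)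
    set η : Cn k := WithLp.toLp 2 (Fin.snoc (α := fun _ => ℂ) ξ (c (Fin.last (k + 1)) * Complex.I))
    have h1 : ∀ j : Fin (k + 1), η j.castSucc = ξ j := fun j => by simp [η]
    have h2 : η (Fin.last (k + 1)) = c (Fin.last (k + 1)) * Complex.I := by simp [η]
    have h3 : prodDeriv z η = ((c (Fin.last k).castSucc : ℝ) : ℂ) := by
      rw [prodDeriv_apply, ← hξ]
      simp [h1]
    have h4 : baseDeriv z η = 0 := by
      rw [baseDeriv_apply, h2, h3]; simp
    refine ⟨η, ?_⟩
    ext i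
    revert i
    rw [forall_index]
    refine ⟨fun j => ?_, ?_, ?_⟩
    · rw [fderiv_definingMap_moment a hu' hv', h1, h1, hl, hl]
      simp
      ring
    · rw [fderiv_definingMap_prod a hu' hv', h3, h4]; simp
    · rw [fderiv_definingMap_last a hu' hv', h2, h4]; simp
  · rw [mem_N_iff, definingMap_eq_zero_iff]
    exact ⟨fun h => h.2, fun h => ⟨hSS hz.1, h⟩⟩

end DefiningMap
end SLTorus

namespace SLTorus

/-! ### The tangent spaces of `N` -/

section TangentSpace
variable {k : ℕ}

/-- The point of `ℂⁿ` with first `n - 1` coordinates `ξ` and last coordinate `c`. -/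
noncomputable def mkPoint (ξ : Fin (k + 1) → ℂ) (c : ℂ) : Cn k :=
  WithLp.toLp 2 (Fin.snoc (α := fun _ => ℂ) ξ c)

@[simp] theorem mkPoint_castSucc (ξ : Fin (k + 1) → ℂ) (c : ℂ) (j : Fin (k + 1)) :
    mkPoint ξ c j.castSucc = ξ j := by simp [mkPoint]

@[simp] theorem mkPoint_last (ξ : Fin (k + 1) → ℂ) (c : ℂ) :
    mkPoint ξ c (Fin.last (k + 1)) = c := by simp [mkPoint]

theorem herm_mkPoint (ξ η : Fin (k + 1) → ℂ) (c d : ℂ) :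
    herm (mkPoint ξ c) (mkPoint η d) =
      ∑ j, (starRingEnd ℂ) (ξ j) * η j + (starRingEnd ℂ) c * d := by
  rw [herm, Fin.sum_univ_castSucc]
  simp

theorem im_herm_comm (x y : Cn k) : (herm x y).im = -(herm y x).im := by
  have : herm x y = (starRingEnd ℂ) (herm y x) := by
    simp [herm, map_sum, mul_comm]
  rw [this, Complex.conj_im]

/-- The vector `i (z_j e_j - z_{n-1} e_{n-1})`, tangent to the torus orbit of `z`. -/
noncomputable def orbitVec (z : Fin (k + 1) → ℂ) (j : Fin k) : Fin (k + 1) → ℂ := fun l =>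
  Complex.I * ((if l = j.castSucc then z l else 0) - if l = Fin.last k then z l else 0)

@[simp] theorem orbitVec_castSucc (z : Fin (k + 1) → ℂ) (j i : Fin k) :
    orbitVec z j i.castSucc = if i = j then Complex.I * z i.castSucc else 0 := by
  simp [orbitVec, Fin.castSucc_ne_last]

@[simp] theorem orbitVec_last (z : Fin (k + 1) → ℂ) (j : Fin k) :
    orbitVec z j (Fin.last k) = -(Complex.I * z (Fin.last k)) := by
  simp [orbitVec, (Fin.castSucc_ne_last j).symm]

theorem sum_mul_orbitVec (z f : Fin (k + 1) → ℂ) (j : Fin k) :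
    ∑ l, f l * orbitVec z j l =
      Complex.I * (f j.castSucc * z j.castSucc - f (Fin.last k) * z (Fin.last k)) := by
  rw [Fin.sum_univ_castSucc]
  simp
  ring

/-- The frame consisting of the orbit directions and two vectors along `ν` and the last
coordinate. -/
noncomputable def frame (z ν : Fin (k + 1) → ℂ) (α β γ δ : ℂ) : Fin (k + 2) → Cn k :=
  Fin.snoc (α := fun _ => Cn k) (Fin.snoc (α := fun _ => Cn k) (fun j => mkPoint (orbitVec z j) 0)
    (mkPoint (fun l => α * ν l) γ)) (mkPoint (fun l => β * ν l) δ)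

section
variable (z ν : Fin (k + 1) → ℂ) (α β γ δ : ℂ)

@[simp] theorem frame_orbit (j : Fin k) :
    frame z ν α β γ δ j.castSucc.castSucc = mkPoint (orbitVec z j) 0 := by simp [frame]

@[simp] theorem frame_fst :
    frame z ν α β γ δ (Fin.last k).castSucc = mkPoint (fun l => α * ν l) γ := by simp [frame]

@[simp] theorem frame_snd :
    frame z ν α β γ δ (Fin.last (k + 1)) = mkPoint (fun l => β * ν l) δ := by simp [frame]

open Matrix in
theorem omega_frame_of_ne_zero (hz : ∀ j, z j ≠ 0) : Omega (frame z ν α β γ δ) =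
    Complex.I ^ k * (α * δ - β * γ) * ∑ l, ν l * ∏ i ∈ Finset.univ.erase l, z i := by
  set c : Fin (k + 1) → ℂ := fun l => ν l / z l with hc
  have hcz : ∀ l, c l * z l = ν l := fun l => div_mul_cancel₀ _ (hz l)
  -- scaling the first `k` rows by `i` and the first `k + 1` columns by `z`
  have h1 : (Matrix.of fun i j => frame z ν α β γ δ i j).submatrix
      (finSumFinEquiv (m := k) (n := 2)) (finSumFinEquiv (m := k) (n := 2)) =
      fromBlocks (diagonal fun _ => Complex.I) 0 0 1 *
        fromBlocks (1 : Matrix (Fin k) (Fin k) ℂ)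
          (.of fun _ => ![-1, 0]) (.of ![fun j => α * c j.castSucc, fun j => β * c j.castSucc])
          !![α * c (Fin.last k), γ; β * c (Fin.last k), δ] *
        fromBlocks (diagonal fun j : Fin k => z j.castSucc) 0 0 (diagonal ![z (Fin.last k), 1]) := by
    have e1 : ∀ j : Fin k, finSumFinEquiv (n := 2) (Sum.inl j) = j.castSucc.castSucc := fun _ => rfl
    have e2 : finSumFinEquiv (m := k) (n := 2) (Sum.inr 0) = (Fin.last k).castSucc := rfl
    have e3 : finSumFinEquiv (m := k) (n := 2) (Sum.inr 1) = Fin.last (k + 1) := rfl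
    rw [fromBlocks_multiply, fromBlocks_multiply]
    ext i j
    rcases i with i | i <;> rcases j with j | j
    · by_cases h : i = j
      · simp [e1, h]
      · simp [e1, h, Ne.symm h]
    · fin_cases j <;> simp [e1, e2, e3]
    · fin_cases i <;> simp [e1, e2, e3, mul_assoc, hcz, vecMul_diagonal]
    · fin_cases i <;> fin_cases j <;> simp [e2, e3, mul_assoc, hcz,
        vecMul_diagonal]
  have h2 : ∑ l, ν l * ∏ i ∈ Finset.univ.erase l, z i = (∏ i, z i) * ∑ l, c l := by
    rw [Finset.mul_sum]
    refine Finset.sum_congr rfl fun l _ => ?_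
    rw [← hcz l, ← Finset.prod_erase_mul _ _ (Finset.mem_univ l)]
    ring
  have h4 : (.of ![fun j => α * c j.castSucc, fun j => β * c j.castSucc] :
      Matrix (Fin 2) (Fin k) ℂ) * (.of fun _ => ![-1, 0] : Matrix (Fin k) (Fin 2) ℂ) =
      !![-(α * ∑ j : Fin k, c j.castSucc), 0; -(β * ∑ j : Fin k, c j.castSucc), 0] := by
    ext i j
    rw [Matrix.mul_apply]
    fin_cases i <;> fin_cases j <;> simp [Finset.mul_sum]
  have h3 := congrArg Matrix.det h1
  rw [det_submatrix_equiv_self, det_mul, det_mul, det_fromBlocks_zero₂₁, det_fromBlocks_zero₂₁,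
    det_fromBlocks_one₁₁, h4, det_fin_two] at h3
  rw [Omega, ← det_transpose]
  change (Matrix.of fun i j => frame z ν α β γ δ i j).det = _
  rw [h3, h2, Fin.prod_univ_castSucc, Fin.sum_univ_castSucc]
  simp [det_diagonal]
  ring

/-- The value of `Ω` on a frame. The case of a vanishing coordinate follows by continuity. -/
theorem omega_frame : Omega (frame z ν α β γ δ) =
    Complex.I ^ k * (α * δ - β * γ) * ∑ l, ν l * ∏ i ∈ Finset.univ.erase l, z i := by
  set f : ℂ → ℂ := fun t => Omega (frame (fun l => z l + t) ν α β γ δ)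
  set g : ℂ → ℂ := fun t =>
    Complex.I ^ k * (α * δ - β * γ) * ∑ l, ν l * ∏ i ∈ Finset.univ.erase l, (z i + t)
  have hf : Continuous f := by
    refine Continuous.matrix_det (continuous_matrix fun j i => ?_)
    simp only [Matrix.of_apply]
    revert i
    rw [forall_index]
    refine ⟨fun i => ?_, ?_, ?_⟩
    · simp only [frame_orbit]
      refine Fin.lastCases ?_ (fun j => ?_) j
      · simpa using continuous_const
      · simp only [mkPoint_castSucc, orbitVec]
        refine continuous_const.mul (Continuous.sub ?_ ?_)
        · split_ifs <;> fun_prop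
        · split_ifs <;> fun_prop
    · simpa using continuous_const
    · simpa using continuous_const
  have hg : Continuous g := by fun_prop
  have hd : Dense (Set.range fun j => -z j)ᶜ := (Set.finite_range _).countable.dense_compl ℂ
  have hfg : f = g := by
    refine Continuous.ext_on hd hf hg fun t ht => ?_
    refine omega_frame_of_ne_zero _ ν α β γ δ fun j h0 => ht ⟨j, ?_⟩
    linear_combination -h0
  have := congrFun hfg 0
  simpa [f, g] using this

end

/-- The conjugates of the partial derivatives of the product `prodCoord`; this vector is normal to
the torus orbits and to `i` times them. -/
noncomputable def normalVec (z : Cn k) (l : Fin (k + 1)) : ℂ := (starRingEnd ℂ) (prodErase z l)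

theorem conj_mul_normalVec (z : Cn k) (l : Fin (k + 1)) :
    (starRingEnd ℂ) (z l.castSucc) * normalVec z l = (starRingEnd ℂ) (prodCoord z) := by
  rw [normalVec, ← map_mul, mul_comm, prodErase_mul]

/-- The squared length of the differential of the product is `P'(w)`. -/
theorem norm_prodErase_sq {a : Fin (k + 1) → ℝ} {S : Set (ℝ × ℝ)} {u v : ℝ × ℝ → ℝ} {z : Cn k}
    (hz : z ∈ N a S u v) :
    ∑ l, ‖prodErase z l‖ ^ 2 = P' a (root a (v (base z)) (base z).2) := by
  refine Finset.sum_congr rfl fun l _ => ?_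
  rw [prodErase, norm_mul, norm_zpow, Complex.norm_I, one_zpow, one_mul, norm_prod,
    ← Finset.prod_pow]
  exact Finset.prod_congr rfl fun i _ => norm_sq_of_mem hz i

/-- The differential of the product maps `normalVec` to `P'(w)`. -/
theorem sum_prodErase_mul_normalVec {a : Fin (k + 1) → ℝ} {S : Set (ℝ × ℝ)} {u v : ℝ × ℝ → ℝ}
    {z : Cn k} (hz : z ∈ N a S u v) : ∑ l, prodErase z l * normalVec z l =
      ((P' a (root a (v (base z)) (base z).2) : ℝ) : ℂ) := by
  rw [← norm_prodErase_sq hz]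
  push_cast
  refine Finset.sum_congr rfl fun l _ => ?_
  rw [normalVec, Complex.mul_conj, Complex.normSq_eq_norm_sq]
  push_cast; rfl

section Kernel
variable {a : Fin (k + 1) → ℝ} {S : Set (ℝ × ℝ)} {u v : ℝ × ℝ → ℝ} {z : Cn k}

/-- The orbit directions are tangent to `N`. -/
theorem fderiv_definingMap_orbitVec (hu : DifferentiableAt ℝ u (base z))
    (hv : DifferentiableAt ℝ v (base z)) (j : Fin k) :
    fderiv ℝ (definingMap a u v) z (mkPoint (orbitVec (fun l => z l.castSucc) j) 0) = 0 := by
  have h1 : prodDeriv z (mkPoint (orbitVec (fun l => z l.castSucc) j) 0) = 0 := by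
    rw [prodDeriv_apply]
    simp only [mkPoint_castSucc]
    rw [sum_mul_orbitVec (fun l => z l.castSucc) (fun l => prodErase z l), prodErase_mul,
      prodErase_mul, sub_self, mul_zero]
  have h2 : baseDeriv z (mkPoint (orbitVec (fun l => z l.castSucc) j) 0) = 0 := by
    rw [baseDeriv_apply, h1]; simp
  have h3 : ∀ w : ℂ, inner ℝ w (Complex.I * w) = 0 := fun w => by
    rw [Complex.inner, mul_assoc, Complex.mul_conj]; simp
  ext i
  revert i
  rw [forall_index]
  refine ⟨fun i => ?_, ?_, ?_⟩
  · rw [fderiv_definingMap_moment a hu hv]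
    simp only [mkPoint_castSucc, orbitVec_castSucc, orbitVec_last, inner_neg_right, h3]
    split_ifs <;> simp [-Complex.inner, h3]
  · rw [fderiv_definingMap_prod a hu hv, h1, h2]; simp
  · rw [fderiv_definingMap_last a hu hv, h2]; simp

/-- The lift of the tangent vector `c` of the base to the tangent space of `N` along
`normalVec`. -/
noncomputable def liftVec (a : Fin (k + 1) → ℝ) (u v : ℝ × ℝ → ℝ) (z : Cn k) (c : ℝ × ℝ) : Cn k :=
  mkPoint (fun l => ((fderiv ℝ v (base z) c + c.2 * Complex.I) /
      (P' a (root a (v (base z)) (base z).2) : ℝ)) * normalVec z l)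
    (c.1 + fderiv ℝ u (base z) c * Complex.I)

theorem prodDeriv_liftVec (hz : z ∈ N a S u v) (hP : 0 < P' a (root a (v (base z)) (base z).2))
    (c : ℝ × ℝ) : prodDeriv z (liftVec a u v z c) = fderiv ℝ v (base z) c + c.2 * Complex.I := by
  rw [prodDeriv_apply, liftVec]
  simp only [mkPoint_castSucc, mul_left_comm (prodErase z _)]
  rw [← Finset.mul_sum, sum_prodErase_mul_normalVec hz]
  exact div_mul_cancel₀ _ (by exact_mod_cast hP.ne')

theorem baseDeriv_liftVec (hz : z ∈ N a S u v) (hP : 0 < P' a (root a (v (base z)) (base z).2))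
    (c : ℝ × ℝ) : baseDeriv z (liftVec a u v z c) = c := by
  rw [baseDeriv_apply, prodDeriv_liftVec hz hP]
  simp [liftVec]

/-- The lifts of tangent vectors of the base are tangent to `N`. -/
theorem fderiv_definingMap_liftVec (hz : z ∈ N a S u v)
    (hP : 0 < P' a (root a (v (base z)) (base z).2)) (hu : DifferentiableAt ℝ u (base z))
    (hv : DifferentiableAt ℝ v (base z)) (c : ℝ × ℝ) :
    fderiv ℝ (definingMap a u v) z (liftVec a u v z c) = 0 := by
  have h : ∀ (j : Fin (k + 1)) (t : ℂ), inner ℝ (z j.castSucc) (t * normalVec z j) =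
      (t * (starRingEnd ℂ) (prodCoord z)).re := fun j t => by
    rw [Complex.inner, ← conj_mul_normalVec z j]
    ring_nf
  ext i
  revert i
  rw [forall_index]
  refine ⟨fun i => ?_, ?_, ?_⟩
  · rw [fderiv_definingMap_moment a hu hv]
    simp only [liftVec, mkPoint_castSucc, h]
    simp
  · rw [fderiv_definingMap_prod a hu hv, prodDeriv_liftVec hz hP, baseDeriv_liftVec hz hP]; simp
  · rw [fderiv_definingMap_last a hu hv, baseDeriv_liftVec hz hP]; simp [liftVec]

/-- The tangent spaces of `N` are special Lagrangian planes where the reduced equations hold. In the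
frame of orbit vectors and lifts, the symplectic form vanishes by `v_x = - P'(w) u_y`, and both
equations together give `Ω = 1 + u_x² + P'(w) u_y²`. -/
theorem isSpecialLagrangianPlane_ker (hz : z ∈ N a S u v)
    (hP : 0 < P' a (root a (v (base z)) (base z).2)) (hu : DifferentiableAt ℝ u (base z))
    (hv : DifferentiableAt ℝ v (base z)) (hs : SolvesAt a u v (base z))
    (hsurj : Function.Surjective (fderiv ℝ (definingMap a u v) z)) :
    IsSpecialLagrangianPlane (LinearMap.ker (fderiv ℝ (definingMap a u v) z).toLinearMap) := by
  obtain ⟨hs1, hs2⟩ := hs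
  set p := P' a (root a (v (base z)) (base z).2) with hp
  set ux := fderiv ℝ u (base z) (1, 0) with hux
  set uy := fderiv ℝ u (base z) (0, 1) with huy
  set vx := fderiv ℝ v (base z) (1, 0) with hvx
  set vy := fderiv ℝ v (base z) (0, 1) with hvy
  have hpC : (p : ℂ) ≠ 0 := by exact_mod_cast hP.ne'
  set w : Fin (k + 1) → ℂ := fun l => z l.castSucc with hw
  set b := frame w (normalVec z) ((vx : ℂ) / p) ((vy + Complex.I) / p) (1 + ux * Complex.I)
    (uy * Complex.I) with hb
  have hb1 : b (Fin.last k).castSucc = liftVec a u v z (1, 0) := by simp [hb, liftVec, ← hux, ← hvx, ← hp]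
  have hb2 : b (Fin.last (k + 1)) = liftVec a u v z (0, 1) := by simp [hb, liftVec, ← huy, ← hvy, ← hp]
  have hν : ∑ l, (starRingEnd ℂ) (normalVec z l) * normalVec z l = p := by
    rw [hp, ← sum_prodErase_mul_normalVec hz]
    simp [normalVec]
  have horb : ∀ (j : Fin k) (α γ : ℂ),
      herm (mkPoint (orbitVec w j) 0) (mkPoint (fun l => α * normalVec z l) γ) = 0 := by
    intro j α γ
    have h1 : herm (mkPoint (fun l => α * normalVec z l) γ) (mkPoint (orbitVec w j) 0) = 0 := by
      rw [herm_mkPoint, sum_mul_orbitVec w fun l => (starRingEnd ℂ) (α * normalVec z l)]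
      have h2 : ∀ l, (starRingEnd ℂ) (normalVec z l) * w l = prodCoord z := fun l => by
        simp [normalVec, hw, prodErase_mul]
      simp only [map_mul, mul_assoc, h2]
      simp
    have h3 : ∀ x y : Cn k, herm x y = (starRingEnd ℂ) (herm y x) := fun x y => by
      simp [herm, map_sum, mul_comm]
    rw [h3, h1, map_zero]
  have hlift : ∀ α β γ δ : ℂ, herm (mkPoint (fun l => α * normalVec z l) γ)
      (mkPoint (fun l => β * normalVec z l) δ) =
        (starRingEnd ℂ) α * β * p + (starRingEnd ℂ) γ * δ := by
    intro α β γ δ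
    rw [herm_mkPoint, ← hν, Finset.mul_sum]
    congr 1
    refine Finset.sum_congr rfl fun l _ => ?_
    rw [map_mul]; ring
  have hself : ∀ x : Cn k, (herm x x).im = 0 := fun x => by
    have := im_herm_comm x x
    linarith
  have h12 : (herm (b (Fin.last k).castSucc) (b (Fin.last (k + 1)))).im = 0 := by
    rw [hb, frame_fst, frame_snd, hlift, mul_assoc, div_mul_cancel₀ _ hpC, map_div₀,
      Complex.conj_ofReal, Complex.conj_ofReal, ← Complex.ofReal_div]
    -- The second reduced equation cancels the imaginary part.
    have : vx / p = -uy := by rw [hs2]; field_simp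
    rw [this]
    simp
  refine isSpecialLagrangianPlane_of_basis (b := b) ?_ ?_ ?_
    (t := 1 + ux ^ 2 + p * uy ^ 2) (by positivity) ?_
  · have h1 := LinearMap.finrank_range_add_finrank_ker (fderiv ℝ (definingMap a u v) z).toLinearMap
    have h2 : LinearMap.range (fderiv ℝ (definingMap a u v) z).toLinearMap = ⊤ :=
      LinearMap.range_eq_top.2 hsurj
    rw [h2, finrank_top, finrank_euclideanSpace_fin, finrank_real_of_complex,
      finrank_euclideanSpace_fin] at h1
    omega
  · rw [forall_index]
    refine ⟨fun j => ?_, ?_, ?_⟩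
    · rw [hb, frame_orbit]
      exact fderiv_definingMap_orbitVec hu hv j
    · rw [hb1]; exact fderiv_definingMap_liftVec hz hP hu hv _
    · rw [hb2]; exact fderiv_definingMap_liftVec hz hP hu hv _
  · have hsymm : ∀ x y : Cn k, (herm x y).im = 0 → (herm y x).im = 0 := fun x y h => by
      rw [im_herm_comm, h, neg_zero]
    have ho1 : ∀ j : Fin k, (herm (b j.castSucc.castSucc) (b (Fin.last k).castSucc)).im = 0 :=
      fun j => by rw [hb, frame_orbit, frame_fst, horb]; rfl
    have ho2 : ∀ j : Fin k, (herm (b j.castSucc.castSucc) (b (Fin.last (k + 1)))).im = 0 :=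
      fun j => by rw [hb, frame_orbit, frame_snd, horb]; rfl
    have hoo : ∀ i j : Fin k, (herm (b i.castSucc.castSucc) (b j.castSucc.castSucc)).im = 0 := by
      intro i j
      rw [hb, frame_orbit, frame_orbit, herm_mkPoint,
        sum_mul_orbitVec w fun l => (starRingEnd ℂ) (orbitVec w i l)]
      by_cases hij : j = i
      · subst hij
        simp
        ring
      · simp [hij]
        ring
    rw [forall_index]
    refine ⟨fun i => ?_, ?_, ?_⟩ <;> rw [forall_index]
    · exact ⟨fun j => hoo i j, ho1 i, ho2 i⟩
    · exact ⟨fun j => hsymm _ _ (ho1 j), hself _, h12⟩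
    · exact ⟨fun j => hsymm _ _ (ho2 j), hsymm _ _ h12, hself _⟩
  · rw [hb, omega_frame]
    have h1 : ∑ l, normalVec z l * ∏ i ∈ Finset.univ.erase l, w i =
        (Complex.I ^ ((k : ℤ) - 1))⁻¹ * p := by
      rw [hp, ← sum_prodErase_mul_normalVec hz, Finset.mul_sum]
      refine Finset.sum_congr rfl fun l _ => ?_
      have : Complex.I ^ ((k : ℤ) - 1) ≠ 0 := zpow_ne_zero _ Complex.I_ne_zero
      rw [prodErase, hw]
      field_simp
    have h2 : Complex.I ^ k * (Complex.I ^ ((k : ℤ) - 1))⁻¹ = Complex.I := by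
      rw [← zpow_natCast, ← zpow_neg, ← zpow_add₀ Complex.I_ne_zero]
      simp
    rw [h1, mul_mul_mul_comm, mul_comm _ (p : ℂ), mul_right_comm, ← mul_assoc]
    have h3 : (vx : ℂ) / p * (uy * Complex.I) - (vy + Complex.I) / p * (1 + ux * Complex.I) =
        -Complex.I * (1 + ux ^ 2 + p * uy ^ 2) / p := by
      rw [hs2, ← hs1]
      field_simp
      push_cast
      linear_combination (-(ux : ℂ)) * Complex.I_sq
    have h4 : Complex.I ^ k * (((vx : ℂ) / p * (uy * Complex.I) -
        (vy + Complex.I) / p * (1 + ux * Complex.I))) * ((Complex.I ^ ((k : ℤ) - 1))⁻¹ * p) =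
        ((1 + ux ^ 2 + p * uy ^ 2 : ℝ) : ℂ) := by
      rw [h3]
      have : Complex.I ^ k * (-Complex.I * (1 + ux ^ 2 + p * uy ^ 2) / p) *
          ((Complex.I ^ ((k : ℤ) - 1))⁻¹ * p) = (Complex.I ^ k * (Complex.I ^ ((k : ℤ) - 1))⁻¹) *
          (-Complex.I * (1 + ux ^ 2 + p * uy ^ 2)) := by field_simp
      rw [this, h2]
      push_cast
      linear_combination (-(1 + (ux : ℂ) ^ 2 + p * uy ^ 2)) * Complex.I_sq
    rw [← h4]
    ring

end Kernel
end TangentSpace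
end SLTorus

namespace SLTorus
open Filter Topology

/-! ### Local structure, closure and symmetries of `N` -/

section LocalStructure
variable {k : ℕ} {a : Fin (k + 1) → ℝ} {S : Set (ℝ × ℝ)} {u v : ℝ × ℝ → ℝ} {p : Cn k}

theorem P'_root_pos_of_mem_regularSet {S' : Set (ℝ × ℝ)} {z : Cn k} (hz : z ∈ N a S u v)
    (hz' : z ∈ regularSet k S') : 0 < P' a (root a (v (base z)) (base z).2) := by
  obtain ⟨-, j₀, hj₀⟩ := hz'
  refine P'_pos (j₀ := j₀) (root_add_nonneg a _ _ _) fun i hi => ?_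
  rw [← norm_sq_of_mem hz]
  exact pow_pos (norm_pos_iff.2 (hj₀ i hi)) 2

/-- `N` is special Lagrangian at its points over an open set on which `u` and `v` are smooth solutions,
provided that `P'(w) > 0`. -/
theorem isSpecialLagrangianAt_N {S' : Set (ℝ × ℝ)} (hS' : IsOpen S') (hSS : S' ⊆ S)
    (hu : ContDiffOn ℝ ∞ u S') (hv : ContDiffOn ℝ ∞ v S') (hs : ∀ q ∈ S', SolvesAt a u v q)
    (hp : p ∈ N a S u v) (hb : base p ∈ S') (hP : 0 < P' a (root a (v (base p)) (base p).2)) :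
    IsSpecialLagrangianAt ∞ (N a S u v) p := by
  have hD := isDefiningMap_definingMap (a := a) (by simp) hS' hSS hu hv
  refine ⟨regularSet k S', definingMap a u v, ⟨hb, exists_forall_ne_zero hp hP⟩, hD, fun q hq => ?_⟩
  have hn := hS'.mem_nhds hq.2.1
  exact isSpecialLagrangianPlane_ker hq.1 (P'_root_pos_of_mem_regularSet hq.1 hq.2)
    ((hu.contDiffAt hn).differentiableAt (by simp)) ((hv.contDiffAt hn).differentiableAt (by simp))
    (hs _ hq.2.1) (hD.2.2.1 q hq.2)

/-- The lifts of tangent vectors show that `(x, y)` is a submersion on `N` where `P'(w) > 0`. -/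
theorem isC1FibredAt_N (hS : IsOpen S) (hu : ContDiffOn ℝ 1 u S) (hv : ContDiffOn ℝ 1 v S)
    (hp : p ∈ N a S u v) (hP : 0 < P' a (root a (v (base p)) (base p).2)) :
    IsC1FibredAt (N a S u v) p := by
  have hb : base p ∈ S := (mem_N_iff.1 hp).1
  have hn := hS.mem_nhds hb
  refine ⟨regularSet k S, definingMap a u v, ⟨hb, exists_forall_ne_zero hp hP⟩,
    isDefiningMap_definingMap (a := a) (by simp) hS subset_rfl hu hv, fun c => ?_⟩
  refine ⟨liftVec a u v p c, fderiv_definingMap_liftVec hp hP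
    ((hu.contDiffAt hn).differentiableAt (by simp))
    ((hv.contDiffAt hn).differentiableAt (by simp)) c, ?_⟩
  rw [(hasFDerivAt_base p).fderiv, baseDeriv_liftVec hp hP]

/-- The projection of `N` to the base is open at the points with `P'(w) > 0`: over every point
near `base p` there is a point of `N` near `p`. -/
theorem exists_mem_near (hS : IsOpen S) (hu : ContDiffOn ℝ 1 u S) (hv : ContDiffOn ℝ 1 v S)
    (hp : p ∈ N a S u v) (hP : 0 < P' a (root a (v (base p)) (base p).2)) {W : Set (Cn k)}
    (hW : W ∈ 𝓝 p) : ∀ᶠ q in 𝓝 (base p), ∃ z ∈ W, base z = q ∧ definingMap a u v z = 0 := by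
  have hb : base p ∈ S := (mem_N_iff.1 hp).1
  have hn := hS.mem_nhds hb
  have hu' := (hu.contDiffAt hn).differentiableAt one_ne_zero
  have hv' := (hv.contDiffAt hn).differentiableAt one_ne_zero
  have hF : HasStrictFDerivAt (definingMap a u v) (fderiv ℝ (definingMap a u v) p) p :=
    (contDiffAt_definingMap a (hu.contDiffAt hn) (hv.contDiffAt hn)).hasStrictFDerivAt one_ne_zero
  have hB : HasStrictFDerivAt base (baseDeriv p) p :=
    contDiff_base.contDiffAt.hasStrictFDerivAt' (hasFDerivAt_base p) one_ne_zero
  have hsurj : ((fderiv ℝ (definingMap a u v) p).prod (baseDeriv p)).range = ⊤ := by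
    refine LinearMap.range_eq_top.2 ?_
    rintro ⟨e, c⟩
    obtain ⟨η, hη⟩ := (isDefiningMap_definingMap (a := a) one_ne_zero hS subset_rfl hu hv).2.2.1 p
      ⟨hb, exists_forall_ne_zero hp hP⟩ e
    refine ⟨η + liftVec a u v p (c - baseDeriv p η), ?_⟩
    refine Prod.ext ?_ ?_
    · change fderiv ℝ (definingMap a u v) p _ = e
      rw [map_add, hη, fderiv_definingMap_liftVec hp hP hu' hv', add_zero]
    · change baseDeriv p _ = c
      rw [map_add, baseDeriv_liftVec hp hP]
      abel
  have hmap := (hF.prodMk hB).map_nhds_eq_of_surj hsurj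
  have hp0 : definingMap a u v p = 0 := (definingMap_eq_zero_iff a u v p).2 (mem_N_iff.1 hp).2
  rw [hp0] at hmap
  have h1 : (fun z => (definingMap a u v z, base z)) '' W ∈
      𝓝 ((0 : EuclideanSpace ℝ (Fin (k + 2))), base p) := by
    rw [← hmap]; exact image_mem_map hW
  have h2 : Tendsto (fun q : ℝ × ℝ => ((0 : EuclideanSpace ℝ (Fin (k + 2))), q)) (𝓝 (base p))
      (𝓝 (0, base p)) := by
    exact (Continuous.prodMk_right _).tendsto _
  filter_upwards [h2 h1] with q hq
  obtain ⟨z, hz, hzq⟩ := hq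
  exact ⟨z, hz, congrArg Prod.snd hzq, congrArg Prod.fst hzq⟩

/-- Limits of points of `N` lie over the closure of `S`, as all conditions are closed; conversely, the
openness of the projection to the base allows a point over the boundary to be approximated. -/
theorem closure_N (ha : minMultiplicity a = 1) {U : Set (ℝ × ℝ)} {u' v' : ℝ × ℝ → ℝ}
    (hU : IsOpen U) (hSU : closure S ⊆ U) (hu : ContDiffOn ℝ 1 u' U) (hv : ContDiffOn ℝ 1 v' U)
    (huu : Set.EqOn u' u S) (hvv : Set.EqOn v' v S) :
    closure (N a S u v) = N (k := k) a (closure S) u' v' := by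
  refine subset_antisymm (closure_minimal ?_ ?_) ?_
  · intro z hz
    obtain ⟨h1, h2, h3, h4⟩ := mem_N_iff.1 hz
    exact mem_N_iff.2 ⟨subset_closure h1, h2, by rw [hvv h1, h3], by rw [huu h1, h4]⟩
  · have hC : IsClosed (base (k := k) ⁻¹' closure S) := isClosed_closure.preimage continuous_base
    have hmaps : Set.MapsTo (base (k := k)) (base ⁻¹' closure S) U := fun z hz => hSU hz
    have h1 : IsClosed ((base (k := k) ⁻¹' closure S) ∩
        (fun z => (prodCoord z).re - v' (base z)) ⁻¹' {0}) :=
      ContinuousOn.preimage_isClosed_of_isClosed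
        ((Complex.continuous_re.comp (contDiff_prodCoord (r := 0)).continuous).continuousOn.sub
          (hv.continuousOn.comp continuous_base.continuousOn hmaps)) hC isClosed_singleton
    have h2 : IsClosed ((base (k := k) ⁻¹' closure S) ∩
        (fun z => (z (Fin.last (k + 1))).im - u' (base z)) ⁻¹' {0}) :=
      ContinuousOn.preimage_isClosed_of_isClosed
        ((Complex.continuous_im.comp (coord (Fin.last (k + 1))).continuous).continuousOn.sub
          (hu.continuousOn.comp continuous_base.continuousOn hmaps)) hC isClosed_singleton
    have h3 : IsClosed (⋂ j, {z : Cn k | moment a j z = 0}) :=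
      isClosed_iInter fun j =>
        isClosed_eq (contDiff_moment (r := 0) a j).continuous continuous_const
    have : N (k := k) a (closure S) u' v' = ((base (k := k) ⁻¹' closure S) ∩
        (fun z => (prodCoord z).re - v' (base z)) ⁻¹' {0}) ∩ ((base (k := k) ⁻¹' closure S) ∩
        (fun z => (z (Fin.last (k + 1))).im - u' (base z)) ⁻¹' {0}) ∩
        (⋂ j, {z : Cn k | moment a j z = 0}) := by
      ext z
      rw [mem_N_iff]
      simp only [Set.mem_inter_iff, Set.mem_preimage, Set.mem_singleton_iff, Set.mem_iInter,
        Set.mem_ofPred_eq, sub_eq_zero]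
      tauto
    rw [this]
    exact (h1.inter h2).inter h3
  · intro z hz
    obtain ⟨h1, h2, h3, h4⟩ := mem_N_iff.1 hz
    have hz' : z ∈ N a U u' v' := mem_N_iff.2 ⟨hSU h1, h2, h3, h4⟩
    refine mem_closure_iff_nhds.2 fun W hW => ?_
    have h5 := exists_mem_near hU hu hv hz' (P'_root_pos_of_minMultiplicity ha _ _) hW
    obtain ⟨q, ⟨z', hzW, hq, hz0⟩, hqS⟩ := (mem_closure_iff_nhds.1 h1) _ h5
    obtain ⟨h6, h7, h8⟩ := (definingMap_eq_zero_iff a u' v' z').1 hz0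
    subst hq
    exact ⟨z', hzW, mem_N_iff.2 ⟨hqS, h6, by rw [h7, hvv hqS], by rw [h8, huu hqS]⟩⟩

end LocalStructure

section Symmetry
variable {k : ℕ} {a : Fin (k + 1) → ℝ} {S : Set (ℝ × ℝ)} {u v : ℝ × ℝ → ℝ} {p : Cn k}

theorem coe_circle_prod {ι : Type*} (s : Finset ι) (c : ι → Circle) :
    ((∏ j ∈ s, c j : Circle) : ℂ) = ∏ j ∈ s, (c j : ℂ) := map_prod Circle.coeHom c s

/-- The rotation of the first `n - 1` coordinates by the phases `c`. -/
noncomputable def phaseRot (c : Fin (k + 1) → Circle) : Cn k ≃ₗᵢ[ℝ] Cn k :=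
  LinearIsometryEquiv.piLpCongrRight 2
    (fun l => rotation (Fin.snoc (α := fun _ => Circle) c 1 l))

@[simp] theorem phaseRot_castSucc (c : Fin (k + 1) → Circle) (z : Cn k) (j : Fin (k + 1)) :
    phaseRot c z j.castSucc = c j * z j.castSucc := by
  simp [phaseRot, rotation_apply]

@[simp] theorem phaseRot_last (c : Fin (k + 1) → Circle) (z : Cn k) :
    phaseRot c z (Fin.last (k + 1)) = z (Fin.last (k + 1)) := by
  simp [phaseRot, rotation_apply]

theorem prodCoord_phaseRot {c : Fin (k + 1) → Circle} (hc : ∏ j, c j = 1) (z : Cn k) :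
    prodCoord (phaseRot c z) = prodCoord z := by
  have : ∏ j, (c j : ℂ) = 1 := by
    rw [← coe_circle_prod, hc, Circle.coe_one]
  simp only [prodCoord, phaseRot_castSucc, Finset.prod_mul_distrib, this, one_mul]

theorem base_phaseRot {c : Fin (k + 1) → Circle} (hc : ∏ j, c j = 1) (z : Cn k) :
    base (phaseRot c z) = base z := by
  rw [base, base, prodCoord_phaseRot hc, phaseRot_last]

theorem phaseRot_mem_N {c : Fin (k + 1) → Circle} (hc : ∏ j, c j = 1) {z : Cn k}
    (hz : z ∈ N a S u v) : phaseRot c z ∈ N a S u v := by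
  obtain ⟨h1, h2, h3, h4⟩ := mem_N_iff.1 hz
  rw [mem_N_iff, base_phaseRot hc, prodCoord_phaseRot hc, phaseRot_last]
  refine ⟨h1, fun j => ?_, h3, h4⟩
  rw [← h2 j, moment, moment, phaseRot_castSucc, phaseRot_castSucc, norm_mul, norm_mul,
    Circle.norm_coe, Circle.norm_coe, one_mul, one_mul]

/-- The phases of the torus action have product `1`, so `base` and the moduli are invariant. -/
theorem isTorusInvariant_N (a : Fin (k + 1) → ℝ) (S : Set (ℝ × ℝ)) (u v : ℝ × ℝ → ℝ) :
    IsTorusInvariant (N a S u v) := by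
  intro t z hz
  have hc : ∏ j, (Fin.snoc (α := fun _ => Circle) t (∏ j, t j)⁻¹ : Fin (k + 1) → Circle) j = 1 := by
    rw [Fin.prod_univ_castSucc]
    simp
  have : torusAct t z = phaseRot (Fin.snoc (α := fun _ => Circle) t (∏ j, t j)⁻¹) z := by
    ext i
    revert i
    rw [forall_index]
    refine ⟨fun j => ?_, ?_, ?_⟩
    · rw [phaseRot_castSucc]; simp [torusAct]
    · rw [phaseRot_castSucc]; simp [torusAct, coe_circle_prod]
    · rw [phaseRot_last]; simp [torusAct]
  rw [this]
  exact phaseRot_mem_N hc hz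

end Symmetry
end SLTorus

namespace SLTorus
open Filter Topology

/-! ### Points of `N` near the degenerate locus -/

section Degenerate
variable {k : ℕ} {a : Fin (k + 1) → ℝ} {S : Set (ℝ × ℝ)} {u v : ℝ × ℝ → ℝ} {p : Cn k}

theorem prodCoord_of_mem {z : Cn k} (hz : z ∈ N a S u v) :
    prodCoord z = v (base z) + (base z).2 * Complex.I := by
  rw [← (mem_N_iff.1 hz).2.2.1]
  exact (Complex.re_add_im _).symm

theorem prodCoord_eq_zero_iff {z : Cn k} (hz : z ∈ N a S u v) :
    prodCoord z = 0 ↔ v (base z) = 0 ∧ (base z).2 = 0 := by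
  rw [prodCoord_of_mem hz, Complex.ext_iff]
  simp

/-- `w(v, y)` tends to `- min a_j` as `(v, y)` tends to the origin. -/
theorem tendsto_root_zero (a : Fin (k + 1) → ℝ) :
    Tendsto (fun q : ℝ × ℝ => root a q.1 q.2) (𝓝 0) (𝓝 (-minParam a)) := by
  have h0 : Tendsto (fun q : ℝ × ℝ => q.1 ^ 2 + q.2 ^ 2) (𝓝 0) (𝓝 0) := by
    have : Continuous fun q : ℝ × ℝ => q.1 ^ 2 + q.2 ^ 2 := by fun_prop
    simpa using this.tendsto 0
  refine Metric.tendsto_nhds.2 fun ε hε => ?_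
  filter_upwards [h0.eventually (gt_mem_nhds (pow_pos hε (k + 1)))] with q hq
  have h1 := neg_minParam_le_root a q.1 q.2
  rw [Real.dist_eq, abs_of_nonneg (by linarith)]
  by_contra hcon
  push Not at hcon
  -- each factor of `P(w)` is at least `w + min a_j`
  have h2 : ε ^ (k + 1) ≤ P a (root a q.1 q.2) := by
    have := Finset.prod_le_prod (s := (Finset.univ : Finset (Fin (k + 1)))) (f := fun _ => ε)
      (g := fun j => root a q.1 q.2 + a j) (fun _ _ => hε.le)
      fun j _ => by linarith [minParam_le a j]
    simpa [P] using this
  rw [P_root] at h2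
  linarith

/-- Near a degenerate point `p` over `(x₀, 0)` there are points of `N` over `(x₀, y)` for all small
`y ≠ 0`: the moduli of the coordinates are prescribed, and all phases but one can be kept. -/
theorem exists_tendsto_degenerate (hS : IsOpen S) (hu : ContinuousOn u S) (hv : ContinuousOn v S)
    (hp : p ∈ degenerateLocus a S u v) : ∃ Z : ℝ → Cn k, Tendsto Z (𝓝[≠] 0) (𝓝 p) ∧
      ∀ᶠ y in 𝓝[≠] 0, Z y ∈ N a S u v ∧ (base (Z y)).2 = y := by
  obtain ⟨hpN, hpv, hpy⟩ := hp
  set x₀ := (base p).1 with hx₀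
  have hbp : base p = (x₀, 0) := Prod.ext rfl hpy
  obtain ⟨hbS, -, -, hpu⟩ := mem_N_iff.1 hpN
  obtain ⟨j₀, hj₀⟩ := exists_eq_minParam a
  have hnorm : ∀ j : Fin (k + 1), ‖p j.castSucc‖ ^ 2 = -minParam a + a j := fun j => by
    rw [norm_sq_of_mem hpN, hpv, hpy, root_zero]
  have hpj₀ : p j₀.castSucc = 0 := by
    have := hnorm j₀
    rw [hj₀, neg_add_cancel] at this
    exact norm_eq_zero.1 (pow_eq_zero_iff two_ne_zero |>.1 this)
  -- The phases of the coordinates of `p`, where a vanishing coordinate is given the phase `1`.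
  set e : Fin (k + 1) → ℂ := fun j => if p j.castSucc = 0 then 1 else p j.castSucc / ‖p j.castSucc‖
  have he : ∀ j, ‖e j‖ = 1 := fun j => by
    by_cases h : p j.castSucc = 0
    · simp [e, h]
    · simp [e, h]
  have hpe : ∀ j, (‖p j.castSucc‖ : ℂ) * e j = p j.castSucc := fun j => by
    by_cases h : p j.castSucc = 0
    · simp [e, h]
    · have : (‖p j.castSucc‖ : ℂ) ≠ 0 := by simpa using h
      simp only [e, if_neg h]
      field_simp
  set V : ℝ → ℝ := fun y => v (x₀, y)
  set ρ : ℝ → Fin (k + 1) → ℝ := fun y j => √(root a (V y) y + a j)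
  -- The coordinate `z_{j₀}`, which vanishes at `p`, absorbs the remaining modulus and phase: `E y` is the
  -- partial derivative of the product with respect to it.
  set E : ℝ → ℂ := fun y => Complex.I ^ ((k : ℤ) - 1) * ∏ i ∈ Finset.univ.erase j₀, (ρ y i * e i)
  set ξ : ℝ → Fin (k + 1) → ℂ := fun y j =>
    if j = j₀ then (V y + y * Complex.I) / E y else ρ y j * e j
  set Z : ℝ → Cn k := fun y => mkPoint (ξ y) (x₀ + u (x₀, y) * Complex.I)
  have hρpos : ∀ y ≠ 0, ∀ j, 0 < ρ y j := fun y hy j =>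
    Real.sqrt_pos.2 (root_add_pos (fun h => hy (congrArg Prod.snd h)) j)
  have hE0 : ∀ y ≠ 0, E y ≠ 0 := fun y hy =>
    mul_ne_zero (zpow_ne_zero _ Complex.I_ne_zero) (Finset.prod_ne_zero_iff.2 fun i _ =>
      mul_ne_zero (by exact_mod_cast (hρpos y hy i).ne') (norm_ne_zero_iff.1 (by rw [he]; simp)))
  have hprod : ∀ y ≠ 0, prodCoord (Z y) = V y + y * Complex.I := by
    intro y hy
    rw [← prodErase_mul _ j₀]
    have h1 : prodErase (Z y) j₀ = E y := by
      simp only [prodErase, E, Z, mkPoint_castSucc]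
      congr 1
      refine Finset.prod_congr rfl fun i hi => ?_
      simp only [ξ, if_neg (Finset.ne_of_mem_erase hi)]
    rw [h1]
    simp only [Z, mkPoint_castSucc, ξ, if_true]
    exact mul_div_cancel₀ _ (hE0 y hy)
  have hbase : ∀ y ≠ 0, base (Z y) = (x₀, y) := by
    intro y hy
    rw [base, hprod y hy]
    simp [Z]
  have hξnorm : ∀ y ≠ 0, ∀ j, ‖ξ y j‖ = ρ y j := by
    intro y hy j
    by_cases hj : j = j₀
    · subst hj
      have h1 : ‖E y‖ = ∏ i ∈ Finset.univ.erase j, ρ y i := by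
        simp only [E, norm_mul, norm_zpow, Complex.norm_I, one_zpow, one_mul, norm_prod, he, mul_one,
          Complex.norm_real, Real.norm_eq_abs]
        exact Finset.prod_congr rfl fun i _ => abs_of_pos (hρpos y hy i)
      have h2 : ‖(V y + y * Complex.I : ℂ)‖ = ∏ i, ρ y i := by
        have h3 : ‖(V y + y * Complex.I : ℂ)‖ ^ 2 = (∏ i, ρ y i) ^ 2 := by
          rw [← Finset.prod_pow, ← Complex.normSq_eq_norm_sq, Complex.normSq_add_mul_I, ← P_root a,
            P]
          exact Finset.prod_congr rfl fun i _ => (Real.sq_sqrt (root_add_nonneg a _ _ _)).symm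
        exact (pow_left_inj₀ (norm_nonneg _)
          (Finset.prod_nonneg fun i _ => (hρpos y hy i).le) two_ne_zero).1 h3
      simp only [ξ, if_true, norm_div]
      rw [h1, h2, ← Finset.prod_erase_mul _ _ (Finset.mem_univ j)]
      exact mul_div_cancel_left₀ _ (Finset.prod_ne_zero_iff.2 fun i _ => (hρpos y hy i).ne')
    · simp only [ξ, if_neg hj, norm_mul, he, mul_one, Complex.norm_real, Real.norm_eq_abs]
      exact abs_of_pos (hρpos y hy j)
  have hline : Tendsto (fun y : ℝ => (x₀, y)) (𝓝[≠] 0) (𝓝 (base p)) := by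
    rw [hbp]
    exact ((Continuous.prodMk_right x₀).tendsto 0).mono_left nhdsWithin_le_nhds
  have hvlim : Tendsto V (𝓝[≠] 0) (𝓝 0) := by
    have := ((hv.continuousAt (hS.mem_nhds hbS)).tendsto).comp hline
    rwa [hpv] at this
  have hulim : Tendsto (fun y => u (x₀, y)) (𝓝[≠] 0) (𝓝 (u (base p))) :=
    ((hu.continuousAt (hS.mem_nhds hbS)).tendsto).comp hline
  have hρlim : ∀ j, Tendsto (fun y => ρ y j) (𝓝[≠] 0) (𝓝 ‖p j.castSucc‖) := by
    intro j
    have h1 : Tendsto (fun y : ℝ => (V y, y)) (𝓝[≠] 0) (𝓝 0) :=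
      hvlim.prodMk_nhds (tendsto_id.mono_left nhdsWithin_le_nhds)
    have h2 := ((tendsto_root_zero a).comp h1).add_const (a j)
    have h3 := (Real.continuous_sqrt.tendsto _).comp h2
    rw [← hnorm j, Real.sqrt_sq (norm_nonneg _)] at h3
    exact h3
  refine ⟨Z, ?_, ?_⟩
  · have h1 : Tendsto (fun y => (Z y).ofLp) (𝓝[≠] 0) (𝓝 p.ofLp) := by
      rw [tendsto_pi_nhds]
      intro l
      refine Fin.lastCases ?_ (fun j => ?_) l
      · have h2 : p (Fin.last (k + 1)) = (x₀ : ℂ) + u (base p) * Complex.I := by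
          rw [← hpu]; exact (Complex.re_add_im _).symm
        simp only [Z, mkPoint_last]
        rw [h2]
        exact ((Complex.continuous_ofReal.tendsto _).comp hulim).mul_const _ |>.const_add _
      · simp only [Z, mkPoint_castSucc]
        by_cases hj : j = j₀
        · subst hj
          rw [hpj₀]
          have h2 := hρlim j
          rw [hpj₀, norm_zero] at h2
          refine tendsto_zero_iff_norm_tendsto_zero.2 (h2.congr' ?_)
          filter_upwards [self_mem_nhdsWithin] with y hy
          exact (hξnorm y hy j).symm
        · simp only [ξ, if_neg hj]
          rw [← hpe j]
          exact ((Complex.continuous_ofReal.tendsto _).comp (hρlim j)).mul_const _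
    exact ((PiLp.continuous_toLp 2 _).tendsto _).comp h1
  · filter_upwards [hline (hS.mem_nhds hbS), self_mem_nhdsWithin] with y hyS hy
    refine ⟨mem_N_iff.2 ⟨by rw [hbase y hy]; exact hyS, fun j => ?_, ?_, ?_⟩, by rw [hbase y hy]⟩
    · simp only [moment, Z, mkPoint_castSucc, hξnorm y hy, ρ, Real.sq_sqrt (root_add_nonneg a _ _ _)]
      ring
    · rw [hprod y hy, hbase y hy]; simp [V]
    · rw [hbase y hy]; simp [Z]

/-- Points with `y ≠ 0` are not degenerate. -/
theorem N_subset_closure (hS : IsOpen S) (hu : ContinuousOn u S) (hv : ContinuousOn v S) :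
    N (k := k) a S u v ⊆ closure (N a S u v \ degenerateLocus a S u v) := by
  intro p hp
  by_cases hd : p ∈ degenerateLocus a S u v
  · obtain ⟨Z, hZ, hZN⟩ := exists_tendsto_degenerate hS hu hv hd
    refine mem_closure_of_tendsto hZ ?_
    filter_upwards [hZN, self_mem_nhdsWithin] with y hy hy0
    refine ⟨hy.1, fun h => hy0 ?_⟩
    rw [← hy.2]
    exact h.2.2
  · exact subset_closure ⟨hp, hd⟩

end Degenerate
end SLTorus

namespace SLTorus
open Filter Topology Metric

/-! ### Charts over the tangent space -/

section TangentChart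
variable {k : ℕ}

/-- `M` is near `p` the graph of a map over its tangent space `K` at `p`: the map `φ` is inverse to
the orthogonal projection to `K`, with `p` as the origin. -/
structure IsTangentChart (M : Set (Cn k)) (p : Cn k) (K : Submodule ℝ (Cn k)) (φ : K → Cn k)
    (ρ δ : ℝ) : Prop where
  finrank_eq : Module.finrank ℝ K = k + 2
  ρ_pos : 0 < ρ
  δ_pos : 0 < δ
  continuousOn : ContinuousOn φ (ball 0 δ)
  mem : ∀ κ ∈ ball 0 δ, φ κ ∈ M
  mem_ball : ∀ κ ∈ ball 0 δ, φ κ ∈ ball p ρ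
  proj : ∀ κ ∈ ball 0 δ, K.orthogonalProjectionOnto (φ κ - p) = κ
  left_inv : ∀ z ∈ M, z ∈ ball p ρ → φ (K.orthogonalProjectionOnto (z - p)) = z
  hasDerivAt : ∀ κ : K, HasDerivAt (fun s : ℝ => φ (s • κ)) (κ : Cn k) 0
  tangent : ∀ (γ : ℝ → Cn k) (ξ : Cn k), γ 0 = p → (∀ᶠ s in 𝓝 0, γ s ∈ M) →
    HasDerivAt γ ξ 0 → ξ ∈ K

/-- By the inverse function theorem, an embedded `C¹` submanifold is locally a graph over its
tangent space. -/
theorem exists_isTangentChart {M : Set (Cn k)} {p : Cn k} (hp : p ∈ M)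
    (h : IsSubmanifoldAt 1 M p) : ∃ K φ ρ δ, IsTangentChart M p K φ ρ δ := by
  obtain ⟨V, F, hpV, hV, hF, hsurj, hM⟩ := h
  have hFp : F p = 0 := (hM p hpV).1 hp
  set f' := fderiv ℝ F p with hf'
  have hFs : HasStrictFDerivAt F f' p :=
    (hF.contDiffAt (hV.mem_nhds hpV)).hasStrictFDerivAt one_ne_zero
  set K : Submodule ℝ (Cn k) := LinearMap.ker f'.toLinearMap with hK
  set π := K.orthogonalProjectionOnto with hπ
  have hmemK : ∀ ξ, ξ ∈ K ↔ f' ξ = 0 := fun ξ => LinearMap.mem_ker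
  have hker : (f'.prod π).ker = ⊥ := by
    refine LinearMap.ker_eq_bot'.2 fun ξ hξ => ?_
    have h1 : f' ξ = 0 := congrArg Prod.fst hξ
    have h2 : π ξ = 0 := congrArg Prod.snd hξ
    have h3 := K.orthogonalProjectionOnto_mem_subspace_eq_self ⟨ξ, (hmemK ξ).2 h1⟩
    have h4 : (⟨ξ, (hmemK ξ).2 h1⟩ : K) = 0 := by rw [← h3]; exact h2
    exact congrArg Subtype.val h4
  have hrange : (f'.prod π).range = ⊤ := by
    refine LinearMap.range_eq_top.2 ?_
    rintro ⟨e, κ⟩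
    obtain ⟨η, hη⟩ := hsurj p hpV e
    have h1 : ∀ κ : K, f' κ = 0 := fun κ => (hmemK _).1 κ.2
    have h2 : ∀ κ : K, π κ = κ := fun κ => K.orthogonalProjectionOnto_mem_subspace_eq_self κ
    refine ⟨η - π η + κ, Prod.ext ?_ ?_⟩
    · change f' _ = e
      rw [map_add, map_sub, h1, h1, hη]; simp
    · change π _ = κ
      rw [map_add, map_sub, h2, h2]; simp
  set e := ContinuousLinearEquiv.ofBijective (f'.prod π) hker hrange with he
  -- Adjoining the projection to `K` makes the defining map a local diffeomorphism.
  set Θ : Cn k → EuclideanSpace ℝ (Fin (k + 2)) × K := fun z => (F z, π (z - p)) with hΘ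
  have hΘs : HasStrictFDerivAt Θ (e : Cn k →L[ℝ] EuclideanSpace ℝ (Fin (k + 2)) × K) p := by
    have h1 : HasStrictFDerivAt (fun z => π (z - p)) π p := by
      have := π.hasStrictFDerivAt.comp p ((hasStrictFDerivAt_id (𝕜 := ℝ) p).sub_const p)
      simpa using this
    have h2 : (e : Cn k →L[ℝ] EuclideanSpace ℝ (Fin (k + 2)) × K) = f'.prod π :=
      ContinuousLinearEquiv.coe_ofBijective _ hker hrange
    rw [h2]
    exact hFs.prodMk h1
  set H := (hΘs.toOpenPartialHomeomorph Θ).restrOpen V hV with hH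
  have hHcoe : ∀ z, H z = Θ z := fun z => rfl
  have hpH : p ∈ H.source := by
    rw [hH, OpenPartialHomeomorph.restrOpen_source]
    exact ⟨hΘs.mem_toOpenPartialHomeomorph_source, hpV⟩
  have hHV : ∀ z ∈ H.source, z ∈ V := fun z hz => by
    rw [hH, OpenPartialHomeomorph.restrOpen_source] at hz
    exact hz.2
  have hΘp : Θ p = (0, 0) := by simp [hΘ, hFp]
  have h0t : ((0 : EuclideanSpace ℝ (Fin (k + 2))), (0 : K)) ∈ H.target := by
    rw [← hΘp, ← hHcoe]; exact H.map_source hpH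
  have hsymm0 : H.symm (0, 0) = p := by
    rw [← hΘp, ← hHcoe]; exact H.left_inv hpH
  set φ : K → Cn k := fun κ => H.symm (0, κ) with hφ
  obtain ⟨ρ, hρ, hρs⟩ := Metric.mem_nhds_iff.1 (H.open_source.mem_nhds hpH)
  have hincl : Continuous fun κ : K => ((0 : EuclideanSpace ℝ (Fin (k + 2))), κ) :=
    Continuous.prodMk_right _
  have hev : ∀ᶠ κ : K in 𝓝 0, (0, κ) ∈ H.target ∧ φ κ ∈ ball p ρ := by
    have h1 : ∀ᶠ κ : K in 𝓝 0, ((0 : EuclideanSpace ℝ (Fin (k + 2))), κ) ∈ H.target :=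
      (hincl.tendsto 0) (H.open_target.mem_nhds h0t)
    have h2 : ContinuousAt φ 0 := by
      refine ContinuousAt.comp (g := H.symm) ?_ hincl.continuousAt
      exact H.symm.continuousAt h0t
    refine h1.and (h2 ?_)
    have : φ 0 = p := hsymm0
    rw [this]
    exact ball_mem_nhds p hρ
  obtain ⟨δ, hδ, hδ'⟩ := Metric.eventually_nhds_iff_ball.1 hev
  have hΘφ : ∀ κ ∈ ball (0 : K) δ, Θ (φ κ) = (0, κ) := fun κ hκ => by
    rw [← hHcoe]; exact H.right_inv (hδ' κ hκ).1
  refine ⟨K, φ, ρ, δ, ⟨?_, hρ, hδ, ?_, fun κ hκ => ?_, fun κ hκ => (hδ' κ hκ).2,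
    fun κ hκ => congrArg Prod.snd (hΘφ κ hκ), fun z hz hzρ => ?_, fun κ => ?_, ?_⟩⟩
  · have h1 := LinearMap.finrank_range_add_finrank_ker f'.toLinearMap
    change _ + Module.finrank ℝ K = _ at h1
    have h2 : LinearMap.range f'.toLinearMap = ⊤ := LinearMap.range_eq_top.2 (hsurj p hpV)
    rw [h2, finrank_top, finrank_euclideanSpace_fin, finrank_real_of_complex,
      finrank_euclideanSpace_fin] at h1
    omega
  · exact H.symm.continuousOn.comp hincl.continuousOn fun κ hκ => (hδ' κ hκ).1
  · refine (hM _ (hHV _ (H.map_target (hδ' κ hκ).1))).2 ?_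
    exact congrArg Prod.fst (hΘφ κ hκ)
  · have hzs : z ∈ H.source := hρs hzρ
    have h1 : F z = 0 := (hM z (hHV z hzs)).1 hz
    have h2 : H z = (0, π (z - p)) := by rw [hHcoe, hΘ]; simp [h1]
    change H.symm (0, π (z - p)) = z
    rw [← h2, H.left_inv hzs]
  · have h1 : HasFDerivAt H (e : Cn k →L[ℝ] _) (H.symm (0, 0)) := by
      rw [hsymm0]; exact hΘs.hasFDerivAt
    have h2 := H.hasFDerivAt_symm h0t h1
    have h3 : HasDerivAt (fun s : ℝ => ((0 : EuclideanSpace ℝ (Fin (k + 2))), s • κ)) (0, κ) 0 := by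
      refine (hasDerivAt_const (0 : ℝ) _).prodMk ?_
      simpa using (hasDerivAt_id (0 : ℝ)).smul_const κ
    have h4 : e.symm (0, κ) = (κ : Cn k) := by
      rw [ContinuousLinearEquiv.symm_apply_eq]
      change _ = (f' κ, π κ)
      rw [(hmemK _).1 κ.2, hπ, K.orthogonalProjectionOnto_mem_subspace_eq_self κ]
    have h5 : ((0 : EuclideanSpace ℝ (Fin (k + 2))), (0 : ℝ) • κ) = (0, 0) := by simp
    rw [← h5] at h2
    have h6 := h2.comp_hasDerivAt (0 : ℝ) h3
    rw [← h4]
    exact h6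
  · intro γ ξ hγ0 hγM hγ
    rw [hmemK]
    have h1 : HasFDerivAt F f' (γ 0) := by rw [hγ0]; exact hFs.hasFDerivAt
    have h2 := h1.comp_hasDerivAt (0 : ℝ) hγ
    have h3 : F ∘ γ =ᶠ[𝓝 0] fun _ => 0 := by
      have h4 : ∀ᶠ s in 𝓝 0, γ s ∈ V := hγ.continuousAt (by rw [hγ0]; exact hV.mem_nhds hpV)
      filter_upwards [hγM, h4] with s h5 h6
      exact (hM _ h6).1 h5
    exact h2.unique ((hasDerivAt_const (0 : ℝ) _).congr_of_eventuallyEq h3)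

namespace IsTangentChart
variable {M : Set (Cn k)} {p : Cn k} {K : Submodule ℝ (Cn k)} {φ : K → Cn k} {ρ δ : ℝ}

theorem apply_zero (h : IsTangentChart M p K φ ρ δ) (hp : p ∈ M) : φ 0 = p := by
  have := h.left_inv p hp (mem_ball_self h.ρ_pos)
  rwa [sub_self, map_zero] at this

theorem eventually_smul_mem (h : IsTangentChart M p K φ ρ δ) (κ : K) :
    ∀ᶠ s : ℝ in 𝓝 0, s • κ ∈ ball (0 : K) δ := by
  have h1 : Continuous fun s : ℝ => s • κ := by fun_prop
  have h2 := h1.tendsto 0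
  rw [zero_smul] at h2
  exact h2 (ball_mem_nhds _ h.δ_pos)

/-- A linear isometry that fixes `p` and preserves `M` preserves the tangent space. -/
theorem map_mem (h : IsTangentChart M p K φ ρ δ) (hp : p ∈ M) {R : Cn k ≃ₗᵢ[ℝ] Cn k} (hR : R p = p)
    (hRM : ∀ z ∈ M, R z ∈ M) {ξ : Cn k} (hξ : ξ ∈ K) : R ξ ∈ K := by
  have h1 := h.hasDerivAt ⟨ξ, hξ⟩
  have h2 := (R.toContinuousLinearEquiv.hasFDerivAt (x := φ ((0 : ℝ) • ⟨ξ, hξ⟩))).comp_hasDerivAt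
    (0 : ℝ) h1
  refine h.tangent _ _ ?_ ?_ h2
  · change R (φ ((0 : ℝ) • _)) = p
    rw [zero_smul, h.apply_zero hp, hR]
  · filter_upwards [h.eventually_smul_mem ⟨ξ, hξ⟩] with s hs
    exact hRM _ (h.mem _ hs)

/-- Under a linear isometry that fixes `p` and preserves `M`, the coordinates of the chart transform
by the same isometry. -/
theorem proj_map (h : IsTangentChart M p K φ ρ δ) (hp : p ∈ M) {R : Cn k ≃ₗᵢ[ℝ] Cn k} (hR : R p = p)
    (hRM : ∀ z ∈ M, R z ∈ M) (hRM' : ∀ z ∈ M, R.symm z ∈ M) (z : Cn k) :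
    (K.orthogonalProjectionOnto (R z - p) : Cn k) = R (K.orthogonalProjectionOnto (z - p)) := by
  have hR' : R.symm p = p := by rw [LinearIsometryEquiv.symm_apply_eq, hR]
  refine Submodule.eq_starProjection_of_mem_of_inner_eq_zero
    (h.map_mem hp hR hRM (SetLike.coe_mem _)) fun w hw => ?_
  have h1 : R z - p - R (K.orthogonalProjectionOnto (z - p)) =
      R (z - p - K.orthogonalProjectionOnto (z - p)) := by
    rw [map_sub R, map_sub R, hR]
  rw [h1, ← R.symm.inner_map_map, LinearIsometryEquiv.symm_apply_apply]
  exact K.starProjection_inner_eq_zero _ _ (h.map_mem hp hR' hRM' hw)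

/-- A point of the chart is fixed by such an isometry if and only if its coordinate is. -/
theorem map_eq_iff (h : IsTangentChart M p K φ ρ δ) (hp : p ∈ M) {R : Cn k ≃ₗᵢ[ℝ] Cn k}
    (hR : R p = p) (hRM : ∀ z ∈ M, R z ∈ M) (hRM' : ∀ z ∈ M, R.symm z ∈ M) {κ : K}
    (hκ : κ ∈ ball 0 δ) : R (φ κ) = φ κ ↔ R (κ : Cn k) = κ := by
  have h1 := h.proj_map hp hR hRM hRM' (φ κ)
  rw [h.proj κ hκ] at h1
  constructor
  · intro h2
    rw [h2, h.proj κ hκ] at h1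
    exact h1.symm
  · intro h2
    rw [h2] at h1
    have h3 : R (φ κ) ∈ ball p ρ := by
      have := h.mem_ball κ hκ
      rw [Metric.mem_ball] at this ⊢
      rwa [← R.dist_map, hR] at this
    have h4 := h.left_inv _ (hRM _ (h.mem κ hκ)) h3
    rw [Subtype.ext h1] at h4
    exact h4.symm

end IsTangentChart
end TangentChart
end SLTorus

namespace SLTorus
open Filter Topology Metric

/-! ### Degenerate points are singular -/

section Singular
variable {k : ℕ} {a : Fin (k + 1) → ℝ} {S : Set (ℝ × ℝ)} {u v : ℝ × ℝ → ℝ} {p : Cn k}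

theorem symm_phaseRot (c : Fin (k + 1) → Circle) (z : Cn k) :
    (phaseRot c).symm z = phaseRot c⁻¹ z := by
  rw [LinearIsometryEquiv.symm_apply_eq]
  ext l
  refine Fin.lastCases ?_ (fun j => ?_) l
  · simp
  · rw [phaseRot_castSucc, phaseRot_castSucc, ← mul_assoc, ← Circle.coe_mul]
    simp

theorem symm_phaseRot_mem_N {c : Fin (k + 1) → Circle} (hc : ∏ j, c j = 1) {z : Cn k}
    (hz : z ∈ N a S u v) : (phaseRot c).symm z ∈ N a S u v := by
  rw [symm_phaseRot]
  exact phaseRot_mem_N (by simp [hc]) hz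

/-- The phases `e` at `i` and `e⁻¹` at `j`. -/
noncomputable def pairPhase (i j : Fin (k + 1)) (e : Circle) : Fin (k + 1) → Circle :=
  Pi.mulSingle i e * Pi.mulSingle j e⁻¹

theorem prod_pairPhase (i j : Fin (k + 1)) (e : Circle) : ∏ l, pairPhase i j e l = 1 := by
  simp [pairPhase, Finset.prod_mul_distrib]

theorem pairPhase_fst {i j : Fin (k + 1)} (hij : i ≠ j) (e : Circle) : pairPhase i j e i = e := by
  simp [pairPhase, hij]

theorem phaseRot_pairPhase_eq_self {i j : Fin (k + 1)} (e : Circle) {z : Cn k}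
    (hi : z i.castSucc = 0) (hj : z j.castSucc = 0) : phaseRot (pairPhase i j e) z = z := by
  ext l
  refine Fin.lastCases (by simp) (fun l => ?_) l
  rw [phaseRot_castSucc]
  by_cases h1 : l = i
  · rw [h1, hi, mul_zero]
  by_cases h2 : l = j
  · rw [h2, hj, mul_zero]
  simp [pairPhase, h1, h2]

theorem norm_sq_of_mem_degenerateLocus (hp : p ∈ degenerateLocus a S u v) (l : Fin (k + 1)) :
    ‖p l.castSucc‖ ^ 2 = -minParam a + a l := by
  rw [norm_sq_of_mem hp.1, hp.2.1, hp.2.2, root_zero]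

theorem eq_zero_of_mem_degenerateLocus (hp : p ∈ degenerateLocus a S u v) {l : Fin (k + 1)}
    (hl : a l = minParam a) : p l.castSucc = 0 := by
  have := norm_sq_of_mem_degenerateLocus hp l
  rw [hl, neg_add_cancel] at this
  exact norm_eq_zero.1 (pow_eq_zero_iff two_ne_zero |>.1 this)

section
variable {K : Submodule ℝ (Cn k)} {φ : K → Cn k} {ρ δ : ℝ}
  (h : IsTangentChart (N a S u v) p K φ ρ δ) (hp : p ∈ degenerateLocus a S u v)
include h

theorem hasDerivAt_chart_coord (κ : K) (l : Fin (k + 2)) :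
    HasDerivAt (fun s : ℝ => φ (s • κ) l) ((κ : Cn k) l) 0 := by
  have h1 : HasFDerivAt (coord (k := k) l) (coord l) (φ ((0 : ℝ) • κ)) := (coord l).hasFDerivAt
  exact h1.comp_hasDerivAt (0 : ℝ) (h.hasDerivAt κ)

include hp

/-- Coordinates that vanish at a degenerate point have equal moduli on `N`, hence on the tangent
space. -/
theorem norm_eq_norm_of_mem_tangent {i l : Fin (k + 1)} (hi : a i = minParam a)
    (hl : a l = minParam a) (κ : K) : ‖(κ : Cn k) i.castSucc‖ = ‖(κ : Cn k) l.castSucc‖ := by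
  have key : ∀ l : Fin (k + 1), a l = minParam a →
      Tendsto (fun s : ℝ => |s|⁻¹ * ‖φ (s • κ) l.castSucc‖) (𝓝[≠] 0)
        (𝓝 ‖(κ : Cn k) l.castSucc‖) := by
    intro l hl
    have h1 := (hasDerivAt_iff_tendsto_slope.1 (hasDerivAt_chart_coord h κ l.castSucc)).norm
    refine h1.congr fun s => ?_
    rw [slope, zero_smul, h.apply_zero hp.1, eq_zero_of_mem_degenerateLocus hp hl]
    simp
  refine tendsto_nhds_unique_of_eventuallyEq (key i hi) (key l hl) ?_
  filter_upwards [(h.eventually_smul_mem κ).filter_mono nhdsWithin_le_nhds] with s hs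
  have h1 := norm_sq_of_mem (h.mem _ hs) i
  rw [hi, ← hl, ← norm_sq_of_mem (h.mem _ hs) l] at h1
  rw [(pow_left_inj₀ (norm_nonneg _) (norm_nonneg _) two_ne_zero).1 h1]

/-- The differences `|z_l|² - |z_i|²` are constant on `N`, and the derivative of `|z_i|²` at `p` vanishes
for an index `i` with `z_i = 0`. -/
theorem inner_eq_zero_of_mem_tangent (κ : K) (l : Fin (k + 1)) :
    inner ℝ (p l.castSucc) ((κ : Cn k) l.castSucc) = 0 := by
  obtain ⟨i, hi⟩ := exists_eq_minParam a
  have key : ∀ l : Fin (k + 1), HasDerivAt (fun s : ℝ => ‖φ (s • κ) l.castSucc‖ ^ 2)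
      (2 * inner ℝ (p l.castSucc) ((κ : Cn k) l.castSucc)) 0 := by
    intro l
    have := (hasDerivAt_chart_coord h κ l.castSucc).norm_sq
    rwa [zero_smul, h.apply_zero hp.1] at this
  have h1 : (fun s : ℝ => ‖φ (s • κ) l.castSucc‖ ^ 2) =ᶠ[𝓝 0]
      fun s : ℝ => ‖φ (s • κ) i.castSucc‖ ^ 2 + (a l - a i) := by
    filter_upwards [h.eventually_smul_mem κ] with s hs
    rw [norm_sq_of_mem (h.mem _ hs), norm_sq_of_mem (h.mem _ hs)]
    ring
  have h2 := (key l).unique (((key i).add_const (a l - a i)).congr_of_eventuallyEq h1)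
  rw [eq_zero_of_mem_degenerateLocus hp hi, inner_zero_left] at h2
  linarith

/-- If two of the coordinates vanish at `p`, the tangent space contains a vector along the last
coordinate axis: the conditions on the other coordinates leave too few dimensions. -/
theorem exists_mem_tangent_last {i j : Fin (k + 1)} (hij : i ≠ j) (hi : a i = minParam a)
    (hj : a j = minParam a) : ∃ κ : K, κ ≠ 0 ∧ ∀ l : Fin (k + 1), (κ : Cn k) l.castSucc = 0 := by
  set T : Finset (Fin (k + 1)) := (Finset.univ.erase i).erase j with hT
  have hTcard : T.card + 2 = k + 1 := by
    have h1 := Finset.card_erase_add_one (s := Finset.univ) (Finset.mem_univ i)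
    have h2 := Finset.card_erase_add_one (s := Finset.univ.erase i) (a := j)
      (by simp [hij.symm])
    rw [Finset.card_fin] at h1
    rw [hT]
    omega
  -- Two conditions for `κ_i` and one for each of the `n - 3` coordinates other than `i`, `j` and the
  -- last; the condition for `κ_j` is implied. There are `n - 1` conditions in dimension `n`.
  set L : K →ₗ[ℝ] ℂ × (T → ℝ) := LinearMap.prod (coord i.castSucc).toLinearMap
    (LinearMap.pi fun l : T => Complex.imLm ∘ₗ
      LinearMap.mulLeft ℝ ((starRingEnd ℂ) (p l.1.castSucc)) ∘ₗ
        (coord l.1.castSucc).toLinearMap) ∘ₗ K.subtype with hL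
  have hlt : Module.finrank ℝ (ℂ × (T → ℝ)) < Module.finrank ℝ K := by
    rw [h.finrank_eq, Module.finrank_prod, Complex.finrank_real_complex,
      Module.finrank_fintype_fun_eq_card, Fintype.card_coe]
    omega
  obtain ⟨κ, hκ, hκ0⟩ := (Submodule.ne_bot_iff _).1 (LinearMap.ker_ne_bot_of_finrank_lt (f := L) hlt)
  refine ⟨κ, hκ0, ?_⟩
  have h1 : (κ : Cn k) i.castSucc = 0 := congrArg Prod.fst (LinearMap.mem_ker.1 hκ)
  have h2 : ∀ l : T, ((starRingEnd ℂ) (p l.1.castSucc) * (κ : Cn k) l.1.castSucc).im = 0 := fun l =>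
    congrFun (congrArg Prod.snd (LinearMap.mem_ker.1 hκ)) l
  intro l
  by_cases hl : a l = minParam a
  · have h3 := norm_eq_norm_of_mem_tangent h hp hi hl κ
    rw [h1, norm_zero] at h3
    exact norm_eq_zero.1 h3.symm
  · have hlT : l ∈ T := by
      simp only [hT, Finset.mem_erase, Finset.mem_univ, and_true]
      exact ⟨fun h0 => hl (h0 ▸ hj), fun h0 => hl (h0 ▸ hi)⟩
    have h3 : (starRingEnd ℂ) (p l.castSucc) * (κ : Cn k) l.castSucc = 0 := by
      refine Complex.ext ?_ (h2 ⟨l, hlT⟩)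
      have := inner_eq_zero_of_mem_tangent h hp κ l
      rw [Complex.inner, mul_comm] at this
      exact this
    have h4 : p l.castSucc ≠ 0 := by
      intro h0
      have h5 := norm_sq_of_mem_degenerateLocus hp l
      rw [h0, norm_zero] at h5
      apply hl
      linarith
    exact (mul_eq_zero.1 h3).resolve_left ((map_ne_zero _).2 h4)

/-- In the chart, the degenerate locus is the set where the `i`-th coordinate vanishes, for an index
`i` at which the minimum is attained together with another index `j`: both sets consist of the fixed
points of the symmetry that changes the signs of the coordinates `i` and `j`. -/
theorem prodCoord_chart_eq_zero_iff {i j : Fin (k + 1)} (hij : i ≠ j) (hi : a i = minParam a)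
    (hj : a j = minParam a) {κ : K} (hκ : κ ∈ ball 0 δ) :
    prodCoord (φ κ) = 0 ↔ (κ : Cn k) i.castSucc = 0 := by
  set R := phaseRot (k := k) (pairPhase i j (-1)) with hR
  have hc := prod_pairPhase i j (-1)
  have hfix : ∀ z : Cn k, R z = z → z i.castSucc = 0 := by
    intro z hz
    have h1 := congrArg (fun w : Cn k => w i.castSucc) hz
    simp only [hR, phaseRot_castSucc, pairPhase_fst hij] at h1
    have h2 : ((-1 : Circle) : ℂ) = -1 := by simp
    rw [h2] at h1
    linear_combination (-1 / 2 : ℂ) * h1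
  have hiff := h.map_eq_iff hp.1 (R := R)
    (phaseRot_pairPhase_eq_self _ (eq_zero_of_mem_degenerateLocus hp hi)
      (eq_zero_of_mem_degenerateLocus hp hj)) (fun z hz => phaseRot_mem_N hc hz)
    (fun z hz => symm_phaseRot_mem_N hc hz) hκ
  have hN := h.mem κ hκ
  constructor
  · intro h0
    have h1 : φ κ ∈ degenerateLocus a S u v := ⟨hN, (prodCoord_eq_zero_iff hN).1 h0⟩
    exact hfix _ (hiff.1 (phaseRot_pairPhase_eq_self _ (eq_zero_of_mem_degenerateLocus h1 hi)
      (eq_zero_of_mem_degenerateLocus h1 hj)))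
  · intro h0
    have h1 : (κ : Cn k) j.castSucc = 0 := by
      have := norm_eq_norm_of_mem_tangent h hp hi hj κ
      rw [h0, norm_zero] at this
      exact norm_eq_zero.1 this.symm
    rw [← prodErase_mul _ i, hfix _ (hiff.2 (phaseRot_pairPhase_eq_self _ h0 h1)), mul_zero]

/-- If `N` is a submanifold at a degenerate point over `(x₀, 0)`, then `v(x, 0) = 0` for all `x`
near `x₀`: the curve with tangent along the last axis consists of degenerate points. -/
theorem eventually_v_eq_zero {i j : Fin (k + 1)} (hij : i ≠ j) (hi : a i = minParam a)
    (hj : a j = minParam a) : ∀ᶠ x in 𝓝 (base p).1, v (x, 0) = 0 := by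
  obtain ⟨κ, hκ0, hκ⟩ := exists_mem_tangent_last h hp hij hi hj
  obtain ⟨ε, hε, hε'⟩ := Metric.eventually_nhds_iff_ball.1 (h.eventually_smul_mem κ)
  set b := ε / 2 with hb
  have hbpos : 0 < b := by positivity
  have hmem : ∀ s ∈ Set.Icc (-b) b, s • κ ∈ ball (0 : K) δ := fun s hs =>
    hε' s (by rw [mem_ball_zero_iff, Real.norm_eq_abs, abs_lt]; constructor <;> linarith [hs.1, hs.2])
  set f : ℝ → ℝ := fun s => (φ (s • κ) (Fin.last (k + 1))).re with hf
  have hdeg : ∀ s ∈ Set.Icc (-b) b, base (φ (s • κ)) = (f s, 0) ∧ v (f s, 0) = 0 := by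
    intro s hs
    have h1 : prodCoord (φ (s • κ)) = 0 :=
      (prodCoord_chart_eq_zero_iff h hp hij hi hj (hmem s hs)).2 (by simp [hκ])
    have h2 := (prodCoord_eq_zero_iff (h.mem _ (hmem s hs))).1 h1
    have h3 : base (φ (s • κ)) = (f s, 0) := Prod.ext rfl h2.2
    exact ⟨h3, by rw [← h3]; exact h2.1⟩
  have hcont : ContinuousOn f (Set.Icc (-b) b) := by
    have h1 : ContinuousOn (fun s : ℝ => φ (s • κ)) (Set.Icc (-b) b) :=
      h.continuousOn.comp (by fun_prop) hmem
    exact (Complex.continuous_re.comp (coord (Fin.last (k + 1))).continuous).comp_continuousOn h1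
  -- the component of the curve along `κ`, hence its last coordinate, determines the parameter
  have hinner : ∀ s ∈ Set.Icc (-b) b,
      inner ℝ ((κ : Cn k) (Fin.last (k + 1))) ((φ (s • κ) - p) (Fin.last (k + 1))) =
        s * ‖κ‖ ^ 2 := by
    intro s hs
    have h1 := h.proj _ (hmem s hs)
    have h2 : inner ℝ (κ : Cn k) (φ (s • κ) - p) = s * ‖κ‖ ^ 2 := by
      have h3 := K.inner_orthogonalProjectionOnto_eq_of_mem_left κ (φ (s • κ) - p)
      rw [h1] at h3
      rw [← h3]
      exact (real_inner_smul_right κ κ s).trans (by rw [real_inner_self_eq_norm_sq])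
    rw [← h2, PiLp.inner_apply, Fin.sum_univ_castSucc]
    simp [hκ]
  have hinj : Set.InjOn f (Set.Icc (-b) b) := by
    intro s hs t ht hst
    have h1 : φ (s • κ) (Fin.last (k + 1)) = φ (t • κ) (Fin.last (k + 1)) := by
      refine Complex.ext hst ?_
      rw [(mem_N_iff.1 (h.mem _ (hmem s hs))).2.2.2, (mem_N_iff.1 (h.mem _ (hmem t ht))).2.2.2,
        (hdeg s hs).1, (hdeg t ht).1, hst]
    have h2 := hinner s hs
    have h3 := hinner t ht
    rw [PiLp.sub_apply] at h2 h3
    rw [h1, h3] at h2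
    exact (mul_right_cancel₀ (pow_ne_zero 2 (norm_ne_zero_iff.2 hκ0)) h2).symm
  have hf0 : f 0 = (base p).1 := by
    simp only [hf, zero_smul, h.apply_zero hp.1]
    rfl
  have hm : (-b) ∈ Set.Icc (-b) b := ⟨le_rfl, by linarith⟩
  have hM : b ∈ Set.Icc (-b) b := ⟨by linarith, le_rfl⟩
  have h0 : (0 : ℝ) ∈ Set.Icc (-b) b := ⟨by linarith, by linarith⟩
  have himg : f '' Set.Icc (-b) b ∈ 𝓝 (base p).1 := by
    rw [← hf0]
    rcases hcont.strictMonoOn_of_injOn_Icc' (by linarith) hinj with hmono | hanti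
    · exact mem_of_superset (Icc_mem_nhds (hmono hm h0 (by linarith)) (hmono h0 hM hbpos))
        (intermediate_value_Icc (by linarith) hcont)
    · exact mem_of_superset (Icc_mem_nhds (hanti h0 hM hbpos) (hanti hm h0 (by linarith)))
        (intermediate_value_Icc' (by linarith) hcont)
  filter_upwards [himg] with x hx
  obtain ⟨s, hs, rfl⟩ := hx
  exact (hdeg s hs).2

end

/-- At a degenerate point at which two coordinates vanish `N` is not a `C¹` submanifold. Otherwise
`v(x, 0)` vanishes near `x₀`, and `N` contains points with `y > 0` and with `y < 0` near `p`. After a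
rotation of the second one, the segment between their coordinates in the tangent space avoids the
degenerate locus; but `y` changes sign along it, and where `y = 0` also `v = 0`. -/
theorem not_isSubmanifoldAt (ha : 1 < minMultiplicity a) (hS : IsOpen S) (hu : ContinuousOn u S)
    (hv : ContinuousOn v S) (hp : p ∈ degenerateLocus a S u v) :
    ¬ IsSubmanifoldAt 1 (N a S u v) p := by
  intro hsub
  obtain ⟨K, φ, ρ, δ, h⟩ := exists_isTangentChart hp.1 hsub
  have : Nontrivial {j : Fin (k + 1) // a j = minParam a} :=
    Finite.one_lt_card_iff_nontrivial.1 ha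
  obtain ⟨⟨i, hi⟩, ⟨j, hj⟩, hij⟩ := exists_pair_ne {j : Fin (k + 1) // a j = minParam a}
  replace hij : i ≠ j := fun h0 => hij (Subtype.ext h0)
  set π := K.orthogonalProjectionOnto with hπ
  have hdeg : ∀ κ ∈ ball (0 : K) δ, prodCoord (φ κ) = 0 ↔ (κ : Cn k) i.castSucc = 0 := fun κ hκ =>
    prodCoord_chart_eq_zero_iff h hp hij hi hj hκ
  have hφ0 : ContinuousAt φ 0 := h.continuousOn.continuousAt (ball_mem_nhds _ h.δ_pos)
  have hx : ∀ᶠ κ : K in 𝓝 0, κ ∈ ball (0 : K) δ ∧ v ((base (φ κ)).1, 0) = 0 := by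
    refine Filter.Eventually.and (ball_mem_nhds _ h.δ_pos) ?_
    have h1 : Tendsto (fun κ => (base (φ κ)).1) (𝓝 0) (𝓝 (base p).1) := by
      rw [← h.apply_zero hp.1]
      exact (continuous_fst.comp continuous_base).continuousAt.comp hφ0
    exact h1.eventually (eventually_v_eq_zero h hp hij hi hj)
  obtain ⟨r, hr, hr'⟩ := Metric.eventually_nhds_iff_ball.1 hx
  obtain ⟨Z, hZ, hZN⟩ := exists_tendsto_degenerate hS hu hv hp
  have hZev : ∀ᶠ y in 𝓝[≠] (0 : ℝ), Z y ∈ N a S u v ∧ (base (Z y)).2 = y ∧ Z y ∈ ball p ρ ∧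
      π (Z y - p) ∈ ball (0 : K) r := by
    have h1 : Tendsto (fun y => π (Z y - p)) (𝓝[≠] 0) (𝓝 0) := by
      have := (π.continuous.tendsto _).comp (hZ.sub_const p)
      rwa [sub_self, map_zero] at this
    filter_upwards [hZN, hZ (ball_mem_nhds p h.ρ_pos), h1 (ball_mem_nhds _ hr)] with y h2 h3 h4
    exact ⟨h2.1, h2.2, h3, h4⟩
  -- Points of `N` on both sides of `y = 0`, and their coordinates in the chart.
  obtain ⟨y₁, ⟨hN₁, hy₁, hb₁, hr₁⟩, hpos⟩ :=
    ((hZev.filter_mono (nhdsWithin_mono (s := Set.Ioi (0 : ℝ)) _ fun y hy => ne_of_gt hy)).and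
      (self_mem_nhdsWithin : Set.Ioi (0 : ℝ) ∈ 𝓝[>] 0)).exists
  obtain ⟨y₂, ⟨hN₂, hy₂, hb₂, hr₂⟩, hneg⟩ :=
    ((hZev.filter_mono (nhdsWithin_mono (s := Set.Iio (0 : ℝ)) _ fun y hy => ne_of_lt hy)).and
      (self_mem_nhdsWithin : Set.Iio (0 : ℝ) ∈ 𝓝[<] 0)).exists
  set κ₁ := π (Z y₁ - p) with hκ₁
  set κ₂ := π (Z y₂ - p) with hκ₂
  have hφ₁ : φ κ₁ = Z y₁ := h.left_inv _ hN₁ hb₁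
  have hφ₂ : φ κ₂ = Z y₂ := h.left_inv _ hN₂ hb₂
  have hne₁ : (κ₁ : Cn k) i.castSucc ≠ 0 := fun h0 => by
    have h1 := (prodCoord_eq_zero_iff hN₁).1 (hφ₁ ▸ (hdeg κ₁ (hr' _ hr₁).1).2 h0)
    rw [hy₁] at h1
    exact (ne_of_gt hpos) h1.2
  have hne₂ : (κ₂ : Cn k) i.castSucc ≠ 0 := fun h0 => by
    have h1 := (prodCoord_eq_zero_iff hN₂).1 (hφ₂ ▸ (hdeg κ₂ (hr' _ hr₂).1).2 h0)
    rw [hy₂] at h1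
    exact (ne_of_lt hneg) h1.2
  set α := (κ₁ : Cn k) i.castSucc with hα
  set β := (κ₂ : Cn k) i.castSucc with hβ
  -- the rotation that moves the argument of `β` to that of `α`
  set c : ℝ := ‖β‖ / ‖α‖ with hc
  have hα0 : 0 < ‖α‖ := norm_pos_iff.2 hne₁
  have hβ0 : 0 < ‖β‖ := norm_pos_iff.2 hne₂
  have hcpos : 0 < c := div_pos hβ0 hα0
  have hcα : ‖(c : ℂ) * α / β‖ = 1 := by
    rw [norm_div, norm_mul, Complex.norm_real, Real.norm_eq_abs, abs_of_pos hcpos, hc]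
    field_simp
  set e : Circle := ⟨(c : ℂ) * α / β, mem_sphere_zero_iff_norm.2 hcα⟩ with he
  set R := phaseRot (k := k) (pairPhase i j e) with hR
  have hprod := prod_pairPhase i j e
  have hRp : R p = p := phaseRot_pairPhase_eq_self _ (eq_zero_of_mem_degenerateLocus hp hi)
    (eq_zero_of_mem_degenerateLocus hp hj)
  set κ₃ := π (R (Z y₂) - p) with hκ₃
  have hN₃ : R (Z y₂) ∈ N a S u v := phaseRot_mem_N hprod hN₂
  have hb₃ : R (Z y₂) ∈ ball p ρ := by
    rw [Metric.mem_ball] at hb₂ ⊢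
    rwa [← R.dist_map, hRp] at hb₂
  have hκ₃R : (κ₃ : Cn k) = R κ₂ := h.proj_map hp.1 hRp (fun z hz => phaseRot_mem_N hprod hz)
    (fun z hz => symm_phaseRot_mem_N hprod hz) (Z y₂)
  have hr₃ : κ₃ ∈ ball (0 : K) r := by
    rw [mem_ball_zero_iff] at hr₂ ⊢
    rwa [Submodule.coe_norm, hκ₃R, R.norm_map, ← Submodule.coe_norm]
  have hφ₃ : φ κ₃ = R (Z y₂) := h.left_inv _ hN₃ hb₃
  have hi₃ : (κ₃ : Cn k) i.castSucc = c * α := by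
    rw [hκ₃R, hR, phaseRot_castSucc, pairPhase_fst hij]
    exact div_mul_cancel₀ _ hne₂
  -- On this segment the coordinate `i` is a positive multiple of `α`.
  set σ : ℝ → K := fun t => (1 - t) • κ₁ + t • κ₃ with hσ
  have hσmem : ∀ t ∈ Set.Icc (0 : ℝ) 1, σ t ∈ ball (0 : K) r := fun t ht =>
    (convex_ball (0 : K) r) hr₁ hr₃ (by linarith [ht.2]) ht.1 (by ring)
  have hgcont : ContinuousOn (fun t => (base (φ (σ t))).2) (Set.Icc 0 1) := by
    have h1 : ContinuousOn (fun t => φ (σ t)) (Set.Icc 0 1) :=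
      h.continuousOn.comp (by fun_prop) fun t ht => (hr' _ (hσmem t ht)).1
    exact (continuous_snd.comp continuous_base).comp_continuousOn h1
  have hg0 : (base (φ (σ 0))).2 = y₁ := by
    have : σ 0 = κ₁ := by simp [hσ]
    rw [this, hφ₁, hy₁]
  have hg1 : (base (φ (σ 1))).2 = y₂ := by
    have : σ 1 = κ₃ := by simp [hσ]
    rw [this, hφ₃, base_phaseRot hprod, hy₂]
  obtain ⟨t, ht, ht0⟩ := intermediate_value_Icc' zero_le_one hgcont
    (show (0 : ℝ) ∈ _ by
      simp only [hg0, hg1]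
      exact ⟨(le_of_lt hneg), (le_of_lt hpos)⟩)
  simp only at ht0
  obtain ⟨hσδ, hσv⟩ := hr' _ (hσmem t ht)
  have h1 : base (φ (σ t)) = ((base (φ (σ t))).1, 0) := Prod.ext rfl ht0
  have h2 : prodCoord (φ (σ t)) = 0 :=
    (prodCoord_eq_zero_iff (h.mem _ hσδ)).2 ⟨by rw [h1]; exact hσv, ht0⟩
  have h3 := (hdeg _ hσδ).1 h2
  have h4 : ((σ t : K) : Cn k) i.castSucc = ((1 - t + t * c : ℝ) : ℂ) * α := by
    simp only [hσ, Submodule.coe_add, Submodule.coe_smul, PiLp.add_apply, PiLp.smul_apply, hi₃,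
      Complex.real_smul]
    rw [← hα]
    push_cast
    ring
  rw [h4] at h3
  have h5 : (1 - t + t * c : ℝ) ≠ 0 := by
    rcases ht.2.lt_or_eq with h6 | h6
    · have := mul_nonneg ht.1 hcpos.le
      exact (by linarith : (0 : ℝ) < 1 - t + t * c).ne'
    · rw [h6]
      simpa using hcpos.ne'
  exact (mul_ne_zero (Complex.ofReal_ne_zero.2 h5) hne₁) h3

end Singular
end SLTorus

theorem theorem4p1 (k : ℕ) (a : Fin (k + 1) → ℝ) (S : Set (ℝ × ℝ)) (hS : IsOpen S)
    (u v : ℝ × ℝ → ℝ) :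
    (SLTorus.minMultiplicity a = 1 →
      ContDiffOn ℝ 1 u S → ContDiffOn ℝ 1 v S →
      (∀ q ∈ S, SLTorus.SolvesAt a u v q) →
        SLTorus.IsTorusInvariant (SLTorus.N a S u v) ∧
        (∀ p ∈ SLTorus.N a S u v, SLTorus.IsSpecialLagrangianAt ∞ (SLTorus.N a S u v) p) ∧
        (∀ (U : Set (ℝ × ℝ)) (u' v' : ℝ × ℝ → ℝ), IsOpen U → closure S ⊆ U →
          ContDiffOn ℝ 1 u' U → ContDiffOn ℝ 1 v' U → Set.EqOn u' u S → Set.EqOn v' v S →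
            closure (SLTorus.N a S u v) = SLTorus.N a (closure S) u' v' ∧
            ∀ p ∈ SLTorus.N a U u' v', SLTorus.IsC1FibredAt (SLTorus.N a U u' v') p)) ∧
    (1 < SLTorus.minMultiplicity a →
      ContinuousOn u S → ContinuousOn v S →
      (∀ q ∈ S, (v q, q.2) ≠ (0, 0) →
        DifferentiableAt ℝ u q ∧ DifferentiableAt ℝ v q ∧ SLTorus.SolvesAt a u v q) →
        SLTorus.IsTorusInvariant (SLTorus.N a S u v) ∧
        (∀ p ∈ SLTorus.N a S u v \ SLTorus.degenerateLocus a S u v,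
          SLTorus.IsSpecialLagrangianAt ∞ (SLTorus.N a S u v) p) ∧
        SLTorus.N a S u v ⊆
          closure (SLTorus.N a S u v \ SLTorus.degenerateLocus a S u v) ∧
        (∀ p ∈ SLTorus.degenerateLocus a S u v,
          ¬ SLTorus.IsSubmanifoldAt 1 (SLTorus.N a S u v) p)) := by
  refine ⟨fun ha hu hv hs => ⟨SLTorus.isTorusInvariant_N a S u v, fun p hp => ?_,
    fun U u' v' hU hSU hu' hv' huu hvv => ⟨SLTorus.closure_N ha hU hSU hu' hv' huu hvv,
      fun p hp => SLTorus.isC1FibredAt_N hU hu' hv' hp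
        (SLTorus.P'_root_pos_of_minMultiplicity ha _ _)⟩⟩,
    fun ha hu hv hs => ⟨SLTorus.isTorusInvariant_N a S u v, fun p hp => ?_,
      SLTorus.N_subset_closure hS hu hv, fun p hp => SLTorus.not_isSubmanifoldAt ha hS hu hv hp⟩⟩
  · have hreg : ∀ q ∈ S, ContDiffAt ℝ ∞ u q ∧ ContDiffAt ℝ ∞ v q := fun q hq => by
      refine SLTorus.contDiffAt_of_solvesAt (SLTorus.P'_root_pos_of_minMultiplicity ha _ _) ?_
      filter_upwards [hS.mem_nhds hq] with q' hq'
      have hn := hS.mem_nhds hq'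
      exact ⟨(hu.contDiffAt hn).differentiableAt one_ne_zero,
        (hv.contDiffAt hn).differentiableAt one_ne_zero, hs q' hq'⟩
    exact SLTorus.isSpecialLagrangianAt_N hS subset_rfl
      (fun q hq => (hreg q hq).1.contDiffWithinAt) (fun q hq => (hreg q hq).2.contDiffWithinAt) hs
      hp (SLTorus.mem_N_iff.1 hp).1 (SLTorus.P'_root_pos_of_minMultiplicity ha _ _)
  · set S' : Set (ℝ × ℝ) := S ∩ (fun q => (v q, q.2)) ⁻¹' {0}ᶜ with hS'
    have hopen : IsOpen S' :=
      (hv.prodMk continuousOn_snd).isOpen_inter_preimage hS isOpen_compl_singleton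
    have hd : ∀ q ∈ S', DifferentiableAt ℝ u q ∧ DifferentiableAt ℝ v q ∧
        SLTorus.SolvesAt a u v q := fun q hq => hs q hq.1 hq.2
    have hreg : ∀ q ∈ S', ContDiffAt ℝ ∞ u q ∧ ContDiffAt ℝ ∞ v q := fun q hq => by
      refine SLTorus.contDiffAt_of_solvesAt (a := a) (SLTorus.P'_root_pos_of_ne hq.2) ?_
      filter_upwards [hopen.mem_nhds hq] with q' hq' using hd q' hq'
    have hb : SLTorus.base p ∈ S' := by
      refine ⟨(SLTorus.mem_N_iff.1 hp.1).1, fun h0 => hp.2 ⟨hp.1, ?_, ?_⟩⟩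
      · exact congrArg Prod.fst h0
      · exact congrArg Prod.snd h0
    exact SLTorus.isSpecialLagrangianAt_N hopen Set.inter_subset_left
      (fun q hq => (hreg q hq).1.contDiffWithinAt) (fun q hq => (hreg q hq).2.contDiffWithinAt)
      (fun q hq => (hd q hq).2.2) hp.1 hb (SLTorus.P'_root_pos_of_ne hb.2)
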